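/- **Setting.** Let $X$ be a complex manifold of dimension $n\ge 1$ (Hausdorff, second countable), and let $f\colon X\to\mathbb C$ be holomorphic with $\log|f|<-1$, such that $f$ is a submersion off $D:=f^{-1}(0)$ and $D=\sum_{i=1}^N m_iD_i$ is a divisor with finitely many irreducible components $D_i$, multiplicities $m_i\ge 1$, and snc reduction. For $I\subseteq\{1,\dots,N\}$ put $X_I^\circ=\{x: x\in D_i\iff i\in I\}$. Let $\eta(0)=0$, $\eta(s)=(1-\log s)^{-1}$ for $s\in(0,1]$, and let $t=(-\log|f|)^{-1}$, $g=\eta(t)$ on $X\setminus D$, both extended by $0$ to $D$. A holomorphic chart $(U_X;z_{i_1},\dots,z_{i_n})$ with $S=\{i: D_i\cap\overline{U_X}\ne\emptyset\}$ is *adapted to $f$* if $S\subseteq\{i_1,\dots,i_n\}$ (the $i_j$ being distinct); $D_i\cap U_X=\{z_i=0\}$ and $\log|z_i|<-1$ for $i\in S$; $f|_{U_X}=\prod_{i\in S}z_i^{m_i}$ if $S\neq\emptyset$; and $\overline{U_X}$ is compact with the coordinates extending continuously to it. For $i\in S$ put $\theta_i=z_i/|z_i|$, $t_i=(-m_i\log|z_i|)^{-1}$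 (extended by $0$ to $D_i$), $w_i=t/t_i$, $u_i=\eta(w_i)$, $v_i=t_i-u_i$. An *adapted pair* consists of an atlas $\{U_X^p\}_{p\in R}$ of adapted charts and a smooth locally finite partition of unity $\{\tau^p\}_{p\in R}$ such that the closed support of $\tau^p$ is contained in $U_X^p$. Put $\bar u_i=\sum_p\tau^pu_i^p$, $\bar v_i=\sum_p\tau^pv_i^p$ on $X\setminus D$, where $u_i^p=v_i^p=0$ if $U_X^p\cap D_i=\emptyset$, and $\mu=(\bar u_1,\dots,\bar u_N)\colon X\setminus D\to\mathbb R^N$. Let $X_{\log}$ be the Kato–Nakayama space of $(X,D)$: its points are the pairs $(x,h)$ with $x\in X$ and $h\colon\mathcal M_x^{\mathrm{gp}}\to\mathbb S^1$ a homomorphism such that $h(\varphi)=\varphi(x)/|\varphi(x)|$ for units $\varphi\in\mathcal O_{X,x}^*$, where $\mathcal M_x$ is the monoid of germs at $x$ of holomorphic functions nonvanishing off $D$; its topology is the coarsest one for which, for each adapted chart, the preimage of $U_X$ is open and $(x,h)\mapsto((|z_i(x)|)_{i\in S},(h(z_i))_{i\in S},(z_j(x))_{j\notin S})$ is continuous on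 it. Let $\Gamma\subseteq X\times\mathbb R^N$ be the closure of the graph of $\mu$. The *A'Campo space* of the adapted pair is $A=\Gamma\times_XX_{\log}\subseteq X_{\log}\times\mathbb R^N$, with projection $\pi\colon A\to X$, $\mu\colon A\to\mathbb R^N$, $\partial A=\pi^{-1}(D)$, $A_I^\circ=\pi^{-1}(X_I^\circ)$, and $\theta\colon A\to\mathbb S^1$, $((x,h),u)\mapsto h(f)$. The functions $g,\theta_i,w_i,v_i,\bar v_i$ are pulled back to $A\setminus\partial A$ and extended by continuity to (the corresponding open subsets of) $A$. For an adapted chart with $k=\#S\ge1$ and $i\in S$, let $U_i=\{w_i>\frac1{n+1}\}\subseteq\pi^{-1}(U_X)$, $Q_{k,n}=[0,\infty)\times\mathbb R^{k-1}\times(\mathbb S^1)^k\times\mathbb C^{n-k}$, and $$\psi_i=(g,(v_j)_{j\in S\setminus i},(\theta_j)_{j\in S},(z_j)_{j\notin S}),\qquad \bar\psi_i=(g,(\bar v_j)_{j\in S\setminus i},(\theta_j)_{j\in S},(z_j)_{j\notin S})\colon U_i\to Q_{k,n}.$$ Finally let $\Delta_I^\circ=\{(\eta(s_1),\dots,\eta(s_N)):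 s_j\ge0,\ \sum_j s_j=1,\ s_j\neq0\iff j\in I\}$. **Statement.** For every adapted pair, the space $A$ is Hausdorff and second countable, and it carries a structure of a $\mathcal C^\infty$-manifold with boundary, of dimension $2n$, with boundary $\partial A$, such that: on $A\setminus\partial A$ it is pulled back from $X\setminus D$ by $\pi$; for every adapted chart and $i\in S$, $\psi_i$ is a $\mathcal C^1$-diffeomorphism onto an open subset of $Q_{k,n}$; every point of $D$ lies in an adapted chart for which all maps $\bar\psi_i$, $i\in S$, are $\mathcal C^1$-diffeomorphisms onto open subsets of $Q_{k,n}$; and for every adapted chart (meeting $D$) with the latter property all $\bar\psi_i$ are $\mathcal C^\infty$-diffeomorphisms onto open subsets of $Q_{k,n}$. Call such a structure *associated with the adapted pair*. Moreover, this structure can be taken so that: 1. $\pi\colon A\to X$ is smooth, and restricts to a diffeomorphism $A\setminus\partial A\to X\setminus D$. 2. $(g,\theta)\colon A\to[0,1)\times\mathbb S^1$ is a smooth submersion, and $f_A=(|f|\circ\pi,\theta)\colon A\to[0,\infty)\times\mathbb S^1$ is smooth. 3. For every $i\in\{1,\dots,N\}$ the function $\bar v_i$ extends from $A\setminus\partial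 A$ to a smooth function $A\to[-1,1]$. 4. For every nonempty $I\subseteq\{1,\dots,N\}$, the restriction $(\pi,\mu)\colon\operatorname{Int}_{\partial A}A_I^\circ\to X_I^\circ\times\Delta_I^\circ$ is a smooth locally trivial fibre bundle with fibre $(\mathbb S^1)^{\#I}$. The underlying $\mathcal C^1$-structure is canonical: if $A$, $A'$ are the A'Campo spaces of two adapted pairs for $f$, each with an associated structure, then there is a homeomorphism $\Phi\colon A\to A'$ which is the identity on $\partial A$ (as a subset of $X_{\log}\times\mathbb R^N$) and satisfies $\pi'\circ\Phi=\pi$, and both $\Phi$ and $\Phi^{-1}$ are $\mathcal C^1$. -/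

import Mathlib

open Set Filter Function
open scoped Manifold ContDiff Topology

noncomputable section

namespace ACampo

/-- A map `F` restricts to a diffeomorphism of class `C^r` from the subset `s` onto the subset `t`.
Maps defined on subsets are of class `C^r` in the sense of `ContMDiffOn`; on embedded submanifolds
(possibly with boundary) of the ambient manifolds this is the usual notion. -/
def IsDiffeoOn {E E' H H' M M' : Type*}
    [NormedAddCommGroup E] [NormedSpace ℝ E] [TopologicalSpace H]
    [NormedAddCommGroup E'] [NormedSpace ℝ E'] [TopologicalSpace H']
    [TopologicalSpace M] [ChartedSpace H M] [TopologicalSpace M'] [ChartedSpace H' M']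
    (I : ModelWithCorners ℝ E H) (J : ModelWithCorners ℝ E' H') (r : WithTop ℕ∞)
    (F : M → M') (s : Set M) (t : Set M') : Prop :=
  BijOn F s t ∧ ContMDiffOn I J r F s ∧
    ∃ G : M' → M, InvOn G F s t ∧ ContMDiffOn J I r G t

/-- The bijection `η : [0,1] → [0,1]`, `η(0) = 0`, `η(s) = (1 - log s)⁻¹`. -/
def eta (s : ℝ) : ℝ := if s = 0 then 0 else (1 - Real.log s)⁻¹

/-- A holomorphic function `f` on a complex manifold `X` of dimension `n`, with `log |f| < -1`,
submersive off `f⁻¹(0)`, such that the reduction of the divisor `f⁻¹(0) = ∑ m i • D i` is snc.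
The irreducible components `D i` of `f⁻¹(0)` are smooth, so being irreducible amounts to being
connected. -/
structure Degeneration (n : ℕ) (X : Type*) [TopologicalSpace X]
    [ChartedSpace (EuclideanSpace ℂ (Fin n)) X] where
  f : X → ℂ
  holomorphic : MDifferentiable 𝓘(ℂ, EuclideanSpace ℂ (Fin n)) 𝓘(ℂ, ℂ) f
  norm_lt : ∀ x, ‖f x‖ < Real.exp (-1)
  submersion : ∀ x, f x ≠ 0 →
    Surjective (mfderiv 𝓘(ℂ, EuclideanSpace ℂ (Fin n)) 𝓘(ℂ, ℂ) f x)
  /-- the number of components -/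
  N : ℕ
  /-- the components -/
  D : Fin N → Set X
  /-- the multiplicities -/
  m : Fin N → ℕ
  m_pos : ∀ i, 0 < m i
  isClosed_D : ∀ i, IsClosed (D i)
  isConnected_D : ∀ i, IsConnected (D i)
  iUnion_D : ⋃ i, D i = {x | f x = 0}
  /-- near every point, the components through that point are distinct coordinate hyperplanes, and
  `f` is a unit times the monomial given by their equations and the multiplicities -/
  normal_crossings : ∀ x, ∃ φ ∈ IsManifold.maximalAtlas 𝓘(ℂ, EuclideanSpace ℂ (Fin n)) ω X,
    x ∈ φ.source ∧ ∃ c : {i // x ∈ D i} ↪ Fin n,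
      (∀ i, x ∉ D i → Disjoint (D i) φ.source) ∧
      (∀ i : {i // x ∈ D i}, ∀ y ∈ φ.source, (y ∈ D i ↔ φ y (c i) = 0)) ∧
      ∃ h : X → ℂ, MDifferentiableOn 𝓘(ℂ, EuclideanSpace ℂ (Fin n)) 𝓘(ℂ, ℂ) h φ.source ∧
        ∀ y ∈ φ.source, h y ≠ 0 ∧
          f y = h y * ∏ᶠ i : {i // x ∈ D i}, φ y (c i) ^ m i

variable {n : ℕ} {X : Type*} [TopologicalSpace X] [ChartedSpace (EuclideanSpace ℂ (Fin n)) X]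

namespace Degeneration

variable (𝒟 : Degeneration n X)

/-- The stratum `X_I°`: points lying on `D i` exactly for `i ∈ I`. -/
def stratum (I : Finset (Fin 𝒟.N)) : Set X := {x | ∀ i, x ∈ 𝒟.D i ↔ i ∈ I}

open Classical in
/-- The index set of those components which meet the closure of `U`. -/
def indexSet (U : Set X) : Finset (Fin 𝒟.N) :=
  Finset.univ.filter fun i => (𝒟.D i ∩ closure U).Nonempty

open Classical in
/-- `t = (-log |f|)⁻¹`, extended by `0` to `f⁻¹(0)`. -/
def t (x : X) : ℝ := if 𝒟.f x = 0 then 0 else (-Real.log ‖𝒟.f x‖)⁻¹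

/-- `g = η(t)`. -/
def g (x : X) : ℝ := eta (𝒟.t x)

/-- The stalk at `x` of the sheaf of monoids `𝒪_X ∩ i_* 𝒪_{X ∖ D}^*`: germs of holomorphic
functions which do not vanish off `D = f⁻¹(0)`. -/
def stalk (x : X) : Submonoid (Germ (𝓝 x) ℂ) where
  carrier := {φ | ∃ F : X → ℂ, φ = (F : Germ (𝓝 x) ℂ) ∧ ∀ᶠ y in 𝓝 x,
    MDifferentiableAt 𝓘(ℂ, EuclideanSpace ℂ (Fin n)) 𝓘(ℂ, ℂ) F y ∧ (𝒟.f y ≠ 0 → F y ≠ 0)}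
  one_mem' := ⟨fun _ => 1, rfl, Eventually.of_forall fun _ =>
    ⟨mdifferentiableAt_const, fun _ => one_ne_zero⟩⟩
  mul_mem' := by
    rintro _ _ ⟨F, rfl, hF⟩ ⟨G, rfl, hG⟩
    refine ⟨F * G, rfl, ?_⟩
    filter_upwards [hF, hG] with y h1 h2
    exact ⟨h1.1.mul h2.1, fun h => mul_ne_zero (h1.2 h) (h2.2 h)⟩

/-- The Kato--Nakayama space `X_log`: pairs of a point `x` and a homomorphism from the group
associated with the stalk at `x` to the circle, given by `φ ↦ φ(x) / |φ(x)|` on units. -/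
@[ext]
structure KatoNakayama where
  pt : X
  hom : Algebra.GrothendieckGroup (𝒟.stalk pt) →* Circle
  hom_unit : ∀ φ : 𝒟.stalk pt, (φ : Germ (𝓝 pt) ℂ).value ≠ 0 →
    (hom (Algebra.GrothendieckGroup.of φ) : ℂ) =
      (φ : Germ (𝓝 pt) ℂ).value / (‖(φ : Germ (𝓝 pt) ℂ).value‖ : ℂ)

open Classical in
/-- The value of the homomorphism `p.hom` on the germ of `F` at `p.pt`, for `F` holomorphic near
that point and not vanishing off `D`. -/
def KatoNakayama.arg {𝒟 : Degeneration n X} (p : 𝒟.KatoNakayama) (F : X → ℂ) : Circle :=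
  if hF : (F : Germ (𝓝 p.pt) ℂ) ∈ 𝒟.stalk p.pt then
    p.hom (Algebra.GrothendieckGroup.of ⟨(F : Germ (𝓝 p.pt) ℂ), hF⟩)
  else 1

/-- The interior `Δ_I°` of the face of the rounded simplex corresponding to `I`. -/
def openFace (I : Finset (Fin 𝒟.N)) : Set (Fin 𝒟.N → ℝ) :=
  {u | (∃ s : Fin 𝒟.N → ℝ, (∀ i, 0 ≤ s i) ∧ ∑ i, s i = 1 ∧ u = fun i => eta (s i)) ∧
    (∀ i ∈ I, u i ≠ 0) ∧ ∀ j ∉ I, u j = 0}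

end Degeneration

/-- A holomorphic chart adapted to `f`. With `S` the set of components meeting the closure of the
domain `U`, the coordinate number `idx i` is the one labelled by the component `i ∈ S`, i.e. the
coordinate called `z_i`; the values of `idx` outside `S` are irrelevant. -/
structure AdaptedChart (𝒟 : Degeneration n X) where
  chart : OpenPartialHomeomorph X (EuclideanSpace ℂ (Fin n))
  chart_mem : chart ∈ IsManifold.maximalAtlas 𝓘(ℂ, EuclideanSpace ℂ (Fin n)) ω X
  idx : Fin 𝒟.N → Fin n
  idx_injOn : InjOn idx (𝒟.indexSet chart.source)
  zero_locus : ∀ i ∈ 𝒟.indexSet chart.source, ∀ x ∈ chart.source,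
    (x ∈ 𝒟.D i ↔ chart x (idx i) = 0)
  f_eq : (𝒟.indexSet chart.source).Nonempty → ∀ x ∈ chart.source,
    𝒟.f x = ∏ i ∈ 𝒟.indexSet chart.source, chart x (idx i) ^ 𝒟.m i
  norm_lt : ∀ i ∈ 𝒟.indexSet chart.source, ∀ x ∈ chart.source,
    ‖chart x (idx i)‖ < Real.exp (-1)
  isCompact_closure : IsCompact (closure chart.source)
  extends_to_closure : ∃ F : X → EuclideanSpace ℂ (Fin n),
    ContinuousOn F (closure chart.source) ∧ EqOn F chart chart.source

namespace AdaptedChart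

variable {𝒟 : Degeneration n X} (c : AdaptedChart 𝒟)

/-- the domain `U_X` -/
def dom : Set X := c.chart.source

/-- the associated index set `S` -/
def S : Finset (Fin 𝒟.N) := 𝒟.indexSet c.chart.source

/-- the coordinate `z_i` -/
def z (i : Fin 𝒟.N) (x : X) : ℂ := c.chart x (c.idx i)

open Classical in
/-- `t_i = (-m_i log |z_i|)⁻¹`, extended by `0` to `D_i`. -/
def t (i : Fin 𝒟.N) (x : X) : ℝ :=
  if c.z i x = 0 then 0 else (-((𝒟.m i : ℝ) * Real.log ‖c.z i x‖))⁻¹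

/-- `w_i = t / t_i` -/
def w (i : Fin 𝒟.N) (x : X) : ℝ := 𝒟.t x / c.t i x

/-- `u_i = η(w_i)` -/
def u (i : Fin 𝒟.N) (x : X) : ℝ := eta (c.w i x)

/-- `v_i = t_i - u_i` -/
def v (i : Fin 𝒟.N) (x : X) : ℝ := c.t i x - c.u i x

/-- The labels of the coordinates `z_j` with `j ∉ S`. -/
abbrev RestIdx : Type := {j : Fin n // j ∉ c.S.image c.idx}

/-- The Kato--Nakayama chart `(r_i)_{i ∈ S}, (θ_i)_{i ∈ S}, (z_j)_{j ∉ S}`. -/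
def knChart (p : 𝒟.KatoNakayama) : (c.S → ℝ) × (c.S → Circle) × (c.RestIdx → ℂ) :=
  (fun i => ‖c.z i p.pt‖, fun i => p.arg (c.z i), fun j => c.chart p.pt j)

end AdaptedChart

/-- The coarsest topology for which the Kato--Nakayama charts over adapted charts have open domains
and are continuous. -/
instance (𝒟 : Degeneration n X) : TopologicalSpace 𝒟.KatoNakayama :=
  TopologicalSpace.generateFrom
    {s | ∃ c : AdaptedChart 𝒟, ∃ O : Set ((c.S → ℝ) × (c.S → Circle) × (c.RestIdx → ℂ)),
      IsOpen O ∧ s = {p | p.pt ∈ c.dom ∧ c.knChart p ∈ O}}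

/-- An adapted pair: an atlas of adapted charts and a smooth (locally finite) partition of unity
whose members are supported in the corresponding charts. -/
structure AdaptedPair (𝒟 : Degeneration n X) (ι : Type*) where
  chart : ι → AdaptedChart 𝒟
  cover : ⋃ p, (chart p).dom = univ
  τ : SmoothPartitionOfUnity ι 𝓘(ℝ, EuclideanSpace ℂ (Fin n)) X univ
  subordinate : τ.IsSubordinate fun p => (chart p).dom

namespace AdaptedPair

variable {𝒟 : Degeneration n X} {ι : Type*} (P : AdaptedPair 𝒟 ι)

open Classical in
/-- `ū_i = ∑ τ^p u_i^p` on `X ∖ D`, where `u_i^p = 0` if the `p`-th chart is disjoint from `D_i`. -/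
def uBar (i : Fin 𝒟.N) (x : X) : ℝ :=
  ∑ᶠ p, P.τ p x * if (𝒟.D i ∩ (P.chart p).dom).Nonempty then (P.chart p).u i x else 0

open Classical in
/-- `v̄_i = ∑ τ^p v_i^p` on `X ∖ D`, where `v_i^p = 0` if the `p`-th chart is disjoint from `D_i`. -/
def vBarX (i : Fin 𝒟.N) (x : X) : ℝ :=
  ∑ᶠ p, P.τ p x * if (𝒟.D i ∩ (P.chart p).dom).Nonempty then (P.chart p).v i x else 0

/-- The closure in `X × ℝ^N` of the graph of `μ = (ū_1, …, ū_N) : X ∖ D → ℝ^N`. -/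
def Gam : Set (X × (Fin 𝒟.N → ℝ)) :=
  closure {q | 𝒟.f q.1 ≠ 0 ∧ q.2 = fun i => P.uBar i q.1}

/-- The A'Campo space: the fibre product of the closed graph and `X_log` over `X`, as a subspace
of `X_log × ℝ^N`. -/
abbrev Space : Type _ := {q : 𝒟.KatoNakayama × (Fin 𝒟.N → ℝ) // (q.1.pt, q.2) ∈ P.Gam}

/-- the projection `π : A → X` -/
def proj (a : P.Space) : X := a.1.1.pt

/-- the map `μ : A → ℝ^N` -/
def mu (a : P.Space) : Fin 𝒟.N → ℝ := a.1.2

/-- `∂A = π⁻¹(D)` -/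
def bd : Set P.Space := {a | 𝒟.f (P.proj a) = 0}

/-- `g` on the A'Campo space -/
def g (a : P.Space) : ℝ := 𝒟.g (P.proj a)

/-- `θ` on the A'Campo space: the argument of `f`. -/
def theta (a : P.Space) : Circle := a.1.1.arg 𝒟.f

/-- The map `f_A = (|f|, θ) : A → ℂ_log = [0,∞) × 𝕊¹`. -/
def fA (a : P.Space) : ℝ × Circle := (‖𝒟.f (P.proj a)‖, P.theta a)

/-- The extension by continuity to the A'Campo space of (the pullback of) a function which is
defined on an open subset of `X`, off `D`. -/
def lift (F : X → ℝ) : P.Space → ℝ := extendFrom P.bdᶜ (F ∘ P.proj)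

/-- The global functions `v̄_i` on the A'Campo space. -/
def vBar (i : Fin 𝒟.N) : P.Space → ℝ := P.lift (P.vBarX i)

/-- The set `U_i = {w_i > 1 / (n + 1)} ⊆ π⁻¹(U_X)`. -/
def piece (c : AdaptedChart 𝒟) (i : Fin 𝒟.N) : Set P.Space :=
  {a | P.proj a ∈ c.dom ∧ 1 / ((n : ℝ) + 1) < P.lift (c.w i) a}

open Classical in
/-- The vector space `ℝ × ℝ^{k-1} × ℂ^k × ℂ^{n-k}` containing
`Q_{k,n} = [0,∞) × ℝ^{k-1} × (𝕊¹)^k × ℂ^{n-k}`, with `k = #S`. -/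
abbrev CoordSpace (c : AdaptedChart 𝒟) (i : Fin 𝒟.N) : Type :=
  ℝ × (↥(c.S.erase i) → ℝ) × (↥c.S → ℂ) × (c.RestIdx → ℂ)

/-- The manifold with boundary `Q_{k,n} = [0,∞) × ℝ^{k-1} × (𝕊¹)^k × ℂ^{n-k}`. -/
def Q (c : AdaptedChart 𝒟) (i : Fin 𝒟.N) : Set (CoordSpace c i) :=
  {q | 0 ≤ q.1 ∧ ∀ j, ‖q.2.2.1 j‖ = 1}

/-- The map `(g, (V_j)_{j ∈ S ∖ i}, (θ_j)_{j ∈ S}, (z_j)_{j ∉ S})`. -/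
def chartMap (c : AdaptedChart 𝒟) (i : Fin 𝒟.N) (V : Fin 𝒟.N → P.Space → ℝ) (a : P.Space) :
    CoordSpace c i :=
  (P.g a, fun j => V j a, fun j => (a.1.1.arg (c.z j) : ℂ), fun j => c.chart (P.proj a) j)

/-- The map `ψ_i = (g, (v_j)_{j ∈ S ∖ i}, rest)`. -/
def psi (c : AdaptedChart 𝒟) (i : Fin 𝒟.N) : P.Space → CoordSpace c i :=
  P.chartMap c i fun j => P.lift (c.v j)

/-- The map `ψ̄_i = (g, (v̄_j)_{j ∈ S ∖ i}, rest)`. -/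
def psiBar (c : AdaptedChart 𝒟) (i : Fin 𝒟.N) : P.Space → CoordSpace c i :=
  P.chartMap c i P.vBar

/-- `A_I° = π⁻¹(X_I°)` -/
def stratum (I : Finset (Fin 𝒟.N)) : Set P.Space := {a | P.proj a ∈ 𝒟.stratum I}

/-- The interior of `A_I°` relative to `∂A`. -/
def openStratum (I : Finset (Fin 𝒟.N)) : Set P.Space :=
  {a | a ∈ P.bd ∧ P.stratum I ∈ 𝓝[P.bd] a}

section

variable [NeZero n] [ChartedSpace (EuclideanHalfSpace (2 * n)) P.Space]

/-- `F` restricts to a `C^r`-diffeomorphism from `U_i` onto an open subset of `Q_{k,n}`. -/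
def IsDiffeoToQ (r : WithTop ℕ∞) (c : AdaptedChart 𝒟) (i : Fin 𝒟.N)
    (F : P.Space → CoordSpace c i) : Prop :=
  ∃ O : Set (CoordSpace c i), IsOpen O ∧
    IsDiffeoOn (𝓡∂ (2 * n)) 𝓘(ℝ, CoordSpace c i) r F (P.piece c i) (O ∩ Q c i)

/-- A chart on `X` meeting `D` is *good* if all the maps `ψ̄_i` are `C^1`-diffeomorphisms onto open
subsets of `Q_{k,n}`. -/
def IsGood (c : AdaptedChart 𝒟) : Prop :=
  c.S.Nonempty ∧ ∀ i ∈ c.S, P.IsDiffeoToQ 1 c i (P.psiBar c i)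

/-- The manifold structure on the A'Campo space is the one associated with the adapted pair: on the
complement of `∂A` it is the one pulled back from `X ∖ D`; it is `C^1`-compatible with the maps
`ψ_i` of all adapted charts; and near `∂A` the maps `ψ̄_i` are smooth charts. -/
structure IsACampoStructure : Prop where
  interior : IsDiffeoOn (𝓡∂ (2 * n)) 𝓘(ℝ, EuclideanSpace ℂ (Fin n)) ∞ P.proj P.bdᶜ
    {x | 𝒟.f x ≠ 0}
  c1_charts : ∀ c : AdaptedChart 𝒟, ∀ i ∈ c.S, P.IsDiffeoToQ 1 c i (P.psi c i)
  exists_good : ∀ x, 𝒟.f x = 0 → ∃ c : AdaptedChart 𝒟, x ∈ c.dom ∧ P.IsGood c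
  smooth_charts : ∀ c : AdaptedChart 𝒟, P.IsGood c →
    ∀ i ∈ c.S, P.IsDiffeoToQ ∞ c i (P.psiBar c i)

/-- The map `(π, μ) : Int_{∂A} A_I° → X_I° × Δ_I°` is a smooth fibre bundle with fibre
`(𝕊¹)^I ⊆ ℂ^I`. -/
def IsSmoothTorusBundle (I : Finset (Fin 𝒟.N)) : Prop :=
  MapsTo (fun a => (P.proj a, P.mu a)) (P.openStratum I) (𝒟.stratum I ×ˢ 𝒟.openFace I) ∧
  ∀ b ∈ 𝒟.stratum I ×ˢ 𝒟.openFace I,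
    ∃ O : Set (X × (Fin 𝒟.N → ℝ)), IsOpen O ∧ b ∈ O ∧ ∃ Θ : P.Space → (I → ℂ),
      IsDiffeoOn (𝓡∂ (2 * n))
        ((𝓘(ℝ, EuclideanSpace ℂ (Fin n)).prod 𝓘(ℝ, Fin 𝒟.N → ℝ)).prod 𝓘(ℝ, I → ℂ)) ∞
        (fun a => ((P.proj a, P.mu a), Θ a))
        (P.openStratum I ∩ {a | (P.proj a, P.mu a) ∈ O})
        (((𝒟.stratum I ×ˢ 𝒟.openFace I) ∩ O) ×ˢ {ζ : I → ℂ | ∀ i, ‖ζ i‖ = 1})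

end

end AdaptedPair

end ACampo

end

open Set Filter Function
open scoped Manifold ContDiff Topology

noncomputable section

set_option linter.unusedSectionVars false

namespace ACampo

open Real (exp log)

open Module (finrank finrank_pi finrank_pi_fintype finrank_prod)

open Finset (mem_erase mem_of_mem_erase mem_filter mul_prod_erase ne_of_mem_erase prod_congr
  single_le_sum sum_congr sum_const sum_le_sum sum_nonneg)

local notation:max "ℂ^" n:max => EuclideanSpace ℂ (Fin n)

local notation:max "𝓘^" n:max => modelWithCornersSelf ℝ (EuclideanSpace ℂ (Fin n))

local notation "ℝ²" => ℝ × ℝ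

local notation:max "ℝ^" n:max => EuclideanSpace ℝ (Fin n)

section ComplexAnalysis

open Metric MeasureTheory

variable {n : ℕ} {f : ℂ^n → ℂ} {p : ℂ^n} {r : ℝ} {k j : Fin n}

theorem differentiableAt_integral_comp_affine {x0 : ℂ^n} {C ε a b : ℝ} (hε : 0 < ε)
    (hf : DifferentiableOn ℂ f (ball p r)) (hC : ∀ y ∈ ball p r, ‖fderiv ℂ f y‖ ≤ C)
    {k : ℝ → ℂ} (hk : Continuous k) {L : ℝ → ℂ^n →L[ℂ] ℂ^n} (hL : Continuous L)
    {d : ℝ → ℂ^n} (hd : Continuous d)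
    (hmem : ∀ x ∈ ball x0 ε, ∀ s ∈ uIcc a b, L s x + d s ∈ ball p r) :
    DifferentiableAt ℂ (fun x => ∫ s in a..b, k s * f (L s x + d s)) x0 := by
  have hC0 : ∀ s ∈ uIcc a b, 0 ≤ C := fun s hs =>
    (norm_nonneg _).trans (hC _ (hmem x0 (mem_ball_self hε) s hs))
  have hcont : ∀ x ∈ ball x0 ε, ContinuousOn (fun s => k s * f (L s x + d s)) (uIcc a b) := by
    intro x hx
    refine hk.continuousOn.mul (hf.continuousOn.comp ?_ (fun s hs => hmem x hx s hs))
    exact ((hL.clm_apply continuous_const).add hd).continuousOn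
  have hb := intervalIntegral.hasFDerivAt_integral_of_dominated_of_fderiv_le (𝕜 := ℂ)
    (μ := volume) (a := a) (b := b) (s := ball x0 ε) (x₀ := x0)
    (F := fun x s => k s * f (L s x + d s))
    (F' := fun x s => k s • (fderiv ℂ f (L s x + d s)).comp (L s))
    (bound := fun s => ‖k s‖ * (C * ‖L s‖)) (ball_mem_nhds x0 hε) (by
      filter_upwards [ball_mem_nhds x0 hε] with x hx
      exact ((hcont x hx).mono uIoc_subset_uIcc).aestronglyMeasurable measurableSet_uIoc)
    ((hcont x0 (mem_ball_self hε)).intervalIntegrable)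
    (by
      have h1 : Measurable fun s => fderiv ℂ f (L s x0 + d s) :=
        (measurable_fderiv ℂ f).comp ((hL.clm_apply continuous_const).add hd).measurable
      have h2 : StronglyMeasurable fun s => (fderiv ℂ f (L s x0 + d s), L s) :=
        h1.stronglyMeasurable.prodMk hL.stronglyMeasurable
      have h3 : StronglyMeasurable fun s => (fderiv ℂ f (L s x0 + d s)).comp (L s) :=
        Continuous.comp_stronglyMeasurable (g := fun q : (ℂ^n →L[ℂ] ℂ) ×
            (ℂ^n →L[ℂ] ℂ^n) => q.1.comp q.2) (by fun_prop) h2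
      exact (hk.stronglyMeasurable.smul h3).aestronglyMeasurable)
    (by
      refine Eventually.of_forall fun s hs x hx => ?_
      rw [norm_smul]
      gcongr
      refine (ContinuousLinearMap.opNorm_comp_le _ _).trans ?_
      gcongr
      exact hC _ (hmem x hx s (uIoc_subset_uIcc hs)))
    (by
      apply Continuous.intervalIntegrable
      exact hk.norm.mul (continuous_const.mul hL.norm))
    (by
      refine Eventually.of_forall fun s hs x hx => ?_
      have h1 : HasFDerivAt f (fderiv ℂ f (L s x + d s)) (L s x + d s) :=
        (hf.differentiableAt (isOpen_ball.mem_nhds (hmem x hx s (uIoc_subset_uIcc hs)))).hasFDerivAt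
      have h2 : HasFDerivAt (fun x => L s x + d s) (L s) x := (L s).hasFDerivAt.add_const _
      exact (h1.comp x h2).const_mul _)
  exact hb.differentiableAt

theorem exists_ball_bound {U : Set ℂ^n} (hU : IsOpen U) (hf : DifferentiableOn ℂ f U) (hp : p ∈ U) :
    ∃ r > 0, ∃ C, ball p r ⊆ U ∧ ∀ y ∈ ball p r, ‖fderiv ℂ f y‖ ≤ C := by
  have h1 : ∀ᶠ y in 𝓝 p, y ∈ U ∧ ‖f y‖ < ‖f p‖ + 1 := (hU.eventually_mem hp).and
    ((hf.continuousOn.continuousAt (hU.mem_nhds hp)).norm.eventually_lt_const (lt_add_one _))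
  obtain ⟨R, hR, h2⟩ := eventually_nhds_iff_ball.1 h1
  refine ⟨R / 2, by positivity, 2 * (‖f p‖ + 1) / (R / 2),
    fun y hy => (h2 y (ball_subset_ball (by linarith) hy)).1, fun y hy => ?_⟩
  have h3 : ball y (R / 2) ⊆ ball p R := ball_subset_ball' (by linarith [mem_ball.1 hy])
  refine Complex.norm_fderiv_le_div_of_mapsTo_ball (hf.mono fun z hz => (h2 z (h3 hz)).1)
    (fun z hz => (dist_le_norm_add_norm _ _).trans ?_) (by positivity)
  linarith [(h2 z (h3 hz)).2, (h2 y (h3 (mem_ball_self (by positivity)))).2]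

theorem hasDerivAt_comp_line {x v : ℂ^n} {ζ : ℂ} (hf : DifferentiableAt ℂ f (x + ζ • v)) :
    HasDerivAt (fun ζ : ℂ => f (x + ζ • v)) (fderiv ℂ f (x + ζ • v) v) ζ :=
  hf.hasFDerivAt.comp_hasDerivAt ζ (by simpa using ((hasDerivAt_id ζ).smul_const v).const_add x)

theorem differentiableOn_fderiv_apply {U : Set ℂ^n} (hU : IsOpen U) (hf : DifferentiableOn ℂ f U)
    (v : ℂ^n) : DifferentiableOn ℂ (fun x => fderiv ℂ f x v) U := by
  intro p hp
  refine DifferentiableAt.differentiableWithinAt ?_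
  obtain ⟨r, hr, C, hrU, hC⟩ := exists_ball_bound hU hf hp
  set ρ := r / (2 * (‖v‖ + 1)) with hρ
  have hρ0 : 0 < ρ := by positivity
  have hin : ∀ x ∈ ball p (r / 2), ∀ ζ ∈ closedBall (0 : ℂ) ρ, x + ζ • v ∈ ball p r := by
    intro x hx ζ hζ
    rw [mem_closedBall_zero_iff] at hζ
    rw [mem_ball] at hx ⊢
    have h1 : ‖ζ • v‖ ≤ r / 2 := by
      rw [norm_smul]
      calc ‖ζ‖ * ‖v‖ ≤ ρ * (‖v‖ + 1) := by gcongr; linarith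
        _ = r / 2 := by rw [hρ]; field_simp
    have h2 := dist_triangle (x + ζ • v) x p
    rw [dist_self_add_left] at h2
    linarith
  have hfr := hf.mono hrU
  have hdiff : ∀ x ∈ ball p (r / 2), ∀ ζ ∈ closedBall (0 : ℂ) ρ,
      HasDerivAt (fun ζ : ℂ => f (x + ζ • v)) (fderiv ℂ f (x + ζ • v) v) ζ := fun x hx ζ hζ =>
    hasDerivAt_comp_line (hfr.differentiableAt (isOpen_ball.mem_nhds (hin x hx ζ hζ)))
  have hD := differentiableAt_integral_comp_affine (x0 := p) (ε := r / 2) (by positivity)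
    (a := 0) (b := 2 * Real.pi) hfr hC
    (k := fun θ => deriv (circleMap 0 ρ) θ * (1 / (circleMap 0 ρ θ) ^ 2)) (by
      simp only [deriv_circleMap]
      have hne : ∀ θ, circleMap 0 ρ θ ^ 2 ≠ 0 := fun θ =>
        pow_ne_zero _ (by simp [circleMap, hρ0.ne'])
      have hc : Continuous (circleMap 0 ρ) := continuous_circleMap 0 ρ
      exact (hc.mul continuous_const).mul (continuous_const.div (hc.pow 2) hne))
    (L := fun _ => ContinuousLinearMap.id ℂ _) continuous_const
    (d := fun θ => circleMap 0 ρ θ • v) ((continuous_circleMap 0 ρ).smul continuous_const)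
    (fun x hx s _ => hin x hx _ (by simp [abs_of_pos hρ0]))
  refine (hD.const_mul (2 * Real.pi * Complex.I)⁻¹).congr_of_eventuallyEq ?_
  filter_upwards [ball_mem_nhds p (half_pos hr)] with x hx
  have h2 : DifferentiableOn ℂ (fun ζ : ℂ => f (x + ζ • v)) (closedBall 0 ρ) := fun ζ hζ =>
    (hdiff x hx ζ hζ).differentiableAt.differentiableWithinAt
  have h3 := h2.deriv_eq_smul_circleIntegral hρ0
  rw [(hdiff x hx 0 (mem_closedBall_self hρ0.le)).deriv] at h3
  simp only [zero_smul, add_zero, smul_eq_mul, sub_zero] at h3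
  rw [eq_inv_mul_iff_mul_eq₀ (by simp [Real.pi_ne_zero]), ← h3, circleIntegral]
  simp [mul_assoc]

theorem contDiffOn_of_differentiableOn {U : Set ℂ^n} (hU : IsOpen U)
    (hf : DifferentiableOn ℂ f U) : ContDiffOn ℂ ∞ f U := by
  rw [contDiffOn_infty]
  intro k
  induction k generalizing f with
  | zero => exact contDiffOn_zero.2 hf.continuousOn
  | succ k ih =>
    push_cast
    rw [contDiffOn_succ_iff_fderiv_of_isOpen hU]
    exact ⟨hf, by simp, contDiffOn_clm_apply.2 fun v => ih (differentiableOn_fderiv_apply hU hf v)⟩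

/-- Scaling of the `k`-th coordinate by `s`. -/
def scaleCoord (k : Fin n) (s : ℝ) : ℂ^n →L[ℂ] ℂ^n := ContinuousLinearMap.id ℂ _ -
    ((1 : ℂ) - (s : ℂ)) • (EuclideanSpace.proj (𝕜 := ℂ) k).smulRight (EuclideanSpace.single k (1 : ℂ))

theorem scaleCoord_apply (k : Fin n) (s : ℝ) (x : ℂ^n) :
    scaleCoord k s x = x - (((1 : ℂ) - (s : ℂ)) * x k) • EuclideanSpace.single k (1 : ℂ) := by
  simp [scaleCoord, mul_smul]

theorem scaleCoord_coord (k j : Fin n) (s : ℝ) (x : ℂ^n) :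
    scaleCoord k s x j = if j = k then s * x k else x j := by
  rw [scaleCoord_apply]
  by_cases h : j = k
  · subst h; simp; ring
  · simp [h]

theorem dist_scaleCoord_le {s : ℝ} (hs : s ∈ Icc (0 : ℝ) 1) {p : ℂ^n} (hp : p k = 0) (x : ℂ^n) :
    dist (scaleCoord k s x) p ≤ dist x p := by
  rw [EuclideanSpace.dist_eq, EuclideanSpace.dist_eq]
  refine Real.sqrt_le_sqrt (sum_le_sum fun j _ => ?_)
  rw [scaleCoord_coord]
  by_cases h : j = k
  · subst h
    simp only [hp, if_true, dist_zero_right, norm_mul, Complex.norm_real, Real.norm_eq_abs,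
      abs_of_nonneg hs.1]
    exact pow_le_pow_left₀ (mul_nonneg hs.1 (norm_nonneg _))
      (mul_le_of_le_one_left (norm_nonneg (x j)) hs.2) 2
  · simp [h]

theorem exists_eq_coord_mul (hp : p k = 0)
    (hf : DifferentiableOn ℂ f (ball p r)) (h0 : ∀ x ∈ ball p r, x k = 0 → f x = 0) :
    ∃ h : ℂ^n → ℂ, DifferentiableOn ℂ h (ball p r) ∧ ∀ x ∈ ball p r, f x = x k * h x := by
  set g : ℂ^n → ℂ := fun x => fderiv ℂ f x (EuclideanSpace.single k 1) with hg
  have hgd : DifferentiableOn ℂ g (ball p r) := differentiableOn_fderiv_apply isOpen_ball hf _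
  have hgc : ContDiffOn ℂ ∞ g (ball p r) := contDiffOn_of_differentiableOn isOpen_ball hgd
  have hLc : Continuous fun s : ℝ => scaleCoord k s := by
    unfold scaleCoord
    fun_prop
  refine ⟨fun x => ∫ s in (0 : ℝ)..1, g (scaleCoord k s x), fun x0 hx0 => ?_, fun x hx => ?_⟩
  · refine DifferentiableAt.differentiableWithinAt ?_
    obtain ⟨r', h1, h2⟩ := exists_between (mem_ball.1 hx0)
    obtain ⟨C, hC⟩ := (isCompact_closedBall p r').exists_bound_of_continuousOn
      ((hgc.continuousOn_fderiv_of_isOpen isOpen_ball (by simp)).mono (closedBall_subset_ball h2))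
    have := differentiableAt_integral_comp_affine (x0 := x0) (ε := r' - dist x0 p) (sub_pos.2 h1)
      (a := 0) (b := 1) (hgd.mono (ball_subset_ball h2.le))
      (fun y hy => hC y (ball_subset_closedBall hy)) (k := fun _ => 1) continuous_const hLc
      (d := fun _ => 0) continuous_const (fun x hx s hs => by
        rw [uIcc_of_le zero_le_one] at hs
        rw [add_zero, mem_ball]
        rw [mem_ball] at hx
        have := dist_scaleCoord_le hs hp x
        have := dist_triangle x x0 p
        linarith)
    simpa using this
  · have hmem : ∀ s ∈ uIcc (0 : ℝ) 1, scaleCoord k s x ∈ ball p r := fun s hs => by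
      rw [uIcc_of_le zero_le_one] at hs
      exact (dist_scaleCoord_le hs hp x).trans_lt hx
    have hder : ∀ s ∈ uIcc (0 : ℝ) 1, HasDerivAt (fun s : ℝ => f (scaleCoord k s x))
        (x k * g (scaleCoord k s x)) s := by
      intro s hs
      have h3 : HasDerivAt (fun s : ℝ => ((1 : ℂ) - (s : ℂ)) * x k) (-x k) s := by
        simpa using ((hasDerivAt_id s).ofReal_comp.const_sub (1 : ℂ)).mul_const (x k)
      have h2 : HasDerivAt (fun s : ℝ => scaleCoord k s x)
          (x k • EuclideanSpace.single k (1 : ℂ)) s := by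
        simpa [scaleCoord_apply] using (h3.smul_const (EuclideanSpace.single k (1 : ℂ))).const_sub x
      simpa [hg, Function.comp_def] using ((hf.differentiableAt (isOpen_ball.mem_nhds
        (hmem s hs))).hasFDerivAt.restrictScalars ℝ).comp_hasDerivAt s h2
    have hcont : ContinuousOn (fun s : ℝ => x k * g (scaleCoord k s x)) (uIcc 0 1) :=
      continuousOn_const.mul (hgd.continuousOn.comp
        ((hLc.clm_apply continuous_const).continuousOn) hmem)
    have h5 := intervalIntegral.integral_eq_sub_of_hasDerivAt hder hcont.intervalIntegrable
    have h7 : f (scaleCoord k 0 x) = 0 := h0 _ (hmem 0 left_mem_uIcc) (by simp [scaleCoord_coord])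
    rw [h7, sub_zero, show scaleCoord k 1 x = x by simp [scaleCoord_apply]] at h5
    simpa using h5.symm

theorem exists_vanishing_hyperplane (hr : 0 < r) (J : Finset (Fin n))
    (hp : ∀ k ∈ J, p k = 0) (hf : DifferentiableOn ℂ f (ball p r))
    (hne : ∀ x ∈ ball p r, (∀ k ∈ J, x k ≠ 0) → f x ≠ 0) (h0 : f p = 0) :
    ∃ k ∈ J, ∀ x ∈ ball p r, x k = 0 → f x = 0 := by
  by_contra! hcon
  set v : ℂ^n := WithLp.toLp 2 fun _ => (1 : ℂ)
  have hvk : ∀ k, v k = 1 := fun k => rfl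
  have hzero : ∀ᶠ q in 𝓝 p, ∃ k ∈ J, f (q - q k • v) = 0 := by
    have hcv : Continuous fun s : ℂ => p + s • v := by fun_prop
    have hcz : Continuous fun z : ℂ^n × ℂ => z.1 + z.2 • v := by fun_prop
    obtain ⟨δ, hδ, hδb⟩ := nhds_basis_closedBall.mem_iff.1
      (hcv.continuousAt.preimage_mem_nhds (isOpen_ball.mem_nhds (by simpa using hr)) :
        (fun s : ℂ => p + s • v) ⁻¹' ball p r ∈ 𝓝 0)
    have hfs : ∀ s ∈ sphere (0 : ℂ) δ, ContinuousAt f (p + s • v) := fun s hs =>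
      hf.continuousOn.continuousAt (isOpen_ball.mem_nhds (hδb (sphere_subset_closedBall hs)))
    have hsph : ∀ s ∈ sphere (0 : ℂ) δ, f (p + s • v) ≠ 0 := fun s hs =>
      hne _ (hδb (sphere_subset_closedBall hs)) fun k hk => by
        simpa [hp k hk, hvk] using ne_of_mem_sphere hs hδ.ne'
    have hball : ∀ᶠ q in 𝓝 p, ∀ s ∈ closedBall (0 : ℂ) δ, q + s • v ∈ ball p r :=
      (isCompact_closedBall (0 : ℂ) δ).eventually_forall_of_forall_eventually fun s hs =>
        hcz.continuousAt.preimage_mem_nhds (isOpen_ball.mem_nhds (hδb hs))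
    obtain ⟨s₀, hs₀, hmin⟩ := (isCompact_sphere (0 : ℂ) δ).exists_isMinOn
      (NormedSpace.sphere_nonempty.2 hδ.le)
      fun s hs => (ContinuousAt.comp (f := fun s : ℂ => p + s • v) (hfs s hs)
        hcv.continuousAt).norm.continuousWithinAt
    have hc' : 0 < ‖f (p + s₀ • v)‖ := norm_pos_iff.2 (hsph s₀ hs₀)
    have hc := half_pos hc'
    set c := ‖f (p + s₀ • v)‖ / 2
    have hlow : ∀ᶠ q in 𝓝 p, ∀ s ∈ sphere (0 : ℂ) δ, c < ‖f (q + s • v)‖ :=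
      (isCompact_sphere (0 : ℂ) δ).eventually_forall_of_forall_eventually fun s hs =>
        (ContinuousAt.comp (f := fun z : ℂ^n × ℂ => z.1 + z.2 • v) (x := (p, s)) (hfs s hs)
          hcz.continuousAt).norm.eventually_const_lt ((half_lt_self hc').trans_le (hmin hs))
    have hsmall : ∀ᶠ q in 𝓝 p, ‖f q‖ < c :=
      (hf.continuousOn.continuousAt (ball_mem_nhds p hr)).norm.eventually_lt_const
        (by simpa [h0] using hc)
    filter_upwards [hball, hlow, hsmall] with q hq1 hq2 hq3
    by_contra! hq4
    have hnz : ∀ s ∈ closedBall (0 : ℂ) δ, f (q + s • v) ≠ 0 := fun s hs hfs =>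
      hne _ (hq1 s hs) (fun k hk h => hq4 k hk (by
        rwa [show q k = -s from eq_neg_of_add_eq_zero_left (by simpa [hvk] using h), neg_smul,
          sub_neg_eq_add])) hfs
    have hd : DifferentiableOn ℂ (fun s : ℂ => (f (q + s • v))⁻¹) (closedBall 0 δ) :=
      (hf.comp (t := ball p r) (Differentiable.differentiableOn (by fun_prop)) hq1).inv hnz
    have := Complex.norm_le_of_forall_mem_frontier_norm_le (f := fun s : ℂ => (f (q + s • v))⁻¹)
      (U := ball (0 : ℂ) δ) isBounded_ball (hd.diffContOnCl_ball subset_rfl) (C := c⁻¹)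
      (fun s hs => by
        rw [frontier_ball _ hδ.ne'] at hs
        rw [norm_inv]
        exact inv_anti₀ hc (hq2 s hs).le) (z := 0) (subset_closure (mem_ball_self hδ))
    simp only [zero_smul, add_zero, norm_inv] at this
    have hfq : 0 < ‖f q‖ := norm_pos_iff.2 (by simpa using hnz 0 (mem_closedBall_self hδ.le))
    exact absurd ((inv_le_inv₀ hfq hc).1 this) (not_le.2 hq3)
  have hproj : ∀ᶠ q in 𝓝 p, ∀ k ∈ J, q - q k • v ∈ ball p r := by
    refine (eventually_all_finset _).2 fun k hk => ?_
    have : ContinuousAt (fun q : ℂ^n => q - q k • v) p := by fun_prop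
    exact this.preimage_mem_nhds (isOpen_ball.mem_nhds (by simpa [hp k hk] using hr))
  obtain ⟨ε, hε, hε1⟩ := eventually_nhds_iff_ball.1 (hzero.and hproj)
  have hdense : ∀ k ∈ J, ∀ V ⊆ ball p ε, IsOpen V → V.Nonempty → ∃ q ∈ V, f (q - q k • v) ≠ 0 := by
    intro k hk V hVs hVo ⟨q0, hq0⟩
    by_contra! hV
    obtain ⟨y, hy, hyk, hfy⟩ := hcon k hk
    set x0 := q0 - q0 k • v with hx0
    have hx0k : x0 k = 0 := by simp [hx0, hvk]
    have hxb : x0 ∈ ball p r := (hε1 q0 (hVs hq0)).2 k hk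
    set W : Set ℂ := {s | x0 + s • (y - x0) ∈ ball p r} with hW
    have hWo : IsOpen W := isOpen_ball.preimage (by fun_prop)
    have hWc : Convex ℝ W := by
      intro s hs t ht a b ha hb hab
      have h1 : x0 + (a • s + b • t) • (y - x0) =
          a • (x0 + s • (y - x0)) + b • (x0 + t • (y - x0)) := by
        rw [smul_add, smul_add, add_add_add_comm, ← add_smul, hab, one_smul, add_smul, smul_assoc,
          smul_assoc]
      exact (congrArg (· ∈ ball p r) h1).mpr (convex_ball p r hs ht ha hb hab)
    have hd : DifferentiableOn ℂ (fun s : ℂ => f (x0 + s • (y - x0))) W := fun s hs =>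
      (hasDerivAt_comp_line (hf.differentiableAt
        (isOpen_ball.mem_nhds hs))).differentiableAt.differentiableWithinAt
    have hev : (fun s : ℂ => f (x0 + s • (y - x0))) =ᶠ[𝓝 0] 0 := by
      have hc : ContinuousAt (fun s : ℂ => x0 + s • (y - x0) + q0 k • v) 0 := by fun_prop
      filter_upwards [hc.preimage_mem_nhds (hVo.mem_nhds (by simpa [hx0] using hq0))] with s hs
      have h1 := hV _ hs
      rwa [show (x0 + s • (y - x0) + q0 k • v) k = q0 k by simp [hx0k, hyk, hvk],
        add_sub_cancel_right] at h1
    have := (hd.analyticOnNhd hWo).eqOn_zero_of_preconnected_of_eventuallyEq_zero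
      hWc.isPreconnected (by simpa [hW] using hxb) hev (by simpa [hW] using hy : (1 : ℂ) ∈ W)
    exact hfy (by simpa using this)
  have hind : ∀ J' ⊆ J, ∃ V ⊆ ball p ε, IsOpen V ∧ V.Nonempty ∧
      ∀ q ∈ V, ∀ k ∈ J', f (q - q k • v) ≠ 0 := by
    intro J'
    induction J' using Finset.induction_on with
    | empty => exact fun _ => ⟨ball p ε, subset_rfl, isOpen_ball, ⟨p, mem_ball_self hε⟩, by simp⟩
    | insert k J' _ ih =>
      intro hJ
      obtain ⟨hk, hJ⟩ := Finset.insert_subset_iff.1 hJ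
      obtain ⟨V, hVs, hVo, hVn, hV⟩ := ih hJ
      obtain ⟨q, hq⟩ := hdense k hk V hVs hVo hVn
      have hco : ContinuousOn (fun q : ℂ^n => f (q - q k • v)) V :=
        hf.continuousOn.comp (by fun_prop) fun q hq => (hε1 q (hVs hq)).2 k hk
      refine ⟨V ∩ (fun q : ℂ^n => f (q - q k • v)) ⁻¹' {0}ᶜ, inter_subset_left.trans hVs,
        hco.isOpen_inter_preimage hVo isOpen_compl_singleton, ⟨q, hq⟩, fun q hq => ?_⟩
      exact (Finset.forall_mem_insert ..).2 ⟨hq.2, hV q hq.1⟩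
  obtain ⟨V, hVs, -, ⟨q, hq⟩, hV⟩ := hind J subset_rfl
  obtain ⟨k, hk, h⟩ := (hε1 q (hVs hq)).1
  exact hV q hq k hk h

/-- A holomorphic function without zeros off the coordinate hyperplanes `x k = 0`, `k ∈ J`, is a
unit times a monomial near a common point of these hyperplanes. -/
theorem exists_unit_mul_monomial (hr : 0 < r) (J : Finset (Fin n))
    (hp : ∀ k ∈ J, p k = 0) (hf : DifferentiableOn ℂ f (ball p r))
    (hne : ∀ x ∈ ball p r, (∀ k ∈ J, x k ≠ 0) → f x ≠ 0) :
    ∃ (a : Fin n → ℕ) (h : ℂ^n → ℂ), DifferentiableOn ℂ h (ball p r) ∧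
      h p ≠ 0 ∧ ∀ x ∈ ball p r, f x = h x * ∏ k ∈ J, x k ^ a k := by
  set v : ℂ^n := WithLp.toLp 2 fun _ => (1 : ℂ)
  have hvk : ∀ k, v k = 1 := fun k => rfl
  have hcv : Continuous fun s : ℂ => p + s • v := by fun_prop
  have hWo : IsOpen {s : ℂ | p + s • v ∈ ball p r} := isOpen_ball.preimage hcv
  have h0W : (0 : ℂ) ∈ {s : ℂ | p + s • v ∈ ball p r} := by simpa using hr
  have han : ∀ f : ℂ^n → ℂ, DifferentiableOn ℂ f (ball p r) →
      AnalyticAt ℂ (fun s : ℂ => f (p + s • v)) 0 := fun f hf =>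
    (hf.comp (t := ball p r) (s := {s : ℂ | p + s • v ∈ ball p r})
      (Differentiable.differentiableOn (by fun_prop)) fun s hs => hs).analyticAt (hWo.mem_nhds h0W)
  have hfin : analyticOrderAt (fun s : ℂ => f (p + s • v)) 0 ≠ ⊤ := by
    intro htop
    rw [analyticOrderAt_eq_top] at htop
    have h1 : ∀ᶠ s : ℂ in 𝓝[≠] 0, f (p + s • v) = 0 ∧ p + s • v ∈ ball p r :=
      (htop.and (hWo.mem_nhds h0W)).filter_mono nhdsWithin_le_nhds
    obtain ⟨s, ⟨hs1, hs2⟩, hs3⟩ := (h1.and self_mem_nhdsWithin).exists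
    exact hne _ hs2 (fun k hk => by simpa [hp k hk, hvk] using hs3) hs1
  obtain ⟨N, hN⟩ := ENat.ne_top_iff_exists.1 hfin
  clear hfin
  induction N generalizing f with
  | zero =>
    refine ⟨0, f, hf, ?_, by simp⟩
    have := (analyticOrderAt_eq_zero (f := fun s : ℂ => f (p + s • v)) (z₀ := 0)).1
      (by rw [← hN]; rfl)
    simpa using this.resolve_left (not_not.2 (han f hf))
  | succ N ih =>
    have h0 := ((analyticOrderAt_ne_zero (f := fun s : ℂ => f (p + s • v)) (z₀ := 0)).1
      (by rw [← hN]; simp)).2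
    rw [zero_smul, add_zero] at h0
    obtain ⟨k, hk, hfk⟩ := exists_vanishing_hyperplane hr J hp hf hne h0
    obtain ⟨h, hh, hfh⟩ := exists_eq_coord_mul (hp k hk) hf hfk
    have hord : analyticOrderAt (fun s : ℂ => h (p + s • v)) 0 = N := by
      have h1 : (fun s : ℂ => f (p + s • v)) =ᶠ[𝓝 0] (fun s : ℂ => s) * fun s => h (p + s • v) := by
        filter_upwards [hWo.mem_nhds h0W] with s hs
        have := hfh _ hs
        simpa [hp k hk, hvk] using this
      rw [analyticOrderAt_congr h1, analyticOrderAt_mul (by fun_prop) (han h hh)] at hN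
      rw [show analyticOrderAt (fun s : ℂ => s) 0 = 1 from analyticOrderAt_id] at hN
      generalize analyticOrderAt (fun s : ℂ => h (p + s • v)) 0 = o at hN ⊢
      induction o using ENat.recTopCoe with
      | top => simp at hN
      | coe o =>
        norm_cast at hN ⊢
        omega
    obtain ⟨a, h', hh', hne', hfac⟩ := ih hh (fun x hx hxk hx0 => hne x hx hxk
      (by rw [hfh x hx, hx0, mul_zero])) hord.symm
    refine ⟨a + (Pi.single k 1 : Fin n → ℕ), h', hh', hne', fun x hx => ?_⟩
    have : ∏ j ∈ J, x j ^ (Pi.single k 1 : Fin n → ℕ) j = x k := by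
      rw [Finset.prod_eq_single k (fun j _ hj => by simp [hj]) (absurd hk)]; simp
    simp only [hfh x hx, hfac x hx, Pi.add_apply, pow_add, Finset.prod_mul_distrib, this]
    ring

end ComplexAnalysis

section FlatFunctions

open Metric

variable {Q : Type*} [NormedAddCommGroup Q] [NormedSpace ℝ Q]

/-- A function vanishing off an open set `P`, and whose derivative on `P` tends to zero at a point
off `P`, has zero derivative at that point. -/
theorem hasFDerivAt_zero_of_vanishing {F : Q → ℝ} {P : Set Q} {q0 : Q} (hq0 : q0 ∉ P)
    (h0 : ∀ᶠ q in 𝓝 q0, q ∉ P → F q = 0) (hc : ∀ᶠ q in 𝓝 q0, ContinuousAt F q) (hP : IsOpen P)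
    (hd : ∀ᶠ q in 𝓝 q0, q ∈ P → DifferentiableAt ℝ F q)
    (hlim : ∀ ε > 0, ∀ᶠ q in 𝓝 q0, q ∈ P → ‖fderiv ℝ F q‖ ≤ ε) :
    HasFDerivAt F (0 : Q →L[ℝ] ℝ) q0 := by
  rw [hasFDerivAt_iff_isLittleO, Asymptotics.isLittleO_iff]
  intro ε hε
  obtain ⟨δ, hδ, hb⟩ := Metric.eventually_nhds_iff_ball.1 ((h0.and hc).and (hd.and (hlim ε hε)))
  filter_upwards [ball_mem_nhds q0 hδ] with y hy
  have hF0 : F q0 = 0 := (hb q0 (mem_ball_self hδ)).1.1 hq0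
  simp only [hF0, sub_zero, _root_.zero_apply]
  by_cases hyP : y ∈ P
  swap
  · rw [(hb y hy).1.1 hyP, norm_zero]; positivity
  set γ : ℝ → Q := fun s => q0 + s • (y - q0) with hγ
  have hγc : Continuous γ := by fun_prop
  have hγd : ∀ s, HasDerivAt γ (y - q0) s := fun s => by
    have h : HasDerivAt γ ((1 : ℝ) • (y - q0)) s :=
      ((hasDerivAt_id s).smul_const (y - q0)).const_add q0
    rwa [one_smul] at h
  have hγb : ∀ s ∈ Icc (0 : ℝ) 1, γ s ∈ ball q0 δ := fun s hs => by
    rw [mem_ball, dist_eq_norm, hγ, add_sub_cancel_left, norm_smul, Real.norm_eq_abs,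
      abs_of_nonneg hs.1]
    rw [mem_ball, dist_eq_norm] at hy
    exact (mul_le_of_le_one_left (norm_nonneg _) hs.2).trans_lt hy
  set S : Set ℝ := Icc 0 1 ∩ γ ⁻¹' Pᶜ
  have hSc : IsCompact S := isCompact_Icc.inter_right (hP.isClosed_compl.preimage hγc)
  have hSn : S.Nonempty := ⟨0, by simp, by simpa [hγ] using hq0⟩
  obtain ⟨a, haS, ha⟩ := hSc.exists_isGreatest hSn
  have ha1 : a < 1 := by
    refine lt_of_le_of_ne haS.1.2 fun h => haS.2 ?_
    simpa [h, hγ] using hyP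
  have hin : ∀ s ∈ Ioc a 1, γ s ∈ P := fun s hs => by_contra fun h =>
    absurd (ha ⟨⟨haS.1.1.trans hs.1.le, hs.2⟩, h⟩) (not_le.2 hs.1)
  have hsub : ∀ s ∈ Icc a 1, s ∈ Icc (0 : ℝ) 1 := fun s hs => ⟨haS.1.1.trans hs.1, hs.2⟩
  obtain ⟨s, hs, hslope⟩ := exists_hasDerivAt_eq_slope (F ∘ γ)
    (fun s => fderiv ℝ F (γ s) (y - q0)) ha1
    (fun s hs => (((hb _ (hγb s (hsub s hs))).1.2).comp hγc.continuousAt).continuousWithinAt)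
    (fun s hs => ((hb _ (hγb s (hsub s (Ioo_subset_Icc_self hs)))).2.1
      (hin s ⟨hs.1, hs.2.le⟩)).hasFDerivAt.comp_hasDerivAt s (hγd s))
  have hFa : F (γ a) = 0 := (hb _ (hγb a haS.1)).1.1 haS.2
  have hy1 : γ 1 = y := by simp [hγ]
  simp only [comp_apply, hFa, hy1, sub_zero] at hslope
  rw [eq_div_iff (by linarith : (1 : ℝ) - a ≠ 0)] at hslope
  rw [← hslope, norm_mul]
  have h1 : ‖fderiv ℝ F (γ s) (y - q0)‖ ≤ ε * ‖y - q0‖ := ContinuousLinearMap.le_of_opNorm_le _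
    ((hb _ (hγb s (hsub s (Ioo_subset_Icc_self hs)))).2.2 (hin s ⟨hs.1, hs.2.le⟩)) _
  have h2 : ‖1 - a‖ ≤ 1 := by
    rw [Real.norm_eq_abs, abs_of_pos (by linarith)]
    linarith [haS.1.1]
  calc _ ≤ (ε * ‖y - q0‖) * 1 := by gcongr
    _ = _ := mul_one _

/-- The elements of `A` express the partial derivatives of `a` on `Ω`. -/
def DerivIn (A : Subalgebra ℝ (Q → ℝ)) (Ω : Set Q) (a : Q → ℝ) : Prop :=
  (∀ q ∈ Ω, DifferentiableAt ℝ a q) ∧ ∀ e, ∃ b ∈ A, ∀ q ∈ Ω, fderiv ℝ a q e = b q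

namespace DerivIn

variable {A : Subalgebra ℝ (Q → ℝ)} {Ω : Set Q} {a b : Q → ℝ}

theorem const (r : ℝ) : DerivIn A Ω fun _ => r :=
  ⟨fun _ _ => by fun_prop, fun e => ⟨0, A.zero_mem, fun q _ => by simp⟩⟩

theorem add (ha : DerivIn A Ω a) (hb : DerivIn A Ω b) : DerivIn A Ω (a + b) := by
  refine ⟨fun q hq => (ha.1 q hq).add (hb.1 q hq), fun e => ?_⟩
  obtain ⟨a', ha', hae⟩ := ha.2 e
  obtain ⟨b', hb', hbe⟩ := hb.2 e
  refine ⟨a' + b', A.add_mem ha' hb', fun q hq => ?_⟩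
  rw [fderiv_add (ha.1 q hq) (hb.1 q hq)]
  simp [hae q hq, hbe q hq]

theorem mul (haA : a ∈ A) (hbA : b ∈ A) (ha : DerivIn A Ω a) (hb : DerivIn A Ω b) :
    DerivIn A Ω (a * b) := by
  refine ⟨fun q hq => (ha.1 q hq).mul (hb.1 q hq), fun e => ?_⟩
  obtain ⟨a', ha', hae⟩ := ha.2 e
  obtain ⟨b', hb', hbe⟩ := hb.2 e
  refine ⟨a * b' + b * a', A.add_mem (A.mul_mem haA hb') (A.mul_mem hbA ha'), fun q hq => ?_⟩
  rw [fderiv_mul (ha.1 q hq) (hb.1 q hq)]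
  simp [hae q hq, hbe q hq]

theorem inv (hi : a⁻¹ ∈ A) (ha : DerivIn A Ω a) (hne : ∀ q ∈ Ω, a q ≠ 0) : DerivIn A Ω a⁻¹ := by
  refine ⟨fun q hq => (ha.1 q hq).inv (hne q hq), fun e => ?_⟩
  obtain ⟨a', ha', hae⟩ := ha.2 e
  refine ⟨-(a⁻¹ * a⁻¹ * a'), A.neg_mem (A.mul_mem (A.mul_mem hi hi) ha'), fun q hq => ?_⟩
  have h := ((hasDerivAt_inv (hne q hq)).comp_hasFDerivAt q (ha.1 q hq).hasFDerivAt).fderiv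
  have h' : fderiv ℝ a⁻¹ q = -(a q ^ 2)⁻¹ • fderiv ℝ a q := h
  rw [h']
  simp [hae q hq, pow_two]

end DerivIn

/-- `a` is bounded, near the points of `N` where `φ ≤ 0`, by negative powers of `φ`. -/
def Moderate (φ : Q → ℝ) (N : Set Q) (a : Q → ℝ) : Prop :=
  ∀ q0 ∈ N, φ q0 ≤ 0 → ∃ C ≥ 0, ∃ k : ℕ, ∀ᶠ q in 𝓝 q0, 0 < φ q → |a q| ≤ C * (φ q)⁻¹ ^ k

namespace Moderate

variable {φ : Q → ℝ} {N : Set Q} {a b : Q → ℝ}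

theorem const (r : ℝ) : Moderate φ N fun _ => r := fun _ _ _ =>
  ⟨|r|, abs_nonneg r, 0, Eventually.of_forall fun _ _ => by simp⟩

theorem of_bounded (h : ∀ q0 ∈ N, φ q0 ≤ 0 → ∃ C ≥ 0, ∀ᶠ q in 𝓝 q0, 0 < φ q → |a q| ≤ C) :
    Moderate φ N a := fun q0 h0 h1 => by
  obtain ⟨C, hC, h⟩ := h q0 h0 h1
  exact ⟨C, hC, 0, by simpa using h⟩

theorem mul (ha : Moderate φ N a) (hb : Moderate φ N b) : Moderate φ N (a * b) := by
  intro q0 h0 h1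
  obtain ⟨C, hC, k, h⟩ := ha q0 h0 h1
  obtain ⟨C', hC', k', h'⟩ := hb q0 h0 h1
  refine ⟨C * C', mul_nonneg hC hC', k + k', ?_⟩
  filter_upwards [h, h'] with q h h' hq
  rw [Pi.mul_apply, abs_mul, pow_add, mul_mul_mul_comm]
  have := h hq
  have := h' hq
  gcongr

theorem add (hN : IsOpen N) (hφ : ContinuousOn φ N) (ha : Moderate φ N a) (hb : Moderate φ N b) :
    Moderate φ N (a + b) := by
  intro q0 h0 h1
  obtain ⟨C, hC, k, h⟩ := ha q0 h0 h1
  obtain ⟨C', hC', k', h'⟩ := hb q0 h0 h1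
  refine ⟨C + C', add_nonneg hC hC', max k k', ?_⟩
  have h2 : ∀ᶠ q in 𝓝 q0, φ q < 1 :=
    (hφ.continuousAt (hN.mem_nhds h0)).eventually_lt continuousAt_const (by linarith)
  filter_upwards [h, h', h2] with q h h' h2 hq
  have h3 : 1 ≤ (φ q)⁻¹ := (one_le_inv₀ hq).2 h2.le
  calc |(a + b) q| ≤ |a q| + |b q| := abs_add_le _ _
    _ ≤ C * (φ q)⁻¹ ^ k + C' * (φ q)⁻¹ ^ k' := add_le_add (h hq) (h' hq)
    _ ≤ C * (φ q)⁻¹ ^ max k k' + C' * (φ q)⁻¹ ^ max k k' := by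
        gcongr <;> first | exact h3 | simp
    _ = _ := by ring

end Moderate

theorem exists_exp_neg_div_mul_le {c : ℝ} (hc : 0 < c) (k : ℕ) :
    ∃ M ≥ 0, ∀ x : ℝ, 0 < x → exp (-c / x) * x⁻¹ ^ k ≤ M * x := by
  refine ⟨(k + 1).factorial / c ^ (k + 1), by positivity, fun x hx => ?_⟩
  have h := Real.pow_div_factorial_le_exp (c / x) (by positivity) (k + 1)
  rw [neg_div, Real.exp_neg]
  have h1 : 0 < (c / x) ^ (k + 1) / (k + 1).factorial := by positivity
  calc (exp (c / x))⁻¹ * x⁻¹ ^ k ≤ ((c / x) ^ (k + 1) / (k + 1).factorial)⁻¹ * x⁻¹ ^ k := by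
        gcongr
    _ = (k + 1).factorial / c ^ (k + 1) * x := by
        rw [div_pow, inv_div, div_div_eq_mul_div, inv_pow, div_mul_eq_mul_div, div_mul_eq_mul_div]
        congr 1
        rw [pow_succ]
        field_simp

/-- The function `exp (-c / φ)`, extended by zero, is smooth if the iterated derivatives of `φ` grow
at most like powers of `1 / φ`. -/
theorem contDiffOn_exp_neg_div [FiniteDimensional ℝ Q] {N : Set Q} (hN : IsOpen N) {φ : Q → ℝ}
    (hφ : ContinuousOn φ N) (𝒢 : Set (Q → ℝ))
    (hd : ∀ a ∈ 𝒢, DerivIn (Algebra.adjoin ℝ 𝒢) {q | q ∈ N ∧ 0 < φ q} a)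
    (hb : ∀ a ∈ 𝒢, Moderate φ N a) (hφd : DerivIn (Algebra.adjoin ℝ 𝒢) {q | q ∈ N ∧ 0 < φ q} φ)
    (hφi : φ⁻¹ ∈ Algebra.adjoin ℝ 𝒢) {c : ℝ} (hc : 0 < c) :
    ContDiffOn ℝ ∞ (fun q => if 0 < φ q then exp (-c / φ q) else 0) N := by
  set A := Algebra.adjoin ℝ 𝒢
  set Ω : Set Q := {q | q ∈ N ∧ 0 < φ q}
  have hΩo : IsOpen Ω := hφ.isOpen_inter_preimage hN isOpen_Ioi
  have hA : ∀ a ∈ A, DerivIn A Ω a ∧ Moderate φ N a := fun a ha => by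
    induction ha using Algebra.adjoin_induction with
    | mem a ha => exact ⟨hd a ha, hb a ha⟩
    | algebraMap r => exact ⟨.const r, .const r⟩
    | add a b _ _ h1 h2 => exact ⟨h1.1.add h2.1, h1.2.add hN hφ h2.2⟩
    | mul a b h1 h2 h3 h4 => exact ⟨.mul h1 h2 h3.1 h4.1, h3.2.mul h4.2⟩
  set F : (Q → ℝ) → Q → ℝ := fun a q => if 0 < φ q then exp (-c / φ q) * a q else 0 with hF
  have hF1 : ∀ a, ∀ q ∈ Ω, F a =ᶠ[𝓝 q] fun q => exp (-c / φ q) * a q := fun a q hq => by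
    filter_upwards [hΩo.mem_nhds hq] with q' hq'
    simp [hF, hq'.2]
  have hF0 : ∀ a q, ¬ 0 < φ q → F a q = 0 := fun a q hq => by simp [hF, hq]
  have hFlim : ∀ a ∈ A, ∀ q0 ∈ N, ¬ 0 < φ q0 → Tendsto (F a) (𝓝 q0) (𝓝 0) := by
    intro a ha q0 hq0 hφ₀
    obtain ⟨C, hC, k, h⟩ := (hA a ha).2 q0 hq0 (not_lt.1 hφ₀)
    obtain ⟨M, hM, h'⟩ := exists_exp_neg_div_mul_le hc k
    have hφc := hφ.continuousAt (hN.mem_nhds hq0)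
    have hlim : Tendsto (fun q => C * M * max (φ q) 0) (𝓝 q0) (𝓝 0) := by
      simpa [max_eq_right (not_lt.1 hφ₀)] using
        (hφc.tendsto.max (tendsto_const_nhds (x := (0 : ℝ)))).const_mul (C * M)
    refine squeeze_zero_norm' ?_ hlim
    filter_upwards [h] with q h
    by_cases hq : 0 < φ q
    · simp only [hF, hq, if_true, norm_mul, Real.norm_eq_abs, Real.abs_exp, max_eq_left hq.le]
      calc exp (-c / φ q) * |a q| ≤ exp (-c / φ q) * (C * (φ q)⁻¹ ^ k) := by
            gcongr; exact h hq
        _ = C * (exp (-c / φ q) * (φ q)⁻¹ ^ k) := by ring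
        _ ≤ C * (M * φ q) := mul_le_mul_of_nonneg_left (h' _ hq) hC
        _ = _ := by ring
    · rw [hF0 a q hq, norm_zero]; positivity
  have hexp : ∀ q ∈ Ω, HasFDerivAt (fun q => exp (-c / φ q))
      ((exp (-c / φ q) * (c * (φ q)⁻¹ * (φ q)⁻¹)) • fderiv ℝ φ q) q := by
    intro q hq
    have h2 := ((hasDerivAt_inv hq.2.ne').const_mul (-c)).exp
    simp only [← div_eq_mul_inv] at h2
    convert! h2.comp_hasFDerivAt q (hφd.1 q hq).hasFDerivAt using 2
    field_simp
  have hFd : ∀ a ∈ A, ∀ e, ∃ b ∈ A, ∀ q ∈ Ω, DifferentiableAt ℝ (F a) q ∧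
      fderiv ℝ (F a) q e = F b q := by
    intro a ha e
    obtain ⟨a', ha', hae⟩ := (hA a ha).1.2 e
    obtain ⟨p', hp', hpe⟩ := hφd.2 e
    refine ⟨c • (φ⁻¹ * φ⁻¹ * p' * a) + a', A.add_mem (A.smul_mem (A.mul_mem (A.mul_mem
      (A.mul_mem hφi hφi) hp') ha) _) ha', fun q hq => ?_⟩
    have h1 : HasFDerivAt (F a) _ q :=
      ((hexp q hq).mul ((hA a ha).1.1 q hq).hasFDerivAt).congr_of_eventuallyEq (hF1 a q hq)
    refine ⟨h1.differentiableAt, ?_⟩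
    rw [h1.fderiv]
    simp only [hF, hq.2, if_true, _root_.add_apply, _root_.smul_apply,
      hpe q hq, hae q hq, smul_eq_mul, Pi.add_apply, Pi.smul_apply, Pi.mul_apply, Pi.inv_apply]
    ring
  have hFc : ∀ a ∈ A, ∀ q ∈ N, ContinuousAt (F a) q := fun a ha q hq => by
    by_cases h : 0 < φ q
    · exact ((hFd a ha 0).choose_spec.2 q ⟨hq, h⟩).1.continuousAt
    · have := hFlim a ha q hq h
      rwa [ContinuousAt, hF0 a q h]
  have hFz : ∀ a ∈ A, ∀ q ∈ N, ¬ 0 < φ q → HasFDerivAt (F a) (0 : Q →L[ℝ] ℝ) q := by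
    intro a ha q0 hq0 hφ₀
    refine hasFDerivAt_zero_of_vanishing (P := Ω) (fun h => hφ₀ h.2) ?_ ?_ hΩo
      (Eventually.of_forall fun q hq => ((hFd a ha 0).choose_spec.2 q hq).1) ?_
    · filter_upwards [hN.mem_nhds hq0] with q hq hqΩ using hF0 a q fun h => hqΩ ⟨hq, h⟩
    · filter_upwards [hN.mem_nhds hq0] with q hq using hFc a ha q hq
    · intro ε hε
      let bs := Module.finBasis ℝ Q
      obtain ⟨C, hC, hCb⟩ := bs.exists_opNorm_le (F := ℝ)
      have : ∀ i, ∀ᶠ q in 𝓝 q0, q ∈ Ω → ‖fderiv ℝ (F a) q (bs i)‖ ≤ ε / C := by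
        intro i
        obtain ⟨b, hbA, hbe⟩ := hFd a ha (bs i)
        filter_upwards [(hFlim b hbA q0 hq0 hφ₀).norm.eventually
          (gt_mem_nhds (show ‖(0 : ℝ)‖ < ε / C by rw [norm_zero]; positivity))] with q h1 hq
        exact (hbe q hq).2 ▸ h1.le
      filter_upwards [eventually_all.2 this] with q hq hqΩ
      refine (hCb (by positivity) fun i => hq i hqΩ).trans (le_of_eq ?_)
      field_simp
  have key : ∀ k : ℕ, ∀ a ∈ A, ContDiffOn ℝ k (F a) N := by
    intro k
    induction k with
    | zero => exact fun a ha => contDiffOn_zero.2 fun q hq => (hFc a ha q hq).continuousWithinAt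
    | succ k ih =>
      intro a ha
      push_cast
      rw [contDiffOn_succ_iff_fderiv_of_isOpen hN]
      refine ⟨fun q hq => ?_, by simp, ?_⟩
      · by_cases h : 0 < φ q
        · exact ((hFd a ha 0).choose_spec.2 q ⟨hq, h⟩).1.differentiableWithinAt
        · exact (hFz a ha q hq h).differentiableAt.differentiableWithinAt
      · rw [contDiffOn_clm_apply]
        intro e
        obtain ⟨b, hbA, hbe⟩ := hFd a ha e
        refine (ih b hbA).congr fun q hq => ?_
        by_cases h : 0 < φ q
        · exact (hbe q ⟨hq, h⟩).2
        · rw [(hFz a ha q hq h).fderiv, hF0 b q h]; rfl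
  have := contDiffOn_infty.2 fun k => key k 1 A.one_mem
  simpa [hF] using this

end FlatFunctions

section Implicit

theorem exists_implicit_scalar {E : Type*} [NormedAddCommGroup E] [NormedSpace ℝ E]
    [CompleteSpace E] {f : E × ℝ → ℝ} {p : E} {y d : ℝ} {r : WithTop ℕ∞} (hr : r ≠ 0)
    (hf : ContDiffAt ℝ r f (p, y)) (hd : HasDerivAt (fun z => f (p, z)) d y) (hne : d ≠ 0) :
    ∃ φ : E → ℝ, ContDiffAt ℝ r φ p ∧ φ p = y ∧ (∀ᶠ q in 𝓝 p, f (q, φ q) = f (p, y)) ∧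
      ∀ᶠ v in 𝓝 (p, y), f v = f (p, y) ↔ φ v.1 = v.2 := by
  have h1 : fderiv ℝ f (p, y) ∘L .inr ℝ E ℝ =
      (ContinuousLinearEquiv.unitsEquivAut ℝ (Units.mk0 d hne) : ℝ →L[ℝ] ℝ) := by
    ext
    simpa using ((hf.differentiableAt hr).hasFDerivAt.comp_hasDerivAt y
      ((hasDerivAt_const y p).prodMk (hasDerivAt_id y))).unique hd
  have hinv : (fderiv ℝ f (p, y) ∘L .inr ℝ E ℝ).IsInvertible := ⟨_, h1.symm⟩
  exact ⟨hf.implicitFunction hr hinv, hf.contDiffAt_implicitFunction hr hinv,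
    hf.implicitFunction_apply_self hr hinv, hf.eventually_apply_implicitFunction hr hinv,
    hf.eventually_apply_eq_iff_implicitFunction hr hinv⟩

end Implicit

section Model

/-- `u` as a function of `g` and `T`, where `1 / u = 1 / g + log T`. -/
def uOf (g T : ℝ) : ℝ := g / (1 + g * log T)

/-- The values of `T` for which `uOf g T` makes sense. -/
def ValidT (g T : ℝ) : Prop := 0 < T ∧ 0 < 1 + g * log T

theorem uOf_anti {g a b : ℝ} (ha : ValidT g a) (hb : ValidT g b) (hab : a ≤ b) :
    uOf g b ≤ uOf g a := by
  have h1 : log a ≤ log b := Real.log_le_log ha.1 hab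
  have h2 : uOf g a - uOf g b = g ^ 2 * (log b - log a) / ((1 + g * log a) * (1 + g * log b)) := by
    unfold uOf
    rw [div_sub_div _ _ ha.2.ne' hb.2.ne']
    ring
  have h3 : 0 ≤ uOf g a - uOf g b := by
    rw [h2]
    exact div_nonneg (mul_nonneg (sq_nonneg _) (sub_nonneg.2 h1)) (mul_pos ha.2 hb.2).le
  linarith

theorem sub_uOf_strictMono {g a b : ℝ} (ha : ValidT g a) (hb : ValidT g b) (hab : a < b) :
    a - uOf g a < b - uOf g b := by
  linarith [uOf_anti ha hb hab.le]

theorem validT_of_mem_Icc {g a b T : ℝ} (ha : ValidT g a) (hb : ValidT g b) (hT : T ∈ Icc a b) :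
    ValidT g T := by
  have hT0 : 0 < T := ha.1.trans_le hT.1
  refine ⟨hT0, ?_⟩
  have h1 := Real.log_le_log ha.1 hT.1
  have h2 := Real.log_le_log hT0 hT.2
  rcases le_total 0 g with h | h
  · nlinarith [ha.2, mul_le_mul_of_nonneg_left h1 h]
  · nlinarith [hb.2, mul_le_mul_of_nonpos_left h2 h]

theorem continuousAt_uOf {g T : ℝ} (h : ValidT g T) :
    ContinuousAt (fun q : ℝ² => uOf q.1 q.2) (g, T) := by
  have : ContinuousAt (fun q : ℝ² => log q.2) (g, T) := continuousAt_snd.log h.1.ne'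
  exact continuousAt_fst.div (continuousAt_const.add (continuousAt_fst.mul this)) h.2.ne'

theorem exists_validT_between {g a b s : ℝ} (ha : ValidT g a) (hb : ValidT g b)
    (h1 : a - uOf g a ≤ s) (h2 : s ≤ b - uOf g b) : ∃ T, ValidT g T ∧ T - uOf g T = s := by
  rcases le_total a b with hab | hab
  · have hc : ContinuousOn (fun T => T - uOf g T) (Icc a b) := fun T hT => by
      refine (continuousAt_id.sub ?_).continuousWithinAt
      exact (continuousAt_uOf (validT_of_mem_Icc ha hb hT)).comp
        (f := fun T : ℝ => (g, T)) (by fun_prop)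
    obtain ⟨T, hT, h⟩ := intermediate_value_Icc hab hc ⟨h1, h2⟩
    exact ⟨T, validT_of_mem_Icc ha hb hT, h⟩
  · rcases hab.eq_or_lt with rfl | hab
    · exact ⟨b, hb, le_antisymm h1 h2⟩
    · exact absurd (sub_uOf_strictMono hb ha hab) (not_lt.2 (h1.trans h2))

theorem exists_validT {g s : ℝ} (h : 0 < g ∨ 0 < s) : ∃ T, ValidT g T ∧ T - uOf g T = s := by
  have hval : ∀ a : ℝ, g ≠ 0 → 0 < a → ValidT g (exp ((a - 1) / g)) ∧
      uOf g (exp ((a - 1) / g)) = g / a := fun a hg ha => by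
    have : 1 + g * log (exp ((a - 1) / g)) = a := by
      rw [Real.log_exp]; field_simp; ring
    exact ⟨⟨Real.exp_pos _, by rwa [this]⟩, by rw [uOf, this]⟩
  rcases lt_trichotomy g 0 with hg | rfl | hg
  · have hs : 0 < s := h.resolve_left (not_lt.2 hg.le)
    have ha : 0 < 2 * (-g) / s := div_pos (by linarith) hs
    have hb : 0 < -g / (s - g) := div_pos (by linarith) (by linarith)
    obtain ⟨hb1, hb2⟩ := hval _ hg.ne hb
    have e1 : 1 + g * log (exp (-2 / s)) = 1 + 2 * (-g) / s := by
      rw [Real.log_exp]; ring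
    refine exists_validT_between (a := exp (-2 / s)) ⟨Real.exp_pos _, by rw [e1]; linarith⟩
      hb1 ?_ ?_
    · have h3 : exp (-2 / s) ≤ s / 2 := by
        rw [neg_div, Real.exp_neg]
        rw [inv_le_comm₀ (Real.exp_pos _) (by positivity), inv_div]
        linarith [Real.add_one_le_exp (2 / s)]
      have h4 : -uOf g (exp (-2 / s)) ≤ s / 2 := by
        rw [uOf, e1, ← neg_div, div_le_iff₀ (by linarith)]
        have : s / 2 * (1 + 2 * (-g) / s) = s / 2 + -g := by field_simp
        linarith
      linarith
    · rw [hb2]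
      have h3 : g / (-g / (s - g)) = g - s := by
        have := hg.ne
        have : s - g ≠ 0 := by linarith
        field_simp
        ring
      rw [h3]
      linarith [Real.exp_pos ((-g / (s - g) - 1) / g)]
  · have hs : 0 < s := h.resolve_left (lt_irrefl _)
    exact ⟨s, ⟨hs, by simp⟩, by simp [uOf]⟩
  · have ha : 0 < g / (1 + |s| + g) := by positivity
    have hb : 0 < 1 + g * (1 + |s| + g) := by positivity
    obtain ⟨ha1, ha2⟩ := hval _ hg.ne' ha
    obtain ⟨hb1, hb2⟩ := hval _ hg.ne' hb
    refine exists_validT_between ha1 hb1 ?_ ?_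
    · rw [ha2]
      have h3 : g / (g / (1 + |s| + g)) = 1 + |s| + g := by field_simp
      have h4 : exp ((g / (1 + |s| + g) - 1) / g) ≤ 1 := by
        rw [Real.exp_le_one_iff]
        refine div_nonpos_of_nonpos_of_nonneg ?_ hg.le
        rw [sub_nonpos, div_le_one (by positivity)]
        linarith [abs_nonneg s]
      rw [h3]
      linarith [neg_abs_le s]
    · rw [hb2]
      have h3 : (1 + g * (1 + |s| + g) - 1) / g = 1 + |s| + g := by field_simp; ring
      have h4 : g / (1 + g * (1 + |s| + g)) ≤ g :=
        div_le_self hg.le (by nlinarith [mul_nonneg hg.le (abs_nonneg s), mul_pos hg hg])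
      rw [h3]
      linarith [Real.add_one_le_exp (1 + |s| + g), le_abs_self s]

open Classical in
/-- The value of `T` as a function of `(g, s)`, where `s = T - u`. -/
def TT (p : ℝ²) : ℝ := if h : 0 < p.1 ∨ 0 < p.2 then (exists_validT h).choose else 0

/-- The value of `u` as a function of `(g, s)`, where `s = T - u`. -/
def UU (p : ℝ²) : ℝ := TT p - p.2

theorem TT_of_nonpos {p : ℝ²} (h1 : p.1 ≤ 0) (h2 : p.2 ≤ 0) : TT p = 0 := dif_neg (by simp [h1, h2])

theorem TT_spec {p : ℝ²} (h : 0 < p.1 ∨ 0 < p.2) :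
    ValidT p.1 (TT p) ∧ TT p - uOf p.1 (TT p) = p.2 := by
  rw [TT, dif_pos h]
  exact (exists_validT h).choose_spec

theorem UU_eq {p : ℝ²} (h : 0 < p.1 ∨ 0 < p.2) : UU p = uOf p.1 (TT p) := by
  rw [UU]; linarith [(TT_spec h).2]

theorem TT_unique {p : ℝ²} (h : 0 < p.1 ∨ 0 < p.2) {T : ℝ} (hT : ValidT p.1 T)
    (hs : T - uOf p.1 T = p.2) : TT p = T := by
  obtain ⟨h1, h2⟩ := TT_spec h
  rcases lt_trichotomy (TT p) T with h3 | h3 | h3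
  · linarith [sub_uOf_strictMono h1 hT h3]
  · exact h3
  · linarith [sub_uOf_strictMono hT h1 h3]

theorem TT_pos_iff {p : ℝ²} : 0 < TT p ↔ 0 < p.1 ∨ 0 < p.2 := by
  refine ⟨fun h => ?_, fun h => (TT_spec h).1.1⟩
  by_contra! h'
  exact h.ne' (TT_of_nonpos h'.1 h'.2)

theorem TT_nonneg (p : ℝ²) : 0 ≤ TT p := by
  by_cases h : 0 < p.1 ∨ 0 < p.2
  · exact (TT_spec h).1.1.le
  · push Not at h
    rw [TT_of_nonpos h.1 h.2]

theorem TT_zero_fst {s : ℝ} : TT (0, s) = max s 0 := by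
  rcases le_or_gt s 0 with h | h
  · rw [TT_of_nonpos le_rfl h, max_eq_right h]
  · rw [TT_unique (Or.inr h) (T := s) ⟨h, by simp⟩ (by simp [uOf]), max_eq_left h.le]

theorem UU_pos_iff {p : ℝ²} : 0 < UU p ↔ 0 < p.1 ∨ p.2 < 0 := by
  by_cases h1 : 0 < p.1
  · simp only [h1, true_or, iff_true, UU_eq (Or.inl h1)]
    exact div_pos h1 (TT_spec (Or.inl h1)).1.2
  · by_cases h2 : 0 < p.2
    · have h3 : uOf p.1 (TT p) ≤ 0 :=
        div_nonpos_of_nonpos_of_nonneg (not_lt.1 h1) (TT_spec (Or.inr h2)).1.2.le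
      simp only [h1, false_or, UU_eq (Or.inr h2), h3.not_gt, h2.not_gt]
    · rw [UU, TT_of_nonpos (not_lt.1 h1) (not_lt.1 h2)]
      simp [h1]

theorem UU_nonneg {p : ℝ²} (h : 0 ≤ p.1) : 0 ≤ UU p := by
  by_cases h1 : 0 < p.1
  · exact (UU_pos_iff.2 (Or.inl h1)).le
  · rw [UU, show p = (0, p.2) from Prod.ext (le_antisymm (not_lt.1 h1) h) rfl, TT_zero_fst]
    simp

theorem isOpen_TT_pos : IsOpen {p : ℝ² | 0 < p.1 ∨ 0 < p.2} :=
  (isOpen_lt continuous_const continuous_fst).union (isOpen_lt continuous_const continuous_snd)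

theorem isOpen_UU_pos : IsOpen {p : ℝ² | 0 < p.1 ∨ p.2 < 0} :=
  (isOpen_lt continuous_const continuous_fst).union (isOpen_lt continuous_snd continuous_const)

theorem inv_one_add_mul_log {g T : ℝ} (h : ValidT g T) :
    1 - uOf g T * log T = (1 + g * log T)⁻¹ := by
  have := h.2.ne'
  unfold uOf
  field_simp
  ring

theorem hasDerivAt_sub_uOf {g T : ℝ} (h : ValidT g T) :
    HasDerivAt (fun T => T - uOf g T) (1 + uOf g T ^ 2 / T) T := by
  have h1 : HasDerivAt (fun T => 1 + g * log T) (g * T⁻¹) T :=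
    ((Real.hasDerivAt_log h.1.ne').const_mul g).const_add 1
  have h2 := (hasDerivAt_id T).sub ((h1.inv h.2.ne').const_mul g)
  have h3 := h.2.ne'
  have h4 := h.1.ne'
  convert! h2 using 1
  unfold uOf
  field_simp
  ring

theorem contDiffAt_TT {p : ℝ²} (h : 0 < p.1 ∨ 0 < p.2) : ContDiffAt ℝ ∞ TT p := by
  obtain ⟨hv, hs⟩ := TT_spec h
  have h1 := hv.1.ne'
  have h2 := hv.2.ne'
  have hf : ContDiffAt ℝ ∞ (fun v : (ℝ²) × ℝ => v.2 - uOf v.1.1 v.2 - v.1.2) (p, TT p) := by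
    unfold uOf
    fun_prop (disch := assumption)
  have hpos : 0 < 1 + uOf p.1 (TT p) ^ 2 / TT p := by
    have := hv.1; positivity
  obtain ⟨φ, hφ, hφp, hφe, -⟩ := exists_implicit_scalar (by simp) hf
    ((hasDerivAt_sub_uOf hv).sub_const p.2) hpos.ne'
  refine hφ.congr_of_eventuallyEq ?_
  have h1 : ∀ᶠ q in 𝓝 p, 0 < φ q := hφ.continuousAt.eventually_const_lt (by rw [hφp]; exact hv.1)
  have h2 : ∀ᶠ q in 𝓝 p, 0 < 1 + q.1 * log (φ q) :=
    (continuousAt_const.add (continuousAt_fst.mul (hφ.continuousAt.log (by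
      rwa [hφp])))).eventually_const_lt (by simpa [hφp] using hv.2)
  filter_upwards [h1, h2, hφe, isOpen_TT_pos.mem_nhds h] with q h1 h2 h3 h4
  refine TT_unique h4 ⟨h1, h2⟩ ?_
  linarith

theorem eventually_TT_lt {p : ℝ²} (h1 : p.1 ≤ 0) (h2 : p.2 ≤ 0) {ε : ℝ} (hε : 0 < ε) :
    ∀ᶠ q in 𝓝 p, TT q < ε := by
  wlog hε1 : ε < 1 generalizing ε
  · filter_upwards [this (ε := 1 / 2) (by norm_num) (by norm_num)] with q hq
    linarith [not_lt.1 hε1]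
  have hlog : log ε < 0 := Real.log_neg hε hε1
  have hv : ValidT p.1 ε := ⟨hε, by nlinarith⟩
  have hu : uOf p.1 ε ≤ 0 := div_nonpos_of_nonpos_of_nonneg h1 hv.2.le
  have hc1 : ∀ᶠ q : ℝ² in 𝓝 p, 0 < 1 + q.1 * log ε :=
    (show ContinuousAt (fun q : ℝ² => 1 + q.1 * log ε) p by fun_prop).eventually_const_lt hv.2
  have hc2 : ∀ᶠ q : ℝ² in 𝓝 p, q.2 < ε - uOf q.1 ε :=
    continuousAt_snd.eventually_lt (continuousAt_const.sub ((continuousAt_uOf hv).comp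
      (f := fun q : ℝ² => (q.1, ε)) (by fun_prop))) (by linarith)
  filter_upwards [hc1, hc2] with q hq1 hq2
  by_cases hq : 0 < q.1 ∨ 0 < q.2
  · obtain ⟨h3, h4⟩ := TT_spec hq
    by_contra! h5
    linarith [uOf_anti ⟨hε, hq1⟩ h3 h5]
  · push Not at hq
    rwa [TT_of_nonpos hq.1 hq.2]

theorem continuous_TT : Continuous TT := by
  rw [continuous_iff_continuousAt]
  intro p
  by_cases h : 0 < p.1 ∨ 0 < p.2
  · exact (contDiffAt_TT h).continuousAt
  · push Not at h
    rw [Metric.continuousAt_iff']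
    intro ε hε
    filter_upwards [eventually_TT_lt h.1 h.2 hε] with q hq
    rwa [TT_of_nonpos h.1 h.2, Real.dist_eq, sub_zero, abs_of_nonneg (TT_nonneg q)]

theorem continuous_UU : Continuous UU := continuous_TT.sub continuous_snd

theorem contDiffAt_UU {p : ℝ²} (h : 0 < p.1 ∨ 0 < p.2) : ContDiffAt ℝ ∞ UU p :=
  (contDiffAt_TT h).sub contDiffAt_snd

theorem fderiv_TT {p : ℝ²} (h : 0 < p.1 ∨ 0 < p.2) (e : ℝ²) :
    fderiv ℝ TT p e = (e.2 + (1 - UU p * log (TT p)) ^ 2 * e.1) * (TT p * (TT p + UU p ^ 2)⁻¹) := by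
  obtain ⟨hv, -⟩ := TT_spec h
  have hT := ((contDiffAt_TT h).differentiableAt (by simp)).hasFDerivAt
  have hD := ((hasFDerivAt_fst (𝕜 := ℝ)).mul (hT.log hv.1.ne')).const_add 1
  have hall := (hT.sub (hasFDerivAt_fst.mul ((hasDerivAt_inv hv.2.ne').comp_hasFDerivAt p hD))).sub
    hasFDerivAt_snd
  have hconst := (isOpen_TT_pos.eventually_mem h).mono fun q hq => sub_eq_zero.2 (TT_spec hq).2
  have huniq := DFunLike.congr_fun ((hall.congr_of_eventuallyEq (f₁ := fun _ => (0 : ℝ))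
    (hconst.mono fun q hq => hq.symm)).unique (hasFDerivAt_const 0 p)) e
  simp at huniq
  rw [UU_eq h, inv_one_add_mul_log hv]
  have h1 := hv.1
  have h2 := hv.2
  have h5 : 0 < TT p + uOf p.1 (TT p) ^ 2 := by positivity
  have hu : uOf p.1 (TT p) * (1 + p.1 * log (TT p)) = p.1 := div_mul_cancel₀ _ h2.ne'
  set D := 1 + p.1 * log (TT p) with hD
  set u := uOf p.1 (TT p)
  rw [← mul_assoc, ← div_eq_mul_inv, eq_div_iff h5.ne', ← sub_eq_zero]
  field_simp at huniq
  have h6 : D ^ 2 * (fderiv ℝ TT p e * (TT p + u ^ 2) - (e.2 + D⁻¹ ^ 2 * e.1) * TT p) = 0 := by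
    have h7 : D ^ 2 * (fderiv ℝ TT p e * (TT p + u ^ 2) - (e.2 + D⁻¹ ^ 2 * e.1) * TT p) =
        D ^ 2 * fderiv ℝ TT p e * TT p + (u * D) ^ 2 * fderiv ℝ TT p e - D ^ 2 * e.2 * TT p
          - (D * D⁻¹) ^ 2 * e.1 * TT p := by ring
    rw [h7, hu, mul_inv_cancel₀ h2.ne']
    have h8 : log (TT p) * p.1 = D - 1 := by rw [hD]; ring
    linear_combination (exp := 1) huniq + (e.1 * TT p) * h8
  exact (mul_eq_zero.1 h6).resolve_left (by positivity)

/-- On the set where `u` is positive, `T` is a flat function of `g`, for fixed `u`. -/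
theorem TT_eq_exp_mul {p : ℝ²} (h : 0 < p.1 ∨ p.2 < 0) :
    TT p = exp (UU p)⁻¹ * expNegInvGlue p.1 := by
  rcases le_or_gt p.1 0 with h1 | h1
  · rw [expNegInvGlue.zero_of_nonpos h1, mul_zero,
      TT_of_nonpos h1 (h.resolve_left (not_lt.2 h1)).le]
  · obtain ⟨hv, -⟩ := TT_spec (Or.inl h1)
    rw [UU_eq (Or.inl h1), expNegInvGlue, if_neg (not_le.2 h1), ← Real.exp_add, uOf, inv_div]
    have : (1 + p.1 * log (TT p)) / p.1 + -p.1⁻¹ = log (TT p) := by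
      field_simp; ring
    rw [this, Real.exp_log hv.1]

theorem contDiffAt_UU' {p : ℝ²} (h : 0 < p.1 ∨ p.2 < 0) : ContDiffAt ℝ ∞ UU p := by
  have hu : 0 < UU p := UU_pos_iff.2 h
  have hq : ContDiffAt ℝ ∞ (fun v : (ℝ²) × ℝ => expNegInvGlue v.1.1) (p, UU p) :=
    (expNegInvGlue.contDiff (n := ⊤)).contDiffAt.comp (p, UU p) contDiff_fst.fst.contDiffAt
  have hf : ContDiffAt ℝ ∞ (fun v : (ℝ²) × ℝ =>
      v.2 + v.1.2 - exp v.2⁻¹ * expNegInvGlue v.1.1) (p, UU p) :=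
    (contDiffAt_snd.add contDiff_fst.snd.contDiffAt).sub ((contDiffAt_snd.inv hu.ne').exp.mul hq)
  have hd : HasDerivAt (fun u : ℝ => u + p.2 - exp u⁻¹ * expNegInvGlue p.1)
      (1 - exp (UU p)⁻¹ * -(UU p ^ 2)⁻¹ * expNegInvGlue p.1) (UU p) :=
    ((hasDerivAt_id _).add_const p.2).sub (((hasDerivAt_inv hu.ne').exp).mul_const _)
  have hpos : 0 < 1 - exp (UU p)⁻¹ * -(UU p ^ 2)⁻¹ * expNegInvGlue p.1 := by
    have := expNegInvGlue.nonneg p.1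
    rw [mul_neg, neg_mul, sub_neg_eq_add]
    positivity
  obtain ⟨φ, hφ, hφp, -, hφe⟩ := exists_implicit_scalar (by simp) hf hd hpos.ne'
  refine hφ.congr_of_eventuallyEq ?_
  have hzero : ∀ q : ℝ², 0 < q.1 ∨ q.2 < 0 →
      UU q + q.2 - exp (UU q)⁻¹ * expNegInvGlue q.1 = 0 := fun q hq => by
    rw [← TT_eq_exp_mul hq, UU]; ring
  have hcont : Tendsto (fun q : ℝ² => (q, UU q)) (𝓝 p) (𝓝 (p, UU p)) :=
    (continuous_id.prodMk continuous_UU).continuousAt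
  filter_upwards [hcont.eventually hφe, isOpen_UU_pos.mem_nhds h] with q h1 h2
  exact (h1.1 (by rw [hzero q h2, hzero p h])).symm

theorem contDiffAt_TT' {p : ℝ²} (h : 0 < p.1 ∨ p.2 < 0) : ContDiffAt ℝ ∞ TT p := by
  simpa only [UU, sub_add_cancel] using (contDiffAt_UU' h).add contDiffAt_snd

theorem fderiv_UU' {p : ℝ²} (h : 0 < p.1 ∨ p.2 < 0) (e : ℝ²) :
    fderiv ℝ UU p e = (exp (UU p)⁻¹ * (p.1⁻¹ ^ 2 * expNegInvGlue p.1) * e.1 - e.2) *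
      (UU p ^ 2 * (TT p + UU p ^ 2)⁻¹) := by
  have hu : 0 < UU p := UU_pos_iff.2 h
  have hU := ((contDiffAt_UU' h).differentiableAt (by simp)).hasFDerivAt
  have hqd : HasDerivAt expNegInvGlue (p.1⁻¹ ^ 2 * expNegInvGlue p.1) p.1 := by
    simpa using expNegInvGlue.hasDerivAt_polynomial_eval_inv_mul 1 p.1
  have hall := ((hU.add hasFDerivAt_snd).sub (((hasDerivAt_inv hu.ne').comp_hasFDerivAt p hU).exp.mul
    (hqd.comp_hasFDerivAt p (hasFDerivAt_fst (𝕜 := ℝ)))))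
  have huniq := DFunLike.congr_fun ((hall.congr_of_eventuallyEq (f₁ := fun _ => (0 : ℝ)) (by
    filter_upwards [isOpen_UU_pos.mem_nhds h] with q hq
    have := TT_eq_exp_mul hq
    rw [UU] at this
    simp [UU, ← this])).unique (hasFDerivAt_const 0 p)) e
  simp at huniq
  have hT := TT_eq_exp_mul h
  have h5 : 0 < TT p + UU p ^ 2 := by
    have := TT_nonneg p; positivity
  rw [← mul_assoc, ← div_eq_mul_inv, eq_div_iff h5.ne']
  have h6 : fderiv ℝ UU p e * (UU p ^ 2) + e.2 * UU p ^ 2 + fderiv ℝ UU p e * TT p -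
      exp (UU p)⁻¹ * (p.1⁻¹ ^ 2 * expNegInvGlue p.1) * e.1 * UU p ^ 2 = 0 := by
    have h7 := congrArg (fun z => z * UU p ^ 2) huniq
    simp only [zero_mul] at h7
    rw [hT]
    rw [← h7]
    field_simp
    ring
  linarith

end Model

section Perturbation

open Polynomial

theorem mul_log_sq_le {T : ℝ} (h0 : 0 < T) (h1 : T ≤ 1) : T * log T ^ 2 ≤ 2 := by
  have h2 : 0 ≤ -log T := by linarith [Real.log_nonpos h0.le h1]
  have h3 := Real.quadratic_le_exp_of_nonneg h2
  rw [Real.exp_neg, Real.exp_log h0] at h3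
  have h4 : T * (1 + -log T + (-log T) ^ 2 / 2) ≤ 1 := by
    calc _ ≤ T * T⁻¹ := by gcongr
      _ = 1 := mul_inv_cancel₀ h0.ne'
  nlinarith [mul_nonneg h0.le h2]

theorem mul_log_sq_le_sqrt {T : ℝ} (h0 : 0 < T) (h1 : T ≤ 1) : T * log T ^ 2 ≤ 8 * √T := by
  have h2 : 0 < √T := Real.sqrt_pos.2 h0
  have h3 := mul_log_sq_le h2 (Real.sqrt_le_one.2 h1)
  rw [Real.log_sqrt h0.le] at h3
  nth_rw 1 [← Real.mul_self_sqrt h0.le]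
  nlinarith

theorem TT_eq_zero {p : ℝ²} (h : ¬(0 < p.1 ∨ 0 < p.2)) : TT p = 0 :=
  (not_lt.1 (mt TT_pos_iff.1 h)).antisymm (TT_nonneg p)

variable {E : Type*} [NormedAddCommGroup E] [NormedSpace ℝ E]

theorem clm_apply_eq (L : E × ℝ² →L[ℝ] ℝ) (a : E) (b c : ℝ) :
    L (a, b, c) = L (a, 0, 0) + b * L (0, 1, 0) + c * L (0, 0, 1) := by
  rw [show (a, b, c) = (a, 0, 0) + b • (0, 1, 0) + c • (0, 0, 1) by simp]
  simp only [map_add, map_smul, smul_eq_mul]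

/-- The map `(x, g, s) ↦ (x, T, u)`. -/
def modelMap (q : E × ℝ²) : E × ℝ² := (q.1, TT q.2, UU q.2)

theorem continuous_modelMap : Continuous (modelMap (E := E)) :=
  continuous_fst.prodMk ((continuous_TT.comp continuous_snd).prodMk
    (continuous_UU.comp continuous_snd))

theorem hasFDerivAt_modelMap {q : E × ℝ²} (h : DifferentiableAt ℝ TT q.2) :
    HasFDerivAt modelMap ((ContinuousLinearMap.fst ℝ E (ℝ²)).prod
      (((fderiv ℝ TT q.2).comp (.snd ℝ E (ℝ²))).prod
        (((fderiv ℝ TT q.2) - .snd ℝ ℝ ℝ).comp (.snd ℝ E (ℝ²))))) q := by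
  have hU : HasFDerivAt UU (fderiv ℝ TT q.2 - .snd ℝ ℝ ℝ) q.2 := h.hasFDerivAt.sub hasFDerivAt_snd
  exact hasFDerivAt_fst.prodMk
    ((h.hasFDerivAt.comp q hasFDerivAt_snd).prodMk (hU.comp q hasFDerivAt_snd))

/-- A smooth function of `(x, T, u)` which is small to first order at `T = 0`. -/
structure FlatPert (K : E × ℝ² → ℝ) (W : Set (E × ℝ²)) : Prop where
  isOpen : IsOpen W
  smooth : ContDiffOn ℝ ∞ K W
  zero : ∀ x u, (x, (0 : ℝ), u) ∈ W → K (x, 0, u) = 0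
  deriv : ∀ x, (x, (0 : ℝ), (0 : ℝ)) ∈ W → fderiv ℝ K (x, 0, 0) (0, 1, 0) = 0

namespace FlatPert

variable {K : E × ℝ² → ℝ} {W : Set (E × ℝ²)} (hK : FlatPert K W)
include hK

theorem differentiableAt {y : E × ℝ²} (hy : y ∈ W) : DifferentiableAt ℝ K y :=
  (hK.smooth.contDiffAt (hK.isOpen.mem_nhds hy)).differentiableAt (by simp)

theorem fderiv_apply_of_zero {x : E} {u : ℝ} (h : (x, (0 : ℝ), u) ∈ W) (e : E) (b : ℝ) :
    fderiv ℝ K (x, 0, u) (e, 0, b) = 0 := by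
  set γ := fun τ : ℝ => ((x, 0, u) : E × ℝ²) + τ • (e, 0, b) with hγ
  have h2 : HasDerivAt γ (e, 0, b) 0 := by
    have := ((hasDerivAt_id (0 : ℝ)).smul_const ((e, 0, b) : E × ℝ²)).const_add (x, 0, u)
    rwa [one_smul] at this
  have h3 := (hK.differentiableAt h).hasFDerivAt.comp_hasDerivAt_of_eq (0 : ℝ) h2 (by simp [hγ])
  refine (h3.congr_of_eventuallyEq (f₁ := fun _ => 0) ?_).unique (hasDerivAt_const 0 0)
  filter_upwards [h2.continuousAt.preimage_mem_nhds (hK.isOpen.mem_nhds (by simpa [hγ] using h))]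
    with τ hτ
  have : γ τ = (x + τ • e, 0, u + τ • b) := by simp [hγ]
  rw [mem_preimage, this] at hτ
  rw [comp_apply, this, hK.zero _ _ hτ]

theorem hasFDerivAt_comp {q : E × ℝ²} (hq : modelMap q ∈ W) (h : DifferentiableAt ℝ TT q.2) :
    HasFDerivAt (K ∘ modelMap) ((fderiv ℝ K (modelMap q)).comp
      ((ContinuousLinearMap.fst ℝ E (ℝ²)).prod (((fderiv ℝ TT q.2).comp (.snd ℝ E (ℝ²))).prod
        (((fderiv ℝ TT q.2) - .snd ℝ ℝ ℝ).comp (.snd ℝ E (ℝ²)))))) q :=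
  (hK.differentiableAt hq).hasFDerivAt.comp q (hasFDerivAt_modelMap h)

theorem norm_fderiv_comp_le {q : E × ℝ²} (hq : modelMap q ∈ W) (h : 0 < q.2.1 ∨ 0 < q.2.2)
    {B : ℝ} (hB : (1 + (1 - UU q.2 * log (TT q.2)) ^ 2) * (TT q.2 * (TT q.2 + UU q.2 ^ 2)⁻¹) ≤ B) :
    ‖fderiv ℝ (K ∘ modelMap) q‖ ≤ ‖(fderiv ℝ K (modelMap q)).comp (.inl ℝ E (ℝ²))‖ +
      |fderiv ℝ K (modelMap q) (0, 1, 0)| * B + |fderiv ℝ K (modelMap q) (0, 0, 1)| * (B + 1) := by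
  have hTT := (contDiffAt_TT h).differentiableAt (by simp)
  rw [(hK.hasFDerivAt_comp hq hTT).fderiv]
  have hα : 0 ≤ TT q.2 * (TT q.2 + UU q.2 ^ 2)⁻¹ := by
    have := TT_nonneg q.2
    positivity
  have hB0 : 0 ≤ B := le_trans (by positivity) hB
  refine ContinuousLinearMap.opNorm_le_bound _ (by positivity) fun e => ?_
  set L := fderiv ℝ K (modelMap q)
  have he1 : ‖e.1‖ ≤ ‖e‖ := norm_fst_le e
  have he2 : |e.2.1| ≤ ‖e‖ := (norm_fst_le e.2).trans (norm_snd_le e)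
  have he3 : |e.2.2| ≤ ‖e‖ := (norm_snd_le e.2).trans (norm_snd_le e)
  have hT' : |fderiv ℝ TT q.2 e.2| ≤ B * ‖e‖ := by
    rw [fderiv_TT h, abs_mul, abs_of_nonneg hα]
    generalize TT q.2 * (TT q.2 + UU q.2 ^ 2)⁻¹ = r at *
    generalize 1 - UU q.2 * log (TT q.2) = s at *
    have h1 : |e.2.2 + s ^ 2 * e.2.1| ≤ (1 + s ^ 2) * ‖e‖ := by
      refine (abs_add_le _ _).trans ?_
      rw [abs_mul, abs_of_nonneg (sq_nonneg s), add_mul, one_mul]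
      gcongr
    calc _ ≤ (1 + s ^ 2) * ‖e‖ * r := mul_comm r _ ▸ mul_le_mul_of_nonneg_right h1 hα
      _ = (1 + s ^ 2) * r * ‖e‖ := by ring
      _ ≤ B * ‖e‖ := by gcongr
  have h3 : |fderiv ℝ TT q.2 e.2 - e.2.2| ≤ (B + 1) * ‖e‖ := (abs_sub _ _).trans (by linarith)
  have h4 : |L (e.1, 0, 0)| ≤ ‖L.comp (.inl ℝ E (ℝ²))‖ * ‖e‖ :=
    (L.comp (.inl ℝ E (ℝ²))).le_opNorm_of_le he1
  change |L (e.1, fderiv ℝ TT q.2 e.2, fderiv ℝ TT q.2 e.2 - e.2.2)| ≤ _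
  rw [clm_apply_eq]
  calc _ ≤ ‖L.comp (.inl ℝ E (ℝ²))‖ * ‖e‖ + B * ‖e‖ * |L (0, 1, 0)| +
        (B + 1) * ‖e‖ * |L (0, 0, 1)| := by
        refine (abs_add_three _ _ _).trans ?_
        rw [abs_mul, abs_mul]
        gcongr
    _ = _ := by ring

theorem eventually_norm_fderiv_le {q0 : E × ℝ²} (hq0 : modelMap q0 ∈ W) (hT : TT q0.2 = 0)
    {ε : ℝ} (hε : 0 < ε) :
    ∀ᶠ q in 𝓝 q0, (0 < q.2.1 ∨ 0 < q.2.2) → ‖fderiv ℝ (K ∘ modelMap) q‖ ≤ ε := by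
  have hcm := (continuous_modelMap (E := E)).continuousAt (x := q0)
  have hW := hK.isOpen.mem_nhds hq0
  have hLc : ContinuousAt (fun q => fderiv ℝ K (modelMap q)) q0 := ContinuousAt.comp (f := modelMap)
    ((hK.smooth.continuousOn_fderiv_of_isOpen hK.isOpen (by simp)).continuousAt hW) hcm
  have hm0 : modelMap q0 = (q0.1, 0, UU q0.2) := by rw [modelMap, hT]
  have hcT := continuous_TT
  have hcU := continuous_UU
  have hz : ∀ e b, fderiv ℝ K (modelMap q0) (e, 0, b) = 0 := by
    rw [hm0] at hq0 ⊢
    exact hK.fderiv_apply_of_zero hq0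
  have h1 : (fderiv ℝ K (modelMap q0)).comp (.inl ℝ E (ℝ²)) = 0 := by ext e; exact hz e 0
  have hu0 : 0 ≤ UU q0.2 := by
    have : ¬ (0 < q0.2.1 ∨ 0 < q0.2.2) := fun h => (TT_pos_iff.2 h).ne' hT
    push Not at this
    rw [UU, hT]; linarith [this.2]
  have hL2 : ∀ v, ContinuousAt (fun q => |fderiv ℝ K (modelMap q) v|) q0 := fun v =>
    (hLc.clm_apply continuousAt_const).abs
  have key : ∀ B : E × ℝ² → ℝ, ContinuousAt B q0 →
      (fderiv ℝ K (modelMap q0) (0, 1, 0) = 0 ∨ B q0 = 0) →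
      (∀ q : E × ℝ², 0 < TT q.2 → TT q.2 < 1 →
        3 * (TT q.2 * (TT q.2 + UU q.2 ^ 2)⁻¹) + 2 * (TT q.2 * log (TT q.2) ^ 2) ≤ B q) →
      ∀ᶠ q in 𝓝 q0, (0 < q.2.1 ∨ 0 < q.2.2) → ‖fderiv ℝ (K ∘ modelMap) q‖ ≤ ε := by
    intro B hB h0 hle
    have hc : ContinuousAt (fun q => ‖(fderiv ℝ K (modelMap q)).comp (.inl ℝ E (ℝ²))‖ +
        |fderiv ℝ K (modelMap q) (0, 1, 0)| * B q + |fderiv ℝ K (modelMap q) (0, 0, 1)| * (B q + 1))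
        q0 := ((hLc.clm_comp continuousAt_const).norm.add ((hL2 _).mul hB)).add
      ((hL2 _).mul (hB.add continuousAt_const))
    filter_upwards [(hcT.comp continuous_snd).continuousAt.eventually
      (gt_mem_nhds
      (show TT q0.2 < 1 by simp [hT])),
      hcm.preimage_mem_nhds hW, hc.eventually (gt_mem_nhds
        (show _ < ε by rcases h0 with h | h <;> simpa [h1, hz, h] using hε))] with q hq1 hq2 hq3 hq
    refine (hK.norm_fderiv_comp_le hq2 hq (le_trans ?_ (hle q (TT_spec hq).1.1 hq1))).trans hq3.le
    have hTp := (TT_spec hq).1.1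
    generalize TT q.2 = T at *
    generalize UU q.2 = u
    have h5 : 0 < T + u ^ 2 := by positivity
    have h6 : u ^ 2 * (T + u ^ 2)⁻¹ ≤ 1 := by rw [← div_eq_mul_inv, div_le_one h5]; linarith
    calc (1 + (1 - u * log T) ^ 2) * (T * (T + u ^ 2)⁻¹)
        ≤ (3 + 2 * u ^ 2 * log T ^ 2) * (T * (T + u ^ 2)⁻¹) := by
          refine mul_le_mul_of_nonneg_right ?_ (by positivity)
          nlinarith [sq_nonneg (1 + u * log T)]
      _ = 3 * (T * (T + u ^ 2)⁻¹) + 2 * (T * log T ^ 2) * (u ^ 2 * (T + u ^ 2)⁻¹) := by ring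
      _ ≤ 3 * (T * (T + u ^ 2)⁻¹) + 2 * (T * log T ^ 2) * 1 := by gcongr
      _ = _ := by ring
  rcases hu0.eq_or_lt with hu0 | hu0
  · refine key (fun _ => 7) continuousAt_const (.inl ?_) fun q hTp hq1 => ?_
    · rw [hm0, ← hu0] at hq0 ⊢
      exact hK.deriv _ hq0
    have h6 : TT q.2 * (TT q.2 + UU q.2 ^ 2)⁻¹ ≤ 1 := by
      rw [← div_eq_mul_inv, div_le_one (by positivity)]; linarith [sq_nonneg (UU q.2)]
    linarith [mul_log_sq_le hTp hq1.le]
  · refine key (fun q => 3 * (TT q.2 * (TT q.2 + UU q.2 ^ 2)⁻¹) + 16 * √(TT q.2)) ?_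
      (.inr (by simp [hT])) fun q hTp hq1 => by linarith [mul_log_sq_le_sqrt hTp hq1.le]
    have : TT q0.2 + UU q0.2 ^ 2 ≠ 0 := by rw [hT]; positivity
    fun_prop (disch := assumption)

theorem contDiffAt_comp {q : E × ℝ²} (hq : modelMap q ∈ W) (h : 0 < q.2.1 ∨ 0 < q.2.2) :
    ContDiffAt ℝ ∞ (K ∘ modelMap) q := by
  have h1 : ContDiffAt ℝ ∞ (modelMap (E := E)) q :=
    contDiffAt_fst.prodMk (((contDiffAt_TT h).comp q contDiffAt_snd).prodMk
      ((contDiffAt_UU h).comp q contDiffAt_snd))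
  exact (hK.smooth.contDiffAt (hK.isOpen.mem_nhds hq)).comp q h1

theorem hasFDerivAt_zero {q0 : E × ℝ²} (hq0 : modelMap q0 ∈ W) (hT : TT q0.2 = 0) :
    HasFDerivAt (K ∘ modelMap) (0 : E × ℝ² →L[ℝ] ℝ) q0 := by
  have hW : ∀ᶠ q in 𝓝 q0, modelMap q ∈ W :=
    continuous_modelMap.continuousAt.preimage_mem_nhds (hK.isOpen.mem_nhds hq0)
  refine hasFDerivAt_zero_of_vanishing (P := {q : E × ℝ² | 0 < q.2.1 ∨ 0 < q.2.2})
    (fun h => (TT_pos_iff.2 h).ne' hT) ?_ ?_ (isOpen_TT_pos.preimage continuous_snd) ?_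
    fun ε hε => hK.eventually_norm_fderiv_le hq0 hT hε
  · filter_upwards [hW] with q hq hqP
    have hm : modelMap q = (q.1, 0, UU q.2) := by rw [modelMap, TT_eq_zero hqP]
    rw [hm] at hq
    rw [comp_apply, hm, hK.zero _ _ hq]
  · filter_upwards [hW] with q hq
    exact ((hK.smooth.continuousOn).continuousAt (hK.isOpen.mem_nhds hq)).comp
      continuous_modelMap.continuousAt
  · filter_upwards [hW] with q hq h
    exact (hK.contDiffAt_comp hq h).differentiableAt (by simp)

theorem contDiffOn_one : ContDiffOn ℝ 1 (K ∘ modelMap) (modelMap ⁻¹' W) := by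
  have ho : IsOpen (modelMap ⁻¹' W) := hK.isOpen.preimage continuous_modelMap
  have hd : ∀ q ∈ modelMap ⁻¹' W, DifferentiableAt ℝ (K ∘ modelMap) q := fun q hq => by
    by_cases h : 0 < q.2.1 ∨ 0 < q.2.2
    · exact (hK.contDiffAt_comp hq h).differentiableAt (by simp)
    · exact (hK.hasFDerivAt_zero hq (TT_eq_zero h)).differentiableAt
  rw [show (1 : WithTop ℕ∞) = 0 + 1 from rfl, contDiffOn_succ_iff_fderiv_of_isOpen ho]
  refine ⟨fun q hq => (hd q hq).differentiableWithinAt, by simp,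
    contDiffOn_zero.2 fun q hq => ContinuousAt.continuousWithinAt ?_⟩
  by_cases h : 0 < q.2.1 ∨ 0 < q.2.2
  · exact ((hK.contDiffAt_comp hq h).fderiv_right (m := 0) (by simp)).continuousAt
  · have hT := TT_eq_zero h
    rw [ContinuousAt, (hK.hasFDerivAt_zero hq hT).fderiv, Metric.tendsto_nhds]
    intro ε hε
    filter_upwards [ho.mem_nhds hq, hK.eventually_norm_fderiv_le hq hT (half_pos hε)] with q' h1 h2
    rw [dist_zero_right]
    by_cases h' : 0 < q'.2.1 ∨ 0 < q'.2.2
    · linarith [h2 h']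
    · simpa [(hK.hasFDerivAt_zero h1 (TT_eq_zero h')).fderiv] using hε

end FlatPert

end Perturbation

section Solved

open Polynomial

variable {E : Type*} [NormedAddCommGroup E] [NormedSpace ℝ E]

/-- A solution `s = σ (x, g, v)` of `s + K (x, T, u) = v`, where `T` and `u` are the model functions
of `(g, s)`. -/
structure SolvedPert (K : E × ℝ² → ℝ) (W : Set (E × ℝ²)) (σ : E × ℝ² → ℝ)
    (N : Set (E × ℝ²)) : Prop where
  isOpen_target : IsOpen W
  smooth : ContDiffOn ℝ ∞ K W
  isOpen : IsOpen N
  contDiff : ContDiffOn ℝ 1 σ N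
  mem : ∀ q ∈ N, modelMap (q.1, q.2.1, σ q) ∈ W
  eq : ∀ q ∈ N, σ q + K (modelMap (q.1, q.2.1, σ q)) = q.2.2
  deriv : ∀ q ∈ N, |fderiv ℝ (K ∘ modelMap) (q.1, q.2.1, σ q) (0, 0, 1)| ≤ 1 / 2

namespace SolvedPert

variable {K : E × ℝ² → ℝ} {W : Set (E × ℝ²)} {σ : E × ℝ² → ℝ} {N : Set (E × ℝ²)}
  (hS : SolvedPert K W σ N)

/-- The point `(g, σ)` at which the model functions are evaluated. -/
def pt (σ : E × ℝ² → ℝ) (q : E × ℝ²) : ℝ² := (q.2.1, σ q)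

/-- The point `(x, T, u)`. -/
def mm (σ : E × ℝ² → ℝ) (q : E × ℝ²) : E × ℝ² := modelMap (q.1, q.2.1, σ q)

/-- The function `T`, evaluated at `(g, σ)`. -/
def tt (σ : E × ℝ² → ℝ) (q : E × ℝ²) : ℝ := TT (pt σ q)

/-- The function `u`, evaluated at `(g, σ)`. -/
def uu (σ : E × ℝ² → ℝ) (q : E × ℝ²) : ℝ := UU (pt σ q)

/-- The derivative of `H` in the direction `v` at `(x, T, u)`. -/
def pd (σ H : E × ℝ² → ℝ) (v q : E × ℝ²) : ℝ := fderiv ℝ H (mm σ q) v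

/-- The inverse of `T + u ^ 2`. -/
def e0 (σ : E × ℝ² → ℝ) : E × ℝ² → ℝ := (tt σ + uu σ * uu σ)⁻¹

/-- The derivative of `T` with respect to `s`. -/
def al (σ : E × ℝ² → ℝ) : E × ℝ² → ℝ := tt σ * e0 σ

/-- The derivative of `s + K (x, T, u)` with respect to `s`. -/
def den (K σ : E × ℝ² → ℝ) : E × ℝ² → ℝ :=
  1 + pd σ K (0, 1, 0) * al σ + pd σ K (0, 0, 1) * (al σ + fun _ => -1)

include hS

theorem differentiableAt {q : E × ℝ²} (hq : q ∈ N) : DifferentiableAt ℝ σ q :=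
  (hS.contDiff.contDiffAt (hS.isOpen.mem_nhds hq)).differentiableAt (by simp)

theorem continuousOn_pt : ContinuousOn (pt σ) N :=
  (continuous_snd.fst.continuousOn).prodMk hS.contDiff.continuousOn

theorem continuousOn_tt : ContinuousOn (tt σ) N := continuous_TT.comp_continuousOn hS.continuousOn_pt

theorem continuousOn_uu : ContinuousOn (uu σ) N := continuous_UU.comp_continuousOn hS.continuousOn_pt

theorem hasFDerivAt_pt {q : E × ℝ²} (hq : q ∈ N) :
    HasFDerivAt (pt σ) (((ContinuousLinearMap.fst ℝ ℝ ℝ).comp (.snd ℝ E (ℝ²))).prod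
      (fderiv ℝ σ q)) q :=
  (((ContinuousLinearMap.fst ℝ ℝ ℝ).comp (.snd ℝ E (ℝ²))).hasFDerivAt).prodMk
    (hS.differentiableAt hq).hasFDerivAt

theorem fderiv_tt {q : E × ℝ²} (hq : q ∈ N) (hT : DifferentiableAt ℝ TT (pt σ q)) :
    DifferentiableAt ℝ (tt σ) q ∧ ∀ e,
      fderiv ℝ (tt σ) q e = fderiv ℝ TT (pt σ q) (e.2.1, fderiv ℝ σ q e) :=
  have h := hT.hasFDerivAt.comp q (hS.hasFDerivAt_pt hq)
  ⟨h.differentiableAt, fun e => congrArg (· e) h.fderiv⟩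

theorem fderiv_uu {q : E × ℝ²} (hq : q ∈ N) (hT : DifferentiableAt ℝ TT (pt σ q)) :
    DifferentiableAt ℝ (uu σ) q ∧ ∀ e,
      fderiv ℝ (uu σ) q e = fderiv ℝ TT (pt σ q) (e.2.1, fderiv ℝ σ q e) - fderiv ℝ σ q e :=
  have h := (hT.hasFDerivAt.sub hasFDerivAt_snd).comp q (hS.hasFDerivAt_pt hq)
  ⟨h.differentiableAt, fun e => congrArg (· e) h.fderiv⟩

theorem hasFDerivAt_mm {H : E × ℝ² → ℝ} (hH : ContDiffOn ℝ ∞ H W) {q : E × ℝ²} (hq : q ∈ N) :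
    HasFDerivAt H (fderiv ℝ H (mm σ q)) (mm σ q) :=
  ((hH.contDiffAt (hS.isOpen_target.mem_nhds (hS.mem q hq))).differentiableAt (by simp)).hasFDerivAt

theorem fderiv_comp_mm {H : E × ℝ² → ℝ} (hH : ContDiffOn ℝ ∞ H W) {q : E × ℝ²} (hq : q ∈ N)
    (hT : DifferentiableAt ℝ TT (pt σ q)) : DifferentiableAt ℝ (H ∘ mm σ) q ∧ ∀ e,
      fderiv ℝ (H ∘ mm σ) q e = pd σ H (e.1, 0, 0) q + pd σ H (0, 1, 0) q * fderiv ℝ (tt σ) q e +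
        pd σ H (0, 0, 1) q * fderiv ℝ (uu σ) q e := by
  have h1 : HasFDerivAt (mm σ) ((ContinuousLinearMap.fst ℝ E (ℝ²)).prod
      ((fderiv ℝ (tt σ) q).prod (fderiv ℝ (uu σ) q))) q := hasFDerivAt_fst.prodMk
    ((hS.fderiv_tt hq hT).1.hasFDerivAt.prodMk (hS.fderiv_uu hq hT).1.hasFDerivAt)
  have h := (hS.hasFDerivAt_mm hH hq).comp q h1
  refine ⟨h.differentiableAt, fun e => ?_⟩
  rw [h.fderiv]
  refine (clm_apply_eq (fderiv ℝ H (mm σ q)) e.1 (fderiv ℝ (tt σ) q e)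
    (fderiv ℝ (uu σ) q e)).trans ?_
  simp only [pd]
  ring

theorem half_le_den {q : E × ℝ²} (hq : q ∈ N) {b : ℝ} (hT : DifferentiableAt ℝ TT (pt σ q) ∧
    ∀ a s, fderiv ℝ TT (pt σ q) (a, s) = al σ q * s + b * a) : 1 / 2 ≤ den K σ q := by
  have h3 := (hS.hasFDerivAt_mm hS.smooth hq).comp (q.1, q.2.1, σ q)
    (hasFDerivAt_modelMap (q := ((q.1, q.2.1, σ q) : E × ℝ²)) hT.1)
  have h4 : fderiv ℝ (K ∘ modelMap) (q.1, q.2.1, σ q) (0, 0, 1) =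
      fderiv ℝ K (mm σ q) (0, al σ q, al σ q - 1) := by
    rw [show al σ q = fderiv ℝ TT (pt σ q) (0, 1) by rw [hT.2]; ring]
    exact congrArg (· (0, 0, 1)) h3.fderiv
  have h6 := hS.deriv q hq
  rw [h4, clm_apply_eq, show ((0, 0, 0) : E × ℝ²) = 0 from rfl, map_zero, abs_le] at h6
  simp only [den, pd, Pi.add_apply, Pi.mul_apply, Pi.one_apply]
  linarith [h6.1]

/-- The function `exp (-c / φ)`, extended by zero, is smooth for `φ = T` and for `φ = u` if the
derivative `β` of `T` with respect to `g` is expressed by functions of moderate growth. -/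
theorem contDiffOn_exp [FiniteDimensional ℝ E] {φ β : E × ℝ² → ℝ} {G : Set (E × ℝ² → ℝ)}
    {A : Subalgebra ℝ (E × ℝ² → ℝ)} {c : ℝ} (hc : 0 < c) (k : ℕ) (hφ : φ = tt σ ∨ φ = uu σ)
    (hk : ∀ q, 0 < φ q → φ q ^ k ≤ tt σ q + uu σ q * uu σ q)
    (hd : ∀ q, 0 < φ q → DifferentiableAt ℝ TT (pt σ q) ∧
      ∀ a s, fderiv ℝ TT (pt σ q) (a, s) = al σ q * s + β q * a)
    (hA : A = Algebra.adjoin ℝ ({a | ∃ H, ContDiffOn ℝ ∞ H W ∧ a = H ∘ mm σ} ∪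
      ({φ⁻¹, e0 σ, (den K σ)⁻¹} ∪ G)))
    (hβ : tt σ ∈ A → uu σ ∈ A → e0 σ ∈ A → β ∈ A)
    (hG : ∀ a ∈ G, φ⁻¹ ∈ A → G ⊆ A → DerivIn A {q | q ∈ N ∧ 0 < φ q} φ →
      DerivIn A {q | q ∈ N ∧ 0 < φ q} a ∧ Moderate φ N a) :
    ContDiffOn ℝ ∞ (fun q => if 0 < φ q then exp (-c / φ q) else 0) N := by
  subst hA
  set 𝒢 : Set (E × ℝ² → ℝ) := _ ∪ _
  set A := Algebra.adjoin ℝ 𝒢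
  set Ω : Set (E × ℝ²) := {q | q ∈ N ∧ 0 < φ q}
  have hsub : 𝒢 ⊆ A := Algebra.subset_adjoin
  have hH : ∀ H, ContDiffOn ℝ ∞ H W → H ∘ mm σ ∈ A := fun H h => hsub (.inl ⟨H, h, rfl⟩)
  have hi : φ⁻¹ ∈ A := hsub (.inr (.inl (by simp)))
  have hE : e0 σ ∈ A := hsub (.inr (.inl (by simp)))
  have hD : (den K σ)⁻¹ ∈ A := hsub (.inr (.inl (by simp)))
  have hTA : tt σ ∈ A := hH (fun y => y.2.1) contDiff_snd.fst.contDiffOn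
  have huA : uu σ ∈ A := hH (fun y => y.2.2) contDiff_snd.snd.contDiffOn
  have hα : al σ ∈ A := A.mul_mem hTA hE
  replace hβ := hβ hTA huA hE
  have hHW : ∀ {H : E × ℝ² → ℝ}, ContDiffOn ℝ ∞ H W → ∀ v, ContDiffOn ℝ ∞ (fun y => fderiv ℝ H y v) W :=
    fun h v => (h.fderiv_of_isOpen hS.isOpen_target (by simp)).clm_apply contDiffOn_const
  have hpd : ∀ {H : E × ℝ² → ℝ}, ContDiffOn ℝ ∞ H W → ∀ v, pd σ H v ∈ A := fun h v => hH _ (hHW h v)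
  have hK := hpd hS.smooth
  have hden : ∀ q ∈ Ω, 1 / 2 ≤ den K σ q := fun q hq => hS.half_le_den hq.1 (hd q hq.2)
  have hσ : ∀ e, ∃ b ∈ A, ∀ q ∈ Ω, fderiv ℝ σ q e = b q := by
    intro e
    refine ⟨((fun _ => e.2.2) - pd σ K (e.1, 0, 0) - (pd σ K (0, 1, 0) + pd σ K (0, 0, 1)) * β *
      fun _ => e.2.1) * (den K σ)⁻¹, A.mul_mem (A.sub_mem (A.sub_mem (A.algebraMap_mem e.2.2) (hK _))
        (A.mul_mem (A.mul_mem (A.add_mem (hK _) (hK _)) hβ) (A.algebraMap_mem e.2.1))) hD,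
      fun q hq => ?_⟩
    obtain ⟨hT, hd⟩ := hd q hq.2
    have h1 : den K σ q ≠ 0 := by linarith [hden q hq]
    have h2 := hS.fderiv_comp_mm hS.smooth hq.1 hT
    have h3 : (fun q => σ q + (K ∘ mm σ) q) =ᶠ[𝓝 q] fun q => q.2.2 :=
      eventually_of_mem (hS.isOpen.mem_nhds hq.1) hS.eq
    have h4 : fderiv ℝ (fun q => σ q + (K ∘ mm σ) q) q e = e.2.2 := by
      rw [h3.fderiv_eq]
      exact congrArg (· e) (((ContinuousLinearMap.snd ℝ ℝ ℝ).comp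
        (.snd ℝ E (ℝ²))).hasFDerivAt (x := q)).fderiv
    rw [fderiv_fun_add (hS.differentiableAt hq.1) h2.1, add_apply, h2.2, (hS.fderiv_tt hq.1 hT).2,
      (hS.fderiv_uu hq.1 hT).2, hd] at h4
    simp only [Pi.mul_apply, Pi.sub_apply, Pi.add_apply, Pi.inv_apply]
    rw [eq_mul_inv_iff_mul_eq₀ h1]
    simp only [den, Pi.add_apply, Pi.mul_apply, Pi.one_apply]
    linear_combination h4
  have hTd : DerivIn A Ω (tt σ) := by
    refine ⟨fun q hq => (hS.fderiv_tt hq.1 (hd q hq.2).1).1, fun e => ?_⟩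
    obtain ⟨b, hb, hbe⟩ := hσ e
    refine ⟨al σ * b + β * fun _ => e.2.1, A.add_mem (A.mul_mem hα hb)
      (A.mul_mem hβ (A.algebraMap_mem e.2.1)), fun q hq => ?_⟩
    rw [(hS.fderiv_tt hq.1 (hd q hq.2).1).2, (hd q hq.2).2, hbe q hq]
    rfl
  have hUd : DerivIn A Ω (uu σ) := by
    refine ⟨fun q hq => (hS.fderiv_uu hq.1 (hd q hq.2).1).1, fun e => ?_⟩
    obtain ⟨b, hb, hbe⟩ := hσ e
    obtain ⟨b', hb', hbe'⟩ := hTd.2 e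
    refine ⟨b' - b, A.sub_mem hb' hb, fun q hq => ?_⟩
    rw [(hS.fderiv_uu hq.1 (hd q hq.2).1).2, ← (hS.fderiv_tt hq.1 (hd q hq.2).1).2, hbe q hq,
      hbe' q hq]
    rfl
  have hHd : ∀ H, ContDiffOn ℝ ∞ H W → DerivIn A Ω (H ∘ mm σ) := fun H h => by
    refine ⟨fun q hq => (hS.fderiv_comp_mm h hq.1 (hd q hq.2).1).1, fun e => ?_⟩
    obtain ⟨b, hb, hbe⟩ := hTd.2 e
    obtain ⟨c, hc, hce⟩ := hUd.2 e
    refine ⟨pd σ H (e.1, 0, 0) + pd σ H (0, 1, 0) * b + pd σ H (0, 0, 1) * c, A.add_mem (A.add_mem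
      (hpd h _) (A.mul_mem (hpd h _) hb)) (A.mul_mem (hpd h _) hc), fun q hq => ?_⟩
    rw [(hS.fderiv_comp_mm h hq.1 (hd q hq.2).1).2, hbe q hq, hce q hq]
    rfl
  have hφd : DerivIn A Ω φ ∧ ContinuousOn φ N := by
    rcases hφ with rfl | rfl
    exacts [⟨hTd, hS.continuousOn_tt⟩, ⟨hUd, hS.continuousOn_uu⟩]
  have hEd : DerivIn A Ω (e0 σ) := (hTd.add (hUd.mul huA huA hUd)).inv hE fun q hq =>
    ((pow_pos hq.2 k).trans_le (hk q hq.2)).ne'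
  have hαd : DerivIn A Ω (al σ) := hTd.mul hTA hE hEd
  have hpdd := fun v => hHd _ (hHW hS.smooth v)
  refine contDiffOn_exp_neg_div hS.isOpen hφd.2 𝒢 ?_ ?_ hφd.1 hi hc
  · rintro a (⟨H, h, rfl⟩ | (rfl | rfl | rfl) | ha)
    · exact hHd H h
    · exact hφd.1.inv hi fun q hq => hq.2.ne'
    · exact hEd
    · exact (((DerivIn.const 1).add ((hpdd _).mul (hK _) hα hαd)).add ((hpdd _).mul (hK _) (A.add_mem
        hα (A.algebraMap_mem (-1))) (hαd.add (DerivIn.const (-1))))).inv hD fun q hq => by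
          linarith [hden q hq]
    · exact (hG a ha hi (fun _ h => hsub (.inr (.inr h))) hφd.1).1
  · rintro a (⟨H, h, rfl⟩ | (rfl | rfl | rfl) | ha)
    · refine Moderate.of_bounded fun q0 h0 _ => ⟨|H (mm σ q0)| + 1, by positivity, ?_⟩
      have hc : ContinuousAt (fun q => |H (mm σ q)|) q0 := ((h.continuousOn.comp
        (continuousOn_fst.prodMk (hS.continuousOn_tt.prodMk hS.continuousOn_uu))
        hS.mem).continuousAt (hS.isOpen.mem_nhds h0)).abs
      filter_upwards [hc.eventually_lt continuousAt_const (lt_add_one _)] with q hq _ using hq.le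
    · exact fun q0 h0 _ => ⟨1, zero_le_one, 1, .of_forall fun q hq => by
        rw [Pi.inv_apply, abs_of_pos (inv_pos.2 hq)]; simp⟩
    · exact fun q0 h0 _ => ⟨1, zero_le_one, k, .of_forall fun q hq => by
        have h1 := pow_pos hq k
        rw [one_mul, inv_pow, e0, Pi.inv_apply, abs_inv, abs_of_pos]
        exacts [inv_anti₀ h1 (hk q hq), h1.trans_le (hk q hq)]⟩
    · refine Moderate.of_bounded fun q0 h0 _ => ⟨2, zero_le_two, ?_⟩
      filter_upwards [hS.isOpen.mem_nhds h0] with q hq hq'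
      have := hden q ⟨hq, hq'⟩
      rw [Pi.inv_apply, abs_of_pos (inv_pos.2 (by linarith))]
      exact inv_le_of_inv_le₀ zero_lt_two (by linarith)
    · exact (hG a ha hi (fun _ h => hsub (.inr (.inr h))) hφd.1).2

theorem contDiffOn_exp_T [FiniteDimensional ℝ E] {c : ℝ} (hc : 0 < c) :
    ContDiffOn ℝ ∞ (fun q => if 0 < TT (pt σ q) then exp (-c / TT (pt σ q)) else 0) N := by
  let L : E × ℝ² → ℝ := fun q => log (tt σ q)
  refine hS.contDiffOn_exp (φ := tt σ) (β := (1 - uu σ * L) * (1 - uu σ * L) * al σ) (G := {L}) hc 1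
    (.inl rfl) (fun q _ => by linarith [mul_self_nonneg (uu σ q)]) (fun q hq => ?_) rfl
    (fun hT hu hE => ?_) ?_
  · have hp := TT_pos_iff.1 hq
    refine ⟨(contDiffAt_TT hp).differentiableAt (by simp), fun a s => ?_⟩
    rw [fderiv_TT hp]
    simp only [al, e0, tt, uu, L, Pi.mul_apply, Pi.inv_apply, Pi.add_apply, Pi.sub_apply,
      Pi.one_apply]
    ring
  · have h1 := sub_mem (one_mem _) (mul_mem hu (Algebra.subset_adjoin (.inr (.inr rfl))))
    exact mul_mem (mul_mem h1 h1) (mul_mem hT hE)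
  · rintro _ rfl hi - h1
    refine ⟨⟨fun q hq => (h1.1 q hq).log hq.2.ne', fun e => ?_⟩,
      fun q0 h0 hq0 => ⟨1, zero_le_one, 1, ?_⟩⟩
    · obtain ⟨b, hb, hbe⟩ := h1.2 e
      refine ⟨(tt σ)⁻¹ * b, mul_mem hi hb, fun q hq => ?_⟩
      rw [fderiv.log (h1.1 q hq) hq.2.ne']
      simp [hbe q hq]
    · filter_upwards [(hS.continuousOn_tt.continuousAt (hS.isOpen.mem_nhds h0)).eventually_lt
        continuousAt_const (hq0.trans_lt zero_lt_one)] with q hq1 hq2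
      rw [abs_of_nonpos (Real.log_nonpos hq2.le hq1.le), ← Real.log_inv, one_mul, pow_one]
      linarith [Real.log_le_sub_one_of_pos (inv_pos.2 hq2)]

omit hS in
theorem mul_abs_log_pow_le {T : ℝ} (h0 : 0 < T) (k : ℕ) :
    T * |log T| ^ k ≤ k.factorial + T ^ (k + 1) := by
  rcases le_or_gt T 1 with h1 | h1
  · have h2 : log T ≤ 0 := Real.log_nonpos h0.le h1
    have h3 := Real.pow_div_factorial_le_exp (-log T) (by linarith) k
    rw [Real.exp_neg, Real.exp_log h0, div_le_iff₀ (by positivity)] at h3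
    rw [abs_of_nonpos h2]
    calc _ ≤ T * (T⁻¹ * k.factorial) := by gcongr
      _ = k.factorial := by field_simp
      _ ≤ _ := le_add_of_nonneg_right (by positivity)
  · have h2 : 0 ≤ log T := Real.log_nonneg h1.le
    rw [abs_of_nonneg h2, pow_succ']
    have h3 : log T ≤ T := by linarith [Real.log_le_sub_one_of_pos h0]
    exact le_add_of_nonneg_of_le (by positivity) (by gcongr)

theorem contDiffOn_exp_U [FiniteDimensional ℝ E] {c : ℝ} (hc : 0 < c) :
    ContDiffOn ℝ ∞ (fun q => if 0 < UU (pt σ q) then exp (-c / UU (pt σ q)) else 0) N := by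
  let M : ℝ[X] → E × ℝ² → ℝ := fun p q =>
    exp (uu σ q)⁻¹ * (p.eval q.2.1⁻¹ * expNegInvGlue q.2.1)
  have hT0 : ∀ q, 0 ≤ tt σ q := fun q => TT_nonneg _
  refine hS.contDiffOn_exp (φ := uu σ) (β := M (X ^ 2) * (uu σ * uu σ * e0 σ)) (G := range M) hc 2
    (.inr rfl) (fun q _ => by linarith [hT0 q]) (fun q hq => ?_) rfl (fun _ hu hE => mul_mem
      (Algebra.subset_adjoin (.inr (.inr ⟨_, rfl⟩))) (mul_mem (mul_mem hu hu) hE)) ?_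
  · have hp := UU_pos_iff.1 hq
    have hT := (contDiffAt_TT' hp).differentiableAt (by simp)
    refine ⟨hT, fun a s => ?_⟩
    have h1 : fderiv ℝ UU (pt σ q) (a, s) = fderiv ℝ TT (pt σ q) (a, s) - s :=
      congrArg (· (a, s)) (hT.hasFDerivAt.sub hasFDerivAt_snd).fderiv
    rw [← eq_sub_iff_add_eq.1 h1, fderiv_UU' hp]
    have h2 := hT0 q
    have h3 : 0 < tt σ q + uu σ q * uu σ q := by have : 0 < uu σ q := hq; positivity
    simp only [al, e0, M, Pi.mul_apply, Pi.inv_apply, Pi.add_apply, eval_pow, eval_X]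
    change (exp (uu σ q)⁻¹ * (q.2.1⁻¹ ^ 2 * expNegInvGlue q.2.1) * a - s) *
      (uu σ q ^ 2 * (tt σ q + uu σ q ^ 2)⁻¹) + s = _
    rw [pow_two (uu σ q)]
    field_simp
    ring
  rintro _ ⟨p, rfl⟩ hi hM h2
  constructor
  · have hfd : ∀ q ∈ {q | q ∈ N ∧ 0 < uu σ q}, HasFDerivAt (M p) (exp (uu σ q)⁻¹ •
        ((X ^ 2 * (p - derivative (R := ℝ) p)).eval q.2.1⁻¹ * expNegInvGlue q.2.1) •
          ((ContinuousLinearMap.fst ℝ ℝ ℝ).comp (.snd ℝ E (ℝ²))) +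
        (p.eval q.2.1⁻¹ * expNegInvGlue q.2.1) • (exp (uu σ q)⁻¹ • (-(uu σ q ^ 2)⁻¹) •
          fderiv ℝ (uu σ) q)) q := fun q hq => by
      have h6 := (expNegInvGlue.hasDerivAt_polynomial_eval_inv_mul p q.2.1).comp_hasFDerivAt q
        ((ContinuousLinearMap.fst ℝ ℝ ℝ).comp (.snd ℝ E (ℝ²))).hasFDerivAt
      exact ((hasDerivAt_inv hq.2.ne').comp_hasFDerivAt q (h2.1 q hq).hasFDerivAt).exp.mul h6
    refine ⟨fun q hq => (hfd q hq).differentiableAt, fun e => ?_⟩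
    obtain ⟨b, hb, hbe⟩ := h2.2 e
    refine ⟨M (X ^ 2 * (p - derivative (R := ℝ) p)) * (fun _ => e.2.1) -
      M p * ((uu σ)⁻¹ * (uu σ)⁻¹ * b), sub_mem (mul_mem (hM ⟨_, rfl⟩) (Subalgebra.algebraMap_mem _ e.2.1))
        (mul_mem (hM ⟨_, rfl⟩) (mul_mem (mul_mem hi hi) hb)), fun q hq => ?_⟩
    rw [(hfd q hq).fderiv]
    simp only [add_apply, smul_apply, ContinuousLinearMap.comp_apply, ContinuousLinearMap.coe_fst',
      ContinuousLinearMap.coe_snd', smul_eq_mul, hbe q hq, Pi.sub_apply, Pi.mul_apply, Pi.inv_apply,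
      M]
    ring
  clear hi hM h2
  induction p using Polynomial.induction_on' with
  | add p₁ p₂ hp₁ hp₂ =>
    have : M (p₁ + p₂) = M p₁ + M p₂ := by
      ext q; simp only [M, eval_add, Pi.add_apply]; ring
    rw [this]
    exact hp₁.add hS.isOpen hS.continuousOn_uu hp₂
  | monomial k r =>
    intro q0 h0 hq0
    have hTq := hT0 q0
    set B := k.factorial + (tt σ q0 + 1) ^ (k + 1) with hB
    refine ⟨|r| * (2 ^ k * (tt σ q0 + 1 + B)), by positivity, k, ?_⟩
    filter_upwards [(hS.continuousOn_tt.continuousAt (hS.isOpen.mem_nhds h0)).eventually_lt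
      continuousAt_const (lt_add_one (tt σ q0)), (hS.continuousOn_uu.continuousAt
      (hS.isOpen.mem_nhds h0)).eventually_lt continuousAt_const
        (hq0.trans_lt zero_lt_one)] with q hq1 hq2 hq3
    rcases le_or_gt q.2.1 0 with hg | hg
    · simp only [M, expNegInvGlue.zero_of_nonpos hg, mul_zero, abs_zero]
      positivity
    have hpt : 0 < (pt σ q).1 := hg
    have hTp : 0 < tt σ q := TT_pos_iff.2 (.inl hpt)
    have hg' : q.2.1⁻¹ = (uu σ q)⁻¹ - log (tt σ q) := by
      simp only [uu, tt, UU_eq (.inl hpt), uOf, inv_div]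
      simp only [pt] at *
      field_simp
      ring
    have hTe : tt σ q = exp (uu σ q)⁻¹ * expNegInvGlue q.2.1 := TT_eq_exp_mul (.inl hpt)
    have hMe : M (monomial k r) q = r * (q.2.1⁻¹ ^ k * tt σ q) := by
      simp only [M, eval_monomial, hTe]; ring
    rw [hMe, abs_mul, mul_assoc]
    gcongr
    rw [abs_of_pos (by positivity)]
    generalize tt σ q = T at *
    have h6 : q.2.1⁻¹ ^ k ≤ 2 ^ k * ((uu σ q)⁻¹ ^ k + |log T| ^ k) := by
      have h8 : q.2.1⁻¹ ≤ 2 * max (uu σ q)⁻¹ |log T| := by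
        linarith [le_max_left (uu σ q)⁻¹ |log T|, le_max_right (uu σ q)⁻¹ |log T|,
          neg_abs_le (log T)]
      refine (pow_le_pow_left₀ (by positivity) h8 k).trans ?_
      rw [mul_pow]
      gcongr
      rcases max_choice (uu σ q)⁻¹ |log T| with h | h <;> rw [h]
      · linarith [show 0 ≤ |log T| ^ k by positivity]
      · linarith [show 0 ≤ (uu σ q)⁻¹ ^ k by positivity]
    have h10 : T * |log T| ^ k ≤ B := (mul_abs_log_pow_le hTp k).trans (by rw [hB]; gcongr)
    calc q.2.1⁻¹ ^ k * T ≤ 2 ^ k * ((uu σ q)⁻¹ ^ k + |log T| ^ k) * T := by gcongr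
      _ = 2 ^ k * (T * (uu σ q)⁻¹ ^ k + T * |log T| ^ k) := by ring
      _ ≤ 2 ^ k * ((tt σ q0 + 1) * (uu σ q)⁻¹ ^ k + B * (uu σ q)⁻¹ ^ k) :=
          mul_le_mul_of_nonneg_left (add_le_add (by gcongr) (h10.trans (le_mul_of_one_le_right
            (by positivity) (one_le_pow₀ ((one_le_inv₀ hq3).2 hq2.le))))) (by positivity)
      _ = _ := by ring

end SolvedPert

end Solved

theorem contDiff_exp_model {c : ℝ} (hc : 0 < c) :
    ContDiff ℝ ∞ (fun p : ℝ² => if 0 < TT p then exp (-c / TT p) else 0) ∧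
    ContDiff ℝ ∞ (fun p : ℝ² => if 0 < UU p then exp (-c / UU p) else 0) := by
  have hS : SolvedPert (E := ℝ) (fun _ => 0) univ (fun q => q.2.2) univ := by
    refine ⟨isOpen_univ, contDiffOn_const, isOpen_univ, contDiff_snd.snd.contDiffOn,
      fun _ _ => mem_univ _, fun q _ => add_zero _, fun q _ => ?_⟩
    have : ((fun _ : ℝ × ℝ² => (0 : ℝ)) ∘ modelMap) = fun _ => 0 := rfl
    rw [this]
    simp
  have h1 := contDiffOn_univ.1 (hS.contDiffOn_exp_T hc)
  have h2 := contDiffOn_univ.1 (hS.contDiffOn_exp_U hc)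
  have h3 : ContDiff ℝ ∞ fun p : ℝ² => ((0 : ℝ), p) := contDiff_const.prodMk contDiff_id
  exact ⟨h1.comp h3, h2.comp h3⟩

section RealFunctions

/-- `(-m log r)⁻¹`, extended by `0`. -/
def tOf (m r : ℝ) : ℝ := if r = 0 then 0 else (-(m * log r))⁻¹

theorem tOf_pos {m r : ℝ} (hm : 0 < m) (h0 : 0 < r) (h1 : r < 1) : 0 < tOf m r := by
  rw [tOf, if_neg h0.ne']
  have := Real.log_neg h0 h1
  exact inv_pos.2 (by nlinarith)

theorem tOf_nonneg {m r : ℝ} (hm : 0 < m) (h0 : 0 ≤ r) (h1 : r < 1) : 0 ≤ tOf m r := by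
  rcases h0.eq_or_lt with h | h
  · rw [← h, tOf, if_pos rfl]
  · exact (tOf_pos hm h h1).le

theorem tOf_lt_one {m r : ℝ} (hm : 1 ≤ m) (h0 : 0 ≤ r) (h1 : r < exp (-1)) : tOf m r < 1 := by
  rw [tOf]
  split_ifs with h
  · exact zero_lt_one
  · have := (Real.log_lt_iff_lt_exp (lt_of_le_of_ne h0 (Ne.symm h))).2 h1
    exact inv_lt_one_of_one_lt₀ (by nlinarith)

theorem expNegInvGlue_tOf {m r : ℝ} (hm : 0 < m) (h0 : 0 ≤ r) (h1 : r < 1) :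
    expNegInvGlue (m * tOf m r) = r := by
  rcases h0.eq_or_lt with h | h
  · simp [← h, tOf, expNegInvGlue]
  · have h2 := tOf_pos hm h h1
    have h3 := Real.log_neg h h1
    rw [expNegInvGlue, if_neg (not_le.2 (by positivity)), tOf, if_neg h.ne']
    have : -(m * (-(m * log r))⁻¹)⁻¹ = log r := by
      field_simp
    rw [this, Real.exp_log h]

theorem tOf_expNegInvGlue {m T : ℝ} (hm : 0 < m) (h0 : 0 ≤ T) :
    tOf m (expNegInvGlue (m * T)) = T := by
  rcases h0.eq_or_lt with h | h
  · simp [← h, tOf, expNegInvGlue]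
  · have h1 : 0 < m * T := by positivity
    rw [tOf, if_neg (expNegInvGlue.pos_of_pos h1).ne', expNegInvGlue, if_neg (not_le.2 h1),
      Real.log_exp]
    field_simp

theorem contDiffAt_tOf {m r : ℝ} (hm : 0 < m) (h0 : 0 < r) (h1 : r < 1) :
    ContDiffAt ℝ ∞ (tOf m) r := by
  have h2 := Real.log_neg h0 h1
  have h : ContDiffAt ℝ ∞ (fun r => (-(m * log r))⁻¹) r :=
    (contDiffAt_const.mul (contDiffAt_id.log h0.ne')).neg.inv (by
      have : m * log r < 0 := mul_neg_of_pos_of_neg hm h2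
      simp only [id]; linarith)
  refine h.congr_of_eventuallyEq ?_
  filter_upwards [eventually_ne_nhds h0.ne'] with s hs
  rw [tOf, if_neg hs]

theorem tendsto_log_abs_nhds_zero : Tendsto log (𝓝[≠] 0) atBot := Real.tendsto_log_nhdsNE_zero

theorem continuousAt_tOf {m r : ℝ} (hm : 0 < m) (h0 : 0 ≤ r) (h1 : r < 1) :
    ContinuousAt (tOf m) r := by
  rcases h0.eq_or_lt with h | h
  · rw [← h, continuousAt_iff_punctured_nhds]
    have h2 : Tendsto (fun r => (-(m * log r))⁻¹) (𝓝[≠] 0) (𝓝 0) :=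
      tendsto_inv_atTop_zero.comp (tendsto_neg_atBot_atTop.comp
        (tendsto_log_abs_nhds_zero.const_mul_atBot hm))
    have h3 : tOf m 0 = 0 := if_pos rfl
    rw [h3]
    refine h2.congr' ?_
    filter_upwards [self_mem_nhdsWithin] with s hs
    exact (if_neg hs).symm
  · exact (contDiffAt_tOf hm h h1).continuousAt

theorem eta_zero : eta 0 = 0 := if_pos rfl

theorem eta_of_pos {s : ℝ} (h : 0 < s) : eta s = (1 - log s)⁻¹ := if_neg h.ne'

theorem eta_pos {s : ℝ} (h0 : 0 < s) (h1 : s ≤ 1) : 0 < eta s := by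
  rw [eta_of_pos h0]
  exact inv_pos.2 (by linarith [Real.log_nonpos h0.le h1])

theorem eta_nonneg {s : ℝ} (h0 : 0 ≤ s) (h1 : s ≤ 1) : 0 ≤ eta s := by
  rcases h0.eq_or_lt with h | h
  · rw [← h, eta_zero]
  · exact (eta_pos h h1).le

theorem eta_le_one {s : ℝ} (h0 : 0 ≤ s) (h1 : s ≤ 1) : eta s ≤ 1 := by
  rcases h0.eq_or_lt with h | h
  · rw [← h, eta_zero]; exact zero_le_one
  · rw [eta_of_pos h]
    exact inv_le_one_of_one_le₀ (by linarith [Real.log_nonpos h0 h1])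

theorem eta_lt_one {s : ℝ} (h0 : 0 ≤ s) (h1 : s < 1) : eta s < 1 := by
  rcases h0.eq_or_lt with h | h
  · rw [← h, eta_zero]; exact zero_lt_one
  · rw [eta_of_pos h]
    exact inv_lt_one_of_one_lt₀ (by linarith [Real.log_neg h h1])

theorem contDiffAt_eta {s : ℝ} (h0 : 0 < s) (h1 : s ≤ 1) : ContDiffAt ℝ ∞ eta s := by
  have h : ContDiffAt ℝ ∞ (fun r => (1 - log r)⁻¹) s :=
    (contDiffAt_const.sub (contDiffAt_id.log h0.ne')).inv
      (by simp only [id]; linarith [Real.log_nonpos h0.le h1])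
  refine h.congr_of_eventuallyEq ?_
  filter_upwards [eventually_ne_nhds h0.ne'] with r hr
  rw [eta, if_neg hr]

theorem continuousAt_eta {s : ℝ} (h0 : 0 ≤ s) (h1 : s ≤ 1) : ContinuousAt eta s := by
  rcases h0.eq_or_lt with h | h
  · rw [← h, continuousAt_iff_punctured_nhds, eta_zero]
    have h2 : Tendsto (fun r => (1 - log r)⁻¹) (𝓝[≠] 0) (𝓝 0) := by
      refine tendsto_inv_atTop_zero.comp ?_
      have := tendsto_neg_atBot_atTop.comp tendsto_log_abs_nhds_zero
      simpa [sub_eq_add_neg] using tendsto_atTop_add_const_left _ (1 : ℝ) this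
    refine h2.congr' ?_
    filter_upwards [self_mem_nhdsWithin] with s hs
    exact (if_neg hs).symm
  · exact (contDiffAt_eta h h1).continuousAt

/-- The inverse of `η`, extended by `0`. -/
def omega (u : ℝ) : ℝ := exp 1 * expNegInvGlue u

theorem contDiff_omega : ContDiff ℝ ∞ omega := contDiff_const.mul expNegInvGlue.contDiff

theorem continuous_omega : Continuous omega := contDiff_omega.continuous

theorem omega_pos {u : ℝ} (h : 0 < u) : 0 < omega u :=
  mul_pos (Real.exp_pos _) (expNegInvGlue.pos_of_pos h)

theorem omega_nonneg (u : ℝ) : 0 ≤ omega u := mul_nonneg (Real.exp_pos _).le (expNegInvGlue.nonneg u)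

theorem omega_of_nonpos {u : ℝ} (h : u ≤ 0) : omega u = 0 := by
  rw [omega, expNegInvGlue.zero_of_nonpos h, mul_zero]

theorem omega_of_pos {u : ℝ} (h : 0 < u) : omega u = exp (1 - u⁻¹) := by
  rw [omega, expNegInvGlue, if_neg (not_le.2 h), ← Real.exp_add, sub_eq_add_neg]

theorem omega_eta {s : ℝ} (h0 : 0 ≤ s) (h1 : s ≤ 1) : omega (eta s) = s := by
  rcases h0.eq_or_lt with h | h
  · rw [← h, eta_zero, omega_of_nonpos le_rfl]
  · rw [omega_of_pos (eta_pos h h1), eta_of_pos h, inv_inv, sub_sub_cancel, Real.exp_log h]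

theorem eta_omega {u : ℝ} (h0 : 0 ≤ u) : eta (omega u) = u := by
  rcases h0.eq_or_lt with h | h
  · rw [← h, omega_of_nonpos le_rfl, eta_zero]
  · rw [eta_of_pos (omega_pos h), omega_of_pos h, Real.log_exp, sub_sub_cancel, inv_inv]

theorem eta_div {t T : ℝ} (ht : 0 < t) (ht1 : t ≤ 1) (hT : 0 < T) (h : t ≤ T) :
    ValidT (eta t) T ∧ eta (t / T) = uOf (eta t) T := by
  have h0 : 0 < 1 - log t := by linarith [Real.log_nonpos ht.le ht1]
  have h2 : log (t / T) = log t - log T := Real.log_div ht.ne' hT.ne'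
  have h3 : log t ≤ log T := Real.log_le_log ht h
  have h4 : 1 + eta t * log T = (1 - log t + log T) / (1 - log t) := by
    rw [eta_of_pos ht]; field_simp
  have h5 : 0 < 1 - log t + log T := by linarith
  refine ⟨⟨hT, by rw [h4]; positivity⟩, ?_⟩
  rw [uOf, h4, eta_of_pos (by positivity), h2, eta_of_pos ht,
    show 1 - (log t - log T) = 1 - log t + log T by ring]
  field_simp

theorem TT_eta {t T : ℝ} (ht : 0 < t) (ht1 : t ≤ 1) (hT : 0 < T) (h : t ≤ T) :
    TT (eta t, T - eta (t / T)) = T := by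
  obtain ⟨h1, h2⟩ := eta_div ht ht1 hT h
  exact TT_unique (Or.inl (eta_pos ht ht1)) h1 (by rw [h2])

theorem omega_UU {p : ℝ²} (h : 0 < p.1) : omega (UU p) = omega p.1 / TT p := by
  have hT := (TT_spec (Or.inl h)).1.1
  rw [eq_div_iff hT.ne', omega, omega, TT_eq_exp_mul (Or.inl h), expNegInvGlue,
    if_neg (not_le.2 (UU_pos_iff.2 (Or.inl h)))]
  have : exp (-(UU p)⁻¹) * exp (UU p)⁻¹ = 1 := by rw [← Real.exp_add]; simp
  linear_combination (exp 1 * expNegInvGlue p.1) * this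

/-- The radius with `T = (-m log r)⁻¹`. -/
def radius (m : ℝ) (p : ℝ²) : ℝ := expNegInvGlue (m * TT p)

theorem expNegInvGlue_mul_eq {m : ℝ} (hm : 0 < m) (x : ℝ) :
    expNegInvGlue (m * x) = if 0 < x then exp (-(1 / m) / x) else 0 := by
  split_ifs with h
  · rw [expNegInvGlue, if_neg (not_le.2 (mul_pos hm h))]
    congr 1; field_simp
  · exact expNegInvGlue.zero_of_nonpos (mul_nonpos_of_nonneg_of_nonpos hm.le (not_lt.1 h))

theorem contDiff_radius {m : ℝ} (hm : 0 < m) : ContDiff ℝ ∞ (radius m) := by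
  have : radius m = fun p => if 0 < TT p then exp (-(1 / m) / TT p) else 0 :=
    funext fun p => expNegInvGlue_mul_eq hm _
  rw [this]
  exact (contDiff_exp_model (one_div_pos.2 hm)).1

theorem contDiff_omega_UU : ContDiff ℝ ∞ fun p => omega (UU p) := by
  have h := (contDiff_exp_model one_pos).2
  have h2 : (fun p => omega (UU p)) = fun p => exp 1 * if 0 < UU p then exp (-1 / UU p) else 0 := by
    ext p
    rw [omega, ← one_mul (UU p), expNegInvGlue_mul_eq one_pos, one_div_one, one_mul]
  rw [h2]
  exact contDiff_const.mul h

theorem SolvedPert.contDiffOn_radius {E : Type*} [NormedAddCommGroup E] [NormedSpace ℝ E]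
    [FiniteDimensional ℝ E] {K : E × ℝ² → ℝ} {W : Set (E × ℝ²)} {σ : E × ℝ² → ℝ}
    {N : Set (E × ℝ²)} (hS : SolvedPert K W σ N) {m : ℝ} (hm : 0 < m) :
    ContDiffOn ℝ ∞ (fun q => radius m (q.2.1, σ q)) N := by
  simp only [radius, expNegInvGlue_mul_eq hm]
  exact hS.contDiffOn_exp_T (one_div_pos.2 hm)

theorem SolvedPert.contDiffOn_omega_UU {E : Type*} [NormedAddCommGroup E] [NormedSpace ℝ E]
    [FiniteDimensional ℝ E] {K : E × ℝ² → ℝ} {W : Set (E × ℝ²)} {σ : E × ℝ² → ℝ}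
    {N : Set (E × ℝ²)} (hS : SolvedPert K W σ N) :
    ContDiffOn ℝ ∞ (fun q => omega (UU (q.2.1, σ q))) N := by
  have h := hS.contDiffOn_exp_U one_pos
  have h2 : (fun q : E × ℝ² => omega (UU (q.2.1, σ q))) = fun q => exp 1 *
      if 0 < UU (SolvedPert.pt σ q) then exp (-1 / UU (SolvedPert.pt σ q)) else 0 := by
    ext q
    rw [omega, ← one_mul (UU (q.2.1, σ q)), expNegInvGlue_mul_eq one_pos, one_div_one]
    rfl
  rw [h2]
  exact contDiffOn_const.mul h

end RealFunctions

variable {n : ℕ} {X : Type*} [TopologicalSpace X] [ChartedSpace ℂ^n X]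

theorem mem_contDiffGroupoid_real {e : OpenPartialHomeomorph ℂ^n
    ℂ^n} (h : e ∈ contDiffGroupoid ω 𝓘(ℂ, ℂ^n)) : e ∈ contDiffGroupoid ∞ 𝓘^n := by
  rw [contDiffGroupoid, mem_groupoid_of_pregroupoid] at h ⊢
  simp only [contDiffPregroupoid, modelWithCornersSelf_coe, modelWithCornersSelf_coe_symm,
    CompTriple.comp_eq, preimage_id_eq, id_eq, range_id, inter_univ] at h ⊢
  exact ⟨(h.1.restrict_scalars ℝ).of_le le_top, (h.2.restrict_scalars ℝ).of_le le_top⟩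

variable [IsManifold 𝓘(ℂ, ℂ^n) ω X]

instance isManifold_real : IsManifold 𝓘^n ∞ X where
  compatible he he' := mem_contDiffGroupoid_real ((contDiffGroupoid ω 𝓘(ℂ, ℂ^n)).compatible he he')

theorem mem_maximalAtlas_real {e : OpenPartialHomeomorph X ℂ^n}
    (he : e ∈ IsManifold.maximalAtlas 𝓘(ℂ, ℂ^n) ω X) :
    e ∈ IsManifold.maximalAtlas 𝓘^n ∞ X := by
  rw [IsManifold.mem_maximalAtlas_iff] at he ⊢
  exact fun e' he' => ⟨mem_contDiffGroupoid_real (he e' he').1,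
    mem_contDiffGroupoid_real (he e' he').2⟩

theorem mdifferentiableAt_chart {e : OpenPartialHomeomorph X ℂ^n}
    (he : e ∈ IsManifold.maximalAtlas 𝓘(ℂ, ℂ^n) ω X) {x : X}
    (hx : x ∈ e.source) : MDifferentiableAt 𝓘(ℂ, ℂ^n) 𝓘(ℂ, ℂ^n) e x :=
  (contMDiffAt_of_mem_maximalAtlas he hx).mdifferentiableAt (by simp)

theorem mdifferentiableAt_chart_symm {e : OpenPartialHomeomorph X ℂ^n}
    (he : e ∈ IsManifold.maximalAtlas 𝓘(ℂ, ℂ^n) ω X) {ξ : ℂ^n} (hx : ξ ∈ e.target) :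
    MDifferentiableAt 𝓘(ℂ, ℂ^n) 𝓘(ℂ, ℂ^n) e.symm ξ :=
  (contMDiffAt_symm_of_mem_maximalAtlas he hx).mdifferentiableAt (by simp)

/-- A function on a complex manifold is holomorphic near a point. -/
def HolAt (n : ℕ) {X : Type*} [TopologicalSpace X]
    [ChartedSpace ℂ^n X] (F : X → ℂ) (x : X) : Prop :=
  ∀ᶠ y in 𝓝 x, MDifferentiableAt 𝓘(ℂ, ℂ^n) 𝓘(ℂ) F y

theorem HolAt.contMDiffAt {F : X → ℂ} {x : X} (hF : HolAt n F x) :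
    ContMDiffAt 𝓘^n 𝓘(ℝ, ℂ) ∞ F x := by
  set e := chartAt ℂ^n x
  have he : e ∈ IsManifold.maximalAtlas 𝓘(ℂ, ℂ^n) ω X := IsManifold.chart_mem_maximalAtlas x
  have hx : x ∈ e.source := mem_chart_source _ x
  obtain ⟨U, hU, hUo, hxU⟩ := eventually_nhds_iff.1 hF
  have hVo : IsOpen (e.target ∩ e.symm ⁻¹' U) := e.isOpen_inter_preimage_symm hUo
  have hd : DifferentiableOn ℂ (F ∘ e.symm) (e.target ∩ e.symm ⁻¹' U) := fun ξ hξ =>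
    (((hU _ hξ.2).comp ξ (mdifferentiableAt_chart_symm he hξ.1)).differentiableAt
      ).differentiableWithinAt
  have h1 : ContDiffAt ℝ ∞ (F ∘ e.symm) (e x) := ((contDiffOn_of_differentiableOn hVo hd).contDiffAt
      (hVo.mem_nhds ⟨e.map_source hx, by simpa [e.left_inv hx] using hxU⟩)).restrict_scalars ℝ
  have h2 : ContMDiffAt 𝓘^n 𝓘(ℝ, ℂ) ∞ ((F ∘ e.symm) ∘ e) x :=
    h1.contMDiffAt.comp x (contMDiffAt_of_mem_maximalAtlas (mem_maximalAtlas_real he) hx)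
  refine h2.congr_of_eventuallyEq ?_
  filter_upwards [e.open_source.mem_nhds hx] with y hy
  simp [e.left_inv hy]

theorem holAt_coord {e : OpenPartialHomeomorph X ℂ^n}
    (he : e ∈ IsManifold.maximalAtlas 𝓘(ℂ, ℂ^n) ω X) {x : X}
    (hx : x ∈ e.source) (k : Fin n) : HolAt n (fun y => e y k) x := by
  filter_upwards [e.open_source.mem_nhds hx] with y hy
  have h : MDifferentiableAt 𝓘(ℂ, ℂ^n) 𝓘(ℂ) (EuclideanSpace.proj (𝕜 := ℂ) k : ℂ^n →L[ℂ] ℂ) (e y) :=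
    (EuclideanSpace.proj (𝕜 := ℂ) k : ℂ^n →L[ℂ] ℂ).mdifferentiableAt
  exact h.comp y (mdifferentiableAt_chart he hy)

theorem Degeneration.holAt_f (D : Degeneration n X) (x : X) : HolAt n D.f x :=
  Eventually.of_forall fun y => D.holomorphic y

theorem Degeneration.contMDiff_f (D : Degeneration n X) :
    ContMDiff 𝓘^n 𝓘(ℝ, ℂ) ∞ D.f := fun x => (D.holAt_f x).contMDiffAt

theorem Degeneration.continuous_f (D : Degeneration n X) : Continuous D.f :=
  D.contMDiff_f.continuous

variable {D : Degeneration n X}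

namespace Degeneration

variable (D : Degeneration n X)

theorem f_eq_zero_iff {x : X} : D.f x = 0 ↔ ∃ j, x ∈ D.D j := by
  have : x ∈ ⋃ i, D.D i ↔ x ∈ {x | D.f x = 0} := by rw [D.iUnion_D]
  simpa using this.symm

theorem isOpen_f_ne : IsOpen {x | D.f x ≠ 0} := isOpen_ne_fun D.continuous_f continuous_const

theorem t_eq (x : X) : D.t x = tOf 1 ‖D.f x‖ := by
  simp [t, tOf]

theorem norm_f_lt_one (x : X) : ‖D.f x‖ < 1 := (D.norm_lt x).trans (by simp)

theorem continuous_t : Continuous D.t := by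
  rw [funext D.t_eq]
  exact continuous_iff_continuousAt.2 fun x => ContinuousAt.comp (g := tOf 1)
    (continuousAt_tOf one_pos (norm_nonneg _) (D.norm_f_lt_one x)) D.continuous_f.norm.continuousAt

theorem t_nonneg (x : X) : 0 ≤ D.t x := by
  rw [t_eq]; exact tOf_nonneg one_pos (norm_nonneg _) (D.norm_f_lt_one x)

theorem t_lt_one (x : X) : D.t x < 1 := by
  rw [t_eq]; exact tOf_lt_one le_rfl (norm_nonneg _) (D.norm_lt x)

theorem t_pos {x : X} (h : D.f x ≠ 0) : 0 < D.t x := by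
  rw [t_eq]; exact tOf_pos one_pos (norm_pos_iff.2 h) (D.norm_f_lt_one x)

theorem t_eq_zero {x : X} (h : D.f x = 0) : D.t x = 0 := if_pos h

theorem continuous_g : Continuous D.g := continuous_iff_continuousAt.2 fun x =>
  ContinuousAt.comp (g := eta) (continuousAt_eta (D.t_nonneg x) (D.t_lt_one x).le)
    D.continuous_t.continuousAt

theorem g_nonneg (x : X) : 0 ≤ D.g x := eta_nonneg (D.t_nonneg x) (D.t_lt_one x).le

theorem g_lt_one (x : X) : D.g x < 1 := eta_lt_one (D.t_nonneg x) (D.t_lt_one x)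

theorem g_pos {x : X} (h : D.f x ≠ 0) : 0 < D.g x := eta_pos (D.t_pos h) (D.t_lt_one x).le

theorem g_eq_zero {x : X} (h : D.f x = 0) : D.g x = 0 := by rw [g, D.t_eq_zero h, eta_zero]

theorem g_eq_zero_iff {x : X} : D.g x = 0 ↔ D.f x = 0 :=
  ⟨fun h => by_contra fun h' => (D.g_pos h').ne' h, D.g_eq_zero⟩

theorem omega_g (x : X) : omega (D.g x) = D.t x := omega_eta (D.t_nonneg x) (D.t_lt_one x).le

theorem norm_f_eq (x : X) : ‖D.f x‖ = expNegInvGlue (omega (D.g x)) := by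
  rw [omega_g, t_eq, ← one_mul (tOf 1 _), expNegInvGlue_tOf one_pos (norm_nonneg _)
    (D.norm_f_lt_one x)]

theorem contMDiffAt_norm {F : X → ℂ} {x : X}
    (hF : ContMDiffAt 𝓘^n 𝓘(ℝ, ℂ) ∞ F x) (h : F x ≠ 0) :
    ContMDiffAt 𝓘^n 𝓘(ℝ) ∞ (fun y => ‖F y‖) x := (contDiffAt_norm ℝ h).contMDiffAt.comp x hF

theorem contMDiffAt_t {x : X} (h : D.f x ≠ 0) : ContMDiffAt 𝓘^n 𝓘(ℝ) ∞ D.t x := by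
  rw [funext D.t_eq]
  exact (contDiffAt_tOf one_pos (norm_pos_iff.2 h) (D.norm_f_lt_one x)).contMDiffAt.comp x
    (contMDiffAt_norm (D.contMDiff_f x) h)

theorem contMDiffAt_g {x : X} (h : D.f x ≠ 0) : ContMDiffAt 𝓘^n 𝓘(ℝ) ∞ D.g x :=
  (contDiffAt_eta (D.t_pos h) (D.t_lt_one x).le).contMDiffAt.comp x (D.contMDiffAt_t h)

end Degeneration

namespace AdaptedChart

variable (c : AdaptedChart D)

theorem isOpen_dom : IsOpen c.dom := c.chart.open_source

theorem mem_S {j : Fin D.N} : j ∈ c.S ↔ (D.D j ∩ closure c.dom).Nonempty := by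
  simp [S, Degeneration.indexSet, dom]

variable {c} {x : X} {j : Fin D.N}

theorem mem_S_of_mem (hx : x ∈ c.dom) (h : x ∈ D.D j) : j ∈ c.S :=
  c.mem_S.2 ⟨x, h, subset_closure hx⟩

theorem z_eq_zero_iff (hx : x ∈ c.dom) (hj : j ∈ c.S) : c.z j x = 0 ↔ x ∈ D.D j :=
  (c.zero_locus j hj x hx).symm

theorem S_nonempty (hx : x ∈ c.dom) (h : D.f x = 0) : c.S.Nonempty := by
  obtain ⟨j, hj⟩ := D.f_eq_zero_iff.1 h
  exact ⟨j, mem_S_of_mem hx hj⟩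

theorem z_ne_zero (hx : x ∈ c.dom) (hj : j ∈ c.S) (h : D.f x ≠ 0) : c.z j x ≠ 0 := fun h0 =>
  h (D.f_eq_zero_iff.2 ⟨j, (z_eq_zero_iff hx hj).1 h0⟩)

theorem t_eq : c.t j x = tOf (D.m j) ‖c.z j x‖ := by
  simp [t, tOf]

theorem m_pos' (D : Degeneration n X) (j : Fin D.N) : (0 : ℝ) < D.m j := by
  exact_mod_cast D.m_pos j

theorem one_le_m (D : Degeneration n X) (j : Fin D.N) : (1 : ℝ) ≤ D.m j := by
  exact_mod_cast D.m_pos j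

theorem norm_z_lt_one (hx : x ∈ c.dom) (hj : j ∈ c.S) : ‖c.z j x‖ < 1 :=
  (c.norm_lt j hj x hx).trans (by simp)

theorem holAt_z (hx : x ∈ c.dom) (j : Fin D.N) : HolAt n (c.z j) x := holAt_coord c.chart_mem hx _

theorem contMDiffAt_chart (hx : x ∈ c.dom) : ContMDiffAt 𝓘^n 𝓘^n ∞ c.chart x :=
  contMDiffAt_of_mem_maximalAtlas (mem_maximalAtlas_real c.chart_mem) hx

theorem contMDiffAt_chart_symm {ξ : ℂ^n} (hξ : ξ ∈ c.chart.target) :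
    ContMDiffAt 𝓘^n 𝓘^n ∞ c.chart.symm ξ :=
  contMDiffAt_symm_of_mem_maximalAtlas (mem_maximalAtlas_real c.chart_mem) hξ

theorem contMDiffAt_z (hx : x ∈ c.dom) (j : Fin D.N) :
    ContMDiffAt 𝓘^n 𝓘(ℝ, ℂ) ∞ (c.z j) x := (holAt_z hx j).contMDiffAt

theorem continuousAt_t (hx : x ∈ c.dom) (hj : j ∈ c.S) : ContinuousAt (c.t j) x := by
  have : c.t j = fun y => tOf (D.m j) ‖c.z j y‖ := funext fun y => t_eq
  rw [this]
  exact ContinuousAt.comp (g := tOf (D.m j)) (continuousAt_tOf (m_pos' D j) (norm_nonneg _)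
    (norm_z_lt_one hx hj)) (contMDiffAt_z hx j).continuousAt.norm

theorem t_nonneg (hx : x ∈ c.dom) (hj : j ∈ c.S) : 0 ≤ c.t j x := by
  rw [t_eq]; exact tOf_nonneg (m_pos' D j) (norm_nonneg _) (norm_z_lt_one hx hj)

theorem t_lt_one (hx : x ∈ c.dom) (hj : j ∈ c.S) : c.t j x < 1 := by
  rw [t_eq]; exact tOf_lt_one (one_le_m D j) (norm_nonneg _) (c.norm_lt j hj x hx)

theorem t_pos (hx : x ∈ c.dom) (hj : j ∈ c.S) (h : x ∉ D.D j) : 0 < c.t j x := by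
  rw [t_eq]; exact tOf_pos (m_pos' D j) (norm_pos_iff.2 fun h0 => h ((z_eq_zero_iff hx hj).1 h0))
    (norm_z_lt_one hx hj)

theorem t_eq_zero (hx : x ∈ c.dom) (h : x ∈ D.D j) : c.t j x = 0 :=
  if_pos ((z_eq_zero_iff hx (mem_S_of_mem hx h)).2 h)

theorem notMem_D (h : D.f x ≠ 0) (j : Fin D.N) : x ∉ D.D j := fun h' =>
  h (D.f_eq_zero_iff.2 ⟨j, h'⟩)

theorem norm_z_eq (hx : x ∈ c.dom) (hj : j ∈ c.S) :
    ‖c.z j x‖ = expNegInvGlue (D.m j * c.t j x) := by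
  rw [t_eq, expNegInvGlue_tOf (m_pos' D j) (norm_nonneg _) (norm_z_lt_one hx hj)]

theorem contMDiffAt_t (hx : x ∈ c.dom) (hj : j ∈ c.S) (h : x ∉ D.D j) :
    ContMDiffAt 𝓘^n 𝓘(ℝ) ∞ (c.t j) x := by
  have : c.t j = fun y => tOf (D.m j) ‖c.z j y‖ := funext fun y => t_eq
  have hz : c.z j x ≠ 0 := fun h0 => h ((z_eq_zero_iff hx hj).1 h0)
  rw [this]
  exact (contDiffAt_tOf (m_pos' D j) (norm_pos_iff.2 hz) (norm_z_lt_one hx hj)).contMDiffAt.comp x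
    (Degeneration.contMDiffAt_norm (contMDiffAt_z hx j) hz)

theorem f_eq_prod (hx : x ∈ c.dom) (hS : c.S.Nonempty) :
    D.f x = ∏ i ∈ c.S, c.z i x ^ D.m i := c.f_eq hS x hx

theorem sum_inv_t (hx : x ∈ c.dom) (hS : c.S.Nonempty) (h : D.f x ≠ 0) :
    ∑ j ∈ c.S, (c.t j x)⁻¹ = (D.t x)⁻¹ := by
  have h1 : ∀ j ∈ c.S, (c.t j x)⁻¹ = -((D.m j : ℝ) * log ‖c.z j x‖) := fun j hj => by
    rw [t, if_neg (z_ne_zero hx hj h), inv_inv]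
  rw [sum_congr rfl h1, Degeneration.t, if_neg h, inv_inv, f_eq_prod hx hS, norm_prod,
    Real.log_prod (fun j hj => norm_ne_zero_iff.2 (pow_ne_zero _ (z_ne_zero hx hj h))),
    ← Finset.sum_neg_distrib]
  refine sum_congr rfl fun j hj => ?_
  rw [norm_pow, Real.log_pow]

theorem t_le_t (hx : x ∈ c.dom) (hj : j ∈ c.S) (h : D.f x ≠ 0) : D.t x ≤ c.t j x := by
  have h1 := t_pos hx hj (notMem_D h j)
  rw [← inv_le_inv₀ h1 (D.t_pos h), ← sum_inv_t hx ⟨j, hj⟩ h]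
  exact single_le_sum (f := fun j => (c.t j x)⁻¹) (fun i hi => inv_nonneg.2 (t_nonneg hx hi)) hj

theorem w_pos (hx : x ∈ c.dom) (hj : j ∈ c.S) (h : D.f x ≠ 0) : 0 < c.w j x :=
  div_pos (D.t_pos h) (t_pos hx hj (notMem_D h j))

theorem w_le_one (hx : x ∈ c.dom) (hj : j ∈ c.S) (h : D.f x ≠ 0) : c.w j x ≤ 1 :=
  (div_le_one (t_pos hx hj (notMem_D h j))).2 (t_le_t hx hj h)

theorem sum_w (hx : x ∈ c.dom) (hS : c.S.Nonempty) (h : D.f x ≠ 0) : ∑ j ∈ c.S, c.w j x = 1 := by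
  simp only [w, div_eq_mul_inv, ← Finset.mul_sum]
  rw [sum_inv_t hx hS h, mul_inv_cancel₀ (D.t_pos h).ne']

theorem omega_u (hx : x ∈ c.dom) (hj : j ∈ c.S) (h : D.f x ≠ 0) : omega (c.u j x) = c.w j x :=
  omega_eta (w_pos hx hj h).le (w_le_one hx hj h)

theorem u_pos (hx : x ∈ c.dom) (hj : j ∈ c.S) (h : D.f x ≠ 0) : 0 < c.u j x :=
  eta_pos (w_pos hx hj h) (w_le_one hx hj h)

theorem u_le_one (hx : x ∈ c.dom) (hj : j ∈ c.S) (h : D.f x ≠ 0) : c.u j x ≤ 1 :=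
  eta_le_one (w_pos hx hj h).le (w_le_one hx hj h)

theorem TT_v (hx : x ∈ c.dom) (hj : j ∈ c.S) (h : D.f x ≠ 0) : TT (D.g x, c.v j x) = c.t j x :=
  TT_eta (D.t_pos h) (D.t_lt_one x).le (t_pos hx hj (notMem_D h j)) (t_le_t hx hj h)

theorem u_eq_uOf (hx : x ∈ c.dom) (hj : j ∈ c.S) (h : D.f x ≠ 0) :
    ValidT (D.g x) (c.t j x) ∧ c.u j x = uOf (D.g x) (c.t j x) :=
  eta_div (D.t_pos h) (D.t_lt_one x).le (t_pos hx hj (notMem_D h j)) (t_le_t hx hj h)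

theorem contMDiffAt_u (hx : x ∈ c.dom) (hj : j ∈ c.S) (h : D.f x ≠ 0) :
    ContMDiffAt 𝓘^n 𝓘(ℝ) ∞ (c.u j) x := by
  have h1 : ContMDiffAt 𝓘^n 𝓘(ℝ) ∞ (c.w j) x :=
    (D.contMDiffAt_t h).div₀ (contMDiffAt_t hx hj (notMem_D h j)) (t_pos hx hj (notMem_D h j)).ne'
  exact (contDiffAt_eta (w_pos hx hj h) (w_le_one hx hj h)).contMDiffAt.comp x h1

theorem contMDiffAt_v (hx : x ∈ c.dom) (hj : j ∈ c.S) (h : D.f x ≠ 0) :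
    ContMDiffAt 𝓘^n 𝓘(ℝ) ∞ (c.v j) x :=
  (contMDiffAt_t hx hj (notMem_D h j)).sub (contMDiffAt_u hx hj h)

theorem neBot_nhdsWithin (hx : x ∈ c.dom) : (𝓝[{y | D.f y ≠ 0}] x).NeBot := by
  rw [← mem_closure_iff_nhdsWithin_neBot, mem_closure_iff_frequently]
  by_contra hcon
  rw [not_frequently] at hcon
  set ξ := c.chart x
  have hξ : ξ ∈ c.chart.target := c.chart.map_source hx
  have hS : c.S.Nonempty := S_nonempty hx (by simpa using hcon.self_of_nhds)
  set v : ℂ^n := WithLp.toLp 2 fun _ => (1 : ℂ) with hv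
  have hγ : Tendsto (fun τ : ℂ => ξ + τ • v) (𝓝[≠] 0) (𝓝 ξ) := by
    have : Continuous fun τ : ℂ => ξ + τ • v := by fun_prop
    exact (this.tendsto' 0 ξ (by simp)).mono_left nhdsWithin_le_nhds
  have h1 : ∀ᶠ τ in 𝓝[≠] (0 : ℂ), ξ + τ • v ∈ c.chart.target ∧
      D.f (c.chart.symm (ξ + τ • v)) = 0 := by
    refine hγ.eventually (p := fun η => η ∈ c.chart.target ∧ D.f (c.chart.symm η) = 0) ?_
    have h3 : Tendsto c.chart.symm (𝓝 ξ) (𝓝 x) := by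
      have := (c.chart.continuousAt_symm hξ).tendsto
      rwa [c.chart.left_inv hx] at this
    filter_upwards [c.chart.open_target.mem_nhds hξ, h3.eventually hcon] with η h4 h5
    exact ⟨h4, by simpa using h5⟩
  have h2 : ∀ᶠ τ in 𝓝[≠] (0 : ℂ), ∀ k, ξ k + τ ≠ 0 := by
    refine eventually_all.2 fun k => ?_
    by_cases hk : ξ k = 0
    · filter_upwards [self_mem_nhdsWithin] with τ hτ
      rwa [hk, zero_add]
    · have : ContinuousAt (fun τ : ℂ => ξ k + τ) 0 := by fun_prop
      exact (this.eventually_ne (by simpa using hk)).filter_mono nhdsWithin_le_nhds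
  obtain ⟨τ, ⟨h3, h4⟩, h5⟩ := (h1.and h2).exists
  have h6 := c.chart.map_target h3
  rw [c.f_eq hS _ h6, Finset.prod_eq_zero_iff] at h4
  obtain ⟨j, -, hj⟩ := h4
  rw [c.chart.right_inv h3] at hj
  refine h5 (c.idx j) ?_
  have := eq_zero_of_pow_eq_zero hj
  simpa [hv] using this

theorem exists_unit {c' : AdaptedChart D} (hx : x ∈ c.dom) (hx' : x ∈ c'.dom) (hj : x ∈ D.D j) :
    ∃ h : X → ℂ, HolAt n h x ∧ h x ≠ 0 ∧ ∀ᶠ y in 𝓝 x, c'.z j y = h y * c.z j y := by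
  have key : ∀ c c' : AdaptedChart D, x ∈ c.dom → x ∈ c'.dom →
      ∃ h : X → ℂ, HolAt n h x ∧ ∀ᶠ y in 𝓝 x, c'.z j y = h y * c.z j y := by
    intro c c' hx hx'
    have hjS := mem_S_of_mem hx hj
    have hjS' := mem_S_of_mem hx' hj
    set ξ := c.chart x
    have hξ : ξ ∈ c.chart.target := c.chart.map_source hx
    have hO : IsOpen (c.chart.target ∩ c.chart.symm ⁻¹' c'.dom) :=
      c.chart.isOpen_inter_preimage_symm c'.isOpen_dom
    obtain ⟨r, hr, hball⟩ := Metric.isOpen_iff.1 hO ξ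
      ⟨hξ, by simpa [ξ, c.chart.left_inv hx] using hx'⟩
    obtain ⟨h, hh, he⟩ := exists_eq_coord_mul (f := c'.z j ∘ c.chart.symm) (p := ξ) (r := r)
      (k := c.idx j) ((z_eq_zero_iff hx hjS).2 hj) (fun η hη => by
        have h1 := ((holAt_z (hball hη).2 j).self_of_nhds).comp η
          (mdifferentiableAt_chart_symm c.chart_mem (hball hη).1)
        exact h1.differentiableAt.differentiableWithinAt)
      (fun η hη h0 => by
        have h1 := c.chart.map_target (hball hη).1
        refine (z_eq_zero_iff (hball hη).2 hjS').2 ((z_eq_zero_iff h1 hjS).1 ?_)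
        rw [z, c.chart.right_inv (hball hη).1, h0])
    have hn : ∀ᶠ y in 𝓝 x, y ∈ c.dom ∧ c.chart y ∈ Metric.ball ξ r :=
      Filter.Eventually.and (c.isOpen_dom.mem_nhds hx)
        ((c.chart.continuousAt hx).preimage_mem_nhds (Metric.ball_mem_nhds _ hr))
    refine ⟨h ∘ c.chart, ?_, ?_⟩
    · filter_upwards [hn] with y hy
      exact ((hh.differentiableAt (Metric.isOpen_ball.mem_nhds hy.2)).mdifferentiableAt).comp y
        (mdifferentiableAt_chart c.chart_mem hy.1)
    · filter_upwards [hn] with y hy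
      have := he _ hy.2
      rw [comp_apply, c.chart.left_inv hy.1] at this
      rw [this, mul_comm]; rfl
  obtain ⟨h, hh, he⟩ := key c c' hx hx'
  obtain ⟨h', hh', he'⟩ := key c' c hx' hx
  refine ⟨h, hh, fun h0 => ?_, he⟩
  have h1 : ∀ᶠ y in 𝓝[{y | D.f y ≠ 0}] x, h' y * h y = 1 := by
    filter_upwards [nhdsWithin_le_nhds he, nhdsWithin_le_nhds he',
      nhdsWithin_le_nhds (c.isOpen_dom.mem_nhds hx), self_mem_nhdsWithin] with y h1 h2 h3 h4
    have h5 := z_ne_zero h3 (mem_S_of_mem hx hj) h4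
    rw [h1, ← mul_assoc] at h2
    exact mul_right_cancel₀ h5 (by rw [← h2, one_mul])
  have h2 : Tendsto (fun y => h' y * h y) (𝓝[{y | D.f y ≠ 0}] x) (𝓝 (h' x * h x)) :=
    (hh'.contMDiffAt.continuousAt.mul hh.contMDiffAt.continuousAt).tendsto.mono_left
      nhdsWithin_le_nhds
  have := neBot_nhdsWithin hx
  have h3 := tendsto_nhds_unique (h2.congr' h1) tendsto_const_nhds
  simp [h0] at h3

end AdaptedChart

/-- The direction `z / |z|` of a complex number. -/
def angle : ℂ →* ℂ where
  toFun z := z / ‖z‖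
  map_one' := by simp
  map_mul' z w := by simp [mul_div_mul_comm]

theorem angle_apply (z : ℂ) : angle z = z / ‖z‖ := rfl

theorem norm_angle {z : ℂ} (h : z ≠ 0) : ‖angle z‖ = 1 := by
  rw [angle_apply, norm_div, Complex.norm_real, norm_norm, div_self (norm_ne_zero_iff.2 h)]

theorem norm_mul_angle (z : ℂ) : ‖z‖ * angle z = z := by
  rcases eq_or_ne z 0 with rfl | h
  · simp
  · rw [angle_apply, mul_div_cancel₀]
    exact_mod_cast norm_ne_zero_iff.2 h

theorem angle_circle (θ : Circle) : angle θ = θ := by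
  rw [angle_apply, Circle.norm_coe, Complex.ofReal_one, div_one]

theorem angle_ofReal {r : ℝ} (h : 0 < r) : angle r = 1 := by
  rw [angle_apply, Complex.norm_real, Real.norm_of_nonneg h.le, div_self]
  exact_mod_cast h.ne'

theorem contDiffAt_angle {z : ℂ} (h : z ≠ 0) : ContDiffAt ℝ ∞ angle z := by
  have h1 : ContDiffAt ℝ ∞ (fun z : ℂ => (‖z‖ : ℂ)) z :=
    Complex.ofRealCLM.contDiff.contDiffAt.comp z (contDiffAt_norm ℝ h)
  exact contDiffAt_id.mul (h1.inv (by simpa using h))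

theorem exists_circle {z : ℂ} (h : ‖z‖ = 1) : ∃ ζ : Circle, (ζ : ℂ) = z :=
  ⟨⟨z, mem_sphere_zero_iff_norm.2 h⟩, rfl⟩

theorem circle_coe_prod {α : Type*} (J : Finset α) (F : α → Circle) :
    ((∏ j ∈ J, F j : Circle) : ℂ) = ∏ j ∈ J, (F j : ℂ) := map_prod Circle.coeHom F J

theorem tendsto_circle {α : Type*} {l : Filter α} {F : α → Circle} {θ : Circle} :
    Tendsto F l (𝓝 θ) ↔ Tendsto (fun a => (F a : ℂ)) l (𝓝 θ) := tendsto_subtype_rng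

theorem HolAt.continuousAt {F : X → ℂ} {x : X} (hF : HolAt n F x) : ContinuousAt F x :=
  hF.contMDiffAt.continuousAt

theorem mem_stalk {F : X → ℂ} {x : X} (hF : HolAt n F x) (h : ∀ᶠ y in 𝓝 x, D.f y ≠ 0 → F y ≠ 0) :
    (F : Germ (𝓝 x) ℂ) ∈ D.stalk x := ⟨F, rfl, hF.and h⟩

theorem mem_stalk_of_ne {F : X → ℂ} {x : X} (hF : HolAt n F x) (h : F x ≠ 0) :
    (F : Germ (𝓝 x) ℂ) ∈ D.stalk x := mem_stalk hF <| by
  filter_upwards [hF.continuousAt.eventually_ne h] with y hy _ using hy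

namespace AdaptedChart

variable {c : AdaptedChart D} {x : X}

theorem z_mem_stalk (hx : x ∈ c.dom) {j : Fin D.N} (hj : j ∈ c.S) :
    (c.z j : Germ (𝓝 x) ℂ) ∈ D.stalk x := mem_stalk (holAt_z hx j) <| by
  filter_upwards [c.isOpen_dom.mem_nhds hx] with y hy using z_ne_zero hy hj

open Classical in
theorem exists_factorization (hx : x ∈ c.dom) {F : X → ℂ} (hF : HolAt n F x)
    (hne : ∀ᶠ y in 𝓝 x, D.f y ≠ 0 → F y ≠ 0) :
    ∃ (a : Fin D.N → ℕ) (h : X → ℂ), HolAt n h x ∧ h x ≠ 0 ∧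
      F =ᶠ[𝓝 x] h * ∏ j ∈ c.S.filter (x ∈ D.D ·), c.z j ^ a j := by
  set I := c.S.filter (x ∈ D.D ·) with hI
  have hIS : ∀ j ∈ I, j ∈ c.S ∧ x ∈ D.D j := fun j hj => by simpa [hI] using hj
  set ξ := c.chart x
  have hξ : ξ ∈ c.chart.target := c.chart.map_source hx
  have hs : Tendsto c.chart.symm (𝓝 ξ) (𝓝 x) := by
    have := (c.chart.continuousAt_symm hξ).tendsto
    rwa [c.chart.left_inv hx] at this
  have hf : ∀ᶠ y in 𝓝 x, (∀ j ∈ I, c.z j y ≠ 0) → D.f y ≠ 0 := by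
    have h1 : ∀ᶠ y in 𝓝 x, ∀ j, x ∉ D.D j → y ∉ D.D j := eventually_all.2 fun j => by
      by_cases hj : x ∈ D.D j
      · exact Eventually.of_forall fun y h => absurd hj h
      · filter_upwards [(D.isClosed_D j).isOpen_compl.mem_nhds hj] with y hy _ using hy
    filter_upwards [h1, c.isOpen_dom.mem_nhds hx] with y hy1 hy2 hy3 hy4
    obtain ⟨j, hj⟩ := D.f_eq_zero_iff.1 hy4
    have hxj : x ∈ D.D j := by_contra fun h => hy1 j h hj
    have hjS := mem_S_of_mem hx hxj
    exact hy3 j (by simp [hI, hjS, hxj]) ((z_eq_zero_iff hy2 hjS).2 hj)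
  have hall : ∀ᶠ η in 𝓝 ξ, η ∈ c.chart.target ∧
      MDifferentiableAt 𝓘(ℂ, ℂ^n) 𝓘(ℂ) F (c.chart.symm η) ∧
      ((∀ j ∈ I, c.z j (c.chart.symm η) ≠ 0) → F (c.chart.symm η) ≠ 0) := by
    filter_upwards [c.chart.open_target.mem_nhds hξ, hs.eventually hF, hs.eventually hne,
      hs.eventually hf] with η h1 h2 h3 h4
    exact ⟨h1, h2, fun h => h3 (h4 h)⟩
  obtain ⟨r, hr, hball⟩ := Metric.eventually_nhds_iff_ball.1 hall
  obtain ⟨a, h, hh, h0, he⟩ := exists_unit_mul_monomial (f := F ∘ c.chart.symm) hr (I.image c.idx)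
    (fun k hk => by
      obtain ⟨j, hj, rfl⟩ := Finset.mem_image.1 hk
      exact (z_eq_zero_iff hx (hIS j hj).1).2 (hIS j hj).2)
    (fun η hη => ((hball η hη).2.1.comp η
      (mdifferentiableAt_chart_symm c.chart_mem (hball η hη).1)).differentiableAt
        |>.differentiableWithinAt)
    (fun η hη hk => (hball η hη).2.2 fun j hj => by
      rw [z, c.chart.right_inv (hball η hη).1]
      exact hk _ (Finset.mem_image_of_mem _ hj))
  have hn : ∀ᶠ y in 𝓝 x, y ∈ c.dom ∧ c.chart y ∈ Metric.ball ξ r :=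
    Filter.Eventually.and (c.isOpen_dom.mem_nhds hx)
      ((c.chart.continuousAt hx).preimage_mem_nhds (Metric.ball_mem_nhds _ hr))
  refine ⟨fun j => a (c.idx j), h ∘ c.chart, ?_, h0, ?_⟩
  · filter_upwards [hn] with y hy
    exact ((hh.differentiableAt (Metric.isOpen_ball.mem_nhds hy.2)).mdifferentiableAt).comp y
      (mdifferentiableAt_chart c.chart_mem hy.1)
  · filter_upwards [hn] with y hy
    have := he _ hy.2
    rw [comp_apply, c.chart.left_inv hy.1, Finset.prod_image
      (fun i hi j hj hij => c.idx_injOn (hIS i hi).1 (hIS j hj).1 hij)] at this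
    rw [this]
    simp [z]

end AdaptedChart

open AdaptedChart

namespace Degeneration.KatoNakayama

variable (p : D.KatoNakayama)

theorem arg_of_mem {F : X → ℂ} (hF : (F : Germ (𝓝 p.pt) ℂ) ∈ D.stalk p.pt) :
    p.arg F = p.hom (Algebra.GrothendieckGroup.of ⟨(F : Germ (𝓝 p.pt) ℂ), hF⟩) := dif_pos hF

theorem arg_congr {F G : X → ℂ} (h : F =ᶠ[𝓝 p.pt] G) : p.arg F = p.arg G := by
  have : (F : Germ (𝓝 p.pt) ℂ) = (G : Germ (𝓝 p.pt) ℂ) := Germ.coe_eq.2 h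
  by_cases hF : (F : Germ (𝓝 p.pt) ℂ) ∈ D.stalk p.pt
  · rw [p.arg_of_mem hF, p.arg_of_mem (this ▸ hF)]
    congr 3
  · rw [arg, arg, dif_neg hF, dif_neg (this ▸ hF)]

theorem arg_mul {F G : X → ℂ} (hF : (F : Germ (𝓝 p.pt) ℂ) ∈ D.stalk p.pt)
    (hG : (G : Germ (𝓝 p.pt) ℂ) ∈ D.stalk p.pt) : p.arg (F * G) = p.arg F * p.arg G := by
  have h : ((F * G : X → ℂ) : Germ (𝓝 p.pt) ℂ) ∈ D.stalk p.pt := (D.stalk p.pt).mul_mem hF hG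
  rw [p.arg_of_mem hF, p.arg_of_mem hG, p.arg_of_mem h, ← map_mul, ← map_mul]
  rfl

theorem arg_unit {F : X → ℂ} (hF : HolAt n F p.pt) (h : F p.pt ≠ 0) :
    (p.arg F : ℂ) = angle (F p.pt) := by
  rw [p.arg_of_mem (mem_stalk_of_ne hF h)]
  exact p.hom_unit ⟨(F : Germ (𝓝 p.pt) ℂ), mem_stalk_of_ne hF h⟩ h

theorem arg_one : p.arg 1 = 1 := by
  have h : HolAt n (1 : X → ℂ) p.pt := Eventually.of_forall fun y => mdifferentiableAt_const
  ext
  rw [p.arg_unit h (by simp)]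
  simp

theorem pow_mem_stalk {x : X} {F : X → ℂ} (hF : (F : Germ (𝓝 x) ℂ) ∈ D.stalk x) (k : ℕ) :
    ((F ^ k : X → ℂ) : Germ (𝓝 x) ℂ) ∈ D.stalk x := (D.stalk x).pow_mem hF k

theorem arg_pow {F : X → ℂ} (hF : (F : Germ (𝓝 p.pt) ℂ) ∈ D.stalk p.pt) (k : ℕ) :
    p.arg (F ^ k) = p.arg F ^ k := by
  induction k with
  | zero => rw [pow_zero, pow_zero, arg_one]
  | succ k ih => rw [pow_succ, p.arg_mul (pow_mem_stalk hF k) hF, ih, pow_succ]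

theorem prod_mem_stalk {x : X} {J : Finset (Fin D.N)} {F : Fin D.N → X → ℂ}
    (hF : ∀ j ∈ J, (F j : Germ (𝓝 x) ℂ) ∈ D.stalk x) :
    ((∏ j ∈ J, F j : X → ℂ) : Germ (𝓝 x) ℂ) ∈ D.stalk x := by
  classical
  induction J using Finset.induction_on with
  | empty => exact (D.stalk x).one_mem
  | insert j J hj ih =>
    rw [Finset.prod_insert hj]
    exact (D.stalk x).mul_mem (hF j (by simp)) (ih fun i hi => hF i (by simp [hi]))

theorem arg_prod {J : Finset (Fin D.N)} {F : Fin D.N → X → ℂ}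
    (hF : ∀ j ∈ J, (F j : Germ (𝓝 p.pt) ℂ) ∈ D.stalk p.pt) :
    p.arg (∏ j ∈ J, F j) = ∏ j ∈ J, p.arg (F j) := by
  classical
  induction J using Finset.induction_on with
  | empty => simp [arg_one]
  | insert j J hj ih =>
    rw [Finset.prod_insert hj, Finset.prod_insert hj, p.arg_mul (hF j (by simp))
      (prod_mem_stalk fun i hi => hF i (by simp [hi])), ih fun i hi => hF i (by simp [hi])]

variable {p} {c : AdaptedChart D}

theorem z_eq_norm_mul_arg (hx : p.pt ∈ c.dom) (j : Fin D.N) :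
    c.z j p.pt = ‖c.z j p.pt‖ * (p.arg (c.z j) : ℂ) := by
  by_cases h : c.z j p.pt = 0
  · rw [h]; simp
  · rw [p.arg_unit (holAt_z hx j) h, norm_mul_angle]

theorem arg_f (hx : p.pt ∈ c.dom) (hS : c.S.Nonempty) :
    p.arg D.f = ∏ j ∈ c.S, p.arg (c.z j) ^ D.m j := by
  have h : D.f =ᶠ[𝓝 p.pt] ∏ j ∈ c.S, c.z j ^ D.m j := by
    filter_upwards [c.isOpen_dom.mem_nhds hx] with y hy
    rw [f_eq_prod hy hS]; simp
  rw [p.arg_congr h, arg_prod p fun j hj => pow_mem_stalk (z_mem_stalk hx hj) _]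
  exact prod_congr rfl fun j hj => arg_pow p (z_mem_stalk hx hj) _

theorem ext_of_arg {p q : D.KatoNakayama} (hpq : p.pt = q.pt) (hx : p.pt ∈ c.dom)
    (h : ∀ j ∈ c.S, p.arg (c.z j) = q.arg (c.z j)) : p = q := by
  obtain ⟨x, hom, hu⟩ := p
  obtain ⟨y, hom', hu'⟩ := q
  obtain rfl : x = y := hpq
  set p : D.KatoNakayama := ⟨x, hom, hu⟩
  set q : D.KatoNakayama := ⟨x, hom', hu'⟩
  suffices hom = hom' by subst this; rfl
  refine Algebra.GrothendieckGroup.lift.symm.injective (MonoidHom.ext fun φ => ?_)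
  obtain ⟨φ, F, rfl, hF⟩ := φ
  classical
  obtain ⟨a, u, hu1, hu2, he⟩ := exists_factorization (c := c) hx
    (F := F) (hF.mono fun y hy => hy.1) (hF.mono fun y hy => hy.2)
  have key : ∀ r : D.KatoNakayama, r.pt = x → r.arg F = r.arg u *
      ∏ j ∈ c.S.filter (x ∈ D.D ·), r.arg (c.z j) ^ a j := by
    rintro r rfl
    have hm : ∀ j ∈ c.S.filter (r.pt ∈ D.D ·), (c.z j : Germ (𝓝 r.pt) ℂ) ∈ D.stalk r.pt :=
      fun j hj => z_mem_stalk hx (Finset.mem_filter.1 hj).1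
    rw [r.arg_congr he, r.arg_mul (mem_stalk_of_ne hu1 hu2)
      (prod_mem_stalk fun j hj => pow_mem_stalk (hm j hj) _),
      r.arg_prod fun j hj => pow_mem_stalk (hm j hj) _]
    congr 1
    exact prod_congr rfl fun j hj => r.arg_pow (hm j hj) _
  have h1 : p.arg F = q.arg F := by
    rw [key p rfl, key q rfl]
    congr 1
    · ext; rw [p.arg_unit hu1 hu2, q.arg_unit hu1 hu2]
    · exact prod_congr rfl fun j hj => by rw [h j (Finset.mem_filter.1 hj).1]
  have hFm : (F : Germ (𝓝 x) ℂ) ∈ D.stalk x := ⟨F, rfl, hF⟩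
  rw [p.arg_of_mem hFm, q.arg_of_mem hFm] at h1
  exact h1

theorem exists_arg_eq {x : X} (hx : x ∈ c.dom) (θ : Fin D.N → Circle) :
    ∃ p : D.KatoNakayama, p.pt = x ∧ ∀ j, x ∈ D.D j → p.arg (c.z j) = θ j := by
  classical
  set ξ := c.chart x
  have hξ : ξ ∈ c.chart.target := c.chart.map_source hx
  set I := c.S.filter (x ∈ D.D ·) with hI
  have hIS : ∀ j ∈ I, j ∈ c.S ∧ x ∈ D.D j := fun j hj => by simpa [hI] using hj
  set d : ℂ^n := ∑ j ∈ I, EuclideanSpace.single (c.idx j) (θ j : ℂ) with hd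
  have hdj : ∀ j ∈ I, d (c.idx j) = θ j := by
    intro j hj
    rw [hd, WithLp.ofLp_sum, Finset.sum_apply, Finset.sum_eq_single j]
    · simp
    · intro i hi hij
      have : c.idx j ≠ c.idx i := fun h => hij (c.idx_injOn (hIS j hj).1 (hIS i hi).1 h).symm
      simp [this]
    · exact fun h => absurd hj h
  set γ : ℝ → X := fun τ => c.chart.symm (ξ + (τ : ℂ) • d) with hγ
  have hγ0 : Tendsto (fun τ : ℝ => ξ + (τ : ℂ) • d) (𝓝[>] 0) (𝓝 ξ) := by
    have : Continuous fun τ : ℝ => ξ + (τ : ℂ) • d := by fun_prop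
    exact (this.tendsto' 0 ξ (by simp)).mono_left nhdsWithin_le_nhds
  have hγx : Tendsto γ (𝓝[>] 0) (𝓝 x) := by
    have := (c.chart.continuousAt_symm hξ).tendsto
    rw [c.chart.left_inv hx] at this
    exact this.comp hγ0
  have hz : ∀ᶠ τ : ℝ in 𝓝[>] 0, ∀ j ∈ I, c.z j (γ τ) = τ * θ j := by
    filter_upwards [hγ0.eventually (c.chart.open_target.mem_nhds hξ)] with τ hτ j hj
    have h0 : ξ (c.idx j) = 0 := (z_eq_zero_iff hx (hIS j hj).1).2 (hIS j hj).2
    rw [AdaptedChart.z, hγ, c.chart.right_inv hτ]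
    simp [h0, hdj j hj]
  have hlim : ∀ (F u : X → ℂ) (a : Fin D.N → ℕ), HolAt n u x → u x ≠ 0 →
      F =ᶠ[𝓝 x] u * ∏ j ∈ I, c.z j ^ a j → Tendsto (fun τ => angle (F (γ τ))) (𝓝[>] 0)
        (𝓝 (angle (u x) * ∏ j ∈ I, (θ j : ℂ) ^ a j)) := by
    intro F u a hu hu0 he
    have h1 : Tendsto (fun τ => angle (u (γ τ)) * ∏ j ∈ I, (θ j : ℂ) ^ a j) (𝓝[>] 0)
        (𝓝 (angle (u x) * ∏ j ∈ I, (θ j : ℂ) ^ a j)) :=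
      (((contDiffAt_angle hu0).continuousAt.tendsto.comp
        (hu.continuousAt.tendsto.comp hγx))).mul_const _
    refine h1.congr' ?_
    filter_upwards [hγx.eventually he, hz, self_mem_nhdsWithin] with τ h2 h3 h4
    rw [h2, Pi.mul_apply, map_mul, Finset.prod_apply, map_prod]
    congr 1
    refine prod_congr rfl fun j hj => ?_
    rw [Pi.pow_apply, map_pow, h3 j hj, map_mul, angle_ofReal h4, one_mul, angle_circle]
  have hex : ∀ φ : D.stalk x, ∃ ζ : Circle, ∀ F : X → ℂ, (φ : Germ (𝓝 x) ℂ) = F →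
      Tendsto (fun τ => angle (F (γ τ))) (𝓝[>] 0) (𝓝 (ζ : ℂ)) := by
    rintro ⟨φ, F₀, rfl, hF⟩
    obtain ⟨a, u, hu1, hu2, he⟩ := exists_factorization (c := c) hx
      (F := F₀) (hF.mono fun y hy => hy.1) (hF.mono fun y hy => hy.2)
    obtain ⟨ζ₀, hζ₀⟩ := exists_circle (norm_angle hu2)
    refine ⟨ζ₀ * ∏ j ∈ I, θ j ^ a j, fun F hFe => ?_⟩
    have := hlim F u a hu1 hu2 ((Germ.coe_eq.1 hFe).symm.trans he)
    rw [Circle.coe_mul, hζ₀, circle_coe_prod]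
    simpa using this
  choose H hH using hex
  have huniq : ∀ (φ : D.stalk x) (F : X → ℂ) (ζ : ℂ), (φ : Germ (𝓝 x) ℂ) = F →
      Tendsto (fun τ => angle (F (γ τ))) (𝓝[>] 0) (𝓝 ζ) → (H φ : ℂ) = ζ := fun φ F ζ h1 h2 =>
    tendsto_nhds_unique (hH φ F h1) h2
  let hom₀ : D.stalk x →* Circle :=
    { toFun := H
      map_one' := by
        ext
        refine huniq 1 (fun _ => 1) _ rfl ?_
        simp
      map_mul' := by
        rintro ⟨φ, F, rfl, hF⟩ ⟨ψ, G, rfl, hG⟩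
        ext
        refine huniq _ (F * G) _ rfl ?_
        rw [Circle.coe_mul]
        refine ((hH ⟨_, F, rfl, hF⟩ F rfl).mul (hH ⟨_, G, rfl, hG⟩ G rfl)).congr fun τ => ?_
        rw [Pi.mul_apply, map_mul] }
  refine ⟨⟨x, Algebra.GrothendieckGroup.lift hom₀, ?_⟩, rfl, ?_⟩
  · rintro ⟨φ, F, rfl, hF⟩ hφ
    have h1 : Algebra.GrothendieckGroup.lift hom₀ (Algebra.GrothendieckGroup.of
        (⟨_, F, rfl, hF⟩ : D.stalk x)) = hom₀ ⟨_, F, rfl, hF⟩ :=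
      DFunLike.congr_fun (Algebra.GrothendieckGroup.lift.symm_apply_apply hom₀) _
    rw [h1]
    have hF' : HolAt n F x := hF.mono fun y hy => hy.1
    exact huniq _ F (angle (F x)) rfl ((contDiffAt_angle hφ).continuousAt.tendsto.comp
      (hF'.continuousAt.tendsto.comp hγx))
  · intro j hj
    have hjS := mem_S_of_mem hx hj
    have hm := z_mem_stalk hx hjS
    rw [arg_of_mem _ hm]
    have h1 : Algebra.GrothendieckGroup.lift hom₀ (Algebra.GrothendieckGroup.of
        (⟨_, hm⟩ : D.stalk x)) = hom₀ ⟨_, hm⟩ :=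
      DFunLike.congr_fun (Algebra.GrothendieckGroup.lift.symm_apply_apply hom₀) _
    refine h1.trans ?_
    ext
    refine huniq _ (c.z j) _ rfl ?_
    refine tendsto_const_nhds.congr' ?_
    filter_upwards [hz, self_mem_nhdsWithin] with τ h2 h3
    rw [h2 j (by simp [hI, hjS, hj]), map_mul, angle_ofReal h3, one_mul, angle_circle]

end Degeneration.KatoNakayama

namespace AdaptedChart

/-- The vector with coordinates `b_j`, for the labelled ones, and `ζ_k`, for the others. -/
def assemble (c : AdaptedChart D) (b : c.S → ℂ) (ζ : c.RestIdx → ℂ) : ℂ^n :=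
  WithLp.toLp 2 fun k => if h : k ∈ c.S.image c.idx then
    b ⟨(Finset.mem_image.1 h).choose, (Finset.mem_image.1 h).choose_spec.1⟩ else ζ ⟨k, h⟩

variable {c : AdaptedChart D}

theorem assemble_idx (b : c.S → ℂ) (ζ : c.RestIdx → ℂ) (j : c.S) :
    c.assemble b ζ (c.idx j) = b j := by
  have h : c.idx j ∈ c.S.image c.idx := Finset.mem_image_of_mem _ j.2
  have h1 := (Finset.mem_image.1 h).choose_spec
  have h2 : (Finset.mem_image.1 h).choose = j := c.idx_injOn h1.1 j.2 h1.2
  simp only [assemble, dif_pos h]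
  congr 1
  exact Subtype.ext h2

theorem assemble_rest (b : c.S → ℂ) (ζ : c.RestIdx → ℂ) (k : c.RestIdx) :
    c.assemble b ζ k = ζ k := dif_neg k.2

theorem eq_assemble (ξ : ℂ^n) : ξ = c.assemble (fun j => ξ (c.idx j)) fun k => ξ k := by
  ext k
  by_cases h : k ∈ c.S.image c.idx
  · obtain ⟨j, hj, rfl⟩ := Finset.mem_image.1 h
    exact (assemble_idx (fun j => ξ (c.idx j)) (fun k => ξ k) ⟨j, hj⟩).symm
  · exact (assemble_rest (fun j => ξ (c.idx j)) (fun k => ξ k) ⟨k, h⟩).symm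

theorem contDiff_assemble : ContDiff ℝ ∞ fun q : (c.S → ℂ) × (c.RestIdx → ℂ) =>
    c.assemble q.1 q.2 := by
  refine (contDiff_piLp 2).2 fun k => ?_
  by_cases h : k ∈ c.S.image c.idx
  · obtain ⟨j, hj, rfl⟩ := Finset.mem_image.1 h
    have : (fun q : (c.S → ℂ) × (c.RestIdx → ℂ) => c.assemble q.1 q.2 (c.idx j)) =
        fun q => q.1 ⟨j, hj⟩ := funext fun q => assemble_idx q.1 q.2 ⟨j, hj⟩
    rw [this]
    fun_prop
  · have : (fun q : (c.S → ℂ) × (c.RestIdx → ℂ) => c.assemble q.1 q.2 k) =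
        fun q => q.2 ⟨k, h⟩ := funext fun q => assemble_rest q.1 q.2 ⟨k, h⟩
    rw [this]
    fun_prop

theorem assemble_sub (b b' : c.S → ℂ) (ζ ζ' : c.RestIdx → ℂ) :
    c.assemble b ζ - c.assemble b' ζ' = c.assemble (b - b') (ζ - ζ') := by
  rw [eq_assemble (c := c) (c.assemble b ζ - c.assemble b' ζ')]
  congr 1
  · ext j; simp [assemble_idx]
  · ext k; simp [assemble_rest]

theorem continuous_circle_coe : Continuous fun θ : Circle => (θ : ℂ) :=
  continuous_iff_continuousAt.2 fun _ => tendsto_circle.1 tendsto_id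

theorem continuous_assemble_knChart : Continuous fun k : (c.S → ℝ) × (c.S → Circle) ×
    (c.RestIdx → ℂ) => c.assemble (fun j => ((k.1 j : ℝ) : ℂ) * (k.2.1 j : ℂ)) k.2.2 := by
  have h : Continuous fun k : (c.S → ℝ) × (c.S → Circle) × (c.RestIdx → ℂ) =>
      ((fun j => ((k.1 j : ℝ) : ℂ) * (k.2.1 j : ℂ), k.2.2) : (c.S → ℂ) × (c.RestIdx → ℂ)) :=
    (continuous_pi fun j => (Complex.continuous_ofReal.comp
      ((continuous_apply j).comp continuous_fst)).mul (continuous_circle_coe.comp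
        ((continuous_apply j).comp continuous_snd.fst))).prodMk continuous_snd.snd
  exact contDiff_assemble.continuous.comp h

theorem chart_eq_assemble {p : D.KatoNakayama} (hx : p.pt ∈ c.dom) : c.chart p.pt =
    c.assemble (fun j => (((c.knChart p).1 j : ℝ) : ℂ) * ((c.knChart p).2.1 j : ℂ))
      (c.knChart p).2.2 := by
  refine (eq_assemble (c := c) _).trans ?_
  congr 1
  ext j
  exact Degeneration.KatoNakayama.z_eq_norm_mul_arg hx j

end AdaptedChart

namespace Degeneration.KatoNakayama

variable {c : AdaptedChart D}

theorem isOpen_dom (c : AdaptedChart D) : IsOpen {p : D.KatoNakayama | p.pt ∈ c.dom} :=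
  TopologicalSpace.isOpen_generateFrom_of_mem ⟨c, univ, isOpen_univ, by simp⟩

theorem continuousAt_knChart {p : D.KatoNakayama} (hp : p.pt ∈ c.dom) :
    ContinuousAt c.knChart p := by
  intro O hO
  obtain ⟨O', hO', ho, hm⟩ := mem_nhds_iff.1 hO
  refine mem_map.2 (mem_of_superset ?_ (preimage_mono hO'))
  have h1 : IsOpen {q : D.KatoNakayama | q.pt ∈ c.dom ∧ c.knChart q ∈ O'} :=
    TopologicalSpace.isOpen_generateFrom_of_mem ⟨c, O', ho, rfl⟩
  exact mem_of_superset (h1.mem_nhds ⟨hp, hm⟩) fun q hq => hq.2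

theorem tendsto_arg_of_ne {α : Type*} {l : Filter α} {q : α → D.KatoNakayama} {x : X}
    (hq : Tendsto (fun a => (q a).pt) l (𝓝 x)) {F : X → ℂ} (hF : HolAt n F x) (h : F x ≠ 0) :
    Tendsto (fun a => ((q a).arg F : ℂ)) l (𝓝 (angle (F x))) := by
  have h1 : Tendsto (fun a => angle (F (q a).pt)) l (𝓝 (angle (F x))) :=
    (contDiffAt_angle h).continuousAt.tendsto.comp (hF.continuousAt.tendsto.comp hq)
  refine h1.congr' ?_
  filter_upwards [hq.eventually hF.eventually_nhds,
    hq.eventually (hF.continuousAt.eventually_ne h)] with a h2 h3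
  exact ((q a).arg_unit h2 h3).symm

theorem eventually_arg_eq {c' : AdaptedChart D} {x : X} {j : Fin D.N} (hx : x ∈ c.dom)
    (hj : x ∈ D.D j) {h : X → ℂ} (hh : HolAt n h x) (h0 : h x ≠ 0)
    (he : ∀ᶠ y in 𝓝 x, c'.z j y = h y * c.z j y) :
    ∀ᶠ y in 𝓝 x, ∀ p : D.KatoNakayama, p.pt = y → p.arg (c'.z j) = p.arg h * p.arg (c.z j) := by
  filter_upwards [he.eventually_nhds, hh.eventually_nhds, hh.continuousAt.eventually_ne h0,
    c.isOpen_dom.mem_nhds hx] with y h1 h2 h3 h4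
  rintro p rfl
  have : c'.z j =ᶠ[𝓝 p.pt] h * c.z j := h1
  rw [p.arg_congr this, p.arg_mul (mem_stalk_of_ne h2 h3) (z_mem_stalk h4 (mem_S_of_mem hx hj))]

theorem nhds_eq {p : D.KatoNakayama} (hp : p.pt ∈ c.dom) :
    𝓝 p = comap c.knChart (𝓝 (c.knChart p)) ⊓ 𝓟 {q | q.pt ∈ c.dom} := by
  refine le_antisymm (le_inf (continuousAt_knChart hp).le_comap
    (le_principal_iff.2 ((isOpen_dom c).mem_nhds hp))) ?_
  set l := comap c.knChart (𝓝 (c.knChart p)) ⊓ 𝓟 {q | q.pt ∈ c.dom}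
  have hk : Tendsto c.knChart l (𝓝 (c.knChart p)) := tendsto_comap.mono_left inf_le_left
  have hd : ∀ᶠ q in l, q.pt ∈ c.dom := le_principal_iff.1 inf_le_right
  have hchart : Tendsto (fun q : D.KatoNakayama => c.chart q.pt) l (𝓝 (c.chart p.pt)) := by
    rw [chart_eq_assemble hp]
    refine ((continuous_assemble_knChart.tendsto _).comp hk).congr' ?_
    filter_upwards [hd] with q hq
    exact (chart_eq_assemble hq).symm
  have hpt : Tendsto (fun q : D.KatoNakayama => q.pt) l (𝓝 p.pt) := by
    have h1 := (c.chart.continuousAt_symm (c.chart.map_source hp)).tendsto.comp hchart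
    rw [c.chart.left_inv hp] at h1
    refine h1.congr' ?_
    filter_upwards [hd] with q hq
    exact c.chart.left_inv hq
  refine (TopologicalSpace.nhds_generateFrom (a := p)).symm ▸ ?_
  refine le_iInf₂ fun s hs => ?_
  obtain ⟨hps, c', O, hO, rfl⟩ := hs
  have harg : ∀ j ∈ c'.S, Tendsto (fun q : D.KatoNakayama => q.arg (c'.z j)) l
      (𝓝 (p.arg (c'.z j))) := by
    intro j hj
    rw [tendsto_circle]
    by_cases hx : p.pt ∈ D.D j
    · obtain ⟨h, h1, h2, h3⟩ := exists_unit (c' := c') hp hps.1 hx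
      have h4 := eventually_arg_eq hp hx h1 h2 h3
      have h5 : Tendsto (fun q : D.KatoNakayama => (q.arg (c.z j) : ℂ)) l
          (𝓝 (p.arg (c.z j) : ℂ)) := tendsto_circle.1
        (((continuous_apply (⟨j, mem_S_of_mem hp hx⟩ : c.S)).tendsto _).comp
          ((continuous_fst.tendsto _).comp ((continuous_snd.tendsto _).comp hk)))
      rw [h4.self_of_nhds p rfl, Circle.coe_mul, p.arg_unit h1 h2]
      refine ((tendsto_arg_of_ne hpt h1 h2).mul h5).congr' ?_
      filter_upwards [hpt.eventually h4] with q hq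
      rw [hq q rfl, Circle.coe_mul]
    · have h0 : c'.z j p.pt ≠ 0 := fun h => hx ((z_eq_zero_iff hps.1 hj).1 h)
      have h1 := holAt_z hps.1 j
      rw [p.arg_unit h1 h0]
      exact tendsto_arg_of_ne hpt h1 h0
  have hk' : Tendsto c'.knChart l (𝓝 (c'.knChart p)) := by
    refine Tendsto.prodMk_nhds ?_ (Tendsto.prodMk_nhds ?_ ?_)
    · exact tendsto_pi_nhds.2 fun j =>
        ((holAt_z hps.1 j).continuousAt.norm.tendsto).comp hpt
    · exact tendsto_pi_nhds.2 fun j => harg j j.2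
    · exact tendsto_pi_nhds.2 fun k =>
        ((holAt_coord c'.chart_mem hps.1 k).continuousAt.tendsto).comp hpt
  rw [le_principal_iff]
  filter_upwards [hpt.eventually (c'.isOpen_dom.mem_nhds hps.1),
    hk'.eventually (hO.mem_nhds hps.2)] with q h1 h2 using ⟨h1, h2⟩

theorem continuousAt_pt {p : D.KatoNakayama} (hp : p.pt ∈ c.dom) :
    ContinuousAt (fun q : D.KatoNakayama => q.pt) p := by
  have hd : ∀ᶠ q : D.KatoNakayama in 𝓝 p, q.pt ∈ c.dom := (isOpen_dom c).mem_nhds hp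
  have hchart : Tendsto (fun q : D.KatoNakayama => c.chart q.pt) (𝓝 p) (𝓝 (c.chart p.pt)) := by
    rw [chart_eq_assemble hp]
    refine ((continuous_assemble_knChart.tendsto _).comp (continuousAt_knChart hp)).congr' ?_
    filter_upwards [hd] with q hq
    exact (chart_eq_assemble hq).symm
  have h1 := (c.chart.continuousAt_symm (c.chart.map_source hp)).tendsto.comp hchart
  rw [c.chart.left_inv hp] at h1
  refine h1.congr' ?_
  filter_upwards [hd] with q hq
  exact c.chart.left_inv hq

theorem continuousAt_arg {p : D.KatoNakayama} (hp : p.pt ∈ c.dom) {j : Fin D.N} (hj : j ∈ c.S) :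
    ContinuousAt (fun q : D.KatoNakayama => q.arg (c.z j)) p :=
  (continuous_apply (⟨j, hj⟩ : c.S)).continuousAt.comp
    (continuous_fst.continuousAt.comp (continuous_snd.continuousAt.comp (continuousAt_knChart hp)))

theorem tendsto_iff {α : Type*} {l : Filter α} {q : α → D.KatoNakayama} {p : D.KatoNakayama}
    (hp : p.pt ∈ c.dom) : Tendsto q l (𝓝 p) ↔ Tendsto (fun a => (q a).pt) l (𝓝 p.pt) ∧
      ∀ j ∈ c.S, Tendsto (fun a => (q a).arg (c.z j)) l (𝓝 (p.arg (c.z j))) := by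
  refine ⟨fun h => ⟨(continuousAt_pt hp).tendsto.comp h, fun j hj =>
    (continuousAt_arg hp hj).tendsto.comp h⟩, fun ⟨h1, h2⟩ => ?_⟩
  rw [nhds_eq hp, tendsto_inf, tendsto_comap_iff, tendsto_principal]
  refine ⟨Tendsto.prodMk_nhds ?_ (Tendsto.prodMk_nhds ?_ ?_),
    h1.eventually (c.isOpen_dom.mem_nhds hp)⟩
  · exact tendsto_pi_nhds.2 fun j =>
      ((holAt_z hp j).continuousAt.norm.tendsto).comp h1
  · exact tendsto_pi_nhds.2 fun j => h2 j j.2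
  · exact tendsto_pi_nhds.2 fun k =>
      ((holAt_coord c.chart_mem hp k).continuousAt.tendsto).comp h1

theorem continuous_pt (hc : ∀ x, ∃ c : AdaptedChart D, x ∈ c.dom) :
    Continuous fun q : D.KatoNakayama => q.pt := continuous_iff_continuousAt.2 fun p => by
  obtain ⟨c, hp⟩ := hc p.pt
  exact continuousAt_pt hp

theorem t2Space [T2Space X] (hc : ∀ x, ∃ c : AdaptedChart D, x ∈ c.dom) :
    T2Space D.KatoNakayama := by
  rw [t2_iff_nhds]
  intro p q hne
  obtain ⟨c, hp⟩ := hc p.pt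
  have h1 := (continuous_pt hc).tendsto p
  have h2 := (continuous_pt hc).tendsto q
  have hpt : p.pt = q.pt :=
    tendsto_nhds_unique (l := 𝓝 p ⊓ 𝓝 q) (h1.mono_left inf_le_left) (h2.mono_left inf_le_right)
  refine ext_of_arg hpt hp fun j hj => ?_
  exact tendsto_nhds_unique (l := 𝓝 p ⊓ 𝓝 q)
    ((continuousAt_arg hp hj).tendsto.mono_left inf_le_left)
    ((continuousAt_arg (hpt ▸ hp) hj).tendsto.mono_left inf_le_right)

theorem secondCountableTopology [SecondCountableTopology X]
    (hc : ∀ x, ∃ c : AdaptedChart D, x ∈ c.dom) : SecondCountableTopology D.KatoNakayama := by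
  choose c hx using hc
  obtain ⟨s, hs, hcov⟩ := TopologicalSpace.countable_cover_nhds
    fun x => (c x).isOpen_dom.mem_nhds (hx x)
  have : Countable s := hs.to_subtype
  have : ∀ x : s, SecondCountableTopology {p : D.KatoNakayama | p.pt ∈ (c x).dom} := fun x => by
    have hi : Topology.IsInducing fun p : {p : D.KatoNakayama | p.pt ∈ (c x).dom} => (c x).knChart p := by
      refine Topology.isInducing_iff_nhds.2 fun p => ?_
      rw [nhds_subtype_eq_comap, nhds_eq p.2, comap_inf, comap_principal, comap_comap]
      have : Subtype.val ⁻¹' {q : D.KatoNakayama | q.pt ∈ (c x).dom} =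
          (univ : Set {p : D.KatoNakayama | p.pt ∈ (c x).dom}) := eq_univ_of_forall fun p => p.2
      rw [this, principal_univ, inf_top_eq]
      rfl
    exact hi.secondCountableTopology
  refine TopologicalSpace.secondCountableTopology_of_countable_cover
    (ι := s) (U := fun x => {p | p.pt ∈ (c x).dom}) (fun x => isOpen_dom (c x)) ?_
  refine eq_univ_of_forall fun p => ?_
  have : p.pt ∈ ⋃ x ∈ s, (c x).dom := hcov ▸ mem_univ _
  simpa using this

end Degeneration.KatoNakayama

/-- The change of `t_j` under multiplication of the coordinate by a unit. -/
def trT (κ T : ℝ) : ℝ := T / (1 - κ * T)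

/-- The change of `u_j` under multiplication of the coordinate by a unit. -/
def trU (κ T u : ℝ) : ℝ := u / (1 - u * log (1 - κ * T))

namespace AdaptedChart

variable {c c' : AdaptedChart D} {x : X} {j : Fin D.N}

theorem transition (hx : x ∈ c.dom) (hx' : x ∈ c'.dom) (hj : j ∈ c.S) (hj' : j ∈ c'.S)
    (hf : D.f x ≠ 0) {h : ℂ} (he : c'.z j x = h * c.z j x) : 0 < 1 - D.m j * log ‖h‖ * c.t j x ∧
    0 < 1 - c.u j x * log (1 - D.m j * log ‖h‖ * c.t j x) ∧
    c'.t j x = trT (D.m j * log ‖h‖) (c.t j x) ∧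
    c'.u j x = trU (D.m j * log ‖h‖) (c.t j x) (c.u j x) := by
  set κ := D.m j * log ‖h‖ with hκ
  have hz := z_ne_zero hx hj hf
  have hz' := z_ne_zero hx' hj' hf
  have hh : h ≠ 0 := fun h0 => hz' (by rw [he, h0, zero_mul])
  have hT := t_pos hx hj (notMem_D hf j)
  have hT' := t_pos hx' hj' (notMem_D hf j)
  have h1 : (c'.t j x)⁻¹ = (c.t j x)⁻¹ - κ := by
    rw [t, t, if_neg hz, if_neg hz', inv_inv, inv_inv, he, norm_mul,
      Real.log_mul (norm_ne_zero_iff.2 hh) (norm_ne_zero_iff.2 hz), hκ]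
    ring
  have h2 : 1 - κ * c.t j x = c.t j x / c'.t j x := by
    rw [div_eq_mul_inv, h1]; field_simp
  have h3 : 0 < 1 - κ * c.t j x := h2 ▸ div_pos hT hT'
  have h4 : c'.w j x = c.w j x * (1 - κ * c.t j x) := by
    rw [w, w, h2]; field_simp
  have hw := w_pos hx hj hf
  have hw1 := w_le_one hx hj hf
  have hw' := w_pos hx' hj' hf
  have hw1' := w_le_one hx' hj' hf
  have h5 : 1 - log (c'.w j x) = 1 - log (c.w j x) - log (1 - κ * c.t j x) := by
    rw [h4, Real.log_mul hw.ne' h3.ne']; ring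
  have h6 : 0 < 1 - log (c'.w j x) := by linarith [Real.log_nonpos hw'.le hw1']
  have h7 : 0 < 1 - log (c.w j x) := by linarith [Real.log_nonpos hw.le hw1]
  have h8 : c.u j x = (1 - log (c.w j x))⁻¹ := eta_of_pos hw
  have h9 : 1 - c.u j x * log (1 - κ * c.t j x) = (1 - log (c'.w j x)) / (1 - log (c.w j x)) := by
    rw [h5, h8]; field_simp
  refine ⟨h3, h9 ▸ div_pos h6 h7, ?_, ?_⟩
  · rw [trT, h2]; field_simp
  · rw [trU, h9, h8, u, eta_of_pos hw']
    field_simp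

theorem continuousAt_u (hx : x ∈ c.dom) (hj : j ∈ c.S) (hf : D.f x = 0) (hx' : x ∉ D.D j) :
    ContinuousAt (c.u j) x ∧ c.u j x = 0 := by
  have hT := t_pos hx hj hx'
  have h1 : ContinuousAt (c.w j) x := D.continuous_t.continuousAt.div (continuousAt_t hx hj) hT.ne'
  have h2 : c.w j x = 0 := by rw [w, D.t_eq_zero hf, zero_div]
  have h3 : ContinuousAt eta (c.w j x) := by
    rw [h2]; exact continuousAt_eta le_rfl zero_le_one
  exact ⟨ContinuousAt.comp (g := eta) h3 h1, by rw [u, h2, eta_zero]⟩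

theorem tendsto_u_sub_u (hx : x ∈ c.dom) (hx' : x ∈ c'.dom) (hj : x ∈ D.D j) :
    Tendsto (fun y => c'.u j y - c.u j y) (𝓝[{y | D.f y ≠ 0}] x) (𝓝 0) := by
  have hjS := mem_S_of_mem hx hj
  have hjS' := mem_S_of_mem hx' hj
  obtain ⟨h, hh, h0, he⟩ := exists_unit (c' := c') hx hx' hj
  have hκ : ContinuousAt (fun y => log (1 - D.m j * log ‖h y‖ * c.t j y)) x := by
    refine ContinuousAt.log ?_ ?_
    · exact continuousAt_const.sub ((continuousAt_const.mul
        (hh.continuousAt.norm.log (norm_ne_zero_iff.2 h0))).mul (continuousAt_t hx hjS))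
    · rw [t_eq_zero hx hj]; simp
  have hκ0 : Tendsto (fun y => log (1 - D.m j * log ‖h y‖ * c.t j y))
      (𝓝[{y | D.f y ≠ 0}] x) (𝓝 0) := by
    have := hκ.tendsto
    rw [t_eq_zero hx hj, mul_zero, sub_zero, Real.log_one] at this
    exact this.mono_left nhdsWithin_le_nhds
  refine squeeze_zero_norm' (a := fun y =>
    2 * |log (1 - D.m j * log ‖h y‖ * c.t j y)|) ?_ (by simpa using hκ0.abs.const_mul 2)
  have hsmall : ∀ᶠ y in 𝓝[{y | D.f y ≠ 0}] x,
      |log (1 - D.m j * log ‖h y‖ * c.t j y)| < 1 / 2 := by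
    have := hκ0.abs
    rw [abs_zero] at this
    exact this.eventually_lt_const (by norm_num)
  filter_upwards [hsmall, nhdsWithin_le_nhds he, nhdsWithin_le_nhds (c.isOpen_dom.mem_nhds hx),
    nhdsWithin_le_nhds (c'.isOpen_dom.mem_nhds hx'), self_mem_nhdsWithin] with y h1 h2 h3 h4 h5
  obtain ⟨-, h7, -, h9⟩ := transition h3 h4 hjS hjS' h5 h2
  rw [h9, trU]
  have hu0 := u_pos h3 hjS h5
  have hu1 := u_le_one h3 hjS h5
  set L := log (1 - D.m j * log ‖h y‖ * c.t j y)
  set u := c.u j y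
  have h10 : u / (1 - u * L) - u = u * u * L / (1 - u * L) := by field_simp; ring
  have h11 : 1 / 2 ≤ 1 - u * L := by
    have : u * L ≤ |L| := (le_abs_self _).trans (by
      rw [abs_mul, abs_of_pos hu0]; exact mul_le_of_le_one_left (abs_nonneg _) hu1)
    linarith
  rw [h10, Real.norm_eq_abs, abs_div, abs_of_pos h7, div_le_iff₀ h7, abs_mul,
    abs_of_pos (mul_pos hu0 hu0)]
  have h12 : u * u ≤ 1 := by nlinarith
  nlinarith [abs_nonneg L, mul_nonneg (abs_nonneg L) (sub_nonneg.2 h12),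
    mul_nonneg (abs_nonneg L) (sub_nonneg.2 h11)]

open Classical in
/-- The function `u_i`, or `0` if the chart is disjoint from the component. -/
def uE (c : AdaptedChart D) (i : Fin D.N) (x : X) : ℝ :=
  if (D.D i ∩ c.dom).Nonempty then c.u i x else 0

open Classical in
/-- The function `v_i`, or `0` if the chart is disjoint from the component. -/
def vE (c : AdaptedChart D) (i : Fin D.N) (x : X) : ℝ :=
  if (D.D i ∩ c.dom).Nonempty then c.v i x else 0

/-- The function `u_i` for `i ∈ S`, and `0` otherwise. -/
def uS (c : AdaptedChart D) (i : Fin D.N) (x : X) : ℝ := if i ∈ c.S then c.u i x else 0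

theorem mem_S_of_inter (h : (D.D j ∩ c.dom).Nonempty) : j ∈ c.S := by
  obtain ⟨y, hy, hy'⟩ := h
  exact mem_S_of_mem hy' hy

theorem contMDiffAt_uE (hx : x ∈ c.dom) (hf : D.f x ≠ 0) :
    ContMDiffAt 𝓘^n 𝓘(ℝ) ∞ (c.uE j) x := by
  by_cases h : (D.D j ∩ c.dom).Nonempty
  · have : c.uE j = c.u j := funext fun y => if_pos h
    rw [this]
    exact contMDiffAt_u hx (mem_S_of_inter h) hf
  · have : c.uE j = fun _ => 0 := funext fun y => if_neg h
    rw [this]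
    exact contMDiffAt_const

end AdaptedChart

namespace AdaptedPair

variable {ι : Type*} (P : AdaptedPair D ι)

theorem exists_chart (P : AdaptedPair D ι) (x : X) : ∃ c : AdaptedChart D, x ∈ c.dom := by
  have : x ∈ ⋃ p, (P.chart p).dom := P.cover ▸ mem_univ x
  obtain ⟨p, hp⟩ := mem_iUnion.1 this
  exact ⟨_, hp⟩

theorem exists_finset (x0 : X) : ∃ F : Finset ι, (∀ p ∈ F, x0 ∈ (P.chart p).dom) ∧
    ∀ᶠ x in 𝓝 x0, ∑ p ∈ F, P.τ p x = 1 ∧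
      ∀ φ : ι → ℝ, ∑ᶠ p, P.τ p x * φ p = ∑ p ∈ F, P.τ p x * φ p := by
  refine ⟨P.τ.fintsupport x0, fun p hp => P.subordinate p ((P.τ.mem_fintsupport_iff x0 p).1 hp), ?_⟩
  filter_upwards [P.τ.eventually_finsupport_subset x0] with x hx
  refine ⟨P.τ.sum_finsupport' x (mem_univ x) hx, fun φ => ?_⟩
  refine finsum_eq_sum_of_support_subset _ fun p hp => hx ?_
  rw [P.τ.mem_finsupport]
  exact left_ne_zero_of_mul hp

theorem uBar_eq (j : Fin D.N) (x : X) : P.uBar j x = ∑ᶠ p, P.τ p x * (P.chart p).uE j x := rfl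

theorem vBarX_eq (j : Fin D.N) (x : X) : P.vBarX j x = ∑ᶠ p, P.τ p x * (P.chart p).vE j x := rfl

theorem contMDiffAt_sum_tau {F : Finset ι} {φ : ι → X → ℝ} {x : X}
    (h : ∀ p ∈ F, ContMDiffAt 𝓘^n 𝓘(ℝ) ∞ (φ p) x) : ContMDiffAt 𝓘^n 𝓘(ℝ) ∞
      (fun y => ∑ p ∈ F, P.τ p y * φ p y) x :=
  ContMDiffAt.sum (t := F) fun p hp => ((P.τ p).contMDiff.contMDiffAt).mul (h p hp)

theorem contMDiffAt_uBar {x : X} (hf : D.f x ≠ 0) (j : Fin D.N) :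
    ContMDiffAt 𝓘^n 𝓘(ℝ) ∞ (P.uBar j) x := by
  obtain ⟨F, hF, he⟩ := P.exists_finset x
  refine (P.contMDiffAt_sum_tau (F := F) (φ := fun p => (P.chart p).uE j)
    fun p hp => contMDiffAt_uE (hF p hp) hf).congr_of_eventuallyEq ?_
  filter_upwards [he] with y hy
  rw [uBar_eq, hy.2]

open Classical in
/-- The difference `ū_j - u_j`, which extends continuously by `0`. -/
def delta (c : AdaptedChart D) (j : Fin D.N) (x : X) : ℝ :=
  if D.f x = 0 then 0 else P.uBar j x - c.uS j x

variable {P} {c : AdaptedChart D} {j : Fin D.N} {x : X}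

theorem delta_of_eq (hf : D.f x = 0) : P.delta c j x = 0 := if_pos hf

theorem delta_of_ne (hf : D.f x ≠ 0) : P.delta c j x = P.uBar j x - c.uS j x := if_neg hf

theorem tendsto_uE_sub_uS {c' : AdaptedChart D} (hx : x ∈ c.dom) (hx' : x ∈ c'.dom)
    (hf : D.f x = 0) : Tendsto (fun y => c'.uE j y - c.uS j y) (𝓝[{y | D.f y ≠ 0}] x) (𝓝 0) := by
  by_cases hj : x ∈ D.D j
  · have h1 : c'.uE j = c'.u j := funext fun y => if_pos ⟨x, hj, hx'⟩
    have h2 : c.uS j = c.u j := funext fun y => if_pos (mem_S_of_mem hx hj)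
    rw [h1, h2]
    exact tendsto_u_sub_u hx hx' hj
  · have h1 : Tendsto (c'.uE j) (𝓝[{y | D.f y ≠ 0}] x) (𝓝 0) := by
      by_cases h : (D.D j ∩ c'.dom).Nonempty
      · have h2 : c'.uE j = c'.u j := funext fun y => if_pos h
        obtain ⟨h3, h4⟩ := continuousAt_u hx' (mem_S_of_inter h) hf hj
        rw [h2, ← h4]
        exact h3.tendsto.mono_left nhdsWithin_le_nhds
      · have h2 : c'.uE j = fun _ => 0 := funext fun y => if_neg h
        rw [h2]
        exact tendsto_const_nhds
    have h1' : Tendsto (c.uS j) (𝓝[{y | D.f y ≠ 0}] x) (𝓝 0) := by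
      by_cases h : j ∈ c.S
      · have h2 : c.uS j = c.u j := funext fun y => if_pos h
        obtain ⟨h3, h4⟩ := continuousAt_u hx h hf hj
        rw [h2, ← h4]
        exact h3.tendsto.mono_left nhdsWithin_le_nhds
      · have h2 : c.uS j = fun _ => 0 := funext fun y => if_neg h
        rw [h2]
        exact tendsto_const_nhds
    simpa using h1.sub h1'

theorem continuousAt_delta (hx : x ∈ c.dom) : ContinuousAt (P.delta c j) x := by
  by_cases hf : D.f x = 0
  · obtain ⟨F, hF, he⟩ := P.exists_finset x
    have h1 : Tendsto (fun y => ∑ p ∈ F, P.τ p y * ((P.chart p).uE j y - c.uS j y))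
        (𝓝[{y | D.f y ≠ 0}] x) (𝓝 (∑ p ∈ F, P.τ p x * 0)) :=
      tendsto_finsetSum F fun p hp => (((P.τ p).contMDiff.continuous.tendsto x).mono_left
        nhdsWithin_le_nhds).mul (tendsto_uE_sub_uS hx (hF p hp) hf)
    simp only [mul_zero, Finset.sum_const_zero] at h1
    rw [ContinuousAt, delta_of_eq hf, Metric.tendsto_nhds]
    intro ε hε
    have h2 := (Metric.tendsto_nhds.1 h1) ε hε
    rw [eventually_nhdsWithin_iff] at h2
    filter_upwards [h2, he] with y h3 h4
    by_cases hy : D.f y = 0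
    · rw [delta_of_eq hy, dist_self]; exact hε
    · have h5 := h3 hy
      simp only [mul_sub, Finset.sum_sub_distrib, ← Finset.sum_mul] at h5
      rwa [h4.1, one_mul, ← h4.2, ← uBar_eq, ← delta_of_ne hy] at h5
  · have h1 : ContinuousAt (fun y => P.uBar j y - c.uS j y) x := by
      refine (P.contMDiffAt_uBar hf j).continuousAt.sub ?_
      by_cases h : j ∈ c.S
      · have h2 : c.uS j = c.u j := funext fun y => if_pos h
        rw [h2]
        exact (contMDiffAt_u hx h hf).continuousAt
      · have h2 : c.uS j = fun _ => 0 := funext fun y => if_neg h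
        rw [h2]
        exact continuousAt_const
    refine h1.congr ?_
    filter_upwards [D.isOpen_f_ne.mem_nhds hf] with y hy
    rw [delta_of_ne hy]

theorem gam_le {q : X × (Fin D.N → ℝ)} (hq : q ∈ P.Gam) {U : Set X} (hU : U ∈ 𝓝 q.1)
    {F G : X × (Fin D.N → ℝ) → ℝ} (hF : ContinuousAt F q) (hG : ContinuousAt G q)
    (h : ∀ x ∈ U, D.f x ≠ 0 → F (x, fun i => P.uBar i x) ≤ G (x, fun i => P.uBar i x)) :
    F q ≤ G q := by
  set s := {q : X × (Fin D.N → ℝ) | D.f q.1 ≠ 0 ∧ q.2 = fun i => P.uBar i q.1}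
  have hne : (𝓝[s] q).NeBot := mem_closure_iff_nhdsWithin_neBot.1 hq
  refine le_of_tendsto_of_tendsto (b := 𝓝[s] q) (hF.tendsto.mono_left nhdsWithin_le_nhds)
    (hG.tendsto.mono_left nhdsWithin_le_nhds) ?_
  filter_upwards [self_mem_nhdsWithin,
    nhdsWithin_le_nhds (continuous_fst.continuousAt.preimage_mem_nhds hU)] with r h1 h2
  have : r = (r.1, fun i => P.uBar i r.1) := by rw [← h1.2]
  rw [this]
  exact h _ h2 h1.1

theorem gam_eq {q : X × (Fin D.N → ℝ)} (hq : q ∈ P.Gam) {U : Set X} (hU : U ∈ 𝓝 q.1)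
    {F G : X × (Fin D.N → ℝ) → ℝ} (hF : ContinuousAt F q) (hG : ContinuousAt G q)
    (h : ∀ x ∈ U, D.f x ≠ 0 → F (x, fun i => P.uBar i x) = G (x, fun i => P.uBar i x)) :
    F q = G q := le_antisymm (gam_le hq hU hF hG fun x h1 h2 => (h x h1 h2).le)
    (gam_le hq hU hG hF fun x h1 h2 => (h x h1 h2).ge)

variable (P c j) in
/-- The function `u_j` of an adapted chart, on the closed graph. -/
def uG (q : X × (Fin D.N → ℝ)) : ℝ := q.2 j - P.delta c j q.1

theorem continuousAt_uG {q : X × (Fin D.N → ℝ)} (hx : q.1 ∈ c.dom) : ContinuousAt (P.uG c j) q :=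
  (((continuous_apply j).comp continuous_snd).continuousAt).sub
    (ContinuousAt.comp (f := Prod.fst) (continuousAt_delta hx) continuousAt_fst)

theorem uG_graph (hf : D.f x ≠ 0) : P.uG c j (x, fun i => P.uBar i x) = c.uS j x := by
  simp [uG, delta_of_ne hf]

theorem uG_graph' (hf : D.f x ≠ 0) (hj : j ∈ c.S) :
    P.uG c j (x, fun i => P.uBar i x) = c.u j x := by
  rw [uG_graph hf, AdaptedChart.uS, if_pos hj]

section Gam

variable {q : X × (Fin D.N → ℝ)} (hq : q ∈ P.Gam) (hx : q.1 ∈ c.dom)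
include hq

theorem gam_of_ne (hf : D.f q.1 ≠ 0) : q.2 = fun i => P.uBar i q.1 := by
  ext i
  exact gam_eq hq univ_mem ((continuous_apply i).comp continuous_snd).continuousAt
    (ContinuousAt.comp (f := Prod.fst) (P.contMDiffAt_uBar hf i).continuousAt continuousAt_fst)
    fun x _ _ => rfl

include hx

theorem uG_of_notMem (hj : j ∉ c.S) : P.uG c j q = 0 :=
  gam_eq hq (c.isOpen_dom.mem_nhds hx) (continuousAt_uG hx) continuousAt_const fun x _ hf => by
    rw [uG_graph hf, AdaptedChart.uS, if_neg hj]

theorem uG_of_ne (hf : D.f q.1 ≠ 0) (hj : j ∈ c.S) : P.uG c j q = c.u j q.1 := by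
  have : q = (q.1, fun i => P.uBar i q.1) := Prod.ext rfl (gam_of_ne hq hf)
  rw [this]
  exact uG_graph' hf hj

theorem uG_nonneg (hj : j ∈ c.S) : 0 ≤ P.uG c j q :=
  gam_le hq (c.isOpen_dom.mem_nhds hx) continuousAt_const (continuousAt_uG hx) fun x h hf => by
    rw [uG_graph' hf hj]; exact (u_pos h hj hf).le

theorem TT_uG (hj : j ∈ c.S) : TT (D.g q.1, c.t j q.1 - P.uG c j q) = c.t j q.1 := by
  have ht : ContinuousAt (fun q : X × (Fin D.N → ℝ) => c.t j q.1) q :=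
    ContinuousAt.comp (f := Prod.fst) (continuousAt_t hx hj) continuousAt_fst
  refine gam_eq (F := fun q => TT (D.g q.1, c.t j q.1 - P.uG c j q)) (G := fun q => c.t j q.1)
    hq (c.isOpen_dom.mem_nhds hx) ?_ ht fun x h hf => ?_
  · exact continuous_TT.continuousAt.comp (f := fun q : X × (Fin D.N → ℝ) =>
      (D.g q.1, c.t j q.1 - P.uG c j q)) ((D.continuous_g.comp continuous_fst).continuousAt.prodMk
        (ht.sub (continuousAt_uG hx)))
  · simp only [uG_graph' hf hj]
    exact AdaptedChart.TT_v h hj hf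

theorem t_mul_omega_uG (hj : j ∈ c.S) : c.t j q.1 * omega (P.uG c j q) = D.t q.1 := by
  have ht : ContinuousAt (fun q : X × (Fin D.N → ℝ) => c.t j q.1) q :=
    ContinuousAt.comp (f := Prod.fst) (continuousAt_t hx hj) continuousAt_fst
  refine gam_eq (F := fun q => c.t j q.1 * omega (P.uG c j q)) (G := fun q => D.t q.1)
    hq (c.isOpen_dom.mem_nhds hx) ?_ (D.continuous_t.comp continuous_fst).continuousAt
    fun x h hf => ?_
  · exact ht.mul (continuous_omega.continuousAt.comp (continuousAt_uG hx))
  · simp only [uG_graph' hf hj, omega_u h hj hf, AdaptedChart.w]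
    rw [mul_div_cancel₀ _ (t_pos h hj (notMem_D hf j)).ne']

theorem sum_omega_uG (hS : c.S.Nonempty) : ∑ j ∈ c.S, omega (P.uG c j q) = 1 := by
  refine gam_eq (F := fun q => ∑ j ∈ c.S, omega (P.uG c j q)) (G := fun _ => 1)
    hq (c.isOpen_dom.mem_nhds hx) ?_ continuousAt_const fun x h hf => ?_
  · exact tendsto_finsetSum _ fun j _ =>
      (continuous_omega.continuousAt.comp (continuousAt_uG hx)).tendsto
  · rw [← sum_w h hS hf]
    exact sum_congr rfl fun j hj => by
      rw [uG_graph' hf hj, omega_u h hj hf]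

end Gam

end AdaptedPair

variable {c : AdaptedChart D} {i j : Fin D.N} {ι : Type*} {P : AdaptedPair D ι} {a : P.Space}

theorem TT_omega_div {g w : ℝ} (hg : 0 ≤ g) (hw : 0 < w) (hw1 : w ≤ 1) :
    TT (g, omega g / w - eta w) = omega g / w := by
  rcases hg.eq_or_lt with h | h
  · rw [← h, omega_of_nonpos le_rfl, zero_div, zero_sub]
    exact TT_of_nonpos le_rfl (neg_nonpos.2 (eta_pos hw hw1).le)
  · have h0 : 0 < omega g := omega_pos h
    have hl : log (omega g / w) = 1 - g⁻¹ - log w := by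
      rw [Real.log_div h0.ne' hw.ne', omega_of_pos h, Real.log_exp]
    have h1 : 1 + g * log (omega g / w) = g * (1 - log w) := by
      rw [hl]; field_simp; ring
    have h2 : 0 < 1 - log w := by linarith [Real.log_nonpos hw.le hw1]
    refine TT_unique (Or.inl h) ⟨by positivity, by rw [h1]; positivity⟩ ?_
    rw [uOf, h1, eta_of_pos hw]
    field_simp

theorem UU_omega_div {g w : ℝ} (hg : 0 ≤ g) (hw : 0 < w) (hw1 : w ≤ 1) :
    UU (g, omega g / w - eta w) = eta w := by
  rw [UU, TT_omega_div hg hw hw1]; ring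

namespace AdaptedPair

theorem sum_S {F : Fin D.N → ℝ} (hi : i ∈ c.S) :
    ∑ j ∈ c.S, F j = F i + ∑ j : ↥(c.S.erase i), F j := by
  rw [← Finset.add_sum_erase _ _ hi, Finset.sum_coe_sort (c.S.erase i) F]

/-- The weight `w_i` in terms of the coordinates. -/
def wCo (y : CoordSpace c i) : ℝ := 1 - ∑ j : ↥(c.S.erase i), omega (UU (y.1, y.2.1 j))

/-- The functions `v_j`, including `v_i`, in terms of the coordinates. -/
def sCo (y : CoordSpace c i) (j : c.S) : ℝ :=
  if h : (j : Fin D.N) = i then omega y.1 / wCo y - eta (wCo y)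
  else y.2.1 ⟨j, mem_erase.2 ⟨h, j.2⟩⟩

/-- The coordinates of the point of `X` in terms of the coordinates of the A'Campo space. -/
def zCo (y : CoordSpace c i) : ℂ^n :=
  c.assemble (fun j => radius (D.m j) (y.1, sCo y j) * y.2.2.1 j) y.2.2.2

/-- The point of `X` in terms of the coordinates of the A'Campo space. -/
def xCo (y : CoordSpace c i) : X := c.chart.symm (zCo y)

variable (c i) in
/-- The domain of the coordinates. -/
def src : Set (CoordSpace c i) := {y | 1 / ((n : ℝ) + 1) < wCo y ∧ zCo y ∈ c.chart.target}

theorem sCo_self (y : CoordSpace c i) (hi : i ∈ c.S) :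
    sCo y ⟨i, hi⟩ = omega y.1 / wCo y - eta (wCo y) := dif_pos rfl

theorem sCo_of_ne (y : CoordSpace c i) (j : ↥(c.S.erase i)) :
    sCo y ⟨j, mem_of_mem_erase j.2⟩ = y.2.1 j := dif_neg (ne_of_mem_erase j.2)

theorem wCo_le_one (y : CoordSpace c i) : wCo y ≤ 1 := by
  have : 0 ≤ ∑ j : ↥(c.S.erase i), omega (UU (y.1, y.2.1 j)) := sum_nonneg fun j _ => omega_nonneg _
  rw [wCo]; linarith

theorem contDiff_wCo : ContDiff ℝ ∞ (wCo (c := c) (i := i)) := by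
  refine contDiff_const.sub (ContDiff.sum fun j _ => contDiff_omega_UU.comp (contDiff_fst.prodMk ?_))
  fun_prop

theorem contDiffAt_sCo {y : CoordSpace c i} (hy : 0 < wCo y) (j : c.S) :
    ContDiffAt ℝ ∞ (fun y => sCo y j) y := by
  by_cases h : (j : Fin D.N) = i
  · have : (fun y : CoordSpace c i => sCo y j) = fun y => omega y.1 / wCo y - eta (wCo y) :=
      funext fun y => dif_pos h
    rw [this]
    exact ((contDiff_omega.comp contDiff_fst).contDiffAt.div contDiff_wCo.contDiffAt hy.ne').sub
      ((contDiffAt_eta hy (wCo_le_one y)).comp y contDiff_wCo.contDiffAt)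
  · have : (fun y : CoordSpace c i => sCo y j) =
        fun y => y.2.1 ⟨j, mem_erase.2 ⟨h, j.2⟩⟩ := funext fun y => dif_neg h
    rw [this]
    fun_prop

theorem contDiffAt_zCo {y : CoordSpace c i} (hy : 0 < wCo y) :
    ContDiffAt ℝ ∞ (zCo (c := c) (i := i)) y := by
  have h : ContDiffAt ℝ ∞ (fun y : CoordSpace c i =>
      ((fun j => (radius (D.m j) (y.1, sCo y j) : ℂ) * y.2.2.1 j, y.2.2.2) :
        (c.S → ℂ) × (c.RestIdx → ℂ))) y := by
    refine ContDiffAt.prodMk (contDiffAt_pi.2 fun j => ?_) (by fun_prop)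
    refine ContDiffAt.mul ?_ (by fun_prop)
    exact Complex.ofRealCLM.contDiff.contDiffAt.comp y
      ((contDiff_radius (m_pos' D j)).contDiffAt.comp y
        (contDiffAt_fst.prodMk (contDiffAt_sCo hy j)))
  exact contDiff_assemble.contDiffAt.comp y h

theorem pos_of_mem_src {y : CoordSpace c i} (hy : y ∈ src c i) : 0 < wCo y :=
  lt_trans (by positivity) hy.1

theorem isOpen_src : IsOpen (src c i) := by
  rw [isOpen_iff_mem_nhds]
  intro y hy
  filter_upwards [contDiff_wCo.continuous.continuousAt.eventually (lt_mem_nhds hy.1),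
    (contDiffAt_zCo (pos_of_mem_src hy)).continuousAt.preimage_mem_nhds
      (c.chart.open_target.mem_nhds hy.2)] with y' h1 h2 using ⟨h1, h2⟩

section Spec

variable {y : CoordSpace c i} (hi : i ∈ c.S) (hy : y ∈ src c i)

include hy

theorem xCo_mem : xCo y ∈ c.dom := c.chart.map_target hy.2

theorem chart_xCo : c.chart (xCo y) = zCo y := c.chart.right_inv hy.2

theorem z_xCo (j : c.S) : c.z j (xCo y) = radius (D.m j) (y.1, sCo y j) * y.2.2.1 j := by
  rw [AdaptedChart.z, chart_xCo hy, zCo, assemble_idx]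

theorem continuousAt_xCo : ContinuousAt (xCo (c := c) (i := i)) y :=
  ContinuousAt.comp (f := zCo) (c.chart.continuousAt_symm hy.2)
    (contDiffAt_zCo (pos_of_mem_src hy)).continuousAt

theorem contMDiffAt_xCo : ContMDiffAt 𝓘(ℝ, CoordSpace c i) 𝓘^n ∞ (xCo (c := c) (i := i)) y :=
  ContMDiffAt.comp (I' := 𝓘^n) y (g := c.chart.symm) (contMDiffAt_chart_symm hy.2)
    (contDiffAt_zCo (pos_of_mem_src hy)).contMDiffAt

variable (hQ : y ∈ Q c i)
include hQ

theorem norm_z_xCo (j : c.S) : ‖c.z j (xCo y)‖ = radius (D.m j) (y.1, sCo y j) := by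
  rw [z_xCo hy, norm_mul, hQ.2 j, mul_one, Complex.norm_real,
    Real.norm_of_nonneg (show 0 ≤ radius (D.m j) (y.1, sCo y j) from expNegInvGlue.nonneg _)]

theorem t_xCo (j : c.S) : c.t j (xCo y) = TT (y.1, sCo y j) := by
  rw [AdaptedChart.t_eq, norm_z_xCo hy hQ, radius, tOf_expNegInvGlue (m_pos' D j) (TT_nonneg _)]

theorem angle_z_xCo {j : c.S} (h : c.z j (xCo y) ≠ 0) : angle (c.z j (xCo y)) = y.2.2.1 j := by
  have h1 : 0 < radius (D.m j) (y.1, sCo y j) := by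
    rw [← norm_z_xCo hy hQ]; exact norm_pos_iff.2 h
  obtain ⟨θ, hθ⟩ := exists_circle (hQ.2 j)
  rw [z_xCo hy, map_mul, angle_ofReal h1, one_mul, ← hθ, angle_circle]

include hi

theorem g_xCo_of_pos (h : 0 < y.1) : D.f (xCo y) ≠ 0 ∧ D.g (xCo y) = y.1 := by
  have hx := xCo_mem hy
  have hT : ∀ j : c.S, 0 < TT (y.1, sCo y j) := fun j => TT_pos_iff.2 (Or.inl h)
  have hz : ∀ j : c.S, c.z j (xCo y) ≠ 0 := fun j => by
    rw [← norm_pos_iff, norm_z_xCo hy hQ]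
    exact expNegInvGlue.pos_of_pos (mul_pos (m_pos' D j) (hT j))
  have hf : D.f (xCo y) ≠ 0 := by
    rw [f_eq_prod hx ⟨i, hi⟩, Finset.prod_ne_zero_iff]
    exact fun j hj => pow_ne_zero _ (hz ⟨j, hj⟩)
  refine ⟨hf, ?_⟩
  have h1 := sum_inv_t hx ⟨i, hi⟩ hf
  have hw := pos_of_mem_src hy
  have h0 : 0 < omega y.1 := omega_pos h
  rw [sum_S hi, t_xCo hy hQ ⟨i, hi⟩, sCo_self, TT_omega_div h.le hw (wCo_le_one y)] at h1
  have h2 : ∀ j : ↥(c.S.erase i), (c.t j (xCo y))⁻¹ = omega (UU (y.1, y.2.1 j)) / omega y.1 := by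
    intro j
    have h4 := t_xCo hy hQ ⟨j, mem_of_mem_erase j.2⟩
    have h5 := hT ⟨j, mem_of_mem_erase j.2⟩
    rw [sCo_of_ne] at h4 h5
    rw [h4, omega_UU (p := (y.1, y.2.1 j)) h]
    field_simp
  rw [sum_congr rfl fun j _ => h2 j, ← Finset.sum_div] at h1
  have h3 : (D.t (xCo y))⁻¹ = (omega y.1)⁻¹ := by
    rw [← h1, inv_div, ← add_div, wCo, sub_add_cancel, one_div]
  rw [Degeneration.g, inv_injective h3, eta_omega h.le]

theorem f_xCo_of_eq_zero (h : y.1 = 0) : D.f (xCo y) = 0 := by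
  have hx := xCo_mem hy
  have h1 := norm_z_xCo hy hQ ⟨i, hi⟩
  rw [sCo_self, radius, h, TT_omega_div le_rfl (pos_of_mem_src hy) (wCo_le_one y),
    omega_of_nonpos le_rfl, zero_div, mul_zero, expNegInvGlue.zero, norm_eq_zero] at h1
  exact D.f_eq_zero_iff.2 ⟨i, (z_eq_zero_iff hx hi).1 h1⟩

theorem g_xCo : D.g (xCo y) = y.1 := by
  rcases hQ.1.eq_or_lt with h | h
  · rw [← h, D.g_eq_zero (f_xCo_of_eq_zero hi hy hQ h.symm)]
  · exact (g_xCo_of_pos hi hy hQ h).2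

theorem u_xCo (h : 0 < y.1) (j : c.S) : c.u j (xCo y) = UU (y.1, sCo y j) := by
  obtain ⟨hf, hg⟩ := g_xCo_of_pos hi hy hQ h
  have ht : D.t (xCo y) = omega y.1 := by rw [← hg, D.omega_g]
  rw [AdaptedChart.u, AdaptedChart.w, ht, t_xCo hy hQ, ← omega_UU (p := (y.1, sCo y j)) h,
    eta_omega (UU_nonneg (p := (y.1, sCo y j)) h.le)]

end Spec

variable (P c) in
/-- The function `u_j` on the A'Campo space. -/
def uA (j : Fin D.N) (a : P.Space) : ℝ := P.uG c j (P.proj a, P.mu a)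

variable (P c) in
/-- The function `v_j` on the A'Campo space. -/
def vA (j : Fin D.N) (a : P.Space) : ℝ := c.t j (P.proj a) - P.uA c j a

theorem mem_gam (a : P.Space) : (P.proj a, P.mu a) ∈ P.Gam := a.2

theorem continuous_proj (P : AdaptedPair D ι) : Continuous P.proj :=
  (Degeneration.KatoNakayama.continuous_pt P.exists_chart).comp
    (continuous_fst.comp continuous_subtype_val)

theorem continuous_mu : Continuous P.mu := continuous_snd.comp continuous_subtype_val

theorem continuousAt_uA {a : P.Space} (ha : P.proj a ∈ c.dom) (j : Fin D.N) :
    ContinuousAt (P.uA c j) a :=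
  ContinuousAt.comp (f := fun a => (P.proj a, P.mu a)) (continuousAt_uG ha)
    (P.continuous_proj.prodMk continuous_mu).continuousAt

theorem continuousAt_vA {a : P.Space} (ha : P.proj a ∈ c.dom) {j : Fin D.N} (hj : j ∈ c.S) :
    ContinuousAt (P.vA c j) a := (ContinuousAt.comp (f := P.proj) (continuousAt_t ha hj)
    P.continuous_proj.continuousAt).sub (continuousAt_uA ha j)

theorem continuousAt_argA {a : P.Space} (ha : P.proj a ∈ c.dom) {j : Fin D.N} (hj : j ∈ c.S) :
    ContinuousAt (fun a : P.Space => (a.1.1.arg (c.z j) : ℂ)) a :=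
  ContinuousAt.comp (f := fun a : P.Space => a.1.1)
    (tendsto_circle.1 (Degeneration.KatoNakayama.continuousAt_arg ha hj))
    (continuous_fst.comp continuous_subtype_val).continuousAt

theorem continuousAt_chartA {a : P.Space} (ha : P.proj a ∈ c.dom) :
    ContinuousAt (fun a : P.Space => c.chart (P.proj a)) a :=
  ContinuousAt.comp (f := P.proj) (c.chart.continuousAt ha) P.continuous_proj.continuousAt

variable (P c i) in
/-- The set `U_i`, in terms of the continuous extension of `w_i`. -/
def pieceA : Set P.Space := {a | P.proj a ∈ c.dom ∧ 1 / ((n : ℝ) + 1) < omega (P.uA c i a)}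

theorem isOpen_pieceA : IsOpen (P.pieceA c i) := by
  rw [isOpen_iff_mem_nhds]
  intro a ha
  filter_upwards [P.continuous_proj.continuousAt.preimage_mem_nhds (c.isOpen_dom.mem_nhds ha.1),
    (continuous_omega.continuousAt.comp (continuousAt_uA ha.1 i)).eventually (lt_mem_nhds ha.2)]
    with b h1 h2 using ⟨h1, h2⟩

theorem UU_vA {a : P.Space} (ha : P.proj a ∈ c.dom) {j : Fin D.N} (hj : j ∈ c.S) :
    TT (P.g a, P.vA c j a) = c.t j (P.proj a) ∧ UU (P.g a, P.vA c j a) = P.uA c j a := by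
  have h : TT (P.g a, P.vA c j a) = c.t j (P.proj a) := TT_uG (mem_gam a) ha hj
  exact ⟨h, by rw [UU, h, vA]; ring⟩

theorem wCo_psiA {a : P.Space} (ha : P.proj a ∈ c.dom) (hi : i ∈ c.S) :
    wCo (P.chartMap c i (P.vA c) a) = omega (P.uA c i a) := by
  have h := sum_omega_uG (mem_gam a) ha ⟨i, hi⟩
  rw [sum_S hi] at h
  rw [wCo, ← h]
  have : ∀ j : ↥(c.S.erase i), UU ((P.chartMap c i (P.vA c) a).1,
      (P.chartMap c i (P.vA c) a).2.1 j) = P.uG c j (P.proj a, P.mu a) :=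
    fun j => (UU_vA ha (mem_of_mem_erase j.2)).2
  simp only [this]
  rw [add_sub_cancel_right]
  rfl

theorem psiA_spec {a : P.Space} (hi : i ∈ c.S) (ha : a ∈ P.pieceA c i) :
    P.chartMap c i (P.vA c) a ∈ src c i ∩ Q c i ∧ xCo (P.chartMap c i (P.vA c) a) = P.proj a ∧
      ∀ j : c.S, sCo (P.chartMap c i (P.vA c) a) j = P.vA c j a := by
  set y := P.chartMap c i (P.vA c) a
  have hw : wCo y = omega (P.uA c i a) := wCo_psiA ha.1 hi
  have hu : ∀ j ∈ c.S, 0 ≤ P.uA c j a := fun j hj => uG_nonneg (mem_gam a) ha.1 hj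
  have hs : ∀ j : c.S, sCo y j = P.vA c j a := by
    intro j
    by_cases h : (j : Fin D.N) = i
    · obtain ⟨j, hj⟩ := j
      obtain rfl : j = i := h
      have h1 : c.t j (P.proj a) * omega (P.uA c j a) = D.t (P.proj a) :=
        t_mul_omega_uG (mem_gam a) ha.1 hj
      have h2 : 0 < omega (P.uA c j a) := lt_trans (by positivity) ha.2
      have h3 : omega y.1 = D.t (P.proj a) := D.omega_g _
      rw [sCo_self, hw, eta_omega (hu j hj), h3, ← h1, mul_div_cancel_right₀ _ h2.ne']
      rfl
    · exact sCo_of_ne y ⟨j, mem_erase.2 ⟨h, j.2⟩⟩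
  have hz : zCo y = c.chart (P.proj a) := by
    rw [eq_assemble (c := c) (c.chart (P.proj a)), zCo]
    congr 1
    ext j
    have h1 := (UU_vA ha.1 j.2).1
    have h2 : radius (D.m j) (y.1, sCo y j) = ‖c.z j (P.proj a)‖ := by
      rw [norm_z_eq ha.1 j.2, ← h1, hs j]; rfl
    rw [h2]
    exact (Degeneration.KatoNakayama.z_eq_norm_mul_arg (p := a.1.1) ha.1 j).symm
  refine ⟨⟨⟨hw ▸ ha.2, hz ▸ c.chart.map_source ha.1⟩, D.g_nonneg _, fun j => Circle.norm_coe _⟩,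
    ?_, hs⟩
  rw [xCo, hz, c.chart.left_inv ha.1]

theorem mu_eq {a : P.Space} (ha : P.proj a ∈ c.dom) (j : Fin D.N) : P.mu a j =
    (if j ∈ c.S then c.t j (P.proj a) - P.vA c j a else 0) + P.delta c j (P.proj a) := by
  split_ifs with hj
  · rw [vA, uA, uG]; ring
  · have : P.uG c j (P.proj a, P.mu a) = 0 := uG_of_notMem (mem_gam a) ha hj
    rw [uG] at this
    rw [zero_add]
    exact sub_eq_zero.1 this

theorem ext_space {a b : P.Space} (h1 : a.1.1 = b.1.1) (h2 : P.mu a = P.mu b) : a = b :=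
  Subtype.ext (Prod.ext h1 h2)

theorem injOn_psiA (hi : i ∈ c.S) : InjOn (P.chartMap c i (P.vA c)) (P.pieceA c i) := by
  intro a ha b hb hab
  obtain ⟨-, h1, h2⟩ := psiA_spec hi ha
  obtain ⟨-, h3, h4⟩ := psiA_spec hi hb
  have hp : P.proj a = P.proj b := by rw [← h1, ← h3, hab]
  have hv : ∀ j : c.S, P.vA c j a = P.vA c j b := fun j => by rw [← h2 j, ← h4 j, hab]
  refine ext_space (Degeneration.KatoNakayama.ext_of_arg hp ha.1 fun j hj => ?_) (funext fun j => ?_)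
  · ext
    have := congrArg (fun y => y.2.2.1 ⟨j, hj⟩) hab
    exact this
  · rw [mu_eq ha.1, mu_eq hb.1, hp]
    congr 1
    split_ifs with hj
    · rw [hv ⟨j, hj⟩]
    · rfl

theorem mem_gam_coord {y : CoordSpace c i} (hi : i ∈ c.S) (hy : y ∈ src c i) (hQ : y ∈ Q c i)
    {u : Fin D.N → ℝ} (hu : ∀ j, u j =
      (if hj : j ∈ c.S then UU (y.1, sCo y ⟨j, hj⟩) else 0) + P.delta c j (xCo y)) :
    (xCo y, u) ∈ P.Gam := by
  have hpos : ∀ y : CoordSpace c i, y ∈ src c i → y ∈ Q c i → 0 < y.1 → ∀ j, P.uBar j (xCo y) =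
      (if hj : j ∈ c.S then UU (y.1, sCo y ⟨j, hj⟩) else 0) + P.delta c j (xCo y) := by
    intro y hy hQ h j
    rw [delta_of_ne (g_xCo_of_pos hi hy hQ h).1, AdaptedChart.uS]
    split_ifs with hj
    · rw [u_xCo hi hy hQ h ⟨j, hj⟩]; ring
    · ring
  rcases hQ.1.eq_or_lt with h | h
  · set γ : ℝ → CoordSpace c i := fun τ => (τ, y.2)
    have hγ0 : γ 0 = y := Prod.ext h rfl
    have hγc : Tendsto γ (𝓝[>] 0) (𝓝 y) := by
      have : Continuous γ := by fun_prop
      exact (hγ0 ▸ this.tendsto 0).mono_left nhdsWithin_le_nhds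
    refine mem_closure_of_tendsto (b := 𝓝[>] (0 : ℝ))
      (f := fun τ => (xCo (γ τ), fun j => P.uBar j (xCo (γ τ)))) ?_ ?_
    · refine Tendsto.prodMk_nhds ((continuousAt_xCo hy).tendsto.comp hγc)
        (tendsto_pi_nhds.2 fun j => ?_)
      have h1 : Tendsto (fun τ => (if hj : j ∈ c.S then UU ((γ τ).1, sCo (γ τ) ⟨j, hj⟩) else 0) +
          P.delta c j (xCo (γ τ))) (𝓝[>] 0) (𝓝 (u j)) := by
        rw [hu j]
        refine Tendsto.add ?_ ((continuousAt_delta (xCo_mem hy)).tendsto.comp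
          ((continuousAt_xCo hy).tendsto.comp hγc))
        by_cases hj : j ∈ c.S
        · simp only [hj, dif_pos]
          have h2 : ContinuousAt (fun y : CoordSpace c i => UU (y.1, sCo y ⟨j, hj⟩)) y :=
            ContinuousAt.comp (f := fun y : CoordSpace c i => (y.1, sCo y ⟨j, hj⟩))
              continuous_UU.continuousAt (continuousAt_fst.prodMk
              (contDiffAt_sCo (pos_of_mem_src hy) _).continuousAt)
          exact h2.tendsto.comp hγc
        · simp only [hj, dif_neg, not_false_eq_true]
          exact tendsto_const_nhds
      refine h1.congr' ?_
      filter_upwards [hγc.eventually (isOpen_src.mem_nhds hy), self_mem_nhdsWithin] with τ h3 h4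
      exact (hpos (γ τ) h3 ⟨le_of_lt h4, hQ.2⟩ h4 j).symm
    · filter_upwards [hγc.eventually (isOpen_src.mem_nhds hy), self_mem_nhdsWithin] with τ h3 h4
      exact ⟨(g_xCo_of_pos hi h3 ⟨le_of_lt h4, hQ.2⟩ h4).1, rfl⟩
  · exact subset_closure ⟨(g_xCo_of_pos hi hy hQ h).1, funext fun j =>
      (hu j).trans (hpos y hy hQ h j).symm⟩

theorem exists_psiA_eq {y : CoordSpace c i} (hi : i ∈ c.S) (hy : y ∈ src c i) (hQ : y ∈ Q c i) :
    ∃ a ∈ P.pieceA c i, P.chartMap c i (P.vA c) a = y := by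
  have hx := xCo_mem hy
  choose θ hθ using fun j : c.S => exists_circle (hQ.2 j)
  obtain ⟨p, hp, hpθ⟩ := Degeneration.KatoNakayama.exists_arg_eq hx
    (fun j => if hj : j ∈ c.S then θ ⟨j, hj⟩ else 1)
  have harg : ∀ j : c.S, (p.arg (c.z j) : ℂ) = y.2.2.1 j := by
    intro j
    by_cases h : c.z j (xCo y) = 0
    · rw [hpθ j ((z_eq_zero_iff hx j.2).1 h), dif_pos j.2, hθ]
    · refine (p.arg_unit (holAt_z (hp.symm ▸ hx) j) (hp.symm ▸ h)).trans ?_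
      rw [hp, angle_z_xCo hy hQ h]
  obtain ⟨u, hu⟩ : ∃ u : Fin D.N → ℝ, ∀ j, u j =
      (if hj : j ∈ c.S then UU (y.1, sCo y ⟨j, hj⟩) else 0) + P.delta c j (xCo y) :=
    ⟨_, fun j => rfl⟩
  have hG := mem_gam_coord hi hy hQ hu
  let a : P.Space := ⟨(p, u), by rw [hp]; exact hG⟩
  have hpa : P.proj a = xCo y := hp
  have hua : ∀ j : c.S, P.uA c j a = UU (y.1, sCo y j) := by
    intro j
    rw [uA, uG, hpa]
    change u j - _ = _
    rw [hu j, dif_pos j.2]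
    ring
  have hva : ∀ j : c.S, P.vA c j a = sCo y j := by
    intro j
    rw [vA, hua j, hpa, t_xCo hy hQ j, UU]; ring
  refine ⟨a, ⟨hpa ▸ hx, ?_⟩, ?_⟩
  · rw [hua ⟨i, hi⟩, sCo_self, UU_omega_div hQ.1 (pos_of_mem_src hy) (wCo_le_one y),
      omega_eta (pos_of_mem_src hy).le (wCo_le_one y)]
    exact hy.1
  · refine Prod.ext ?_ (Prod.ext (funext fun j => ?_) (Prod.ext (funext fun j => harg j)
      (funext fun k => ?_)))
    · change D.g (P.proj a) = y.1
      rw [hpa, g_xCo hi hy hQ]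
    · change P.vA c j a = _
      rw [hva ⟨j, mem_of_mem_erase j.2⟩, sCo_of_ne]
    · change c.chart (P.proj a) k = _
      rw [hpa, chart_xCo hy, zCo, assemble_rest]

theorem bijOn_psiA (hi : i ∈ c.S) :
    BijOn (P.chartMap c i (P.vA c)) (P.pieceA c i) (src c i ∩ Q c i) :=
  ⟨fun _ ha => (psiA_spec hi ha).1, injOn_psiA hi, fun _ hy => exists_psiA_eq hi hy.1 hy.2⟩

theorem tendsto_space {α : Type*} {l : Filter α} {b : α → P.Space} {a : P.Space}
    (ha : P.proj a ∈ c.dom) (h1 : Tendsto (fun s => P.proj (b s)) l (𝓝 (P.proj a)))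
    (h2 : ∀ j ∈ c.S, Tendsto (fun s => ((b s).1.1.arg (c.z j) : ℂ)) l (𝓝 (a.1.1.arg (c.z j) : ℂ)))
    (h3 : ∀ j ∈ c.S, Tendsto (fun s => P.vA c j (b s)) l (𝓝 (P.vA c j a))) : Tendsto b l (𝓝 a) := by
  rw [tendsto_subtype_rng, nhds_prod_eq]
  refine Tendsto.prodMk ((Degeneration.KatoNakayama.tendsto_iff ha).2
    ⟨h1, fun j hj => tendsto_circle.2 (h2 j hj)⟩) (tendsto_pi_nhds.2 fun j => ?_)
  have h4 : Tendsto (fun s => (if j ∈ c.S then c.t j (P.proj (b s)) - P.vA c j (b s) else 0) +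
      P.delta c j (P.proj (b s))) l (𝓝 (P.mu a j)) := by
    rw [mu_eq ha]
    refine Tendsto.add ?_ ((continuousAt_delta ha).tendsto.comp h1)
    split_ifs with hj
    · exact ((continuousAt_t ha hj).tendsto.comp h1).sub (h3 j hj)
    · exact tendsto_const_nhds
  refine h4.congr' ?_
  filter_upwards [h1.eventually (c.isOpen_dom.mem_nhds ha)] with s hs
  exact (mu_eq hs j).symm

variable [Nonempty P.Space]

variable (P c i) in
/-- The inverse of the coordinate map `ψ_i`. -/
def psiInv : CoordSpace c i → P.Space := invFunOn (P.chartMap c i (P.vA c)) (P.pieceA c i)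

theorem invOn_psiInv (hi : i ∈ c.S) :
    InvOn (P.psiInv c i) (P.chartMap c i (P.vA c)) (P.pieceA c i) (src c i ∩ Q c i) :=
  (bijOn_psiA hi).invOn_invFunOn

theorem psiInv_mem (hi : i ∈ c.S) {y : CoordSpace c i} (hy : y ∈ src c i ∩ Q c i) :
    P.psiInv c i y ∈ P.pieceA c i := (bijOn_psiA hi).surjOn.mapsTo_invFunOn hy

theorem psiA_psiInv (hi : i ∈ c.S) {y : CoordSpace c i} (hy : y ∈ src c i ∩ Q c i) :
    P.chartMap c i (P.vA c) (P.psiInv c i y) = y := (invOn_psiInv hi).2 hy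

theorem proj_psiInv (hi : i ∈ c.S) {y : CoordSpace c i} (hy : y ∈ src c i ∩ Q c i) :
    P.proj (P.psiInv c i y) = xCo y := by
  rw [← (psiA_spec hi (psiInv_mem hi hy)).2.1, psiA_psiInv hi hy]

theorem vA_psiInv (hi : i ∈ c.S) {y : CoordSpace c i} (hy : y ∈ src c i ∩ Q c i) (j : c.S) :
    P.vA c j (P.psiInv c i y) = sCo y j := by
  rw [← (psiA_spec hi (psiInv_mem hi hy)).2.2 j, psiA_psiInv hi hy]

theorem arg_psiInv (hi : i ∈ c.S) {y : CoordSpace c i} (hy : y ∈ src c i ∩ Q c i) (j : c.S) :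
    ((P.psiInv c i y).1.1.arg (c.z j) : ℂ) = y.2.2.1 j :=
  congrArg (fun y => y.2.2.1 j) (psiA_psiInv (P := P) hi hy)

theorem continuousOn_psiInv (hi : i ∈ c.S) : ContinuousOn (P.psiInv c i) (src c i ∩ Q c i) := by
  intro y hy
  have hx : P.proj (P.psiInv c i y) ∈ c.dom := (psiInv_mem hi hy).1
  have hev : ∀ᶠ y' in 𝓝[src c i ∩ Q c i] y, y' ∈ src c i ∩ Q c i := self_mem_nhdsWithin
  refine tendsto_space hx ?_ (fun j hj => ?_) fun j hj => ?_
  · rw [proj_psiInv hi hy]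
    refine ((continuousAt_xCo hy.1).tendsto.mono_left nhdsWithin_le_nhds).congr' ?_
    filter_upwards [hev] with y' hy'
    rw [proj_psiInv hi hy']
  · rw [arg_psiInv hi hy ⟨j, hj⟩]
    have h1 : Continuous fun y : CoordSpace c i => y.2.2.1 ⟨j, hj⟩ := by fun_prop
    refine ((h1.tendsto y).mono_left nhdsWithin_le_nhds).congr' ?_
    filter_upwards [hev] with y' hy'
    rw [arg_psiInv hi hy' ⟨j, hj⟩]
  · rw [vA_psiInv hi hy ⟨j, hj⟩]
    refine ((contDiffAt_sCo (pos_of_mem_src hy.1) ⟨j, hj⟩).continuousAt.tendsto.mono_left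
      nhdsWithin_le_nhds).congr' ?_
    filter_upwards [hev] with y' hy'
    rw [vA_psiInv hi hy' ⟨j, hj⟩]

end AdaptedPair

namespace AdaptedPair

theorem t2Space_space [T2Space X] (P : AdaptedPair D ι) : T2Space P.Space := by
  have := Degeneration.KatoNakayama.t2Space P.exists_chart
  infer_instance

theorem secondCountableTopology_space [SecondCountableTopology X] (P : AdaptedPair D ι) :
    SecondCountableTopology P.Space := by
  have := Degeneration.KatoNakayama.secondCountableTopology P.exists_chart
  exact TopologicalSpace.Subtype.secondCountableTopology
    {q : D.KatoNakayama × (Fin D.N → ℝ) | (q.1.pt, q.2) ∈ P.Gam}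

theorem card_S_le (c : AdaptedChart D) : c.S.card ≤ n :=
  (Finset.card_le_card_of_injOn (s := c.S) (t := Finset.univ) c.idx (fun _ _ => Finset.mem_univ _)
    c.idx_injOn).trans_eq (Finset.card_fin n)

theorem exists_pieceA (ha : P.proj a ∈ c.dom) (hS : c.S.Nonempty) :
    ∃ i ∈ c.S, a ∈ P.pieceA c i := by
  by_contra! h
  have h1 : ∀ j ∈ c.S, omega (P.uA c j a) ≤ 1 / ((n : ℝ) + 1) := fun j hj =>
    not_lt.1 fun h2 => h j hj ⟨ha, h2⟩
  have h2 := sum_le_sum h1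
  have h3 : ∑ j ∈ c.S, omega (P.uA c j a) = 1 := sum_omega_uG (mem_gam a) ha hS
  rw [h3, sum_const, nsmul_eq_mul, mul_one_div, le_div_iff₀ (by positivity)] at h2
  have h4 : (c.S.card : ℝ) ≤ n := by exact_mod_cast card_S_le c
  linarith

theorem exists_pieceA_of_bd (ha : a ∈ P.bd) : ∃ (c : AdaptedChart D) (i : Fin D.N),
    i ∈ c.S ∧ a ∈ P.pieceA c i := by
  obtain ⟨c, hc⟩ := P.exists_chart (P.proj a)
  obtain ⟨i, hi, h⟩ := exists_pieceA hc (S_nonempty hc ha)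
  exact ⟨c, i, hi, h⟩

theorem g_eq_zero_iff : P.g a = 0 ↔ a ∈ P.bd := D.g_eq_zero_iff

theorem isOpen_bd_compl : IsOpen P.bdᶜ := D.isOpen_f_ne.preimage P.continuous_proj

theorem dense_bd_compl (P : AdaptedPair D ι) : Dense P.bdᶜ := by
  intro a
  by_cases ha : a ∈ P.bd
  · obtain ⟨c, i, hi, h⟩ := exists_pieceA_of_bd ha
    have : Nonempty P.Space := ⟨a⟩
    set y := P.chartMap c i (P.vA c) a
    have hy0 : y ∈ src c i ∩ Q c i := (psiA_spec hi h).1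
    set γ : ℝ → CoordSpace c i := fun τ => (τ, y.2)
    have hγ0 : γ 0 = y := Prod.ext (g_eq_zero_iff.2 ha).symm rfl
    have hγc : Tendsto γ (𝓝[>] 0) (𝓝 y) := by
      have : Continuous γ := by fun_prop
      exact (hγ0 ▸ this.tendsto 0).mono_left nhdsWithin_le_nhds
    have hmem : ∀ᶠ τ in 𝓝[>] (0 : ℝ), γ τ ∈ src c i ∩ Q c i := by
      filter_upwards [hγc.eventually (isOpen_src.mem_nhds hy0.1), self_mem_nhdsWithin] with τ h1 h2
      exact ⟨h1, le_of_lt h2, hy0.2.2⟩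
    have hlim : Tendsto (fun τ => P.psiInv c i (γ τ)) (𝓝[>] 0) (𝓝 a) := by
      have h1 := (continuousOn_psiInv (P := P) hi y hy0).tendsto.comp
        (tendsto_nhdsWithin_iff.2 ⟨hγc, hmem⟩)
      rwa [(invOn_psiInv hi).1 h] at h1
    refine mem_closure_of_tendsto hlim ?_
    filter_upwards [hmem, self_mem_nhdsWithin] with τ h1 h2
    change D.f (P.proj _) ≠ 0
    rw [proj_psiInv hi h1]
    exact (g_xCo_of_pos hi h1.1 h1.2 h2).1
  · exact subset_closure ha

theorem lift_eq {F : X → ℝ} {G : P.Space → ℝ} (hG : ContinuousAt G a)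
    (h : ∀ᶠ b in 𝓝 a, b ∉ P.bd → F (P.proj b) = G b) : P.lift F a = G a := by
  refine extendFrom_eq (P.dense_bd_compl a) ((hG.tendsto.mono_left nhdsWithin_le_nhds).congr' ?_)
  filter_upwards [nhdsWithin_le_nhds h, self_mem_nhdsWithin] with b h1 h2
  exact (h1 h2).symm

theorem uA_of_ne (ha : P.proj a ∈ c.dom) (hj : j ∈ c.S) (h : a ∉ P.bd) :
    P.uA c j a = c.u j (P.proj a) := uG_of_ne (mem_gam a) ha h hj

theorem eventually_proj (ha : P.proj a ∈ c.dom) : ∀ᶠ b in 𝓝 a, P.proj b ∈ c.dom :=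
  P.continuous_proj.continuousAt.preimage_mem_nhds (c.isOpen_dom.mem_nhds ha)

theorem lift_v (ha : P.proj a ∈ c.dom) (hj : j ∈ c.S) : P.lift (c.v j) a = P.vA c j a :=
  lift_eq (continuousAt_vA ha hj) <| (eventually_proj ha).mono fun b hb h => by
    rw [vA, uA_of_ne hb hj h, AdaptedChart.v]

theorem lift_w (ha : P.proj a ∈ c.dom) (hj : j ∈ c.S) : P.lift (c.w j) a = omega (P.uA c j a) :=
  lift_eq (G := fun a => omega (P.uA c j a))
    (continuous_omega.continuousAt.comp (continuousAt_uA ha j)) <|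
    (eventually_proj ha).mono fun b hb h => by
      simp only [uA_of_ne hb hj h, omega_u hb hj h]

theorem piece_eq (hi : i ∈ c.S) : P.piece c i = P.pieceA c i := by
  ext a
  refine and_congr_right fun ha => ?_
  rw [lift_w ha hi]

theorem psi_eqOn : EqOn (P.psi c i) (P.chartMap c i (P.vA c)) {a | P.proj a ∈ c.dom} :=
  fun _ ha => Prod.ext rfl (Prod.ext (funext fun j => lift_v ha (mem_of_mem_erase j.2)) rfl)

theorem exists_proj_eq {x : X} (hx : D.f x ≠ 0) : ∃ a : P.Space, P.proj a = x := by
  obtain ⟨c, hc⟩ := P.exists_chart x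
  obtain ⟨p, rfl, -⟩ := Degeneration.KatoNakayama.exists_arg_eq hc fun _ => 1
  exact ⟨⟨(p, fun i => P.uBar i p.pt), subset_closure ⟨hx, rfl⟩⟩, rfl⟩

theorem arg_of_ne (ha : P.proj a ∈ c.dom) (hj : j ∈ c.S) (h : a ∉ P.bd) :
    (a.1.1.arg (c.z j) : ℂ) = angle (c.z j (P.proj a)) :=
  a.1.1.arg_unit (holAt_z ha j) (z_ne_zero ha hj h)

theorem mu_of_ne (h : a ∉ P.bd) : P.mu a = fun i => P.uBar i (P.proj a) := gam_of_ne (mem_gam a) h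

theorem injOn_proj : InjOn P.proj P.bdᶜ := by
  intro a ha b hb hab
  obtain ⟨c, hc⟩ := P.exists_chart (P.proj a)
  refine ext_space (Degeneration.KatoNakayama.ext_of_arg hab hc fun j hj => ?_)
    (by rw [mu_of_ne ha, mu_of_ne hb, hab])
  ext
  exact (arg_of_ne hc hj ha).trans ((congrArg (fun x => angle (c.z j x)) hab).trans (arg_of_ne (hab ▸ hc) hj hb).symm)

theorem bijOn_proj (P : AdaptedPair D ι) : BijOn P.proj P.bdᶜ {x | D.f x ≠ 0} :=
  ⟨fun _ h => h, injOn_proj, fun _ hx => by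
    obtain ⟨a, rfl⟩ := exists_proj_eq (P := P) hx
    exact ⟨a, hx, rfl⟩⟩

variable (P) in
/-- The inverse of the projection off the divisor. -/
def projInv [Nonempty P.Space] : X → P.Space := invFunOn P.proj P.bdᶜ

variable [Nonempty P.Space]

theorem invOn_projInv : InvOn P.projInv P.proj P.bdᶜ {x | D.f x ≠ 0} := P.bijOn_proj.invOn_invFunOn

theorem projInv_mem {x : X} (hx : D.f x ≠ 0) : P.projInv x ∉ P.bd :=
  P.bijOn_proj.surjOn.mapsTo_invFunOn hx

theorem proj_projInv {x : X} (hx : D.f x ≠ 0) : P.proj (P.projInv x) = x := invOn_projInv.2 hx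

theorem continuousAt_projInv {x : X} (hx : D.f x ≠ 0) : ContinuousAt P.projInv x := by
  obtain ⟨c, hc⟩ := P.exists_chart x
  have hc' : P.proj (P.projInv x) ∈ c.dom := by rwa [proj_projInv hx]
  have hev : ∀ᶠ y in 𝓝 x, D.f y ≠ 0 ∧ y ∈ c.dom :=
    (IsOpen.eventually_mem D.isOpen_f_ne hx).and (c.isOpen_dom.mem_nhds hc)
  refine tendsto_space hc' ?_ (fun j hj => ?_) fun j hj => ?_
  · rw [proj_projInv hx]
    exact tendsto_id.congr' (hev.mono fun y hy => (proj_projInv hy.1).symm)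
  · rw [arg_of_ne hc' hj (projInv_mem hx), proj_projInv hx]
    have hz := z_ne_zero hc hj hx
    refine Tendsto.congr' (f₁ := fun y => angle (c.z j y)) (hev.mono fun y hy => ?_)
      ((contDiffAt_angle hz).continuousAt.tendsto.comp (contMDiffAt_z hc j).continuousAt.tendsto)
    have hy' : P.proj (P.projInv y) ∈ c.dom := by rw [proj_projInv hy.1]; exact hy.2
    exact (congrArg (fun x => angle (c.z j x)) (proj_projInv hy.1)).symm.trans
      (arg_of_ne hy' hj (projInv_mem hy.1)).symm
  · have hv : ∀ y, D.f y ≠ 0 → y ∈ c.dom → P.vA c j (P.projInv y) = c.v j y := fun y h1 h2 => by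
      rw [vA, uA_of_ne (by rwa [proj_projInv h1]) hj (projInv_mem h1), proj_projInv h1,
        AdaptedChart.v]
    rw [hv x hx hc]
    exact Tendsto.congr' (hev.mono fun y hy => (hv y hy.1 hy.2).symm)
      (contMDiffAt_v hc hj hx).continuousAt.tendsto

end AdaptedPair

theorem hasDerivAt_trT (κ : ℝ) : HasDerivAt (trT κ) 1 0 := by
  have h1 : HasDerivAt (fun T : ℝ => 1 - κ * T) (-κ) 0 := by
    simpa using ((hasDerivAt_id (0 : ℝ)).const_mul κ).const_sub 1
  have h2 := (hasDerivAt_id (0 : ℝ)).div h1 (by simp)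
  simp only [id, mul_zero, sub_zero, one_mul, zero_mul, one_pow, div_one] at h2
  exact h2

theorem trU_zero (κ T : ℝ) : trU κ T 0 = 0 := by simp [trU]

namespace AdaptedPair

variable {x0 : X}

/-- Near a point of `D j`, the function `v̄_j` is a flat perturbation of `v_j`. -/
theorem exists_flatPert (P : AdaptedPair D ι) (hx : x0 ∈ c.dom) (hj : x0 ∈ D.D j) :
    ∃ (K : ℂ^n × ℝ² → ℝ) (W : Set (ℂ^n × ℝ²)),
      FlatPert K W ∧ (∀ u, (c.chart x0, 0, u) ∈ W) ∧ ∀ᶠ x in 𝓝 x0, D.f x ≠ 0 →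
        P.vBarX j x = c.v j x + K (c.chart x, c.t j x, c.u j x) := by
  obtain ⟨F, hF, hev⟩ := P.exists_finset x0
  have hex : ∀ p, ∃ h : X → ℂ, p ∈ F → HolAt n h x0 ∧ h x0 ≠ 0 ∧
      ∀ᶠ y in 𝓝 x0, (P.chart p).z j y = h y * c.z j y := fun p => by
    by_cases hp : p ∈ F
    · obtain ⟨h, hh⟩ := exists_unit (c' := P.chart p) hx (hF p hp) hj
      exact ⟨h, fun _ => hh⟩
    · exact ⟨0, fun h => absurd h hp⟩
  choose h hh using hex
  have hxs : c.chart.symm (c.chart x0) = x0 := c.chart.left_inv hx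
  have hsymm : Tendsto c.chart.symm (𝓝 (c.chart x0)) (𝓝 x0) := by
    have := (c.chart.continuousAt_symm (c.chart.map_source hx)).tendsto
    rwa [hxs] at this
  have hne : ∀ p ∈ F, ∀ᶠ y in 𝓝 x0, HolAt n (h p) y ∧ h p y ≠ 0 := fun p hp =>
    (hh p hp).1.eventually_nhds.and ((hh p hp).1.continuousAt.eventually_ne (hh p hp).2.1)
  have hB : ∀ᶠ ξ in 𝓝 (c.chart x0), ξ ∈ c.chart.target ∧ ∑ p ∈ F, P.τ p (c.chart.symm ξ) = 1 ∧
      ∀ p ∈ F, HolAt n (h p) (c.chart.symm ξ) ∧ h p (c.chart.symm ξ) ≠ 0 :=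
    (c.chart.open_target.eventually_mem (c.chart.map_source hx)).and
      ((hsymm.eventually (hev.mono fun x hx => hx.1)).and
        (hsymm.eventually ((Finset.eventually_all F).2 hne)))
  obtain ⟨B, hB, hBo, hxB⟩ := eventually_nhds_iff.1 hB
  set κ : ι → ℂ^n → ℝ := fun p ξ =>
    D.m j * log ‖h p (c.chart.symm ξ)‖ with hκ
  have hκs : ∀ p ∈ F, ∀ ξ ∈ B, ContDiffAt ℝ ∞ (κ p) ξ := fun p hp ξ hξ => by
    obtain ⟨h1, h2⟩ := (hB ξ hξ).2.2 p hp
    have h3 : ContDiffAt ℝ ∞ (fun ξ => h p (c.chart.symm ξ)) ξ := contMDiffAt_iff_contDiffAt.1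
      (ContMDiffAt.comp ξ h1.contMDiffAt (contMDiffAt_chart_symm (hB ξ hξ).1))
    exact contDiffAt_const.mul ((h3.norm ℝ h2).log (norm_ne_zero_iff.2 h2))
  have hτs : ∀ p, ∀ ξ ∈ B, ContDiffAt ℝ ∞ (fun ξ => P.τ p (c.chart.symm ξ)) ξ := fun p ξ hξ =>
    contMDiffAt_iff_contDiffAt.1 (ContMDiffAt.comp ξ (P.τ p).contMDiff.contMDiffAt
      (contMDiffAt_chart_symm (hB ξ hξ).1))
  set A : ι → ℂ^n × ℝ² → ℝ := fun p q => 1 - κ p q.1 * q.2.1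
  set C : ι → ℂ^n × ℝ² → ℝ := fun p q => 1 - q.2.2 * log (A p q)
  have hAs : ∀ p ∈ F, ∀ q, q.1 ∈ B → ContDiffAt ℝ ∞ (A p) q := fun p hp q hq =>
    contDiffAt_const.sub (((hκs p hp q.1 hq).comp q contDiffAt_fst).mul (by fun_prop))
  have hCs : ∀ p ∈ F, ∀ q, q.1 ∈ B → 0 < A p q → ContDiffAt ℝ ∞ (C p) q := fun p hp q hq h0 =>
    contDiffAt_const.sub (contDiffAt_snd.snd.mul ((hAs p hp q hq).log h0.ne'))
  refine ⟨fun q => ∑ p ∈ F, P.τ p (c.chart.symm q.1) *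
      (trT (κ p q.1) q.2.1 - trU (κ p q.1) q.2.1 q.2.2) - (q.2.1 - q.2.2),
    {q | q.1 ∈ B ∧ ∀ p ∈ F, 0 < A p q ∧ 0 < C p q}, ?_, ?_, ?_⟩
  · have hsm : ∀ q : ℂ^n × ℝ², q.1 ∈ B →
        (∀ p ∈ F, 0 < A p q ∧ 0 < C p q) → ContDiffAt ℝ ∞ (fun q => ∑ p ∈ F,
          P.τ p (c.chart.symm q.1) * (trT (κ p q.1) q.2.1 - trU (κ p q.1) q.2.1 q.2.2) -
          (q.2.1 - q.2.2)) q := fun q hq h1 => by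
      refine ContDiffAt.sub (ContDiffAt.sum fun p hp => ((hτs p q.1 hq).comp q contDiffAt_fst).mul
        (ContDiffAt.sub ?_ ?_)) (by fun_prop)
      · exact contDiffAt_snd.fst.div (hAs p hp q hq) (h1 p hp).1.ne'
      · exact contDiffAt_snd.snd.div (hCs p hp q hq (h1 p hp).1) (h1 p hp).2.ne'
    refine ⟨isOpen_iff_mem_nhds.2 fun q hq => ?_, fun q hq => (hsm q hq.1 hq.2).contDiffWithinAt,
      fun x u hx => ?_, fun x hx => ?_⟩
    · filter_upwards [continuous_fst.continuousAt.preimage_mem_nhds (hBo.mem_nhds hq.1),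
        (Finset.eventually_all F).2 fun p hp =>
          ((hAs p hp q hq.1).continuousAt.eventually (lt_mem_nhds (hq.2 p hp).1)).and
          ((hCs p hp q hq.1 (hq.2 p hp).1).continuousAt.eventually (lt_mem_nhds (hq.2 p hp).2))]
        with q' h1 h2 using ⟨h1, h2⟩
    · have h1 := (hB x hx.1).2.1
      simp only [trT, trU, mul_zero, sub_zero, Real.log_one, div_one, zero_sub,
        ← Finset.sum_mul, h1]
      ring
    · have h1 := (hB x hx.1).2.1
      have h2 := (((hsm _ hx.1 hx.2).differentiableAt (by simp)).hasFDerivAt).comp_hasDerivAt_of_eq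
        (0 : ℝ) (f := fun T : ℝ => (x, T, (0 : ℝ))) ((hasDerivAt_const (0 : ℝ) x).prodMk
          ((hasDerivAt_id (0 : ℝ)).prodMk (hasDerivAt_const (0 : ℝ) (0 : ℝ)))) rfl
      have h3 : HasDerivAt (fun T : ℝ => ∑ p ∈ F, P.τ p (c.chart.symm x) *
          (trT (κ p x) T - trU (κ p x) T 0) - (T - 0)) (∑ p ∈ F, P.τ p (c.chart.symm x) * 1 - 1) 0 := by
        simp only [trU_zero, sub_zero]
        exact (HasDerivAt.fun_sum fun p _ => (hasDerivAt_trT (κ p x)).const_mul _).sub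
          (hasDerivAt_id 0)
      rw [h2.unique h3, ← Finset.sum_mul, h1]
      norm_num
  · exact fun u => ⟨hxB, fun p _ => by simp [A, C]⟩
  · have h1 : ∀ᶠ x in 𝓝 x0, ∀ p ∈ F, x ∈ (P.chart p).dom ∧
        (P.chart p).z j x = h p x * c.z j x := (Finset.eventually_all F).2 fun p hp =>
      ((P.chart p).isOpen_dom.eventually_mem (hF p hp)).and (hh p hp).2.2
    filter_upwards [hev, h1, c.isOpen_dom.eventually_mem hx] with x h2 h3 h4 hf
    rw [vBarX_eq, h2.2]
    have h5 : ∀ p ∈ F, (P.chart p).vE j x =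
        trT (κ p (c.chart x)) (c.t j x) - trU (κ p (c.chart x)) (c.t j x) (c.u j x) := fun p hp => by
      obtain ⟨-, -, h6, h7⟩ := transition h4 (h3 p hp).1
        (mem_S_of_mem hx hj) (mem_S_of_mem (hF p hp) hj) hf (h3 p hp).2
      rw [AdaptedChart.vE, if_pos ⟨x0, hj, hF p hp⟩, AdaptedChart.v, h6, h7, hκ]
      simp only [show c.chart.symm (c.chart x) = x from c.chart.left_inv h4]
    rw [sum_congr rfl fun p hp => by rw [h5 p hp]]
    simp only [show c.chart.symm (c.chart x) = x from c.chart.left_inv h4, AdaptedChart.v]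
    ring

end AdaptedPair

theorem AdaptedChart.exists_v_eq {c : AdaptedChart D} {j : Fin D.N} {x0 : X} (hx : x0 ∈ c.dom)
    (hj : j ∈ c.S) (h : x0 ∉ D.D j) : ∃ R : X × ℝ → ℝ,
      ContMDiffAt ((𝓘^n).prod 𝓘(ℝ)) 𝓘(ℝ) ∞ R (x0, D.g x0) ∧
      ∀ᶠ x in 𝓝 x0, D.f x ≠ 0 → c.v j x = R (x, D.g x) := by
  have hT := t_pos hx hj h
  have hd : 1 + D.g x0 * log (c.t j x0) ≠ 0 := by
    by_cases hf : D.f x0 = 0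
    · simp [D.g_eq_zero hf]
    · exact (u_eq_uOf hx hj hf).1.2.ne'
  have h1 : ContDiffAt ℝ ∞ (fun p : ℝ² => p.2 - uOf p.1 p.2) (D.g x0, c.t j x0) :=
    contDiffAt_snd.sub (contDiffAt_fst.div (contDiffAt_const.add (contDiffAt_fst.mul
      (contDiffAt_snd.log hT.ne'))) hd)
  refine ⟨fun p => c.t j p.1 - uOf p.2 (c.t j p.1), ?_, ?_⟩
  · exact ContMDiffAt.comp (I' := 𝓘(ℝ, ℝ²)) (x0, D.g x0)
      (g := fun p : ℝ² => p.2 - uOf p.1 p.2) (f := fun p : X × ℝ => (p.2, c.t j p.1))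
      h1.contMDiffAt (contMDiffAt_snd.prodMk_space
        (ContMDiffAt.comp (x0, D.g x0) (f := Prod.fst) (contMDiffAt_t hx hj h) contMDiffAt_fst))
  · filter_upwards [c.isOpen_dom.eventually_mem hx] with x h2 h3
    rw [v, (u_eq_uOf h2 hj h3).2]

namespace AdaptedPair

theorem exists_vBarX_eq (P : AdaptedPair D ι) {x0 : X} (h : x0 ∉ D.D j) : ∃ R : X × ℝ → ℝ,
    ContMDiffAt ((𝓘^n).prod 𝓘(ℝ)) 𝓘(ℝ) ∞ R (x0, D.g x0) ∧
      ∀ᶠ x in 𝓝 x0, D.f x ≠ 0 → P.vBarX j x = R (x, D.g x) := by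
  obtain ⟨F, hF, hev⟩ := P.exists_finset x0
  have hex : ∀ p, ∃ R : X × ℝ → ℝ, p ∈ F → ContMDiffAt ((𝓘^n).prod 𝓘(ℝ)) 𝓘(ℝ) ∞ R (x0, D.g x0) ∧
      ∀ᶠ x in 𝓝 x0, D.f x ≠ 0 → (P.chart p).vE j x = R (x, D.g x) := fun p => by
    by_cases hp : p ∈ F
    · by_cases hne : (D.D j ∩ (P.chart p).dom).Nonempty
      · obtain ⟨R, hR⟩ := exists_v_eq (hF p hp) (mem_S_of_inter hne) h
        exact ⟨R, fun _ => by simpa only [AdaptedChart.vE, if_pos hne] using hR⟩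
      · exact ⟨fun _ => 0, fun _ => ⟨contMDiffAt_const, .of_forall fun x _ => by
          rw [AdaptedChart.vE, if_neg hne]⟩⟩
    · exact ⟨fun _ => 0, fun h => absurd h hp⟩
  choose R hR using hex
  refine ⟨fun q => ∑ p ∈ F, P.τ p q.1 * R p q, ContMDiffAt.sum fun p hp =>
    ((P.τ p).contMDiff.contMDiffAt.comp (x0, D.g x0) contMDiffAt_fst).mul (hR p hp).1, ?_⟩
  filter_upwards [hev, (Finset.eventually_all F).2 fun p hp => (hR p hp).2] with x h1 h2 hf
  rw [vBarX_eq, h1.2]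
  exact sum_congr rfl fun p hp => by rw [h2 p hp hf]

theorem lift_eventuallyEq {F : X → ℝ} {G : P.Space → ℝ} (hG : ∀ᶠ b in 𝓝 a, ContinuousAt G b)
    (h : ∀ᶠ b in 𝓝 a, b ∉ P.bd → F (P.proj b) = G b) : P.lift F =ᶠ[𝓝 a] G := by
  filter_upwards [hG, h.eventually_nhds] with b h1 h2 using lift_eq h1 h2

theorem continuous_g_space : Continuous P.g := D.continuous_g.comp P.continuous_proj

theorem eventually_continuousAt_comp {R : X × ℝ → ℝ}
    (hR : ContMDiffAt ((𝓘^n).prod 𝓘(ℝ)) 𝓘(ℝ) ∞ R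
      (P.proj a, P.g a)) : ∀ᶠ b in 𝓝 a, ContinuousAt (fun b => R (P.proj b, P.g b)) b := by
  have hc : Continuous fun b => (P.proj b, P.g b) := P.continuous_proj.prodMk continuous_g_space
  have h1 : ∀ᶠ q in 𝓝 (P.proj a, P.g a), ContinuousAt R q :=
    ((contMDiffAt_iff_contMDiffAt_nhds (by simp)).1 (hR.of_le (m := 1) (by simp))).mono
      fun q h => h.continuousAt
  filter_upwards [(hc.tendsto a).eventually h1] with b hb
  exact ContinuousAt.comp (f := fun b => (P.proj b, P.g b)) hb hc.continuousAt

theorem vBar_eventuallyEq (h : P.proj a ∉ D.D j) : ∃ R : X × ℝ → ℝ,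
    ContMDiffAt ((𝓘^n).prod 𝓘(ℝ)) 𝓘(ℝ) ∞ R (P.proj a, P.g a) ∧
      ∀ᶠ b in 𝓝 a, P.vBar j b = R (P.proj b, P.g b) := by
  obtain ⟨R, hR, he⟩ := P.exists_vBarX_eq h
  exact ⟨R, hR, lift_eventuallyEq (eventually_continuousAt_comp hR)
    (P.continuous_proj.continuousAt.eventually he)⟩

theorem vA_eventuallyEq (ha : P.proj a ∈ c.dom) (hj : j ∈ c.S) (h : P.proj a ∉ D.D j) :
    ∃ R : X × ℝ → ℝ, ContMDiffAt ((𝓘^n).prod 𝓘(ℝ)) 𝓘(ℝ) ∞ R (P.proj a, P.g a) ∧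
      ∀ᶠ b in 𝓝 a, P.vA c j b = R (P.proj b, P.g b) := by
  obtain ⟨R, hR, he⟩ := exists_v_eq ha hj h
  refine ⟨R, hR, ?_⟩
  have h1 : P.lift (c.v j) =ᶠ[𝓝 a] fun b => R (P.proj b, P.g b) :=
    lift_eventuallyEq (eventually_continuousAt_comp hR) (P.continuous_proj.continuousAt.eventually he)
  filter_upwards [h1, eventually_proj ha] with b h2 h3
  rw [← h2, lift_v h3 hj]

/-- The arguments of a flat perturbation, on the A'Campo space. -/
def ptA (c : AdaptedChart D) (j : Fin D.N) (a : P.Space) : ℂ^n × ℝ² :=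
  (c.chart (P.proj a), P.g a, P.vA c j a)

theorem continuousAt_ptA (ha : P.proj a ∈ c.dom) (hj : j ∈ c.S) :
    ContinuousAt (ptA (P := P) c j) a :=
  (continuousAt_chartA ha).prodMk (continuous_g_space.continuousAt.prodMk (continuousAt_vA ha hj))

theorem modelMap_ptA (ha : P.proj a ∈ c.dom) (hj : j ∈ c.S) :
    modelMap (ptA c j a) = (c.chart (P.proj a), c.t j (P.proj a), P.uA c j a) :=
  Prod.ext rfl (Prod.ext (UU_vA ha hj).1 (UU_vA ha hj).2)

theorem vBar_eventuallyEq_flat {K : ℂ^n × ℝ² → ℝ}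
    {W : Set (ℂ^n × ℝ²)} (hK : FlatPert K W) (ha : P.proj a ∈ c.dom)
    (hj : j ∈ c.S) (hW : modelMap (ptA c j a) ∈ W) (he : ∀ᶠ x in 𝓝 (P.proj a), D.f x ≠ 0 →
      P.vBarX j x = c.v j x + K (c.chart x, c.t j x, c.u j x)) :
    ∀ᶠ b in 𝓝 a, P.vBar j b = P.vA c j b + (K ∘ modelMap) (ptA c j b) := by
  have h1 : ∀ᶠ b in 𝓝 a, P.proj b ∈ c.dom ∧ modelMap (ptA c j b) ∈ W :=
    (eventually_proj ha).and ((continuous_modelMap.continuousAt.comp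
      (continuousAt_ptA ha hj)).eventually (hK.isOpen.eventually_mem hW))
  refine lift_eventuallyEq (h1.mono fun b hb => (continuousAt_vA hb.1 hj).add ?_) ?_
  · exact ContinuousAt.comp (f := ptA c j) ((hK.contDiffOn_one.contDiffAt
      ((hK.isOpen.preimage continuous_modelMap).mem_nhds hb.2)).continuousAt)
      (continuousAt_ptA hb.1 hj)
  · filter_upwards [P.continuous_proj.continuousAt.eventually he, h1] with b h2 h3 h4
    rw [h2 h4, comp_apply, modelMap_ptA h3.1 hj, vA, uA_of_ne h3.1 hj h4, AdaptedChart.v]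

theorem exists_vBar_eventuallyEq_flat (ha : P.proj a ∈ c.dom) (hj : P.proj a ∈ D.D j) :
    ∃ (K : ℂ^n × ℝ² → ℝ) (W : Set (ℂ^n × ℝ²)),
      FlatPert K W ∧ modelMap (ptA c j a) ∈ W ∧ TT (ptA c j a).2 = 0 ∧
      ∀ᶠ b in 𝓝 a, P.vBar j b = P.vA c j b + (K ∘ modelMap) (ptA c j b) := by
  obtain ⟨K, W, hK, h1, h2⟩ := P.exists_flatPert ha hj
  have hjS := mem_S_of_mem ha hj
  have h3 : modelMap (ptA c j a) ∈ W := by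
    rw [modelMap_ptA ha hjS, t_eq_zero ha hj]
    exact h1 _
  exact ⟨K, W, hK, h3, (UU_vA ha hjS).1.trans (t_eq_zero ha hj),
    vBar_eventuallyEq_flat hK ha hjS h3 h2⟩

variable (P c) in
open Classical in
/-- The functions which determine the smooth structure of the A'Campo space over an adapted
chart. -/
def can (a : P.Space) : X × ℝ × (Fin D.N → ℝ) × (Fin D.N → ℂ) :=
  (P.proj a, P.g a, fun j => P.vBar j a, fun j => if j ∈ c.S then (a.1.1.arg (c.z j) : ℂ) else 1)

/-- The model with corners of the target of `can`. -/
abbrev canModel (D : Degeneration n X) := (𝓘^n).prod 𝓘(ℝ, ℝ × (Fin D.N → ℝ) × (Fin D.N → ℂ))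

theorem can_snd_of_mem (hj : j ∈ c.S) : (P.can c a).2.2.2 j = (a.1.1.arg (c.z j) : ℂ) := if_pos hj

theorem contMDiffAt_comp_snd {F : Type*} [NormedAddCommGroup F] [NormedSpace ℝ F]
    {φ : ℝ × (Fin D.N → ℝ) × (Fin D.N → ℂ) → F} {r : WithTop ℕ∞} (hφ : ContDiff ℝ r φ)
    (q : X × ℝ × (Fin D.N → ℝ) × (Fin D.N → ℂ)) :
    ContMDiffAt (canModel D) 𝓘(ℝ, F) r (fun q => φ q.2) q :=
  ContMDiffAt.comp (I' := 𝓘(ℝ, ℝ × (Fin D.N → ℝ) × (Fin D.N → ℂ))) q (f := Prod.snd)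
    hφ.contMDiff.contMDiffAt contMDiffAt_snd

theorem contMDiffAt_comp_fst {F : Type*} [NormedAddCommGroup F] [NormedSpace ℝ F]
    {φ : X → F} {r : WithTop ℕ∞} {q : X × ℝ × (Fin D.N → ℝ) × (Fin D.N → ℂ)}
    (hφ : ContMDiffAt 𝓘^n 𝓘(ℝ, F) r φ q.1) :
    ContMDiffAt (canModel D) 𝓘(ℝ, F) r (fun q => φ q.1) q :=
  ContMDiffAt.comp (I' := 𝓘^n) q (f := Prod.fst) hφ contMDiffAt_fst

theorem exists_can_eq {c' : AdaptedChart D} (ha : P.proj a ∈ c.dom) (ha' : P.proj a ∈ c'.dom) :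
    ∃ Ψ, ContMDiffAt (canModel D) (canModel D) ∞ Ψ (P.can c a) ∧
      ∀ᶠ b in 𝓝 a, P.can c' b = Ψ (P.can c b) := by
  have key : ∀ j, ∃ φ : X × ℝ × (Fin D.N → ℝ) × (Fin D.N → ℂ) → ℂ,
      ContMDiffAt (canModel D) 𝓘(ℝ, ℂ) ∞ φ (P.can c a) ∧
      ∀ᶠ b in 𝓝 a, (P.can c' b).2.2.2 j = φ (P.can c b) := by
    intro j
    by_cases hj : j ∈ c'.S
    · by_cases h : P.proj a ∈ D.D j
      · obtain ⟨u, hu, hu0, he⟩ := exists_unit (c' := c') ha ha' h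
        refine ⟨fun q => angle (u q.1) * q.2.2.2 j,
          ContMDiffAt.comp (I' := 𝓘(ℝ, ℂ × ℂ)) (I := canModel D) (P.can c a)
            (contDiff_mul (𝕜 := ℝ) (𝔸 := ℂ)).contMDiff.contMDiffAt
            (ContMDiffAt.prodMk_space ?_ ?_), ?_⟩
        · exact ContMDiffAt.comp (I' := 𝓘(ℝ, ℂ)) (P.can c a) (g := angle) (f := fun q => u q.1)
            (contDiffAt_angle hu0).contMDiffAt (contMDiffAt_comp_fst hu.contMDiffAt)
        · exact contMDiffAt_comp_snd (φ := fun q => q.2.2 j) (by fun_prop) _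
        · filter_upwards [P.continuous_proj.continuousAt.eventually
            (Degeneration.KatoNakayama.eventually_arg_eq ha h hu hu0 he),
            P.continuous_proj.continuousAt.eventually (hu.eventually_nhds.and
              (hu.continuousAt.eventually_ne hu0))] with b h1 h2
          rw [can_snd_of_mem hj, can_snd_of_mem (mem_S_of_mem ha h)]
          have h3 : (b.1.1.arg u : ℂ) = angle (u (P.proj b)) := b.1.1.arg_unit h2.1 h2.2
          exact (congrArg (fun θ : Circle => (θ : ℂ)) (h1 b.1.1 rfl)).trans
            (congrArg (· * (b.1.1.arg (c.z j) : ℂ)) h3)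
      · have hz : c'.z j (P.proj a) ≠ 0 := fun h0 => h ((z_eq_zero_iff ha' hj).1 h0)
        refine ⟨fun q => angle (c'.z j q.1), ?_, ?_⟩
        · exact ContMDiffAt.comp (I' := 𝓘(ℝ, ℂ)) (P.can c a) (g := angle)
            (f := fun q => c'.z j q.1) (contDiffAt_angle hz).contMDiffAt
            (contMDiffAt_comp_fst (contMDiffAt_z ha' j))
        · have h1 := holAt_z ha' j
          filter_upwards [P.continuous_proj.continuousAt.eventually (h1.eventually_nhds.and
              (h1.continuousAt.eventually_ne hz))] with b h2
          rw [can_snd_of_mem hj]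
          exact b.1.1.arg_unit h2.1 h2.2
    · exact ⟨fun _ => 1, contMDiffAt_const, .of_forall fun b => if_neg hj⟩
  choose φ hφ he using key
  refine ⟨fun q => (q.1, q.2.1, q.2.2.1, fun j => φ j q), ?_, ?_⟩
  · refine contMDiffAt_fst.prodMk (ContMDiffAt.prodMk_space ?_ (ContMDiffAt.prodMk_space ?_
      (contMDiffAt_pi_space.2 hφ)))
    · exact contMDiffAt_comp_snd contDiff_fst _
    · exact contMDiffAt_comp_snd contDiff_snd.fst _
  · filter_upwards [eventually_all.2 he] with b hb
    exact Prod.ext rfl (Prod.ext rfl (Prod.ext rfl (funext fun j => hb j)))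

theorem contMDiffAt_canPair (q : X × ℝ × (Fin D.N → ℝ) × (Fin D.N → ℂ)) :
    ContMDiffAt (canModel D) ((𝓘^n).prod 𝓘(ℝ)) ∞
      (fun q : X × ℝ × (Fin D.N → ℝ) × (Fin D.N → ℂ) => (q.1, q.2.1)) q :=
  contMDiffAt_fst.prodMk (contMDiffAt_comp_snd contDiff_fst _)

theorem exists_vA_eq (ha : P.proj a ∈ c.dom) (hj : j ∈ c.S) :
    ∃ Ψ, ContMDiffAt (canModel D) 𝓘(ℝ) 1 Ψ (P.can c a) ∧
      ∀ᶠ b in 𝓝 a, P.vA c j b = Ψ (P.can c b) := by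
  by_cases h : P.proj a ∈ D.D j
  · obtain ⟨K, W, hK, h1, h2, h3⟩ := exists_vBar_eventuallyEq_flat ha h
    set f : ((ℂ^n × ℝ) × ℝ) × ℝ → ℝ :=
      fun q => q.2 + (K ∘ modelMap) (q.1.1.1, q.1.1.2, q.2) - q.1.2 with hf
    set p : (ℂ^n × ℝ) × ℝ := ((c.chart (P.proj a), P.g a), P.vBar j a)
    have hKc : ContDiffAt ℝ 1 (K ∘ modelMap) (ptA c j a) := hK.contDiffOn_one.contDiffAt
      ((hK.isOpen.preimage continuous_modelMap).mem_nhds h1)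
    have hfc : ContDiffAt ℝ 1 f (p, P.vA c j a) := by
      refine (contDiffAt_snd.add (ContDiffAt.comp (p, P.vA c j a)
        (f := fun q : ((ℂ^n × ℝ) × ℝ) × ℝ => (q.1.1.1, q.1.1.2, q.2)) hKc ?_)).sub (by fun_prop)
      fun_prop
    have hfd : HasDerivAt (fun s => f (p, s)) 1 (P.vA c j a) := by
      have h4 : HasDerivAt (fun s : ℝ => (K ∘ modelMap) (c.chart (P.proj a), P.g a, s)) 0
          (P.vA c j a) := (hK.hasFDerivAt_zero h1 h2).comp_hasDerivAt_of_eq (P.vA c j a)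
          (f := fun s : ℝ => (c.chart (P.proj a), P.g a, s)) ((hasDerivAt_const _ _).prodMk
            ((hasDerivAt_const _ _).prodMk (hasDerivAt_id _))) rfl
      exact (((hasDerivAt_id (P.vA c j a)).add h4).sub_const (P.vBar j a)).congr_deriv (add_zero _)
    obtain ⟨φ, hφ, -, -, hφu⟩ := exists_implicit_scalar one_ne_zero hfc hfd one_ne_zero
    have h0 : ∀ᶠ b in 𝓝 a, f (((c.chart (P.proj b), P.g b), P.vBar j b), P.vA c j b) = 0 := by
      filter_upwards [h3] with b hb
      simp only [hf, hb, ptA]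
      ring
    refine ⟨fun q => φ ((c.chart q.1, q.2.1), q.2.2.1 j), ?_, ?_⟩
    · refine ContMDiffAt.comp (I' := 𝓘(ℝ, (ℂ^n × ℝ) × ℝ)) (P.can c a) (g := φ)
        (f := fun q : X × ℝ × (Fin D.N → ℝ) × (Fin D.N → ℂ) => ((c.chart q.1, q.2.1), q.2.2.1 j))
        hφ.contMDiffAt (ContMDiffAt.prodMk_space (ContMDiffAt.prodMk_space ?_ ?_) ?_)
      · exact contMDiffAt_comp_fst ((contMDiffAt_chart ha).of_le (by simp))
      · exact contMDiffAt_comp_snd contDiff_fst _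
      · exact contMDiffAt_comp_snd (φ := fun q => q.2.1 j) (by fun_prop) _
    · have hvB : ContinuousAt (P.vBar j) a := by
        refine ContinuousAt.congr ?_ (h3.mono fun b hb => hb.symm)
        exact (continuousAt_vA ha hj).add
          (ContinuousAt.comp (f := ptA c j) hKc.continuousAt (continuousAt_ptA ha hj))
      have hc : ContinuousAt (fun b => (((c.chart (P.proj b), P.g b), P.vBar j b), P.vA c j b)) a :=
        (((continuousAt_chartA ha).prodMk continuous_g_space.continuousAt).prodMk hvB).prodMk
          (continuousAt_vA ha hj)
      filter_upwards [hc.eventually hφu, h0] with b h4 h5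
      have h6 : f (p, P.vA c j a) = 0 := h0.self_of_nhds
      exact (h4.1 (h5.trans h6.symm)).symm
  · obtain ⟨R, hR, he⟩ := vA_eventuallyEq ha hj h
    exact ⟨fun q => R (q.1, q.2.1), ContMDiffAt.comp (P.can c a) (g := R)
      (f := fun q : X × ℝ × (Fin D.N → ℝ) × (Fin D.N → ℂ) => (q.1, q.2.1))
      (hR.of_le (by simp)) ((contMDiffAt_canPair _).of_le (by simp)), he⟩

end AdaptedPair

namespace AdaptedPair

section Can

variable {E' H' M : Type*} [NormedAddCommGroup E'] [NormedSpace ℝ E'] [TopologicalSpace H']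
  {J : ModelWithCorners ℝ E' H'} [TopologicalSpace M] [ChartedSpace H' M] {H : M → P.Space}
  {s : Set M} {e : M} {r : WithTop ℕ∞}

theorem contMDiffWithinAt_can (h1 : ContMDiffWithinAt J 𝓘^n r (fun y => P.proj (H y)) s e)
    (h2 : ContMDiffWithinAt J 𝓘(ℝ) r (fun y => P.g (H y)) s e)
    (h3 : ∀ j, ContMDiffWithinAt J 𝓘(ℝ) r (fun y => P.vBar j (H y)) s e)
    (h4 : ∀ j ∈ c.S, ContMDiffWithinAt J 𝓘(ℝ, ℂ) r (fun y => ((H y).1.1.arg (c.z j) : ℂ)) s e) :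
    ContMDiffWithinAt J (canModel D) r (fun y => P.can c (H y)) s e := by
  refine h1.prodMk (h2.prodMk_space (ContMDiffWithinAt.prodMk_space
    (contMDiffWithinAt_pi_space.2 h3) (contMDiffWithinAt_pi_space.2 fun j => ?_)))
  by_cases hj : j ∈ c.S
  · simpa only [if_pos hj] using h4 j hj
  · simpa only [if_neg hj] using contMDiffWithinAt_const

theorem contMDiffWithinAt_comp_pair {R : X × ℝ → ℝ} (hr : r ≤ ∞)
    (hR : ContMDiffAt ((𝓘^n).prod 𝓘(ℝ)) 𝓘(ℝ) ∞ R (P.proj (H e), P.g (H e)))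
    (h1 : ContMDiffWithinAt J 𝓘^n r (fun y => P.proj (H y)) s e)
    (h2 : ContMDiffWithinAt J 𝓘(ℝ) r (fun y => P.g (H y)) s e) :
    ContMDiffWithinAt J 𝓘(ℝ) r (fun y => R (P.proj (H y), P.g (H y))) s e :=
  ContMDiffAt.comp_contMDiffWithinAt e (g := R) (f := fun y => (P.proj (H y), P.g (H y)))
    (hR.of_le hr) (h1.prodMk h2)

theorem contMDiffWithinAt_vBar_of_notMem (hr : r ≤ ∞) (hH : ContinuousWithinAt H s e) (he : e ∈ s)
    (hj : P.proj (H e) ∉ D.D j) (h1 : ContMDiffWithinAt J 𝓘^n r (fun y => P.proj (H y)) s e)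
    (h2 : ContMDiffWithinAt J 𝓘(ℝ) r (fun y => P.g (H y)) s e) :
    ContMDiffWithinAt J 𝓘(ℝ) r (fun y => P.vBar j (H y)) s e := by
  obtain ⟨R, hR, hev⟩ := vBar_eventuallyEq hj
  exact (contMDiffWithinAt_comp_pair hr hR h1 h2).congr_of_eventuallyEq_of_mem
    (hH.eventually hev) he

end Can

theorem contMDiffWithinAt_can_psiInv [Nonempty P.Space] (hi : i ∈ c.S) {y : CoordSpace c i}
    (hy : y ∈ src c i ∩ Q c i) : ContMDiffWithinAt 𝓘(ℝ, CoordSpace c i) (canModel D) 1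
      (fun y => P.can c (P.psiInv c i y)) (src c i ∩ Q c i) y := by
  have hcont := continuousOn_psiInv (P := P) hi y hy
  have h1 : ContMDiffWithinAt 𝓘(ℝ, CoordSpace c i) 𝓘^n 1
      (fun y => P.proj (P.psiInv c i y)) (src c i ∩ Q c i) y :=
    ((contMDiffAt_xCo hy.1).of_le (by simp)).contMDiffWithinAt.congr
      (fun y hy => proj_psiInv hi hy) (proj_psiInv hi hy)
  have h2 : ContMDiffWithinAt 𝓘(ℝ, CoordSpace c i) 𝓘(ℝ) 1
      (fun y => P.g (P.psiInv c i y)) (src c i ∩ Q c i) y :=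
    (contDiff_fst.contMDiff.contMDiffAt (x := y)).contMDiffWithinAt.congr
      (fun y hy => congrArg (·.1) (psiA_psiInv (P := P) hi hy))
      (congrArg (·.1) (psiA_psiInv (P := P) hi hy))
  refine contMDiffWithinAt_can h1 h2 (fun j => ?_) fun j hj => ?_
  · by_cases hj : P.proj (P.psiInv c i y) ∈ D.D j
    · have hd := (psiInv_mem (P := P) hi hy).1
      have hjS := mem_S_of_mem hd hj
      obtain ⟨K, W, hK, hW, -, hev⟩ := exists_vBar_eventuallyEq_flat hd hj
      have hp : ∀ y ∈ src c i ∩ Q c i, ptA c j (P.psiInv c i y) = (zCo y, y.1, sCo y ⟨j, hjS⟩) :=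
        fun y hy => Prod.ext (by rw [ptA, proj_psiInv hi hy, chart_xCo hy.1])
          (Prod.ext (congrArg (·.1) (psiA_psiInv (P := P) hi hy)) (vA_psiInv hi hy ⟨j, hjS⟩))
      have hs : ContDiffAt ℝ 1 (fun y : CoordSpace c i => sCo y ⟨j, hjS⟩) y :=
        (contDiffAt_sCo (pos_of_mem_src hy.1) ⟨j, hjS⟩).of_le (by simp)
      have hKc : ContDiffAt ℝ 1 (K ∘ modelMap) (zCo y, y.1, sCo y ⟨j, hjS⟩) := by
        rw [← hp y hy]
        exact hK.contDiffOn_one.contDiffAt ((hK.isOpen.preimage continuous_modelMap).mem_nhds hW)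
      have hc : ContDiffAt ℝ 1 (fun y : CoordSpace c i => sCo y ⟨j, hjS⟩ +
          (K ∘ modelMap) (zCo y, y.1, sCo y ⟨j, hjS⟩)) y := hs.add (ContDiffAt.comp y
          (f := fun y : CoordSpace c i => (zCo y, y.1, sCo y ⟨j, hjS⟩)) hKc
          (((contDiffAt_zCo (pos_of_mem_src hy.1)).of_le (by simp)).prodMk
            (contDiffAt_fst.prodMk hs)))
      refine hc.contMDiffAt.contMDiffWithinAt.congr_of_eventuallyEq_of_mem ?_ hy
      filter_upwards [hcont.eventually hev, self_mem_nhdsWithin] with y' h3 h4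
      rw [h3, hp y' h4, vA_psiInv hi h4 ⟨j, hjS⟩]
    · exact contMDiffWithinAt_vBar_of_notMem (by simp) hcont hy hj h1 h2
  · have h3 : ContDiff ℝ 1 fun y : CoordSpace c i => y.2.2.1 ⟨j, hj⟩ := by fun_prop
    exact (h3.contMDiff.contMDiffAt (x := y)).contMDiffWithinAt.congr
      (fun y hy => arg_psiInv hi hy ⟨j, hj⟩) (arg_psiInv hi hy ⟨j, hj⟩)

end AdaptedPair

section SmallCharts

variable [T2Space X] {x0 : X} {e : OpenPartialHomeomorph X ℂ^n}
  {idx : Fin D.N → Fin n} {I : Finset (Fin D.N)}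

open Metric

theorem exists_adaptedChart (he : e ∈ IsManifold.maximalAtlas 𝓘(ℂ, ℂ^n) ω X)
    (hx : x0 ∈ e.source) (hI : ∀ j, x0 ∈ D.D j ↔ j ∈ I) (hidx : InjOn idx I)
    (hz : ∀ j ∈ I, ∀ x ∈ e.source, (x ∈ D.D j ↔ e x (idx j) = 0))
    (hf : ∀ x ∈ e.source, D.f x = ∏ j ∈ I, e x (idx j) ^ D.m j) {U : Set X} (hU : U ∈ 𝓝 x0) :
    ∃ (ρ : ℝ) (c : AdaptedChart D), (c.chart : X → ℂ^n) = e ∧ c.idx = idx ∧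
      c.S = I ∧ x0 ∈ c.dom ∧ c.dom ⊆ U ∧ c.chart.target = ball (e x0) ρ := by
  have h1 : ∀ᶠ x in 𝓝 x0, x ∈ e.source ∧ x ∈ U ∧ (∀ j, j ∉ I → x ∉ D.D j) ∧
      ∀ j ∈ I, ‖e x (idx j)‖ < exp (-1) := by
    refine (e.open_source.eventually_mem hx).and 
      ((show ∀ᶠ x in 𝓝 x0, x ∈ U from hU).and (Filter.Eventually.and ?_ ?_))
    · refine eventually_all.2 fun j => ?_
      by_cases hj : j ∈ I
      · exact .of_forall fun x h => absurd hj h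
      · exact ((D.isClosed_D j).isOpen_compl.eventually_mem (fun h => hj ((hI j).1 h))).mono
          fun x hx _ => hx
    · refine (Finset.eventually_all I).2 fun j hj => ?_
      have h2 : ContinuousAt (fun x => ‖e x (idx j)‖) x0 :=
        (ContinuousAt.comp (f := e) (EuclideanSpace.proj (𝕜 := ℂ) (idx j) :
          ℂ^n →L[ℂ] ℂ).continuous.continuousAt (e.continuousAt hx)).norm
      refine h2.eventually_lt continuousAt_const ?_
      rw [(hz j hj x0 hx).1 ((hI j).2 hj), norm_zero]
      exact Real.exp_pos _
  have h2 : ∀ᶠ ξ in 𝓝 (e x0), ξ ∈ e.target ∧ e.symm ξ ∈ U ∧ (∀ j, j ∉ I → e.symm ξ ∉ D.D j) ∧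
      ∀ j ∈ I, ‖e (e.symm ξ) (idx j)‖ < exp (-1) := by
    have h3 := (e.continuousAt_symm (e.map_source hx)).tendsto
    rw [e.left_inv hx] at h3
    exact (e.open_target.eventually_mem (e.map_source hx)).and ((h3.eventually h1).mono
      fun ξ h => h.2)
  obtain ⟨ρ, hρ, hball⟩ := nhds_basis_closedBall.eventually_iff.1 h2
  have hsub : ball (e x0) ρ ⊆ e.target := fun ξ h => (hball (ball_subset_closedBall h)).1
  set s : Set X := e.source ∩ e ⁻¹' ball (e x0) ρ
  have hso : IsOpen s := e.isOpen_inter_preimage isOpen_ball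
  set e' := e.restr s with he'
  have hsrc : e'.source = s := (e.restr_source' s hso).trans (inter_eq_right.2 inter_subset_left)
  have htgt : e'.target = ball (e x0) ρ := by
    ext ξ
    rw [he', e.restr_target, hso.interior_eq]
    constructor
    · rintro ⟨h3, -, h4⟩
      rwa [mem_preimage, e.right_inv h3] at h4
    · exact fun h => ⟨hsub h, e.map_target (hsub h), by rwa [mem_preimage, e.right_inv (hsub h)]⟩
  have hcpt : IsCompact (e.symm '' closedBall (e x0) ρ) :=
    (isCompact_closedBall _ _).image_of_continuousOn
      (e.continuousOn_symm.mono fun ξ h => (hball h).1)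
  have hclos : closure e'.source ⊆ e.symm '' closedBall (e x0) ρ := by
    refine closure_minimal ?_ hcpt.isClosed
    rw [hsrc]
    exact fun x h => ⟨e x, ball_subset_closedBall h.2, e.left_inv h.1⟩
  have hcl : ∀ x ∈ closure e'.source, x ∈ e.source ∧ x ∈ U ∧ (∀ j, j ∉ I → x ∉ D.D j) ∧
      ∀ j ∈ I, ‖e x (idx j)‖ < exp (-1) := fun x h => by
    obtain ⟨ξ, h3, rfl⟩ := hclos h
    exact ⟨e.map_target (hball h3).1, (hball h3).2⟩
  have hx' : x0 ∈ e'.source := by rw [hsrc]; exact ⟨hx, mem_ball_self hρ⟩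
  have hS : D.indexSet e'.source = I := by
    ext j
    simp only [Degeneration.indexSet, mem_filter]
    constructor
    · rintro ⟨-, x, h3, h4⟩
      by_contra h5
      exact (hcl x h4).2.2.1 j h5 h3
    · exact fun h => ⟨Finset.mem_univ _, x0, (hI j).2 h, subset_closure hx'⟩
  have hsub' : ∀ x ∈ e'.source, x ∈ closure e'.source := fun x h => subset_closure h
  refine ⟨ρ, ⟨e', ?_, idx, hS ▸ hidx, ?_, ?_, ?_, ?_, e, ?_, fun _ _ => rfl⟩, rfl, rfl, hS, hx',
    fun x h => (hcl x (hsub' x h)).2.1, htgt⟩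
  · exact restr_mem_maximalAtlas _ he hso
  · rw [hS]
    exact fun j hj x h => hz j hj x (hcl x (hsub' x h)).1
  · rw [hS]
    exact fun _ x h => hf x (hcl x (hsub' x h)).1
  · rw [hS]
    exact fun j hj x h => (hcl x (hsub' x h)).2.2.2 j hj
  · exact hcpt.of_isClosed_subset isClosed_closure hclos
  · exact e.continuousOn.mono fun x h => (hcl x h).1

end SmallCharts

section Root

open Complex

/-- Multiplication of one coordinate by a function. -/
def mulCoord (b : Fin n) (k : ℂ^n → ℂ) (ξ : ℂ^n) :
    ℂ^n := ξ + EuclideanSpace.single b (ξ b * (k ξ - 1))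

theorem mulCoord_self (b : Fin n) (k : ℂ^n → ℂ) (ξ : ℂ^n) : mulCoord b k ξ b = ξ b * k ξ := by
  simp [mulCoord]; ring

theorem mulCoord_of_ne {b b' : Fin n} (h : b' ≠ b) (k : ℂ^n → ℂ)
    (ξ : ℂ^n) : mulCoord b k ξ b' = ξ b' := by
  simp [mulCoord, h]

theorem contDiffOn_mulCoord {b : Fin n} {k : ℂ^n → ℂ} {s : Set ℂ^n} (hk : ContDiffOn ℂ ω k s) :
    ContDiffOn ℂ ω (mulCoord b k) s := by
  have h1 : ContDiff ℂ ω fun z : ℂ => (EuclideanSpace.single b z : ℂ^n) := by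
    rw [contDiff_euclidean]
    intro b'
    by_cases h : b' = b
    · have : (fun z : ℂ => EuclideanSpace.single b z b') = id := by ext; simp [h]
      rw [this]
      exact contDiff_id
    · have : (fun z : ℂ => EuclideanSpace.single b z b') = fun _ => 0 := by ext; simp [h]
      rw [this]
      exact contDiff_const
  have h2 : ContDiff ℂ ω fun ξ : ℂ^n => ξ b :=
    (EuclideanSpace.proj (𝕜 := ℂ) b : ℂ^n →L[ℂ] ℂ).contDiff
  exact contDiffOn_id.add (h1.comp_contDiffOn (h2.contDiffOn.mul (hk.sub contDiffOn_const)))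

/-- Multiplication of one coordinate by a nonvanishing function of the other coordinates. -/
def mulCoordHomeo (b : Fin n) (k : ℂ^n → ℂ) (O : Set ℂ^n)
    (hO : IsOpen O) (hk : ContDiffOn ℂ ω k O) (hk0 : ∀ ξ ∈ O, k ξ ≠ 0)
    (hinv : ∀ ξ ∈ O, ∀ k' : ℂ^n → ℂ, mulCoord b k' ξ ∈ O ∧ k (mulCoord b k' ξ) = k ξ) :
    OpenPartialHomeomorph ℂ^n ℂ^n where
  toFun := mulCoord b k
  invFun := mulCoord b fun ξ => (k ξ)⁻¹
  source := O
  target := O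
  map_source' ξ h := (hinv ξ h _).1
  map_target' ξ h := (hinv ξ h _).1
  left_inv' ξ h := by
    ext b'
    by_cases hb : b' = b
    · rw [hb, mulCoord_self, mulCoord_self, (hinv ξ h _).2, mul_inv_cancel_right₀ (hk0 ξ h)]
    · rw [mulCoord_of_ne hb, mulCoord_of_ne hb]
  right_inv' ξ h := by
    ext b'
    by_cases hb : b' = b
    · rw [hb, mulCoord_self, mulCoord_self, (hinv ξ h _).2, inv_mul_cancel_right₀ (hk0 ξ h)]
    · rw [mulCoord_of_ne hb, mulCoord_of_ne hb]
  open_source := hO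
  open_target := hO
  continuousOn_toFun := (contDiffOn_mulCoord hk).continuousOn
  continuousOn_invFun := (contDiffOn_mulCoord (hk.inv hk0)).continuousOn

theorem exists_root {m : ℕ} (hm : m ≠ 0) (J : Finset (Fin n)) (p : Fin n → ℕ)
    {ξ₀ : ℂ^n} (h0 : ∀ b ∈ J, ξ₀ b ≠ 0) : ∃ (k : ℂ^n → ℂ) (O : Set ℂ^n), IsOpen O ∧ ξ₀ ∈ O ∧
      ContDiffOn ℂ ω k O ∧ (∀ ξ ∈ O, k ξ ≠ 0 ∧ k ξ ^ m = ∏ b ∈ J, ξ b ^ p b) ∧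
      ∀ ξ ξ', (∀ b ∈ J, ξ b = ξ' b) → (ξ ∈ O → ξ' ∈ O) ∧ k ξ = k ξ' := by
  set h : ℂ^n → ℂ := fun ξ => ∏ b ∈ J, ξ b ^ p b
  have hh0 : h ξ₀ ≠ 0 := Finset.prod_ne_zero_iff.2 fun b hb => pow_ne_zero _ (h0 b hb)
  have hsm : ContDiff ℂ ω h := contDiff_prod fun b _ =>
    (EuclideanSpace.proj (𝕜 := ℂ) b : ℂ^n →L[ℂ] ℂ).contDiff.pow _
  obtain ⟨a, ha⟩ := IsAlgClosed.exists_pow_nat_eq (h ξ₀) (Nat.pos_of_ne_zero hm)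
  have ha0 : a ≠ 0 := fun h1 => hh0 (by rw [← ha, h1, zero_pow hm])
  have hd : ContDiff ℂ ω fun ξ => h ξ / h ξ₀ := hsm.div_const _
  refine ⟨fun ξ => a * exp (log (h ξ / h ξ₀) / m), {ξ | h ξ / h ξ₀ ∈ slitPlane},
    isOpen_slitPlane.preimage hd.continuous, ?_, ?_, ?_, ?_⟩
  · change h ξ₀ / h ξ₀ ∈ slitPlane
    rw [div_self hh0]
    exact one_mem_slitPlane
  · intro ξ hξ
    exact (contDiffAt_const.mul ((((contDiffAt_log hξ).comp ξ hd.contDiffAt).div_const _).cexp)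
      ).contDiffWithinAt
  · intro ξ hξ
    refine ⟨mul_ne_zero ha0 (exp_ne_zero _), ?_⟩
    rw [mul_pow, ha, ← exp_nat_mul, mul_div_cancel₀ _ (Nat.cast_ne_zero.2 hm),
      exp_log (slitPlane_ne_zero hξ), mul_div_cancel₀ _ hh0]
  · intro ξ ξ' hξ
    have : h ξ = h ξ' := prod_congr rfl fun b hb => by rw [hξ b hb]
    simp only [mem_ofPred_eq, this]
    exact ⟨id, trivial⟩

end Root

theorem trans_mem_maximalAtlas {e : OpenPartialHomeomorph X ℂ^n} {χ : OpenPartialHomeomorph ℂ^n ℂ^n}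
    (he : e ∈ IsManifold.maximalAtlas 𝓘(ℂ, ℂ^n) ω X) (hχ : χ ∈ contDiffGroupoid ω 𝓘(ℂ, ℂ^n)) :
    e.trans χ ∈ IsManifold.maximalAtlas 𝓘(ℂ, ℂ^n) ω X := by
  rw [IsManifold.mem_maximalAtlas_iff] at he ⊢
  intro e' he'
  obtain ⟨h1, h2⟩ := he e' he'
  generalize contDiffGroupoid ω 𝓘(ℂ, ℂ^n) = G at h1 h2 hχ ⊢
  rw [OpenPartialHomeomorph.trans_symm_eq_symm_trans_symm, OpenPartialHomeomorph.trans_assoc,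
    ← OpenPartialHomeomorph.trans_assoc e'.symm]
  exact ⟨G.trans (G.symm hχ) h1, G.trans h2 hχ⟩

/-- Near a point of the divisor, there is a chart in which `f` is a monomial in the equations of the
components through that point. -/
theorem exists_monomial_chart {c : AdaptedChart D} (hx : x0 ∈ c.dom) {I : Finset (Fin D.N)}
    (hI : ∀ j, x0 ∈ D.D j ↔ j ∈ I) (hne : I.Nonempty) :
    ∃ e ∈ IsManifold.maximalAtlas 𝓘(ℂ, ℂ^n) ω X, x0 ∈ e.source ∧
      (∀ j ∈ I, ∀ x ∈ e.source, (x ∈ D.D j ↔ e x (c.idx j) = 0)) ∧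
      ∀ x ∈ e.source, D.f x = ∏ j ∈ I, e x (c.idx j) ^ D.m j := by
  have hIS : I ⊆ c.S := fun j hj => mem_S_of_mem hx ((hI j).2 hj)
  obtain ⟨j₀, hj₀⟩ := hne
  set b := c.idx j₀ with hb
  have hinj : ∀ {j j'}, j ∈ c.S → j' ∈ c.S → c.idx j = c.idx j' → j = j' := fun h h' h'' =>
    c.idx_injOn h h' h''
  have hneb : ∀ j ∈ c.S, j ≠ j₀ → c.idx j ≠ b := fun j hj h h' => h (hinj hj (hIS hj₀) h')
  have hJ : ∀ b' ∈ (c.S \ I).image c.idx, c.chart x0 b' ≠ 0 := by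
    intro b' hb'
    obtain ⟨j, hj, rfl⟩ := Finset.mem_image.1 hb'
    rw [Finset.mem_sdiff] at hj
    exact fun h => hj.2 ((hI j).1 ((z_eq_zero_iff hx hj.1).1 h))
  set p : Fin n → ℕ := fun b' => ∑ j ∈ (c.S \ I).filter fun j => c.idx j = b', D.m j with hp
  obtain ⟨k, O, hO, h0, hk, hk1, hk2⟩ := exists_root (D.m_pos j₀).ne' _ p hJ
  have hprod : ∀ ξ : ℂ^n, ∏ b' ∈ (c.S \ I).image c.idx, ξ b' ^ p b' =
      ∏ j ∈ c.S \ I, ξ (c.idx j) ^ D.m j := fun ξ => by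
    rw [Finset.prod_image fun j hj j' hj' h => hinj (Finset.sdiff_subset hj)
      (Finset.sdiff_subset hj') h]
    refine prod_congr rfl fun j hj => ?_
    have : (c.S \ I).filter (fun j' => c.idx j' = c.idx j) = {j} := by
      ext j'
      simp only [mem_filter, Finset.mem_singleton]
      exact ⟨fun h => hinj (Finset.sdiff_subset h.1) (Finset.sdiff_subset hj) h.2,
        fun h => by rw [h]; exact ⟨hj, rfl⟩⟩
    rw [hp]
    simp only [this, Finset.sum_singleton]
  have hinv : ∀ ξ ∈ O, ∀ k' : ℂ^n → ℂ, mulCoord b k' ξ ∈ O ∧ k (mulCoord b k' ξ) = k ξ := by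
    intro ξ hξ k'
    obtain ⟨h1, h2⟩ := hk2 ξ (mulCoord b k' ξ) fun b' hb' => by
      obtain ⟨j, hj, rfl⟩ := Finset.mem_image.1 hb'
      rw [Finset.mem_sdiff] at hj
      exact (mulCoord_of_ne (hneb j hj.1 fun h => hj.2 (h ▸ hj₀)) _ _).symm
    exact ⟨h1 hξ, h2.symm⟩
  set χ := mulCoordHomeo b k O hO hk (fun ξ h => (hk1 ξ h).1) hinv
  have hχG : χ ∈ contDiffGroupoid ω 𝓘(ℂ, ℂ^n) := by
    rw [contDiffGroupoid, mem_groupoid_of_pregroupoid]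
    simp only [contDiffPregroupoid, modelWithCornersSelf_coe, modelWithCornersSelf_coe_symm,
      CompTriple.comp_eq, preimage_id_eq, id_eq, range_id, inter_univ]
    exact ⟨contDiffOn_mulCoord hk, contDiffOn_mulCoord (hk.inv fun ξ h => (hk1 ξ h).1)⟩
  have hsrc : ∀ x ∈ (c.chart.trans χ).source, x ∈ c.dom ∧ c.chart x ∈ O := fun x h => by
    rwa [OpenPartialHomeomorph.trans_source] at h
  have hval : ∀ x, c.chart.trans χ x = mulCoord b k (c.chart x) := fun x => rfl
  refine ⟨c.chart.trans χ, trans_mem_maximalAtlas c.chart_mem hχG, ?_, ?_, ?_⟩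
  · rw [OpenPartialHomeomorph.trans_source]
    exact ⟨hx, h0⟩
  · intro j hj x h
    obtain ⟨h1, h2⟩ := hsrc x h
    rw [hval, ← z_eq_zero_iff h1 (hIS hj), AdaptedChart.z]
    by_cases h3 : j = j₀
    · rw [h3, ← hb, mulCoord_self, mul_eq_zero, or_iff_left (hk1 _ h2).1]
    · rw [mulCoord_of_ne (hneb j (hIS hj) h3)]
  · intro x h
    obtain ⟨h1, h2⟩ := hsrc x h
    rw [f_eq_prod h1 ⟨j₀, hIS hj₀⟩, hval, ← Finset.prod_sdiff hIS]
    have h3 := (hk1 _ h2).2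
    rw [hprod] at h3
    simp only [AdaptedChart.z]
    have h4 : ∀ j ∈ I.erase j₀, mulCoord b k (c.chart x) (c.idx j) ^ D.m j =
        c.chart x (c.idx j) ^ D.m j := fun j hj => by
      rw [mulCoord_of_ne (hneb j (hIS (mem_of_mem_erase hj)) (ne_of_mem_erase hj))]
    rw [← h3, ← mul_prod_erase _ _ hj₀, ← mul_prod_erase _ _ hj₀,
      prod_congr rfl h4, ← hb, mulCoord_self, mul_pow]
    ring

section Lipschitz

open scoped NNReal

theorem exists_lipschitzOnWith_of_contDiffAt {E : Type*} [NormedAddCommGroup E] [NormedSpace ℝ E]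
    {F : E → ℝ} {s : Set E} (hs : IsCompact s) (hF : ∀ p ∈ s, ContDiffAt ℝ ∞ F p) :
    ∃ L : ℝ, 0 ≤ L ∧ (∀ p ∈ s, |F p| ≤ L) ∧ ∀ p ∈ s, ∀ q ∈ s, |F p - F q| ≤ L * ‖p - q‖ := by
  have h1 : LocallyLipschitzOn s F := fun p hp => by
    obtain ⟨L, t, ht, hL⟩ := ((hF p hp).of_le (m := 1) (by simp)).exists_lipschitzOnWith
    exact ⟨L, t, mem_nhdsWithin_of_mem_nhds ht, hL⟩
  obtain ⟨L, hL⟩ := h1.exists_lipschitzOnWith_of_compact hs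
  obtain ⟨C, hC⟩ := hs.exists_bound_of_continuousOn fun p hp =>
    (hF p hp).continuousAt.continuousWithinAt
  refine ⟨max L C, le_max_of_le_left L.2, fun p hp => (hC p hp).trans (le_max_right _ _),
    fun p hp q hq => ?_⟩
  have := hL.dist_le_mul p hp q hq
  rw [Real.dist_eq, dist_eq_norm] at this
  exact this.trans (mul_le_mul_of_nonneg_right (le_max_left _ _) (norm_nonneg _))

end Lipschitz

theorem norm_le_sum_norm (x : ℂ^n) : ‖x‖ ≤ ∑ k, ‖x k‖ := by
  have h : x = ∑ k, EuclideanSpace.single k (x k) := by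
    ext k
    simp [Finset.sum_apply, Pi.single_apply]
  calc ‖x‖ = ‖∑ k, EuclideanSpace.single k (x k)‖ := by rw [← h]
    _ ≤ ∑ k, ‖(EuclideanSpace.single k (x k) : ℂ^n)‖ := norm_sum_le _ _
    _ = _ := by simp

namespace AdaptedPair

/-- A bounded region of the coordinate space. -/
def Reg (c : AdaptedChart D) (i : Fin D.N) : Set (CoordSpace c i) :=
  {y | 1 / ((n : ℝ) + 1) < wCo y ∧ |y.1| ≤ 1 ∧ (∀ j, |y.2.1 j| ≤ 2) ∧ ∀ j, ‖y.2.2.1 j‖ ≤ 2}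

theorem mul_sub_mul_le {r r' C δ : ℝ} {z z' : ℂ} (h1 : |r - r'| ≤ C * δ) (h2 : |r'| ≤ C)
    (h3 : ‖z‖ ≤ 2) (h4 : ‖z - z'‖ ≤ δ) (hC : 0 ≤ C) : ‖(r : ℂ) * z - r' * z'‖ ≤ 3 * C * δ := by
  have h5 : (r : ℂ) * z - r' * z' = ((r - r' : ℝ) : ℂ) * z + (r' : ℂ) * (z - z') := by
    push_cast; ring
  have h0 : 0 ≤ δ := (norm_nonneg _).trans h4
  rw [h5]
  refine (norm_add_le _ _).trans ?_
  rw [norm_mul, norm_mul, Complex.norm_real, Complex.norm_real, Real.norm_eq_abs, Real.norm_eq_abs]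
  nlinarith [mul_le_mul h1 h3 (norm_nonneg z) (mul_nonneg hC h0),
    mul_le_mul h2 h4 (norm_nonneg _) hC]

theorem abs_proj_le {c : AdaptedChart D} {i : Fin D.N} (y : CoordSpace c i) :
    |y.1| ≤ ‖y‖ ∧ (∀ j, |y.2.1 j| ≤ ‖y‖) ∧ (∀ j, ‖y.2.2.1 j‖ ≤ ‖y‖) ∧ ∀ k, ‖y.2.2.2 k‖ ≤ ‖y‖ := by
  have h1 : ‖y.2‖ ≤ ‖y‖ := norm_snd_le y
  have h2 : ‖y.2.2‖ ≤ ‖y‖ := (norm_snd_le y.2).trans h1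
  exact ⟨norm_fst_le y, fun j => (norm_le_pi_norm y.2.1 j).trans ((norm_fst_le y.2).trans h1),
    fun j => (norm_le_pi_norm y.2.2.1 j).trans ((norm_fst_le y.2.2).trans h2),
    fun k => (norm_le_pi_norm y.2.2.2 k).trans ((norm_snd_le y.2.2).trans h2)⟩

theorem exists_lipschitz_zCo (D : Degeneration n X) : ∃ L : ℝ, 1 ≤ L ∧
    ∀ (c : AdaptedChart D), ∀ i ∈ c.S, ∀ y ∈ Reg c i, ∀ y' ∈ Reg c i,
      ‖zCo y - zCo y'‖ ≤ L * ‖y - y'‖ := by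
  set B : Set (ℝ²) := Icc (-1) 1 ×ˢ Icc (-2) 2
  set B' : Set (ℝ²) := Icc (-1) 1 ×ˢ Icc (1 / ((n : ℝ) + 1)) 1 with hB'
  have hBc : IsCompact B := isCompact_Icc.prod isCompact_Icc
  have hBc' : IsCompact B' := isCompact_Icc.prod isCompact_Icc
  have hn : (0 : ℝ) < 1 / ((n : ℝ) + 1) := by positivity
  choose L₁ hL₁ hb₁ hl₁ using fun j => exists_lipschitzOnWith_of_contDiffAt hBc fun p _ =>
    (contDiff_radius (m_pos' D j)).contDiffAt
  obtain ⟨L₂, hL₂, -, hl₂⟩ := exists_lipschitzOnWith_of_contDiffAt hBc fun p _ =>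
    contDiff_omega_UU.contDiffAt
  choose L₃ hL₃ hb₃ hl₃ using fun j => exists_lipschitzOnWith_of_contDiffAt
    (F := fun p : ℝ² => radius (D.m j) (p.1, omega p.1 / p.2 - eta p.2)) hBc' fun p hp =>
    (contDiff_radius (m_pos' D j)).contDiffAt.comp p (contDiffAt_fst.prodMk
      (((contDiff_omega.contDiffAt.comp p contDiffAt_fst).div contDiffAt_snd
        (hn.trans_le hp.2.1).ne').sub ((contDiffAt_eta (hn.trans_le hp.2.1) hp.2.2).comp p
          contDiffAt_snd)))
  set C : ℝ := ∑ j, L₁ j + (∑ j, L₃ j) * (1 + n * L₂)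
  have h1C : ∀ j, L₁ j ≤ C := fun j =>
    (single_le_sum (f := L₁) (fun j _ => hL₁ j) (Finset.mem_univ j)).trans
      (le_add_of_nonneg_right (mul_nonneg (sum_nonneg fun j _ => hL₃ j) (by positivity)))
  have h3C : ∀ j, L₃ j * (1 + n * L₂) ≤ C := fun j =>
    (mul_le_mul_of_nonneg_right (single_le_sum (f := L₃) (fun j _ => hL₃ j)
      (Finset.mem_univ j)) (by positivity)).trans
      (le_add_of_nonneg_left (sum_nonneg fun j _ => hL₁ j))
  have hC0 : 0 ≤ C := add_nonneg (sum_nonneg fun j _ => hL₁ j)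
    (mul_nonneg (sum_nonneg fun j _ => hL₃ j) (by positivity))
  refine ⟨n * (3 * C + 1) + 1, by nlinarith [(Nat.cast_nonneg n : (0 : ℝ) ≤ n)],
    fun c i hi y hy y' hy' => ?_⟩
  set δ := ‖y - y'‖ with hδ
  obtain ⟨d1, d2, d3, d4⟩ := abs_proj_le (y - y')
  have hδ0 : 0 ≤ δ := norm_nonneg _
  have hmem : ∀ y ∈ Reg c i, ∀ j, (y.1, y.2.1 j) ∈ B := fun y hy j =>
    ⟨abs_le.1 hy.2.1, abs_le.1 (hy.2.2.1 j)⟩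
  have hdist : ∀ j, ‖((y.1, y.2.1 j) : ℝ²) - (y'.1, y'.2.1 j)‖ ≤ δ := fun j =>
    max_le d1 (d2 j)
  have hw : |wCo y - wCo y'| ≤ n * L₂ * δ := by
    rw [wCo, wCo, sub_sub_sub_cancel_left, ← Finset.sum_sub_distrib]
    refine (Finset.abs_sum_le_sum_abs _ _).trans ((sum_le_sum fun j _ =>
      (hl₂ _ (hmem y' hy' j) _ (hmem y hy j)).trans (mul_le_mul_of_nonneg_left
        ((norm_sub_rev _ _).trans_le (hdist j)) hL₂)).trans ?_)
    rw [sum_const, nsmul_eq_mul, mul_assoc]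
    refine mul_le_mul_of_nonneg_right ?_ (by positivity)
    rw [Finset.card_univ, Fintype.card_coe]
    exact_mod_cast (Finset.card_le_card (Finset.erase_subset _ _)).trans (card_S_le c)
  have hr : ∀ j : c.S, |radius (D.m j) (y.1, sCo y j) - radius (D.m j) (y'.1, sCo y' j)| ≤ C * δ ∧
      |radius (D.m j) (y'.1, sCo y' j)| ≤ C := by
    intro j
    by_cases h : (j : Fin D.N) = i
    · obtain ⟨j, hj⟩ := j
      obtain rfl : j = i := h
      have hmem' : ∀ y ∈ Reg c j, (y.1, wCo y) ∈ B' := fun y hy =>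
        ⟨abs_le.1 hy.2.1, hy.1.le, wCo_le_one y⟩
      rw [sCo_self, sCo_self]
      refine ⟨(hl₃ j _ (hmem' y hy) _ (hmem' y' hy')).trans ?_, (hb₃ j _ (hmem' y' hy')).trans
        (le_trans (le_mul_of_one_le_right (hL₃ j) (le_add_of_nonneg_right (by positivity)))
          (h3C j))⟩
      have h5 : ‖((y.1, wCo y) : ℝ²) - (y'.1, wCo y')‖ ≤ (1 + n * L₂) * δ := by
        refine max_le (d1.trans (le_mul_of_one_le_left hδ0
          (le_add_of_nonneg_right (by positivity)))) (hw.trans ?_)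
        exact mul_le_mul_of_nonneg_right (by linarith) hδ0
      calc _ ≤ L₃ j * ((1 + n * L₂) * δ) := mul_le_mul_of_nonneg_left h5 (hL₃ j)
        _ = L₃ j * (1 + n * L₂) * δ := by ring
        _ ≤ _ := mul_le_mul_of_nonneg_right (h3C j) hδ0
    · have h5 := sCo_of_ne y ⟨j, mem_erase.2 ⟨h, j.2⟩⟩
      have h6 := sCo_of_ne y' ⟨j, mem_erase.2 ⟨h, j.2⟩⟩
      rw [h5, h6]
      exact ⟨(hl₁ j _ (hmem y hy _) _ (hmem y' hy' _)).trans
        (mul_le_mul (h1C j) (hdist _) (norm_nonneg _) hC0), (hb₁ j _ (hmem y' hy' _)).trans (h1C j)⟩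
  have hcomp : ∀ k, ‖(zCo y - zCo y') k‖ ≤ (3 * C + 1) * δ := by
    intro k
    rw [zCo, zCo, assemble_sub]
    by_cases hk : k ∈ c.S.image c.idx
    · obtain ⟨j, hj, rfl⟩ := Finset.mem_image.1 hk
      rw [assemble_idx _ _ ⟨j, hj⟩]
      refine (mul_sub_mul_le (hr ⟨j, hj⟩).1 (hr ⟨j, hj⟩).2 (hy.2.2.2 ⟨j, hj⟩) (d3 ⟨j, hj⟩)
        hC0).trans ?_
      nlinarith
    · rw [assemble_rest _ _ ⟨k, hk⟩]
      exact (d4 ⟨k, hk⟩).trans (le_mul_of_one_le_left hδ0 (by linarith))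
  refine (norm_le_sum_norm _).trans ((sum_le_sum fun k _ => hcomp k).trans ?_)
  rw [sum_const, Finset.card_univ, Fintype.card_fin, nsmul_eq_mul]
  nlinarith

/-- The domain of the flat perturbations in a chart. -/
def box (c : AdaptedChart D) (ε : ℝ) : Set (ℂ^n × ℝ²) :=
  c.chart.target ×ˢ Ioo (-ε) ε ×ˢ Ioo (-1 - ε) ε

/-- An adapted chart which is so small that the functions `v̄_j` are small flat perturbations of
the functions `v_j`. -/
structure IsFlatChart (P : AdaptedPair D ι) (c : AdaptedChart D) (ε κ L : ℝ)
    (K : Fin D.N → ℂ^n × ℝ² → ℝ) (W : Fin D.N → Set (ℂ^n × ℝ²)) : Prop where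
  eps_pos : 0 < ε
  eps_lt : ε < 1
  kappa_nonneg : 0 ≤ κ
  one_le : 1 ≤ L
  mul_le : κ * L ≤ 1 / 4
  flat : ∀ j ∈ c.S, FlatPert (K j) (W j)
  eq : ∀ j ∈ c.S, ∀ x ∈ c.dom, D.f x ≠ 0 → P.vBarX j x = c.v j x + K j (c.chart x, c.t j x, c.u j x)
  mem : ∀ j ∈ c.S, ∀ q ∈ box c ε, modelMap q ∈ W j
  lip : ∀ j ∈ c.S, ∀ q ∈ box c ε, ∀ q' ∈ box c ε,
    |(K j ∘ modelMap) q - (K j ∘ modelMap) q'| ≤ κ * ‖q - q'‖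
  small : ∀ x ∈ c.dom, D.g x < ε ∧ ∀ j ∈ c.S, c.t j x < ε
  lip_zCo : ∀ i ∈ c.S, ∀ y ∈ Reg c i, ∀ y' ∈ Reg c i, ‖zCo y - zCo y'‖ ≤ L * ‖y - y'‖

theorem exists_isFlatChart [T2Space X] (P : AdaptedPair D ι) {x0 : X} (hf : D.f x0 = 0) :
    ∃ (c : AdaptedChart D) (ε κ L : ℝ) (K : Fin D.N → ℂ^n × ℝ² → ℝ) (W : Fin D.N → Set (ℂ^n × ℝ²)),
      x0 ∈ c.dom ∧ IsFlatChart P c ε κ L K W := by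
  classical
  obtain ⟨c₁, hc₁⟩ := P.exists_chart x0
  set I : Finset (Fin D.N) := Finset.univ.filter fun j => x0 ∈ D.D j with hIdef
  have hI : ∀ j, x0 ∈ D.D j ↔ j ∈ I := fun j => by simp [hIdef]
  have hne : I.Nonempty := by
    obtain ⟨j, hj⟩ := D.f_eq_zero_iff.1 hf
    exact ⟨j, (hI j).1 hj⟩
  obtain ⟨e, he, hxe, hez, hef⟩ := exists_monomial_chart hc₁ hI hne
  have hidx : InjOn c₁.idx I := c₁.idx_injOn.mono fun j hj =>
    mem_S_of_mem hc₁ ((hI j).2 hj)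
  obtain ⟨-, c₀, h1, h2, h3, h4, -, -⟩ := exists_adaptedChart he hxe hI hidx hez hef univ_mem
  have hex : ∀ j, ∃ (K : ℂ^n × ℝ² → ℝ) (W : Set (ℂ^n × ℝ²)), j ∈ I → FlatPert K W ∧
        (∀ u, (c₀.chart x0, 0, u) ∈ W) ∧ ∀ᶠ x in 𝓝 x0, D.f x ≠ 0 →
        P.vBarX j x = c₀.v j x + K (c₀.chart x, c₀.t j x, c₀.u j x) := fun j => by
    by_cases hj : j ∈ I
    · obtain ⟨K, W, h⟩ := P.exists_flatPert h4 ((hI j).2 hj)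
      exact ⟨K, W, fun _ => h⟩
    · exact ⟨0, ∅, fun h => absurd h hj⟩
  choose K W hKW using hex
  obtain ⟨L, hL, hLz⟩ := exists_lipschitz_zCo D
  set κ : ℝ := 1 / (4 * L) with hκ
  have hκ0 : 0 < κ := by positivity
  set V : Fin D.N → Set (ℂ^n × ℝ²) := fun j =>
    {q | modelMap q ∈ W j ∧ ‖fderiv ℝ (K j ∘ modelMap) q‖ < κ} with hV
  have hVo : ∀ j ∈ I, IsOpen (V j) := fun j hj => by
    have h5 := (hKW j hj).1
    have ho := h5.isOpen.preimage (continuous_modelMap (E := ℂ^n))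
    exact ((h5.contDiffOn_one.continuousOn_fderiv_of_isOpen ho le_rfl).norm).isOpen_inter_preimage
      ho isOpen_Iio
  set K₀ : Set (ℂ^n × ℝ²) := {e x0} ×ˢ {0} ×ˢ Icc (-1) 0
  have hK₀c : IsCompact K₀ := isCompact_singleton.prod (isCompact_singleton.prod isCompact_Icc)
  have hK₀V : K₀ ⊆ ⋂ j ∈ I, V j := by
    rintro ⟨ξ, g, s⟩ ⟨rfl, rfl, hs⟩
    refine mem_iInter₂.2 fun j hj => ?_
    have hT : TT (0, s) = 0 := by rw [TT_zero_fst, max_eq_right hs.2]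
    have hW : modelMap (e x0, (0 : ℝ), s) ∈ W j := by
      rw [modelMap, hT, ← h1]
      exact (hKW j hj).2.1 _
    refine ⟨hW, ?_⟩
    rw [((hKW j hj).1.hasFDerivAt_zero hW hT).fderiv, norm_zero]
    exact hκ0
  obtain ⟨δ, hδ, hδV⟩ := hK₀c.exists_thickening_subset_open
    (isOpen_biInter_finset fun j hj => hVo j hj) hK₀V
  set ε : ℝ := min δ (1 / 2)
  have hε0 : 0 < ε := lt_min hδ (by norm_num)
  have hεδ : ε ≤ δ := min_le_left _ _
  have hU : ∀ᶠ x in 𝓝 x0, e x ∈ Metric.ball (e x0) ε ∧ (D.g x < ε ∧ ∀ j ∈ I, c₀.t j x < ε) ∧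
      ∀ j ∈ I, D.f x ≠ 0 → P.vBarX j x = c₀.v j x + K j (c₀.chart x, c₀.t j x, c₀.u j x) := by
    refine ((e.continuousAt hxe).eventually (Metric.ball_mem_nhds _ hε0)).and
      (((D.continuous_g.continuousAt.eventually_lt continuousAt_const
        (by rwa [D.g_eq_zero hf])).and ((Finset.eventually_all I).2 fun j hj => ?_)).and
        ((Finset.eventually_all I).2 fun j hj => (hKW j hj).2.2))
    refine (continuousAt_t h4 (h3 ▸ hj)).eventually_lt continuousAt_const ?_
    rwa [t_eq_zero h4 ((hI j).2 hj)]
  obtain ⟨ρ, c, k1, k2, k3, k4, k5, k6⟩ := exists_adaptedChart he hxe hI hidx hez hef hU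
  have hzz : ∀ j, c.z j = c₀.z j := fun j => by
    ext x; rw [AdaptedChart.z, AdaptedChart.z, k1, k2, h1, h2]
  have htt : ∀ j, c.t j = c₀.t j := fun j => by ext x; rw [AdaptedChart.t, AdaptedChart.t, hzz]
  have huu : ∀ j, c.u j = c₀.u j := fun j => by
    ext x; rw [AdaptedChart.u, AdaptedChart.u, AdaptedChart.w, AdaptedChart.w, htt]
  have hvv : ∀ j, c.v j = c₀.v j := fun j => by
    ext x; rw [AdaptedChart.v, AdaptedChart.v, htt, huu]
  have htgt : c.chart.target ⊆ Metric.ball (e x0) ε := fun ξ hξ => by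
    have h5 := (k5 (c.chart.map_target hξ)).1
    rwa [← congrFun k1 (c.chart.symm ξ), c.chart.right_inv hξ] at h5
  have hbox : box c ε ⊆ ⋂ j ∈ I, V j := fun q hq => hδV <| by
    obtain ⟨q1, q2, q3⟩ := hq
    refine Metric.mem_thickening_iff.2 ⟨(e x0, 0, max (-1) (min q.2.2 0)),
      ⟨rfl, rfl, le_max_left _ _, max_le (by norm_num) (min_le_right _ _)⟩, ?_⟩
    refine max_lt ((htgt q1).trans_le hεδ) (max_lt ?_ ?_)
    · rw [Real.dist_eq, sub_zero]
      exact (abs_lt.2 q2).trans_le hεδ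
    · refine lt_of_lt_of_le ?_ hεδ
      rw [Real.dist_eq, abs_lt]
      constructor
      · rcases max_cases (-1) (min q.2.2 0) with h | h <;> rcases min_cases q.2.2 0 with h' | h' <;>
          linarith [q3.1, q3.2]
      · rcases max_cases (-1) (min q.2.2 0) with h | h <;> rcases min_cases q.2.2 0 with h' | h' <;>
          linarith [q3.1, q3.2]
  have hconv : Convex ℝ (box c ε) := by
    rw [box, k6]
    exact (convex_ball _ _).prod ((convex_Ioo _ _).prod (convex_Ioo _ _))
  refine ⟨c, ε, κ, L, K, W, k4, hε0, (min_le_right _ _).trans_lt (by norm_num), hκ0.le, hL, ?_,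
    fun j hj => (hKW j (k3 ▸ hj)).1, fun j hj x hx h => ?_, fun j hj q hq => ?_,
    fun j hj q hq q' hq' => ?_, fun x hx => ?_, hLz c⟩
  · rw [hκ]; apply le_of_eq; field_simp
  · have h5 := (k5 hx).2.2 j (k3 ▸ hj) h
    rw [h5, hvv, htt, huu, k1, h1]
  · exact (mem_iInter₂.1 (hbox hq) j (k3 ▸ hj)).1
  · have hj' : j ∈ I := k3 ▸ hj
    have h5 := (hKW j hj').1
    have h6 := hconv.norm_image_sub_le_of_norm_fderiv_le (f := K j ∘ modelMap) (C := κ)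
      (fun p hp => (h5.contDiffOn_one.contDiffAt ((h5.isOpen.preimage
        continuous_modelMap).mem_nhds (mem_iInter₂.1 (hbox hp) j hj').1)).differentiableAt (by simp))
      (fun p hp => (mem_iInter₂.1 (hbox hp) j hj').2.le) hq' hq
    exact h6
  · obtain ⟨h5, h6⟩ := (k5 hx).2.1
    exact ⟨h5, fun j hj => by rw [htt]; exact h6 j (k3 ▸ hj)⟩

end AdaptedPair

/-- A continuous family of fixed points of a smooth family of contractions is smooth. -/
theorem contDiffAt_of_fixedPoint {E Y : Type*} [NormedAddCommGroup E] [NormedSpace ℝ E]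
    [CompleteSpace E] [NormedAddCommGroup Y] [NormedSpace ℝ Y] [CompleteSpace Y] {F : E × Y → E}
    {φ : Y → E} {y0 : Y} (hF : ContDiffAt ℝ ∞ F (φ y0, y0)) (hφ : ContinuousAt φ y0)
    (hfix : ∀ᶠ y in 𝓝 y0, F (φ y, y) = φ y)
    (hc : ∀ᶠ x in 𝓝 (φ y0), ‖F (x, y0) - F (φ y0, y0)‖ ≤ 1 / 4 * ‖x - φ y0‖) :
    ContDiffAt ℝ ∞ φ y0 := by
  set f : Y × E → E := fun v => v.2 - F (v.2, v.1) with hf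
  have hsw : ContDiffAt ℝ ∞ (fun v : Y × E => F (v.2, v.1)) (y0, φ y0) :=
    ContDiffAt.comp (y0, φ y0) (g := F) (f := fun v : Y × E => (v.2, v.1)) hF
      (contDiffAt_snd.prodMk contDiffAt_fst)
  have hfc : ContDiffAt ℝ ∞ f (y0, φ y0) := contDiffAt_snd.sub hsw
  have h1 : HasFDerivAt (fun x => F (x, y0)) (fderiv ℝ F (φ y0, y0) ∘L .inl ℝ E Y) (φ y0) :=
    ((hF.differentiableAt (by simp)).hasFDerivAt).comp (φ y0) (hasFDerivAt_prodMk_left _ _)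
  have h2 : ‖fderiv ℝ F (φ y0, y0) ∘L .inl ℝ E Y‖ ≤ 1 / 4 := h1.le_of_lip' (by norm_num) hc
  have h3 : HasFDerivAt (fun x => f (y0, x)) (fderiv ℝ f (y0, φ y0) ∘L .inr ℝ Y E) (φ y0) :=
    ((hfc.differentiableAt (by simp)).hasFDerivAt).comp (φ y0) (hasFDerivAt_prodMk_right _ _)
  have h4 : fderiv ℝ f (y0, φ y0) ∘L .inr ℝ Y E = 1 - fderiv ℝ F (φ y0, y0) ∘L .inl ℝ E Y :=
    h3.unique ((hasFDerivAt_id (φ y0)).sub h1)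
  have hinv : (fderiv ℝ f (y0, φ y0) ∘L .inr ℝ Y E).IsInvertible :=
    ⟨ContinuousLinearEquiv.unitsEquiv ℝ E (Units.oneSub _ (h2.trans_lt (by norm_num))), h4.symm⟩
  refine (hfc.contDiffAt_implicitFunction (by simp) hinv).congr_of_eventuallyEq ?_
  filter_upwards [(continuousAt_id.prodMk hφ).eventually
    (hfc.eventually_apply_eq_iff_implicitFunction (by simp) hinv), hfix] with y h5 h6
  refine (h5.1 ?_).symm
  simp only [hf, id, h6, sub_self, hfix.self_of_nhds]

theorem abs_fderiv_le {E : Type*} [NormedAddCommGroup E] [NormedSpace ℝ E]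
    {H : E × ℝ² → ℝ} {B : Set (E × ℝ²)} (hB : IsOpen B) {κ : ℝ} (hκ : 0 ≤ κ)
    (hl : ∀ q ∈ B, ∀ q' ∈ B, |H q - H q'| ≤ κ * ‖q - q'‖) {q : E × ℝ²} (hq : q ∈ B)
    (hd : DifferentiableAt ℝ H q) : |fderiv ℝ H q (0, 0, 1)| ≤ κ := by
  have h1 := hd.hasFDerivAt.le_of_lip' hκ (by
    filter_upwards [hB.mem_nhds hq] with q' h using hl q' h q hq)
  refine ((fderiv ℝ H q).le_opNorm _).trans ((mul_le_mul_of_nonneg_right h1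
    (norm_nonneg _)).trans ?_)
  simp [Prod.norm_def]

theorem FlatPert.exists_solvedPert {E : Type*} [NormedAddCommGroup E] [NormedSpace ℝ E]
    [CompleteSpace E] {K : E × ℝ² → ℝ} {W B : Set (E × ℝ²)} (hK : FlatPert K W)
    (hB : IsOpen B) (hW : ∀ q ∈ B, modelMap q ∈ W) {κ : ℝ} (hκ : 0 ≤ κ) (hκ1 : κ ≤ 1 / 2)
    (hl : ∀ q ∈ B, ∀ q' ∈ B, |(K ∘ modelMap) q - (K ∘ modelMap) q'| ≤ κ * ‖q - q'‖)
    {q0 : E × ℝ²} (hq : q0 ∈ B) :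
    ∃ σ N, SolvedPert K W σ N ∧ (q0.1, q0.2.1, q0.2.2 + (K ∘ modelMap) q0) ∈ N ∧
      (∀ q ∈ N, (q.1, q.2.1, σ q) ∈ B) ∧
      ∀ᶠ q in 𝓝 q0, σ (q.1, q.2.1, q.2.2 + (K ∘ modelMap) q) = q.2.2 := by
  have hc : ∀ q ∈ B, ContDiffAt ℝ 1 (K ∘ modelMap) q := fun q h => hK.contDiffOn_one.contDiffAt
    ((hK.isOpen.preimage continuous_modelMap).mem_nhds (hW q h))
  set f : (E × ℝ²) × ℝ → ℝ := fun v =>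
    v.2 + (K ∘ modelMap) (v.1.1, v.1.2.1, v.2) - v.1.2.2 with hf
  set p : E × ℝ² := (q0.1, q0.2.1, q0.2.2 + (K ∘ modelMap) q0)
  have hfc : ContDiffAt ℝ 1 f (p, q0.2.2) := by
    refine (contDiffAt_snd.add (ContDiffAt.comp (p, q0.2.2) (g := K ∘ modelMap)
      (f := fun v : (E × ℝ²) × ℝ => (v.1.1, v.1.2.1, v.2)) (hc q0 hq) (by fun_prop))).sub
      (by fun_prop)
  have hd : HasDerivAt (fun s => f (p, s)) (1 + fderiv ℝ (K ∘ modelMap) q0 (0, 0, 1)) q0.2.2 := by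
    have h1 : HasDerivAt (fun s : ℝ => (q0.1, q0.2.1, s)) (0, 0, 1) q0.2.2 :=
      (hasDerivAt_const _ _).prodMk ((hasDerivAt_const _ _).prodMk (hasDerivAt_id _))
    have h2 : HasFDerivAt (K ∘ modelMap) (fderiv ℝ (K ∘ modelMap) q0) (q0.1, q0.2.1, q0.2.2) :=
      ((hc q0 hq).differentiableAt one_ne_zero).hasFDerivAt
    exact ((hasDerivAt_id _).add (h2.comp_hasDerivAt q0.2.2 h1)).sub_const _
  have hne := abs_fderiv_le hB hκ hl hq ((hc q0 hq).differentiableAt one_ne_zero)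
  have h0 : f (p, q0.2.2) = 0 := sub_self _
  obtain ⟨σ, h1, h2, h3, h4⟩ := exists_implicit_scalar one_ne_zero hfc hd
    (by linarith [(abs_le.1 (hne.trans hκ1)).1])
  have hg : ContinuousAt (fun q : E × ℝ² => (q.1, q.2.1, σ q)) p :=
    continuousAt_fst.prodMk (continuousAt_snd.fst.prodMk h1.continuousAt)
  have hN : ∀ᶠ q in 𝓝 p, ContDiffAt ℝ 1 σ q ∧ f (q, σ q) = f (p, q0.2.2) ∧ (q.1, q.2.1, σ q) ∈ B :=
    (h1.eventually (by simp)).and (h3.and (hg.eventually (hB.eventually_mem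
      (by simp only [h2]; exact hq))))
  obtain ⟨N, hNs, hNo, hpN⟩ := eventually_nhds_iff.1 hN
  refine ⟨σ, N, ⟨hK.isOpen, hK.smooth, hNo, fun q h => (hNs q h).1.contDiffWithinAt,
    fun q h => hW _ (hNs q h).2.2, fun q h => ?_, fun q h =>
      (abs_fderiv_le hB hκ hl (hNs q h).2.2 ((hc _ (hNs q h).2.2).differentiableAt
        one_ne_zero)).trans hκ1⟩, hpN, fun q h => (hNs q h).2.2, ?_⟩
  · have := (hNs q h).2.1
    rw [h0] at this
    simpa [hf, sub_eq_zero] using this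
  · have hK0 : ContinuousAt (K ∘ modelMap) q0 := (hc q0 hq).continuousAt
    have hcont : ContinuousAt (fun q : E × ℝ² =>
        ((q.1, q.2.1, q.2.2 + (K ∘ modelMap) q), q.2.2)) q0 :=
      (continuousAt_fst.prodMk (continuousAt_snd.fst.prodMk
        (continuousAt_snd.snd.add hK0))).prodMk continuousAt_snd.snd
    filter_upwards [hcont.eventually h4] with q h5
    refine h5.1 ?_
    rw [h0]
    exact sub_self _

namespace AdaptedPair

variable {ε κ L : ℝ} {K : Fin D.N → ℂ^n × ℝ² → ℝ} {W : Fin D.N → Set (ℂ^n × ℝ²)}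

theorem isOpen_box : IsOpen (box c ε) := c.chart.open_target.prod (isOpen_Ioo.prod isOpen_Ioo)

variable (c i ε) in
/-- The domain of the change of coordinates from `ψ_i` to `ψ̄_i`. -/
def srcB : Set (CoordSpace c i) :=
  {y | y ∈ src c i ∧ y.1 ∈ Ioo (-ε) ε ∧ (∀ j, y.2.1 j ∈ Ioo (-1 - ε) ε) ∧ ∀ j, ‖y.2.2.1 j‖ < 2}

variable (K) in
/-- The change of coordinates from `ψ_i` to `ψ̄_i`. -/
def beta (y : CoordSpace c i) : CoordSpace c i :=
  (y.1, fun j => y.2.1 j + (K j ∘ modelMap) (zCo y, y.1, y.2.1 j), y.2.2)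

theorem isOpen_srcB : IsOpen (srcB c i ε) := by
  have h3 : ∀ j, IsOpen {y : CoordSpace c i | y.2.1 j ∈ Ioo (-1 - ε) ε} := fun j =>
    isOpen_Ioo.preimage (by fun_prop)
  have h4 : ∀ j, IsOpen {y : CoordSpace c i | ‖y.2.2.1 j‖ < 2} := fun j =>
    isOpen_lt (by fun_prop) continuous_const
  refine isOpen_src.inter ((isOpen_Ioo.preimage continuous_fst).inter
    (IsOpen.inter (s := {y : CoordSpace c i | ∀ j : ↥(c.S.erase i), y.2.1 j ∈ Ioo (-1 - ε) ε})
      (t := {y : CoordSpace c i | ∀ j : c.S, ‖y.2.2.1 j‖ < 2}) ?_ ?_))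
  · simp only [ofPred_forall]; exact isOpen_iInter_of_finite h3
  · simp only [ofPred_forall]; exact isOpen_iInter_of_finite h4

theorem mem_box {y : CoordSpace c i} (hy : y ∈ srcB c i ε) (j : ↥(c.S.erase i)) :
    (zCo y, y.1, y.2.1 j) ∈ box c ε := ⟨hy.1.2, hy.2.1, hy.2.2.1 j⟩

namespace IsFlatChart

variable (h : IsFlatChart P c ε κ L K W)

include h

theorem kappa_le : κ ≤ 1 / 4 := by nlinarith [h.mul_le, h.one_le, h.kappa_nonneg]

theorem mem_Reg {y : CoordSpace c i} (hy : y ∈ srcB c i ε) : y ∈ Reg c i := by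
  have := h.eps_lt
  refine ⟨hy.1.1, (abs_lt.2 hy.2.1).le.trans this.le, fun j => abs_le.2 ?_, fun j =>
    (hy.2.2.2 j).le⟩
  have h1 := hy.2.2.1 j
  constructor <;> linarith [h1.1, h1.2]

theorem approximates (hi : i ∈ c.S) : ApproximatesLinearOn (beta K)
    (ContinuousLinearEquiv.refl ℝ (CoordSpace c i) : CoordSpace c i →L[ℝ] CoordSpace c i)
    (srcB c i ε) (1 / 4) := by
  intro y hy y' hy'
  have h0 : beta K y - beta K y' - (y - y') = (0, fun j : ↥(c.S.erase i) => (K j ∘ modelMap) (zCo y, y.1, y.2.1 j) -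
      (K j ∘ modelMap) (zCo y', y'.1, y'.2.1 j), 0) := by
    refine Prod.ext (by simp [beta]) (Prod.ext ?_ (by simp [beta]))
    ext j
    simp [beta]
    ring
  obtain ⟨d1, d2, -, -⟩ := abs_proj_le (y - y')
  have hL : ‖y - y'‖ ≤ L * ‖y - y'‖ := le_mul_of_one_le_left (norm_nonneg _) h.one_le
  have h1 : ∀ j : ↥(c.S.erase i), |(K j ∘ modelMap) (zCo y, y.1, y.2.1 j) -
      (K j ∘ modelMap) (zCo y', y'.1, y'.2.1 j)| ≤ 1 / 4 * ‖y - y'‖ := fun j => by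
    refine (h.lip j (mem_of_mem_erase j.2) _ (mem_box hy j) _ (mem_box hy' j)).trans ?_
    have h2 : ‖((zCo y, y.1, y.2.1 j) : ℂ^n × ℝ²) - (zCo y', y'.1, y'.2.1 j)‖ ≤ L * ‖y - y'‖ :=
      max_le (h.lip_zCo i hi y (h.mem_Reg hy) y' (h.mem_Reg hy'))
        (max_le (d1.trans hL) ((d2 j).trans hL))
    calc _ ≤ κ * (L * ‖y - y'‖) := mul_le_mul_of_nonneg_left h2 h.kappa_nonneg
      _ = κ * L * ‖y - y'‖ := by ring
      _ ≤ _ := mul_le_mul_of_nonneg_right h.mul_le (norm_nonneg _)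
  have h5 : (0 : ℝ) ≤ 1 / 4 * ‖y - y'‖ := by positivity
  change ‖beta K y - beta K y' - (y - y')‖ ≤ _
  rw [h0]
  exact max_le (by rwa [norm_zero]) (max_le ((pi_norm_le_iff_of_nonneg h5).2 h1)
    (by rwa [norm_zero]))

/-- The change of coordinates from `ψ_i` to `ψ̄_i` as a homeomorphism of open sets. -/
def betaHomeo (hi : i ∈ c.S) : OpenPartialHomeomorph (CoordSpace c i) (CoordSpace c i) :=
  (h.approximates hi).toOpenPartialHomeomorph (beta K) (srcB c i ε) (by
    rcases subsingleton_or_nontrivial (CoordSpace c i) with h | h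
    · exact Or.inl h
    · refine Or.inr ?_
      rw [ContinuousLinearEquiv.refl_symm, ContinuousLinearEquiv.coe_refl,
        ← NNReal.coe_lt_coe, NNReal.coe_inv, coe_nnnorm, ContinuousLinearMap.norm_id]
      norm_num [← NNReal.coe_lt_coe]) isOpen_srcB

theorem small_coord (hi : i ∈ c.S) {y : CoordSpace c i} (hy : y ∈ src c i ∩ Q c i) :
    y ∈ srcB c i ε := by
  have hx := xCo_mem hy.1
  obtain ⟨h1, h2⟩ := h.small _ hx
  have h0 := h.eps_pos
  rw [g_xCo hi hy.1 hy.2] at h1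
  refine ⟨hy.1, ⟨by linarith [hy.2.1], h1⟩, fun j => ?_, fun j => by rw [hy.2.2 j]; norm_num⟩
  have h3 := h2 j (mem_of_mem_erase j.2)
  rw [t_xCo hy.1 hy.2 ⟨j, mem_of_mem_erase j.2⟩, sCo_of_ne y j] at h3
  have h4 : UU (y.1, y.2.1 j) ≤ 1 := by
    by_contra! h5
    have h6 : 1 < omega (UU (y.1, y.2.1 j)) := by
      rw [omega_of_pos (by linarith), Real.one_lt_exp_iff, sub_pos]
      exact inv_lt_one_of_one_lt₀ h5
    have h7 := single_le_sum (f := fun j : ↥(c.S.erase i) => omega (UU (y.1, y.2.1 j)))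
      (fun j _ => omega_nonneg _) (Finset.mem_univ j)
    have h8 := pos_of_mem_src hy.1
    rw [wCo] at h8
    linarith
  have h5 : y.2.1 j = TT (y.1, y.2.1 j) - UU (y.1, y.2.1 j) := by rw [UU]; ring
  have h6 := TT_nonneg (y.1, y.2.1 j)
  have h7 := UU_nonneg (p := (y.1, y.2.1 j)) hy.2.1
  exact ⟨by linarith, by linarith⟩

theorem vBar_eq {a : P.Space} (ha : P.proj a ∈ c.dom) {j : Fin D.N} (hj : j ∈ c.S)
    (hm : ptA c j a ∈ box c ε) : P.vBar j a = P.vA c j a + (K j ∘ modelMap) (ptA c j a) :=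
  (vBar_eventuallyEq_flat (h.flat j hj) ha hj (h.mem j hj _ hm) (by
    filter_upwards [c.chart.open_source.mem_nhds ha] with x hx using h.eq j hj x hx)).self_of_nhds

theorem psiBar_eq (hi : i ∈ c.S) {a : P.Space} (ha : a ∈ P.pieceA c i) :
    P.psiBar c i a = beta K (P.chartMap c i (P.vA c) a) := by
  obtain ⟨h1, h2, h3⟩ := psiA_spec hi ha
  refine Prod.ext rfl (Prod.ext (funext fun j => ?_) rfl)
  have h4 : zCo (P.chartMap c i (P.vA c) a) = c.chart (P.proj a) := by rw [← h2, chart_xCo h1.1]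
  have h5 : ptA c j a = (zCo (P.chartMap c i (P.vA c) a), (P.chartMap c i (P.vA c) a).1,
      (P.chartMap c i (P.vA c) a).2.1 j) := by rw [h4]; rfl
  refine (h.vBar_eq ha.1 (mem_of_mem_erase j.2) ?_).trans ?_
  · rw [h5]; exact mem_box (h.small_coord hi h1) j
  · rw [h5]; rfl

end IsFlatChart

end AdaptedPair

namespace AdaptedPair

variable {ε κ L : ℝ} {K : Fin D.N → ℂ^n × ℝ² → ℝ} {W : Fin D.N → Set (ℂ^n × ℝ²)}

/-- The coordinates `ψ_i` in terms of the coordinates of the point of `X` and the coordinates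
`ψ̄_i`, for given solutions of the equations relating `v_j` and `v̄_j`. -/
def solve (σ : ↥(c.S.erase i) → ℂ^n × ℝ² → ℝ) (v : ℂ^n × CoordSpace c i) : CoordSpace c i :=
  (v.2.1, fun j => σ j (v.1, v.2.1, v.2.2.1 j), v.2.2.2)

theorem contDiffAt_solve {σ : ↥(c.S.erase i) → ℂ^n × ℝ² → ℝ} {N : ↥(c.S.erase i) → Set (ℂ^n × ℝ²)}
    (hS : ∀ j : ↥(c.S.erase i), SolvedPert (K j) (W j) (σ j) (N j)) {v : ℂ^n × CoordSpace c i}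
    (hv : ∀ j, (v.1, v.2.1, v.2.2.1 j) ∈ N j) (hw : 0 < wCo (solve σ v)) :
    ContDiffAt ℝ ∞ (fun v => wCo (solve σ v)) v ∧ ContDiffAt ℝ ∞ (fun v => zCo (solve σ v)) v := by
  have hA : ∀ (j : ↥(c.S.erase i)) {f : ℂ^n × ℝ² → ℝ}, ContDiffOn ℝ ∞ f (N j) →
      ContDiffAt ℝ ∞ (fun v : ℂ^n × CoordSpace c i =>
        f (v.1, v.2.1, v.2.2.1 j)) v := fun j f hf =>
    ContDiffAt.comp v (f := fun v : ℂ^n × CoordSpace c i =>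
      (v.1, v.2.1, v.2.2.1 j)) (hf.contDiffAt ((hS j).isOpen.mem_nhds (hv j))) (by fun_prop)
  have h1 : ContDiffAt ℝ ∞ (fun v => wCo (solve σ v)) v :=
    contDiffAt_const.sub (ContDiffAt.sum fun j _ => hA j (hS j).contDiffOn_omega_UU)
  refine ⟨h1, ?_⟩
  have h2 : ∀ k : c.S, ContDiffAt ℝ ∞ (fun v : ℂ^n × CoordSpace c i =>
      radius (D.m k) (v.2.1, sCo (solve σ v) k)) v := by
    intro k
    by_cases hk : (k : Fin D.N) = i
    · have h3 : (fun v : ℂ^n × CoordSpace c i => sCo (solve σ v) k) =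
          fun v => omega v.2.1 / wCo (solve σ v) - eta (wCo (solve σ v)) :=
        funext fun v => dif_pos hk
      have h4 : ContDiffAt ℝ ∞ (fun v : ℂ^n × CoordSpace c i =>
          sCo (solve σ v) k) v := by
        rw [h3]
        exact ((contDiff_omega.contDiffAt.comp v (by fun_prop)).div h1 hw.ne').sub
          (ContDiffAt.comp v (g := eta) (contDiffAt_eta hw (wCo_le_one _)) h1)
      exact (contDiff_radius (m_pos' D k)).contDiffAt.comp v (ContDiffAt.prodMk (by fun_prop) h4)
    · have h3 : (fun v : ℂ^n × CoordSpace c i =>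
          radius (D.m k) (v.2.1, sCo (solve σ v) k)) = fun v => radius (D.m k)
            (v.2.1, σ ⟨k, mem_erase.2 ⟨hk, k.2⟩⟩
              (v.1, v.2.1, v.2.2.1 ⟨k, mem_erase.2 ⟨hk, k.2⟩⟩)) :=
        funext fun v => congrArg (fun s => radius (D.m k) (v.2.1, s)) (dif_neg hk)
      rw [h3]
      exact hA ⟨k, mem_erase.2 ⟨hk, k.2⟩⟩ ((hS _).contDiffOn_radius (m_pos' D k))
  have h5 : ContDiffAt ℝ ∞ (fun v : ℂ^n × CoordSpace c i =>
      ((fun k => (radius (D.m k) (v.2.1, sCo (solve σ v) k) : ℂ) * v.2.2.2.1 k, v.2.2.2.2) :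
        (c.S → ℂ) × (c.RestIdx → ℂ))) v := by
    refine ContDiffAt.prodMk (contDiffAt_pi.2 fun k => ?_) (by fun_prop)
    exact (Complex.ofRealCLM.contDiff.contDiffAt.comp v (h2 k)).mul (by fun_prop)
  exact contDiff_assemble.contDiffAt.comp v h5

namespace IsFlatChart

variable (h : IsFlatChart P c ε κ L K W)

include h

/-- The inverse of the change of coordinates is only of class `C^1`, but the point of `X` is a
smooth function of the coordinates `ψ̄_i`. -/
theorem contDiffAt_betaHomeo_symm (hi : i ∈ c.S) {y0 : CoordSpace c i} (hy0 : y0 ∈ srcB c i ε) :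
    ContDiffAt ℝ ∞ (fun y => zCo ((h.betaHomeo hi).symm y)) (beta K y0) ∧
      ContDiffAt ℝ ∞ (fun y => wCo ((h.betaHomeo hi).symm y)) (beta K y0) := by
  set B := h.betaHomeo hi
  set b := beta K y0
  have hBc : ∀ y, B y = beta K y := fun y => rfl
  have hsym : B.symm b = y0 := B.left_inv hy0
  have htgt : b ∈ B.target := B.map_source hy0
  choose σ N hS hN hbox hev using fun j : ↥(c.S.erase i) =>
    (h.flat j (mem_of_mem_erase j.2)).exists_solvedPert isOpen_box
      (h.mem j (mem_of_mem_erase j.2)) h.kappa_nonneg (h.kappa_le.trans (by norm_num))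
      (h.lip j (mem_of_mem_erase j.2)) (mem_box hy0 j)
  have hsolve : ∀ y : CoordSpace c i, (∀ j, σ j (zCo y, y.1,
      y.2.1 j + (K j ∘ modelMap) (zCo y, y.1, y.2.1 j)) = y.2.1 j) →
      solve σ (zCo y, beta K y) = y := fun y hy =>
    Prod.ext rfl (Prod.ext (funext fun j => hy j) rfl)
  have hzc := (contDiffAt_zCo (pos_of_mem_src hy0.1)).continuousAt
  have hs₀ : solve σ (zCo y0, b) = y0 := hsolve y0 fun j => (hev j).self_of_nhds
  obtain ⟨hw, hz⟩ := contDiffAt_solve hS (v := (zCo y0, b)) hN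
    (by rw [hs₀]; exact pos_of_mem_src hy0.1)
  have hfix : ∀ᶠ y in 𝓝 b, solve σ (zCo (B.symm y), y) = B.symm y := by
    have h1 : ∀ᶠ y in 𝓝 y0, solve σ (zCo y, beta K y) = y :=
      (eventually_all.2 fun j => (hzc.prodMk (continuousAt_fst.prodMk
        (by fun_prop : Continuous fun y : CoordSpace c i => y.2.1 j).continuousAt)).eventually
          (hev j)).mono hsolve
    have h3 := (B.continuousAt_symm htgt).eventually (hsym.symm ▸ h1)
    filter_upwards [h3, B.open_target.mem_nhds htgt] with y h4 h5
    rwa [← hBc, B.right_inv h5] at h4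
  have hN' : ∀ j, (zCo y0, b.1, b.2.1 j) ∈ N j := hN
  have hφ : ContinuousAt (fun y => zCo (B.symm y)) b :=
    ContinuousAt.comp (g := zCo) (by rwa [hsym]) (B.continuousAt_symm htgt)
  have hl : ∀ j, ContinuousAt (fun x : ℂ^n =>
      (x, b.1, b.2.1 j)) (zCo y0) := fun j =>
    continuousAt_id.prodMk continuousAt_const
  have hsc : ContinuousAt (fun x => solve σ (x, b)) (zCo y0) :=
    continuousAt_const.prodMk ((continuousAt_pi.2 fun j => ContinuousAt.comp (g := σ j)
      ((hS j).contDiff.continuousOn.continuousAt ((hS j).isOpen.mem_nhds (hN j))) (hl j)).prodMk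
        continuousAt_const)
  have hct : ∀ᶠ x in 𝓝 (zCo y0), ‖zCo (solve σ (x, b)) -
      zCo (solve σ (zCo y0, b))‖ ≤ 1 / 4 * ‖x - zCo y0‖ := by
    filter_upwards [hsc.eventually (isOpen_srcB.eventually_mem (hs₀.symm ▸ hy0)),
      eventually_all.2 fun j => (hl j).eventually ((hS j).isOpen.eventually_mem (hN j))]
      with x h1 h2
    refine (h.lip_zCo i hi _ (h.mem_Reg h1) _ (h.mem_Reg (hs₀.symm ▸ hy0))).trans ?_
    have h3 : ‖solve σ (x, b) - solve σ (zCo y0, b)‖ ≤ κ * ‖x - zCo y0‖ := by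
      have h0 : 0 ≤ κ * ‖x - zCo y0‖ := mul_nonneg h.kappa_nonneg (norm_nonneg _)
      have h4 : solve σ (x, b) - solve σ (zCo y0, b) =
          (0, fun j => σ j (x, b.1, b.2.1 j) -
            σ j (zCo y0, b.1, b.2.1 j), 0) :=
        Prod.ext (sub_self _) (Prod.ext rfl (sub_self _))
      rw [h4]
      refine max_le (by rwa [norm_zero]) (max_le ((pi_norm_le_iff_of_nonneg h0).2 fun j => ?_)
        (by rwa [norm_zero]))
      have h5 := (hS j).eq _ (h2 j)
      have h6 := (hS j).eq _ (hN' j)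
      have h7 := h.lip j (mem_of_mem_erase j.2) _ (hbox j _ (h2 j)) _ (hbox j _ (hN' j))
      simp only [comp_apply] at h5 h6 h7
      change |σ j (x, b.1, b.2.1 j) -
            σ j (zCo y0, b.1, b.2.1 j)| ≤ _
      set s := σ j (x, b.1, b.2.1 j)
      set s' := σ j (zCo y0, b.1, b.2.1 j)
      have h8 : |s - s'| ≤ κ * max ‖x - zCo y0‖ |s - s'| := by
        have h9 : s - s' = -(K j (modelMap (x, b.1, s)) -
          K j (modelMap (zCo y0, b.1, s'))) := by linarith
        calc |s - s'| = _ := by rw [h9, abs_neg]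
          _ ≤ _ := h7
          _ = _ := by simp [Prod.norm_def]
      rcases le_total |s - s'| ‖x - zCo y0‖ with h9 | h9
      · rwa [max_eq_left h9] at h8
      · rw [max_eq_right h9] at h8
        have : |s - s'| ≤ 0 := by nlinarith [h.kappa_le, abs_nonneg (s - s')]
        linarith
    calc _ ≤ L * (κ * ‖x - zCo y0‖) := mul_le_mul_of_nonneg_left h3 (by linarith [h.one_le])
      _ = κ * L * ‖x - zCo y0‖ := by ring
      _ ≤ _ := mul_le_mul_of_nonneg_right h.mul_le (norm_nonneg _)
  have hz' : ContDiffAt ℝ ∞ (fun y => zCo (B.symm y)) b := by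
    refine contDiffAt_of_fixedPoint (F := fun v => zCo (solve σ v)) ?_ hφ ?_ ?_
    · simpa only [hsym] using hz
    · exact hfix.mono fun y hy => congrArg zCo hy
    · simpa only [hsym] using hct
  refine ⟨hz', ContDiffAt.congr_of_eventuallyEq (ContDiffAt.comp b
    (g := fun v => wCo (solve σ v)) (f := fun y => (zCo (B.symm y), y))
    (by simpa only [hsym] using hw) (hz'.prodMk contDiffAt_id)) ?_⟩
  exact hfix.mono fun y hy => (congrArg wCo hy).symm

theorem exists_psiBarInv [Nonempty P.Space] (hi : i ∈ c.S) :
    ∃ (O : Set (CoordSpace c i)) (G : CoordSpace c i → P.Space), IsOpen O ∧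
      BijOn (P.psiBar c i) (P.pieceA c i) (O ∩ Q c i) ∧
      InvOn G (P.psiBar c i) (P.pieceA c i) (O ∩ Q c i) ∧ ContinuousOn G (O ∩ Q c i) ∧
      ∀ y ∈ O ∩ Q c i, ContMDiffWithinAt 𝓘(ℝ, CoordSpace c i) (canModel D) ∞
        (fun y => P.can c (G y)) (O ∩ Q c i) y := by
  set B := h.betaHomeo hi
  have hsym : ∀ y ∈ B.target ∩ Q c i, B.symm y ∈ src c i ∩ Q c i ∧ beta K (B.symm y) = y ∧
      B.symm y ∈ srcB c i ε := by
    intro y hy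
    have h1 : B.symm y ∈ srcB c i ε := B.map_target hy.1
    have h2 : beta K (B.symm y) = y := B.right_inv hy.1
    have h3 : (beta K (B.symm y)).1 = (B.symm y).1 := rfl
    have h4 : (beta K (B.symm y)).2.2 = (B.symm y).2.2 := rfl
    rw [h2] at h3 h4
    exact ⟨⟨h1.1, by rw [← h3]; exact hy.2.1, by rw [← h4]; exact hy.2.2⟩, h2, h1⟩
  have hinv : InvOn (fun y => P.psiInv c i (B.symm y)) (P.psiBar c i) (P.pieceA c i)
      (B.target ∩ Q c i) := by
    refine ⟨fun a ha => ?_, fun y hy => ?_⟩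
    · rw [h.psiBar_eq hi ha]
      exact (congrArg (P.psiInv c i) (B.left_inv (h.small_coord hi (psiA_spec hi ha).1))).trans
        ((invOn_psiInv hi).1 ha)
    · obtain ⟨h1, h2, -⟩ := hsym y hy
      rw [h.psiBar_eq hi (psiInv_mem hi h1), psiA_psiInv hi h1, h2]
  have hcont : ContinuousOn (fun y => P.psiInv c i (B.symm y)) (B.target ∩ Q c i) :=
    (continuousOn_psiInv hi).comp (B.continuousOn_symm.mono inter_subset_left) fun y hy =>
      (hsym y hy).1
  refine ⟨B.target, fun y => P.psiInv c i (B.symm y), B.open_target, hinv.bijOn (fun a ha => ?_)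
    (fun y hy => psiInv_mem hi (hsym y hy).1), hinv, hcont, fun y hy => ?_⟩
  · have h1 := (psiA_spec hi ha).1
    rw [h.psiBar_eq hi ha]
    exact ⟨B.map_source (h.small_coord hi h1), h1.2⟩
  obtain ⟨hsQ, hby, hsB⟩ := hsym y hy
  obtain ⟨hz, hw⟩ := h.contDiffAt_betaHomeo_symm hi hsB
  rw [hby] at hz hw
  have hz' : c.chart.symm (zCo (B.symm y)) ∈ c.dom := xCo_mem hsQ.1
  have h1 : ContMDiffWithinAt 𝓘(ℝ, CoordSpace c i) 𝓘^n ∞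
      (fun y => P.proj (P.psiInv c i (B.symm y))) (B.target ∩ Q c i) y :=
    ((contMDiffAt_chart_symm hsQ.1.2).comp y hz.contMDiffAt).contMDiffWithinAt.congr
      (fun y hy => proj_psiInv hi (hsym y hy).1) (proj_psiInv hi hsQ)
  have hfst : ∀ y ∈ B.target ∩ Q c i, P.g (P.psiInv c i (B.symm y)) = y.1 := fun y hy =>
    congrArg (·.1) (hinv.2 hy)
  have h2 : ContMDiffWithinAt 𝓘(ℝ, CoordSpace c i) 𝓘(ℝ) ∞
      (fun y => P.g (P.psiInv c i (B.symm y))) (B.target ∩ Q c i) y :=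
    (contDiff_fst.contMDiff.contMDiffAt (x := y)).contMDiffWithinAt.congr hfst (hfst y hy)
  refine contMDiffWithinAt_can h1 h2 (fun j => ?_) fun j hj => ?_
  · by_cases hjS : j ∈ c.S
    · by_cases hji : j = i
      · subst hji
        set G : CoordSpace c j → ℝ := fun y => omega y.1 / wCo (B.symm y) - eta (wCo (B.symm y)) +
          K j (zCo (B.symm y), omega y.1 / wCo (B.symm y), eta (wCo (B.symm y))) with hG
        have hv : ∀ y ∈ B.target ∩ Q c j, P.vBar j (P.psiInv c j (B.symm y)) = G y ∧
            (zCo (B.symm y), omega y.1 / wCo (B.symm y), eta (wCo (B.symm y))) ∈ W j := by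
          intro y hy
          obtain ⟨k1, k2, k3⟩ := hsym y hy
          have hpos := pos_of_mem_src k1.1
          have hw1 := wCo_le_one (B.symm y)
          set w := wCo (B.symm y)
          set q := omega y.1 / w
          have k4 : (B.symm y).1 = y.1 := congrArg (·.1) k2
          have k5 : P.vA c j (P.psiInv c j (B.symm y)) = q - eta w := by
            rw [vA_psiInv hi k1 ⟨j, hi⟩, sCo_self, k4]
          have k6 : ptA c j (P.psiInv c j (B.symm y)) = (zCo (B.symm y), y.1,
              q - eta w) :=
            Prod.ext (by rw [ptA, proj_psiInv hi k1, chart_xCo k1.1]) (Prod.ext (hfst y hy) k5)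
          have k7 : modelMap (zCo (B.symm y), y.1,
              q - eta w) = (zCo (B.symm y), q, eta w) := by
            rw [modelMap, TT_omega_div hy.2.1 hpos hw1, UU_omega_div hy.2.1 hpos hw1]
          have hd := xCo_mem k1.1
          obtain ⟨m1, m2⟩ := h.small _ hd
          have m3 := m2 j hi
          rw [t_xCo k1.1 k1.2 ⟨j, hi⟩, sCo_self, k4, TT_omega_div hy.2.1 hpos hw1] at m3
          rw [g_xCo hi k1.1 k1.2, k4] at m1
          have m4 := eta_le_one hpos.le hw1
          have m5 := eta_pos hpos hw1
          have m6 : 0 ≤ q := div_nonneg (omega_nonneg _) hpos.le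
          have m0 := h.eps_pos
          have m7 : ptA c j (P.psiInv c j (B.symm y)) ∈ box c ε := by
            rw [k6]
            exact ⟨k1.1.2, ⟨by linarith [hy.2.1], m1⟩, by linarith, by linarith⟩
          refine ⟨?_, ?_⟩
          · rw [h.vBar_eq (psiInv_mem hi k1).1 hi m7, k5, k6, comp_apply, k7]
          · rw [← k7, ← k6]; exact h.mem j hi _ m7
        have hpos := pos_of_mem_src hsQ.1
        have q1 : ContDiffAt ℝ ∞ (fun y : CoordSpace c j => omega y.1 / wCo (B.symm y)) y :=
          (contDiff_omega.contDiffAt.comp y contDiffAt_fst).div hw hpos.ne'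
        have q2 : ContDiffAt ℝ ∞ (fun y : CoordSpace c j => eta (wCo (B.symm y))) y :=
          ContDiffAt.comp y (g := eta) (contDiffAt_eta hpos (wCo_le_one _)) hw
        have q3 : ContDiffAt ℝ ∞ G y := (q1.sub q2).add (ContDiffAt.comp y (g := K j)
          (f := fun y => (zCo (B.symm y), omega y.1 / wCo (B.symm y), eta (wCo (B.symm y))))
          ((h.flat j hi).smooth.contDiffAt ((h.flat j hi).isOpen.mem_nhds (hv y hy).2))
          (hz.prodMk (q1.prodMk q2)))
        exact q3.contMDiffAt.contMDiffWithinAt.congr (fun y hy => (hv y hy).1) (hv y hy).1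
      · have k1 : ∀ y ∈ B.target ∩ Q c i, P.vBar j (P.psiInv c i (B.symm y)) =
            y.2.1 ⟨j, mem_erase.2 ⟨hji, hjS⟩⟩ := fun y hy =>
          congrArg (fun y : CoordSpace c i => y.2.1 ⟨j, mem_erase.2 ⟨hji, hjS⟩⟩) (hinv.2 hy)
        have k2 : ContDiff ℝ ∞ fun y : CoordSpace c i =>
          y.2.1 ⟨j, mem_erase.2 ⟨hji, hjS⟩⟩ := by fun_prop
        exact (k2.contMDiff.contMDiffAt (x := y)).contMDiffWithinAt.congr k1 (k1 y hy)
    · exact contMDiffWithinAt_vBar_of_notMem le_rfl (hcont y hy) hy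
        (fun hD => hjS (mem_S_of_mem (psiInv_mem hi hsQ).1 hD)) h1 h2
  · have k1 : ∀ y ∈ B.target ∩ Q c i,
        ((P.psiInv c i (B.symm y)).1.1.arg (c.z j) : ℂ) = y.2.2.1 ⟨j, hj⟩ := fun y hy =>
      congrArg (fun y : CoordSpace c i => y.2.2.1 ⟨j, hj⟩) (hinv.2 hy)
    have k2 : ContDiff ℝ ∞ fun y : CoordSpace c i => y.2.2.1 ⟨j, hj⟩ := by fun_prop
    exact (k2.contMDiff.contMDiffAt (x := y)).contMDiffWithinAt.congr k1 (k1 y hy)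

end IsFlatChart

end AdaptedPair

theorem exists_openPartialHomeomorph {E F : Type*} [NormedAddCommGroup E] [NormedSpace ℝ E]
    [CompleteSpace E] [NormedAddCommGroup F] [NormedSpace ℝ F] {H : E → F} {s : Set E}
    (hs : IsOpen s) (hH : ContDiffOn ℝ ∞ H s) {x0 : E} (hx : x0 ∈ s) {f' : E ≃L[ℝ] F}
    (hf : HasFDerivAt H (f' : E →L[ℝ] F) x0) : ∃ e : OpenPartialHomeomorph E F, x0 ∈ e.source ∧
      e.source ⊆ s ∧ (e : E → F) = H ∧ ∀ y ∈ e.target, ContDiffAt ℝ ∞ e.symm y := by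
  have hc : ∀ x ∈ s, ContDiffAt ℝ ∞ H x := fun x h => hH.contDiffAt (hs.mem_nhds h)
  set e₀ := (hc x0 hx).toOpenPartialHomeomorph H hf (by simp)
  have ho : IsOpen (s ∩ fderiv ℝ H ⁻¹' range ((↑) : (E ≃L[ℝ] F) → E →L[ℝ] F)) :=
    (hH.continuousOn_fderiv_of_isOpen hs (by simp)).isOpen_inter_preimage hs
      ContinuousLinearEquiv.isOpen
  refine ⟨e₀.restrOpen _ ho, ⟨(hc x0 hx).mem_toOpenPartialHomeomorph_source hf _, hx, f',
    hf.fderiv.symm⟩, fun x h => h.2.1, rfl, fun y hy => ?_⟩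
  obtain ⟨-, h1, A, h2⟩ := (e₀.restrOpen _ ho).map_target hy
  refine (e₀.restrOpen _ ho).contDiffAt_symm hy (f₀' := A) ?_ (hc _ h1)
  rw [h2]
  exact ((hc _ h1).differentiableAt (by simp)).hasFDerivAt

theorem exists_pow_homeomorph {m : ℕ} (hm : m ≠ 0) {z₀ : ℂ} (hz : z₀ ≠ 0) :
    ∃ e : OpenPartialHomeomorph ℂ ℂ, z₀ ∈ e.source ∧ (e : ℂ → ℂ) = (fun z => z ^ m) ∧
      ∀ y ∈ e.target, ContDiffAt ℝ ∞ e.symm y := by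
  have hne : (m : ℂ) * z₀ ^ (m - 1) ≠ 0 := mul_ne_zero (Nat.cast_ne_zero.2 hm) (pow_ne_zero _ hz)
  have h1 : HasFDerivAt (fun z : ℂ => z ^ m) (((ContinuousLinearEquiv.unitsEquivAut ℂ
      (Units.mk0 _ hne)).restrictScalars ℝ : ℂ ≃L[ℝ] ℂ) : ℂ →L[ℝ] ℂ) z₀ :=
    ((hasDerivAt_pow m z₀).hasFDerivAt.restrictScalars ℝ).congr_fderiv (by ext; simp)
  obtain ⟨e, h2, -, h3, h4⟩ := exists_openPartialHomeomorph isOpen_univ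
    (contDiff_id.pow m).contDiffOn (mem_univ z₀) h1
  exact ⟨e, h2, h3, h4⟩

theorem exists_circle_extension {E' H' M : Type*} [NormedAddCommGroup E'] [NormedSpace ℝ E']
    [TopologicalSpace H'] {J : ModelWithCorners ℝ E' H'} [TopologicalSpace M] [ChartedSpace H' M]
    {φ : Circle → M} {θ₀ : Circle} (h : ContMDiffAt (𝓡 1) J ∞ φ θ₀) :
    ∃ χ : ℂ → M, ContMDiffAt 𝓘(ℝ, ℂ) J ∞ χ θ₀ ∧ ∀ θ : Circle, χ θ = φ θ := by
  have h0 : (θ₀ : ℂ) / (θ₀ : ℂ) ∈ Complex.slitPlane :=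
    (congrArg (· ∈ Complex.slitPlane) (div_self θ₀.coe_ne_zero)).mpr Complex.one_mem_slitPlane
  have h1 : ContDiffAt ℝ ∞ (fun z : ℂ => (Complex.log (z / θ₀)).im) (θ₀ : ℂ) :=
    Complex.imCLM.contDiff.contDiffAt.comp (θ₀ : ℂ) (ContDiffAt.comp (θ₀ : ℂ) (g := Complex.log)
      (f := fun z => z / (θ₀ : ℂ)) ((Complex.contDiffAt_log h0).restrict_scalars ℝ)
      (contDiffAt_id.div_const _))
  have h2 : ContMDiffAt 𝓘(ℝ, ℂ) (𝓡 1) ∞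
      (fun z : ℂ => θ₀ * Circle.exp (Complex.log (z / θ₀)).im) (θ₀ : ℂ) :=
    (contMDiff_mul_left (I := 𝓡 1) (n := ∞) (a := θ₀)).contMDiffAt.comp (θ₀ : ℂ)
      (contMDiff_circleExp.contMDiffAt.comp (θ₀ : ℂ) h1.contMDiffAt)
  have h3 : ∀ θ : Circle, θ₀ * Circle.exp (Complex.log ((θ : ℂ) / θ₀)).im = θ := fun θ => by
    rw [Complex.log_im, ← Circle.coe_div, Circle.exp_arg, mul_div_cancel]
  refine ⟨fun z => φ (θ₀ * Circle.exp (Complex.log (z / θ₀)).im),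
    ContMDiffAt.comp (I' := 𝓡 1) (θ₀ : ℂ) (g := φ) ((h3 θ₀).symm ▸ h) h2,
    fun θ => congrArg φ (h3 θ)⟩

theorem contMDiff_circle_coe : ContMDiff (𝓡 1) 𝓘(ℝ, ℂ) ∞ (fun θ : Circle => (θ : ℂ)) :=
  haveI : Fact (finrank ℝ ℂ = 1 + 1) := finrank_real_complex_fact'
  contMDiff_coe_sphere

variable [NeZero n]

variable (n) in
/-- The complement of the directions `g` and `θ`. -/
abbrev RestSpace : Type := ℝ^(2 * n - 2)

variable (n) in
/-- The model space of the A'Campo space. -/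
abbrev ModelSpace : Type := ℝ^(2 * n)

theorem exists_modelEquiv : ∃ Λ : (ℝ × ℝ^1 × RestSpace n) ≃L[ℝ] ModelSpace n, ∀ y, Λ y 0 = y.1 := by
  set p : ModelSpace n →L[ℝ] ℝ := EuclideanSpace.proj 0
  have hp : ∀ y : ModelSpace n, p y = y 0 := fun y => rfl
  have hn : 1 ≤ n := Nat.one_le_iff_ne_zero.2 (NeZero.ne n)
  have hs : p (EuclideanSpace.single 0 1) = 1 := by simp [hp]
  have hr : LinearMap.range (p : ModelSpace n →ₗ[ℝ] ℝ) = ⊤ := LinearMap.range_eq_top.2 fun r =>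
    ⟨r • EuclideanSpace.single 0 1, by simp [hp]⟩
  have h1 := LinearMap.finrank_range_add_finrank_ker (p : ModelSpace n →ₗ[ℝ] ℝ)
  rw [hr, finrank_top, Module.finrank_self, finrank_euclideanSpace_fin] at h1
  have h2 : finrank ℝ (ℝ^1 × RestSpace n) =
      finrank ℝ (LinearMap.ker (p : ModelSpace n →ₗ[ℝ] ℝ)) := by
    rw [finrank_prod, finrank_euclideanSpace_fin, finrank_euclideanSpace_fin]
    omega
  set ι := ContinuousLinearEquiv.ofFinrankEq h2
  have hι : ∀ w, (ι w : ModelSpace n) 0 = 0 := fun w => (ι w).2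
  set l : (ℝ × ℝ^1 × RestSpace n) →ₗ[ℝ] ModelSpace n :=
    { toFun := fun y => y.1 • EuclideanSpace.single 0 1 + (ι y.2 : ModelSpace n)
      map_add' := fun x y => by simp [add_smul]; abel
      map_smul' := fun r x => by simp [mul_smul] } with hl
  have hl0 : ∀ y, l y 0 = y.1 := fun y => by simp [hl, hι]
  have hinj : Injective l := (injective_iff_map_eq_zero l).2 fun y hy => by
    have h3 : y.1 = 0 := by rw [← hl0, hy]; rfl
    have h4 : l y = (ι y.2 : ModelSpace n) := by simp [hl, h3]
    rw [hy] at h4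
    exact Prod.ext h3 (ι.map_eq_zero_iff.1 (Subtype.ext h4.symm))
  refine ⟨(l.linearEquivOfInjective hinj ?_).toContinuousLinearEquiv, hl0⟩
  rw [finrank_prod, Module.finrank_self, h2, finrank_euclideanSpace_fin, h1]

variable (n) in
/-- A linear identification of the model space whose zeroth coordinate is the first one. -/
def modelEquiv : (ℝ × ℝ^1 × RestSpace n) ≃L[ℝ] ModelSpace n := exists_modelEquiv.choose

theorem modelEquiv_zero (y : ℝ × ℝ^1 × RestSpace n) :
    modelEquiv n y 0 = y.1 := exists_modelEquiv.choose_spec y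

namespace AdaptedPair

theorem continuous_vBar (j : Fin D.N) : Continuous (P.vBar j) := by
  refine continuous_iff_continuousAt.2 fun a => ?_
  by_cases hj : P.proj a ∈ D.D j
  · obtain ⟨p, hp⟩ := P.exists_chart (P.proj a)
    have hjS := mem_S_of_mem hp hj
    obtain ⟨K, W, hK, hW, -, hev⟩ := exists_vBar_eventuallyEq_flat hp hj
    refine ContinuousAt.congr ?_ (EventuallyEq.symm hev)
    exact (continuousAt_vA hp hjS).add (ContinuousAt.comp (g := K ∘ modelMap)
      (hK.contDiffOn_one.continuousOn.continuousAt
        ((hK.isOpen.preimage continuous_modelMap).mem_nhds hW)) (continuousAt_ptA hp hjS))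
  · obtain ⟨R, hR, hev⟩ := vBar_eventuallyEq hj
    exact (eventually_continuousAt_comp hR).self_of_nhds.congr (EventuallyEq.symm hev)

theorem continuousAt_can {a : P.Space} (ha : P.proj a ∈ c.dom) : ContinuousAt (P.can c) a := by
  refine (continuous_proj P).continuousAt.prodMk (continuous_g_space.continuousAt.prodMk
    ((continuousAt_pi.2 fun j => (continuous_vBar j).continuousAt).prodMk
      (continuousAt_pi.2 fun j => ?_)))
  by_cases hj : j ∈ c.S
  · simp only [hj, if_true]; exact continuousAt_argA ha hj
  · simp only [hj, if_false]; exact continuousAt_const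

/-- The charts of the smooth structure of the A'Campo space. -/
structure IsSmoothChart (P : AdaptedPair D ι)
    (e : OpenPartialHomeomorph P.Space (EuclideanHalfSpace (2 * n))) : Prop where
  exists_eq : ∀ a ∈ e.source, ∀ c : AdaptedChart D, P.proj a ∈ c.dom →
    ∃ Ψ, ContMDiffAt (canModel D) 𝓘(ℝ, ModelSpace n) ∞ Ψ (P.can c a) ∧
      ∀ᶠ b in 𝓝 a, (𝓡∂ (2 * n)) (e b) = Ψ (P.can c b)
  symm : ∀ a ∈ e.source, ∀ c : AdaptedChart D, P.proj a ∈ c.dom →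
    ContMDiffWithinAt 𝓘(ℝ, ModelSpace n) (canModel D) ∞
      (fun y => P.can c (e.symm ((𝓡∂ (2 * n)).symm y))) (range (𝓡∂ (2 * n))) ((𝓡∂ (2 * n)) (e a))

/-- The chart `(g, θ, R)` of the A'Campo space, with values in the model space. -/
def coordMap (P : AdaptedPair D ι) (θ₀ : Circle) {V : Type*} (R : P.Space → V) (a : P.Space) :
    ℝ × ℝ^1 × V := (P.g a, chartAt ℝ^1 θ₀ (P.theta a), R a)

/-- A chart is adapted to the map `(g, θ)`. -/
def IsAdaptedAt (P : AdaptedPair D ι) (a : P.Space)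
    (e : OpenPartialHomeomorph P.Space (EuclideanHalfSpace (2 * n))) : Prop :=
  IsSmoothChart P e ∧ a ∈ e.source ∧ ∃ θ₀ : Circle, ∃ R : P.Space → RestSpace n,
    ∀ b ∈ e.source, P.theta b ∈ (chartAt ℝ^1 θ₀).source ∧
      (𝓡∂ (2 * n)) (e b) = modelEquiv n (P.coordMap θ₀ R b)

theorem exists_isAdaptedAt {V : Type*} [NormedAddCommGroup V] [NormedSpace ℝ V]
    [FiniteDimensional ℝ V] (hV : finrank ℝ V = 2 * n - 2) {θ₀ : Circle} {R : P.Space → V}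
    {G : ℝ × ℝ^1 × V → P.Space} {U : Set P.Space}
    {T : Set (ℝ × ℝ^1 × V)} (hU : IsOpen U) (hT : IsOpen T) (h1 : ∀ a ∈ U, P.proj a ∈ c.dom ∧
      P.theta a ∈ (chartAt ℝ^1 θ₀).source ∧ P.coordMap θ₀ R a ∈ T ∧ G (P.coordMap θ₀ R a) = a ∧
      ∃ Ψ, ContMDiffAt (canModel D) 𝓘(ℝ, ℝ^1 × V) ∞ Ψ (P.can c a) ∧
        ∀ᶠ b in 𝓝 a, (P.coordMap θ₀ R b).2 = Ψ (P.can c b))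
    (h2 : ∀ y ∈ T, 0 ≤ y.1 → G y ∈ U ∧ P.coordMap θ₀ R (G y) = y ∧
      ContinuousWithinAt G {y | 0 ≤ y.1} y ∧ ContMDiffWithinAt 𝓘(ℝ, ℝ × ℝ^1 × V) (canModel D) ∞
        (fun y => P.can c (G y)) {y | 0 ≤ y.1} y) {a : P.Space} (ha : a ∈ U) :
    ∃ e, IsAdaptedAt P a e := by
  set ν : V ≃L[ℝ] RestSpace n := ContinuousLinearEquiv.ofFinrankEq
    (by rw [hV, finrank_euclideanSpace_fin])
  set Λ : (ℝ × ℝ^1 × V) ≃L[ℝ] ModelSpace n := ((ContinuousLinearEquiv.refl ℝ ℝ).prodCongr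
      ((ContinuousLinearEquiv.refl ℝ ℝ^1).prodCongr ν)).trans (modelEquiv n)
  have hΛ : ∀ y, Λ y 0 = y.1 := fun y => modelEquiv_zero _
  have hΛs : ∀ y : ModelSpace n, (Λ.symm y).1 = y 0 := fun y => by
    rw [← hΛ, Λ.apply_symm_apply]
  have hg : ∀ b, 0 ≤ P.g b := fun b => D.g_nonneg _
  set F := P.coordMap θ₀ R
  have hFΨ : ∀ a ∈ U, ∃ Ψ, ContMDiffAt (canModel D) 𝓘(ℝ, ModelSpace n) ∞ Ψ (P.can c a) ∧
      ∀ᶠ b in 𝓝 a, Λ (F b) = Ψ (P.can c b) := fun a ha => by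
    obtain ⟨-, -, -, -, Ψ, h3, h4⟩ := h1 a ha
    refine ⟨fun q => Λ (q.2.1, Ψ q), Λ.contDiff.contMDiff.contMDiffAt.comp _
      ((contMDiffAt_comp_snd contDiff_fst _).prodMk_space h3), ?_⟩
    filter_upwards [h4] with b hb
    rw [← hb]
    rfl
  have hFc : ∀ a ∈ U, ContinuousAt (fun b => Λ (F b)) a := fun a ha => by
    obtain ⟨Ψ, h3, h4⟩ := hFΨ a ha
    exact (h3.continuousAt.comp (continuousAt_can (h1 a ha).1)).congr (EventuallyEq.symm h4)
  have hGc : ∀ y : ModelSpace n, 0 ≤ y 0 → Λ.symm y ∈ T →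
      ContinuousWithinAt (fun y => G (Λ.symm y)) (range (𝓡∂ (2 * n))) y := fun y h0 hy =>
    ((h2 _ hy ((hΛs y).symm ▸ h0)).2.2.1).comp Λ.symm.continuous.continuousWithinAt fun z hz => by
      rw [range_modelWithCornersEuclideanHalfSpace] at hz
      exact (hz : 0 ≤ z 0).trans_eq (hΛs z).symm
  set e : OpenPartialHomeomorph P.Space (EuclideanHalfSpace (2 * n)) :=
    { toFun := fun a => ⟨Λ (F a), (hΛ (F a)).symm ▸ hg a⟩, invFun := fun z => G (Λ.symm z.1)
      source := U, target := {z | Λ.symm z.1 ∈ T}, map_source' := fun a ha => by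
        change Λ.symm (Λ (F a)) ∈ T
        rw [Λ.symm_apply_apply]; exact (h1 a ha).2.2.1
      map_target' := fun z hz => (h2 _ hz ((hΛs _).symm ▸ z.2)).1
      left_inv' := fun a ha => by
        rw [Λ.symm_apply_apply]; exact (h1 a ha).2.2.2.1
      right_inv' := fun z hz => Subtype.ext (by
        change Λ (F (G (Λ.symm z.1))) = z.1
        rw [(h2 _ hz ((hΛs _).symm ▸ z.2)).2.1, Λ.apply_symm_apply])
      open_source := hU
      open_target := hT.preimage (Λ.symm.continuous.comp continuous_subtype_val)
      continuousOn_toFun := fun a ha =>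
        ContinuousAt.continuousWithinAt (tendsto_subtype_rng.2 (hFc a ha))
      continuousOn_invFun := fun z hz => ContinuousAt.continuousWithinAt
        ((hGc z.1 z.2 hz).tendsto.comp (tendsto_nhdsWithin_iff.2
          ⟨continuous_subtype_val.continuousAt, Eventually.of_forall fun w => ⟨w, rfl⟩⟩)) }
  have he : ∀ b, (𝓡∂ (2 * n)) (e b) = Λ (F b) := fun b => rfl
  refine ⟨e, ⟨fun a ha c' hc' => ?_, fun a ha c' hc' => ?_⟩, ha, θ₀, fun b => ν (R b), fun b hb =>
    ⟨(h1 b hb).2.1, rfl⟩⟩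
  · obtain ⟨Ψ, h3, h4⟩ := hFΨ a ha
    obtain ⟨Ψ', h5, h6⟩ := exists_can_eq hc' (h1 a ha).1
    refine ⟨Ψ ∘ Ψ', ContMDiffAt.comp (I' := canModel D) _ (h6.self_of_nhds ▸ h3) h5, ?_⟩
    filter_upwards [h4, h6] with b h7 h8
    rw [he, h7, h8]; rfl
  · obtain ⟨Ψ', h5, h6⟩ := exists_can_eq (h1 a ha).1 hc'
    have h3 := h1 a ha
    have h4 := (h2 _ h3.2.2.1 (hg a)).2.2
    rw [he]
    have h7 : ContMDiffWithinAt 𝓘(ℝ, ModelSpace n) (canModel D) ∞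
        (fun y => P.can c (G (Λ.symm y))) (range (𝓡∂ (2 * n))) (Λ (F a)) :=
      ContMDiffWithinAt.comp (I' := 𝓘(ℝ, ℝ × ℝ^1 × V))
        (t := {y | 0 ≤ y.1}) (g := fun y => P.can c (G y)) (Λ (F a))
        (by rw [Λ.symm_apply_apply]; exact h4.2)
        Λ.symm.contDiff.contMDiff.contMDiffAt.contMDiffWithinAt fun z hz => by
          rw [range_modelWithCornersEuclideanHalfSpace] at hz
          exact (hz : 0 ≤ z 0).trans_eq (hΛs z).symm
    have h8 : ∀ y ∈ range (𝓡∂ (2 * n)), e.symm ((𝓡∂ (2 * n)).symm y) = G (Λ.symm y) := by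
      rintro _ ⟨z, rfl⟩
      rw [ModelWithCorners.left_inv]
      rfl
    have h9 : G (Λ.symm (Λ (F a))) = a := by rw [Λ.symm_apply_apply]; exact h3.2.2.2.1
    have h0 : Λ (F a) ∈ range (𝓡∂ (2 * n)) := ⟨e a, rfl⟩
    refine (ContMDiffAt.comp_contMDiffWithinAt (I' := canModel D) (g := Ψ') _
      (by rw [h9]; exact h5) h7).congr_of_eventuallyEq_of_mem ?_ h0
    have h10 := hGc (Λ (F a)) ((hΛ (F a)).symm ▸ hg a) (by rw [Λ.symm_apply_apply]; exact h3.2.2.1)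
    filter_upwards [h10.tendsto.eventually (p := fun b => P.can c' b = Ψ' (P.can c b))
      (by simpa only [h9] using h6), self_mem_nhdsWithin] with y h11 h12
    rw [h8 y h12, h11]
    rfl

end AdaptedPair

namespace AdaptedPair

theorem theta_of_ne (h : a ∉ P.bd) : (P.theta a : ℂ) = angle (D.f (P.proj a)) :=
  a.1.1.arg_unit (D.holAt_f _) h

theorem theta_eq (ha : P.proj a ∈ c.dom) (hi : i ∈ c.S) : P.theta a =
    a.1.1.arg (c.z i) ^ D.m i * ∏ j : ↥(c.S.erase i), a.1.1.arg (c.z j) ^ D.m j := by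
  rw [theta, Degeneration.KatoNakayama.arg_f ha ⟨i, hi⟩, ← mul_prod_erase _ _ hi,
    Finset.prod_coe_sort (c.S.erase i) fun j => a.1.1.arg (c.z j) ^ D.m j]

theorem continuousAt_arg (ha : P.proj a ∈ c.dom) (hi : i ∈ c.S) :
    ContinuousAt (fun a : P.Space => a.1.1.arg (c.z i)) a := tendsto_circle.2 (continuousAt_argA ha hi)

theorem continuous_theta : Continuous P.theta := by
  refine continuous_iff_continuousAt.2 fun a => ?_
  by_cases ha : a ∈ P.bd
  · obtain ⟨c, i, hi, hp⟩ := exists_pieceA_of_bd ha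
    refine ContinuousAt.congr ?_ (EventuallyEq.symm ((eventually_proj hp.1).mono fun b hb =>
      theta_eq (c := c) hb hi))
    exact ((continuousAt_arg hp.1 hi).pow _).mul (tendsto_finsetProd _ fun j _ =>
      (continuousAt_arg hp.1 (mem_of_mem_erase j.2)).pow _)
  · refine tendsto_circle.2 (Tendsto.congr' (f₁ := fun b => angle (D.f (P.proj b)))
      (EventuallyEq.symm ?_) ?_)
    · filter_upwards [isOpen_bd_compl.mem_nhds ha] with b hb using theta_of_ne hb
    · rw [theta_of_ne ha]
      exact ContinuousAt.comp (g := angle) (contDiffAt_angle ha).continuousAt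
        (D.contMDiff_f.continuous.comp (continuous_proj P)).continuousAt

theorem card_restIdx (c : AdaptedChart D) : Fintype.card c.RestIdx = n - c.S.card := by
  rw [Fintype.card_subtype_compl, Fintype.card_fin, Fintype.card_coe,
    Finset.card_image_of_injOn (show InjOn c.idx c.S from c.idx_injOn)]

theorem omega_injective {x y : ℝ} (h0 : 0 ≤ x) (h1 : 0 ≤ y)
    (h : expNegInvGlue (omega x) = expNegInvGlue (omega y)) : x = y := by
  have h2 := congrArg (tOf 1) h
  have h3 := tOf_expNegInvGlue one_pos (omega_nonneg x)
  have h4 := tOf_expNegInvGlue one_pos (omega_nonneg y)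
  rw [one_mul] at h3 h4
  rw [h3, h4] at h2
  rw [← eta_omega h0, h2, eta_omega h1]

section Boundary

variable (c i)

open Classical in
/-- The coordinates other than `g` and the argument of `f`. -/
abbrev RestCoord : Type := (↥(c.S.erase i) → ℝ) × (↥(c.S.erase i) → ℝ^1) × (c.RestIdx → ℂ)

/-- The argument of the power of the `i`-th angle, in terms of the argument of `f` and the other
angles. -/
def baseAngle (θ₀ : Circle) (θ₁ : ↥(c.S.erase i) → Circle) (y : ℝ × ℝ^1 × RestCoord c i) : Circle :=
  (chartAt ℝ^1 θ₀).symm y.2.1 * ∏ j, ((chartAt ℝ^1 (θ₁ j)).symm (y.2.2.2.1 j) ^ D.m j)⁻¹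

open Classical in
/-- The coordinates `ψ̄_i` in terms of coordinates of a manifold with boundary. -/
def toQ (θ₀ : Circle) (θ₁ : ↥(c.S.erase i) → Circle) (ρ : ℂ → ℂ)
    (y : ℝ × ℝ^1 × RestCoord c i) : CoordSpace c i :=
  (y.1, y.2.2.1, fun j => if h : (j : Fin D.N) = i then ρ (baseAngle c i θ₀ θ₁ y) else
    ((chartAt ℝ^1
      (θ₁ ⟨j, mem_erase.2 ⟨h, j.2⟩⟩)).symm (y.2.2.2.1 ⟨j, mem_erase.2 ⟨h, j.2⟩⟩) : ℂ),
    y.2.2.2.2)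

end Boundary

theorem exists_isAdaptedAt_bd [T2Space X] (ha : a ∈ P.bd) : ∃ e, IsAdaptedAt P a e := by
  have : Nonempty P.Space := ⟨a⟩
  obtain ⟨c, ε, κ, L, K, W, hx, h⟩ := exists_isFlatChart P ha
  obtain ⟨i, hi, hap⟩ := exists_pieceA hx (S_nonempty hx ha)
  obtain ⟨O, G₀, hO, hbij, hinv, hGc, hG⟩ := h.exists_psiBarInv hi
  set θ₀ := P.theta a
  set θ₁ : ↥(c.S.erase i) → Circle := fun j => a.1.1.arg (c.z j)
  obtain ⟨ρ, hρ0, hρ, hρs⟩ := exists_pow_homeomorph (D.m_pos i).ne' (a.1.1.arg (c.z i)).coe_ne_zero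
  have hmS : ∀ j : ↥(c.S.erase i), (j : Fin D.N) ∈ c.S := fun j => mem_of_mem_erase j.2
  set φ := chartAt ℝ^1 θ₀
  set φ₁ := fun j => chartAt ℝ^1 (θ₁ j)
  set R : P.Space → RestCoord c i := fun b => (fun j => P.vBar j b, fun j => φ₁ j (b.1.1.arg (c.z j)),
    fun k => c.chart (P.proj b) k)
  set B := baseAngle c i θ₀ θ₁ with hB
  set Y := toQ c i θ₀ θ₁ ρ.symm with hY
  have hV : finrank ℝ (RestCoord c i) = 2 * n - 2 := by
    have h1 := card_S_le c
    have h2 := Finset.card_pos.2 ⟨i, hi⟩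
    rw [finrank_prod, finrank_prod, finrank_pi, finrank_pi_fintype,
      finrank_pi_fintype]
    simp only [finrank_euclideanSpace_fin, Complex.finrank_real_complex, sum_const,
      Finset.card_univ, Fintype.card_coe, card_restIdx, Finset.card_erase_of_mem hi, smul_eq_mul]
    omega
  set T₀ : Set (ℝ × ℝ^1 × RestCoord c i) :=
    {y | y.2.1 ∈ φ.target ∧ ∀ j, y.2.2.2.1 j ∈ (φ₁ j).target} with hT₀
  have hT₀o : IsOpen T₀ := by
    refine (φ.open_target.preimage (by fun_prop)).inter
      (t := {y : ℝ × ℝ^1 × RestCoord c i | ∀ j, y.2.2.2.1 j ∈ (φ₁ j).target}) ?_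
    simp only [ofPred_forall]
    exact isOpen_iInter_of_finite fun j => (φ₁ j).open_target.preimage (by fun_prop)
  have hBs : ∀ y ∈ T₀, ContMDiffAt 𝓘(ℝ, ℝ × ℝ^1 × RestCoord c i) (𝓡 1) ∞ B y := by
    intro y hy
    have h1 : ∀ {θ : Circle} {l : ℝ × ℝ^1 × RestCoord c i → ℝ^1},
        ContDiff ℝ ∞ l → l y ∈ (chartAt ℝ^1 θ).target →
        ContMDiffAt 𝓘(ℝ, ℝ × ℝ^1 × RestCoord c i) (𝓡 1) ∞
          (fun y => (chartAt ℝ^1 θ).symm (l y)) y := fun hl hm =>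
      (contMDiffAt_symm_of_mem_maximalAtlas (IsManifold.chart_mem_maximalAtlas _) hm).comp y
        hl.contMDiff.contMDiffAt
    exact (h1 (by fun_prop) hy.1).mul (contMDiffAt_finsetProd fun j _ =>
      ((h1 (by fun_prop) (hy.2 j)).pow _).inv)
  have hBc : ∀ y ∈ T₀, ContDiffAt ℝ ∞ (fun y => (B y : ℂ)) y := fun y hy =>
    (contMDiff_circle_coe.contMDiffAt.comp y (hBs y hy)).contDiffAt
  set T₁ := T₀ ∩ (fun y => (B y : ℂ)) ⁻¹' ρ.target with hT₁
  have hT₁o : IsOpen T₁ := ContinuousOn.isOpen_inter_preimage (fun y hy =>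
    (hBc y hy).continuousAt.continuousWithinAt) hT₀o ρ.open_target
  have hYs : ∀ y ∈ T₁, ContDiffAt ℝ ∞ Y y := by
    intro y hy
    refine ContDiffAt.prodMk (by fun_prop) (ContDiffAt.prodMk (by fun_prop)
      (ContDiffAt.prodMk (contDiffAt_pi.2 fun j => ?_) (by fun_prop)))
    by_cases hj : (j : Fin D.N) = i
    · simp only [hj, dif_pos]
      exact (hρs _ hy.2).comp y (hBc y hy.1)
    · simp only [hj, dif_neg, not_false_iff]
      have h1 : ContDiff ℝ ∞ fun y : ℝ × ℝ^1 × RestCoord c i =>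
        y.2.2.2.1 ⟨j, mem_erase.2 ⟨hj, j.2⟩⟩ := by fun_prop
      exact (contMDiff_circle_coe.contMDiffAt.comp y ((contMDiffAt_symm_of_mem_maximalAtlas
        (IsManifold.chart_mem_maximalAtlas _) (hy.1.2 _)).comp y h1.contMDiff.contMDiffAt)).contDiffAt
  set T := T₁ ∩ Y ⁻¹' O
  have hTo : IsOpen T := ContinuousOn.isOpen_inter_preimage (fun y hy =>
    (hYs y hy).continuousAt.continuousWithinAt) hT₁o hO
  set U : Set P.Space := {b | b ∈ P.pieceA c i ∧ P.theta b ∈ φ.source ∧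
    (∀ j : ↥(c.S.erase i), b.1.1.arg (c.z j) ∈ (φ₁ j).source) ∧ (b.1.1.arg (c.z i) : ℂ) ∈ ρ.source}
  have hU : IsOpen U := isOpen_iff_mem_nhds.2 fun b hb =>
    (isOpen_pieceA.eventually_mem hb.1).and ((continuous_theta.continuousAt.eventually
      (φ.open_source.eventually_mem hb.2.1)).and ((eventually_all.2 fun j =>
        (continuousAt_arg hb.1.1 (hmS j)).eventually
          ((φ₁ j).open_source.eventually_mem (hb.2.2.1 j))).and
        ((continuousAt_argA hb.1.1 hi).eventually (ρ.open_source.eventually_mem hb.2.2.2))))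
  have hQ : ∀ y ∈ T, 0 ≤ y.1 → Y y ∈ O ∩ Q c i := fun y hy h0 => by
    refine ⟨hy.2, h0, fun j => ?_⟩
    by_cases hj : (j : Fin D.N) = i
    · have h1 : ‖ρ.symm (B y)‖ ^ D.m i = 1 := by
        rw [← norm_pow]
        have h2 := ρ.right_inv hy.1.2
        rw [hρ] at h2
        exact (congrArg norm h2).trans (B y).norm_coe
      exact (congrArg norm (dif_pos hj)).trans
        ((pow_eq_one_iff_of_nonneg (norm_nonneg _) (D.m_pos i).ne').1 h1)
    · exact (congrArg norm (dif_neg hj)).trans (Circle.norm_coe _)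
  have hYc : ∀ b ∈ U, P.coordMap θ₀ R b ∈ T₁ ∧ Y (P.coordMap θ₀ R b) = P.psiBar c i b := by
    intro b hb
    have h1 : B (P.coordMap θ₀ R b) = b.1.1.arg (c.z i) ^ D.m i := by
      have h2 : B (P.coordMap θ₀ R b) = P.theta b * ∏ j : ↥(c.S.erase i),
          (b.1.1.arg (c.z j) ^ D.m j)⁻¹ := congrArg₂ (· * ·) (φ.left_inv hb.2.1)
        (prod_congr rfl fun j _ => congrArg (fun θ : Circle => (θ ^ D.m j)⁻¹)
          ((φ₁ j).left_inv (hb.2.2.1 j)))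
      rw [h2, theta_eq hb.1.1 hi, Finset.prod_inv_distrib, mul_inv_cancel_right]
    have h1' : (B (P.coordMap θ₀ R b) : ℂ) = ρ (b.1.1.arg (c.z i)) := by
      rw [h1, hρ]; exact Circle.coe_pow _ _
    refine ⟨⟨⟨φ.map_source hb.2.1, fun j => (φ₁ j).map_source (hb.2.2.1 j)⟩, ?_⟩,
      Prod.ext rfl (Prod.ext rfl (Prod.ext (funext fun j => ?_) rfl))⟩
    · change (B (P.coordMap θ₀ R b) : ℂ) ∈ ρ.target
      rw [h1']; exact ρ.map_source hb.2.2.2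
    · by_cases hj : (j : Fin D.N) = i
      · refine (dif_pos hj).trans ?_
        rw [h1', ρ.left_inv hb.2.2.2]
        exact congrArg (fun j => (b.1.1.arg (c.z j) : ℂ)) hj.symm
      · exact (dif_neg hj).trans (congrArg (fun θ : Circle => (θ : ℂ))
          ((φ₁ ⟨j, mem_erase.2 ⟨hj, j.2⟩⟩).left_inv (hb.2.2.1 _)))
  refine exists_isAdaptedAt hV hU hTo (G := fun y => G₀ (Y y)) (R := R) (c := c) (θ₀ := θ₀)
    (fun b hb => ⟨hb.1.1, hb.2.1, ⟨(hYc b hb).1, ?_⟩, ?_, ?_⟩) (fun y hy h0 => ?_)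
    ⟨hap, mem_chart_source _ _, fun j => mem_chart_source _ _, hρ0⟩
  · change Y (P.coordMap θ₀ R b) ∈ O
    rw [(hYc b hb).2]; exact (hbij.1 hb.1).1
  · exact (congrArg G₀ (hYc b hb).2).trans (hinv.1 hb.1)
  · have hch : ∀ {θ θ' : Circle}, θ' ∈ (chartAt ℝ^1 θ).source →
        ∃ χ : ℂ → ℝ^1, ContMDiffAt 𝓘(ℝ, ℂ) (𝓡 1) ∞ χ θ' ∧
          ∀ ζ : Circle, χ ζ = chartAt ℝ^1 θ ζ := fun hm =>
      exists_circle_extension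
        (contMDiffAt_of_mem_maximalAtlas (IsManifold.chart_mem_maximalAtlas _) hm)
    obtain ⟨χ, k1, k2⟩ := hch hb.2.1
    choose χ₁ k3 k4 using fun j => hch (hb.2.2.1 j)
    set pr : X × ℝ × (Fin D.N → ℝ) × (Fin D.N → ℂ) → ℂ := fun q =>
      q.2.2.2 i ^ D.m i * ∏ j : ↥(c.S.erase i), q.2.2.2 j ^ D.m j with hpr
    have hprs : ContDiff ℝ ∞ fun q : ℝ × (Fin D.N → ℝ) × (Fin D.N → ℂ) =>
        q.2.2 i ^ D.m i * ∏ j : ↥(c.S.erase i), q.2.2 j ^ D.m j :=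
      ContDiff.mul (by fun_prop) (contDiff_prod fun j _ => by fun_prop)
    have hprb : ∀ b : P.Space, P.proj b ∈ c.dom → pr (P.can c b) = P.theta b := fun b hb => by
      simp only [hpr, can_snd_of_mem hi, fun j : ↥(c.S.erase i) =>
        can_snd_of_mem (P := P) (a := b) (hmS j)]
      refine Eq.symm ((congrArg (fun θ : Circle => (θ : ℂ)) (theta_eq hb hi)).trans ?_)
      simp only [Circle.coe_mul, Circle.coe_pow, circle_coe_prod]
    refine ⟨fun q => (χ (pr q), fun j => q.2.2.1 j, fun j => χ₁ j (q.2.2.2 j),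
      fun k => c.chart q.1 k), ?_, ?_⟩
    · have k5 : ContMDiffAt (canModel D) 𝓘(ℝ, ℝ^1) ∞ (fun q => χ (pr q))
          (P.can c b) := ContMDiffAt.comp (I' := 𝓘(ℝ, ℂ)) _ ((hprb b hb.1.1).symm ▸ k1)
            (contMDiffAt_comp_snd hprs _)
      have k6 : ∀ j, ContMDiffAt (canModel D) 𝓘(ℝ, ℝ^1) ∞
          (fun q => χ₁ j (q.2.2.2 j)) (P.can c b) := fun j =>
        ContMDiffAt.comp (I' := 𝓘(ℝ, ℂ)) (g := χ₁ j) (f := fun q : X × ℝ × (Fin D.N → ℝ) × (Fin D.N → ℂ) => q.2.2.2 j) _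
          (by rw [can_snd_of_mem (hmS j)]; exact k3 j)
          (contMDiffAt_comp_snd (r := ∞) (φ := fun q => q.2.2 (j : Fin D.N)) (by fun_prop) _)
      have k7 : ContDiff ℝ ∞ fun ξ : ℂ^n => fun k : c.RestIdx => ξ k := by
        fun_prop
      exact k5.prodMk_space ((contMDiffAt_comp_snd (r := ∞) (φ := fun q => fun j : ↥(c.S.erase i) => q.2.1 j)
        (by fun_prop) _).prodMk_space ((contMDiffAt_pi_space.2 k6).prodMk_space
          (contMDiffAt_comp_fst (φ := fun x => fun k : c.RestIdx => c.chart x k)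
            (k7.contMDiff.contMDiffAt.comp _ (contMDiffAt_chart hb.1.1)))))
    · filter_upwards [eventually_proj hb.1.1] with b' hb'
      refine Prod.ext ?_ (Prod.ext rfl (Prod.ext (funext fun j => ?_) rfl))
      · exact ((congrArg χ (hprb b' hb')).trans (k2 _)).symm
      · exact ((congrArg (χ₁ j) (can_snd_of_mem (hmS j))).trans (k4 j _)).symm
  · have hy' := hQ y hy h0
    have hmem : G₀ (Y y) ∈ P.pieceA c i := by
      obtain ⟨b, hb, hb'⟩ := hbij.2.2 hy'
      rw [← hb', hinv.1 hb]; exact hb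
    have hψ : P.psiBar c i (G₀ (Y y)) = Y y := hinv.2 hy'
    have hargi : ((G₀ (Y y)).1.1.arg (c.z i) : ℂ) = ρ.symm (B y) :=
      (congrFun (congrArg (·.2.2.1) hψ) ⟨i, hi⟩).trans (dif_pos rfl)
    have hargj : ∀ j : ↥(c.S.erase i), (G₀ (Y y)).1.1.arg (c.z j) = (φ₁ j).symm (y.2.2.2.1 j) :=
      fun j => Circle.ext ((congrFun (congrArg (·.2.2.1) hψ) ⟨j, hmS j⟩).trans
        (dif_neg (ne_of_mem_erase j.2)))
    have hth : P.theta (G₀ (Y y)) = φ.symm y.2.1 := by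
      have k1 : (G₀ (Y y)).1.1.arg (c.z i) ^ D.m i = B y := Circle.ext (by
        rw [Circle.coe_pow, hargi]
        have k2 := ρ.right_inv hy.1.2
        rwa [hρ] at k2)
      rw [theta_eq hmem.1 hi, k1, hB, baseAngle, Finset.prod_inv_distrib]
      simp only [hargj]
      exact inv_mul_cancel_right _ _
    have hmaps : MapsTo Y ({y | 0 ≤ y.1} ∩ T) (O ∩ Q c i) := fun y hy => hQ y hy.2 hy.1
    refine ⟨⟨hmem, ?_, fun j => ?_, ?_⟩, Prod.ext (congrArg (·.1) hψ) (Prod.ext ?_ (Prod.ext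
      (congrArg (·.2.1) hψ) (Prod.ext (funext fun j => ?_) (congrArg (·.2.2.2) hψ)))), ?_, ?_⟩
    · rw [hth]; exact φ.map_target hy.1.1.1
    · rw [hargj]; exact (φ₁ j).map_target (hy.1.1.2 j)
    · rw [hargi]; exact ρ.map_target hy.1.2
    · exact (congrArg φ hth).trans (φ.right_inv hy.1.1.1)
    · exact (congrArg (φ₁ j) (hargj j)).trans ((φ₁ j).right_inv (hy.1.1.2 j))
    · exact (continuousWithinAt_inter (hTo.mem_nhds hy)).1 ((hGc _ hy').comp
        (hYs y hy.1).continuousAt.continuousWithinAt hmaps)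
    · exact (contMDiffWithinAt_inter (hTo.mem_nhds hy)).1 ((hG _ hy').comp (I' := 𝓘(ℝ, CoordSpace c i))
        y (hYs y hy.1).contMDiffAt.contMDiffWithinAt hmaps)

end AdaptedPair

namespace AdaptedPair

theorem contMDiffAt_can_projInv [Nonempty P.Space] {x : X} (hx : D.f x ≠ 0) (hc : x ∈ c.dom) :
    ContMDiffAt 𝓘^n (canModel D) ∞ (fun x => P.can c (P.projInv x)) x := by
  have hev : ∀ᶠ y in 𝓝 x, D.f y ≠ 0 ∧ y ∈ c.dom :=
    (IsOpen.eventually_mem D.isOpen_f_ne hx).and (c.isOpen_dom.mem_nhds hc)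
  have h1 : ContMDiffAt 𝓘^n 𝓘^n ∞ (fun y => P.proj (P.projInv y)) x :=
    contMDiffAt_id.congr_of_eventuallyEq (hev.mono fun y hy => proj_projInv hy.1)
  have h2 : ContMDiffAt 𝓘^n 𝓘(ℝ) ∞ (fun y => P.g (P.projInv y)) x :=
    (D.contMDiffAt_g hx).congr_of_eventuallyEq
      (hev.mono fun y hy => congrArg D.g (proj_projInv hy.1))
  refine contMDiffWithinAt_can h1 h2 (fun j => contMDiffWithinAt_vBar_of_notMem le_rfl
    (continuousAt_projInv hx).continuousWithinAt (mem_univ x) ?_ h1 h2) fun j hj => ?_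
  · rw [proj_projInv hx]
    exact notMem_D hx j
  · exact (ContMDiffAt.congr_of_eventuallyEq ((contDiffAt_angle
      (z_ne_zero hc hj hx)).contMDiffAt.comp x (contMDiffAt_z hc j)) (hev.mono fun y hy => by
        rw [arg_of_ne (by rw [proj_projInv hy.1]; exact hy.2) hj (projInv_mem hy.1),
          proj_projInv hy.1]; rfl)).contMDiffWithinAt

theorem exists_submersion_chart {x : X} (hx : D.f x ≠ 0) (hc : x ∈ c.dom) :
    ∃ K : Submodule ℝ ℂ^n, finrank ℝ K = 2 * n - 2 ∧ ∃ (q : ℂ^n →L[ℝ] K)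
        (e : OpenPartialHomeomorph ℂ^n (ℂ × K)), c.chart x ∈ e.source ∧ e.source ⊆ c.chart.target ∧
        (∀ ξ, e ξ = (D.f (c.chart.symm ξ), q ξ)) ∧ ∀ y ∈ e.target, ContDiffAt ℝ ∞ e.symm y := by
  have hξ : c.chart x ∈ c.chart.target := c.chart.map_source hc
  set f₁ : ℂ^n → ℂ := fun ξ => D.f (c.chart.symm ξ)
  have hs : ContDiffOn ℝ ∞ f₁ c.chart.target := fun ξ h =>
    ((D.contMDiff_f.contMDiffAt.comp ξ (contMDiffAt_chart_symm h)).contDiffAt).contDiffWithinAt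
  have hm := D.holomorphic.mdifferentiableAt (x := c.chart.symm (c.chart x))
  have hm' := mdifferentiableAt_chart_symm c.chart_mem hξ
  have hcomp : MDifferentiableAt 𝓘(ℂ, ℂ^n) 𝓘(ℂ) f₁ (c.chart x) := hm.comp _ hm'
  have hd := (mdifferentiableAt_iff_differentiableAt.1 hcomp).hasFDerivAt.restrictScalars ℝ
  set F' := (fderiv ℂ f₁ (c.chart x)).restrictScalars ℝ
  have hsurj : Surjective F' := by
    have h1 : mfderiv 𝓘(ℂ, ℂ^n) 𝓘(ℂ) (D.f ∘ c.chart.symm ∘ c.chart) x =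
        mfderiv 𝓘(ℂ, ℂ^n) 𝓘(ℂ) D.f x :=
      EventuallyEq.mfderiv_eq <| (c.chart.open_source.eventually_mem hc).mono fun y hy =>
        congrArg D.f (c.chart.left_inv hy)
    have h2 := mfderiv_comp x hcomp (mdifferentiableAt_chart c.chart_mem hc)
    rw [mfderiv_eq_fderiv] at h2
    have h3 := D.submersion x hx
    rw [← h1] at h3
    intro w
    obtain ⟨v, hv⟩ := h3 w
    exact ⟨_, (DFunLike.congr_fun h2 v).symm.trans hv⟩
  have hr : F'.range = ⊤ := LinearMap.range_eq_top.2 hsurj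
  obtain ⟨q, hq⟩ := F'.ker_closedComplemented_of_finiteDimensional_range
  have hinj : Injective (F'.prod q) := (injective_iff_map_eq_zero _).2 fun v hv => by
    have h1 : F' v = 0 := congrArg Prod.fst hv
    have h2 := hq ⟨v, h1⟩
    have h3 : q v = 0 := congrArg Prod.snd hv
    rw [h3] at h2
    exact (congrArg Subtype.val h2).symm
  have hfr := LinearMap.finrank_range_add_finrank_ker (F' : ℂ^n →ₗ[ℝ] ℂ)
  have hE : finrank ℝ ℂ^n = 2 * n := by
    rw [← Module.finrank_mul_finrank ℝ ℂ, Complex.finrank_real_complex, finrank_euclideanSpace_fin]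
  have hC : finrank ℝ (F' : ℂ^n →ₗ[ℝ] ℂ).range = 2 := by
    rw [hr, finrank_top, Complex.finrank_real_complex]
  rw [hE, hC] at hfr
  set Λ : ℂ^n ≃L[ℝ] ℂ × F'.ker := (LinearEquiv.ofInjectiveOfFinrankEq
    (F'.prod q : ℂ^n →ₗ[ℝ] ℂ × F'.ker) hinj (by
      rw [finrank_prod, Complex.finrank_real_complex, hE]
      exact hfr.symm)).toContinuousLinearEquiv
  have hΛ : (Λ : ℂ^n →L[ℝ] ℂ × F'.ker) = F'.prod q := by ext <;> rfl
  obtain ⟨e, h1, h2, h3, h4⟩ := exists_openPartialHomeomorph c.chart.open_target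
    (H := fun ξ => (f₁ ξ, q ξ)) (f' := Λ) (hs.prodMk q.contDiff.contDiffOn) hξ
    (by rw [hΛ]; exact hd.prodMk q.hasFDerivAt)
  exact ⟨F'.ker, by omega, q, e, h1, h2, fun ξ => congrFun h3 ξ, h4⟩

theorem exists_isAdaptedAt_of_notMem (ha : a ∉ P.bd) : ∃ e, IsAdaptedAt P a e := by
  have : Nonempty P.Space := ⟨a⟩
  obtain ⟨c, hc⟩ := P.exists_chart (P.proj a)
  obtain ⟨K, hK, q, e, h1, h2, h3, h4⟩ := exists_submersion_chart ha hc
  set θ₀ := P.theta a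
  set φ := chartAt ℝ^1 θ₀
  set R : P.Space → K := fun b => q (c.chart (P.proj b))
  set S : ℝ × ℝ^1 × K → ℂ × K := fun y =>
    ((expNegInvGlue (omega y.1) : ℂ) * (φ.symm y.2.1 : ℂ), y.2.2)
  set T₀ : Set (ℝ × ℝ^1 × K) := {y | 0 < y.1 ∧ y.2.1 ∈ φ.target} with hT₀
  have hT₀o : IsOpen T₀ := (isOpen_lt continuous_const continuous_fst).inter
    (φ.open_target.preimage (by fun_prop))
  have hSs : ∀ y ∈ T₀, ContDiffAt ℝ ∞ S y := by
    intro y hy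
    have k1 : ContDiffAt ℝ ∞ (fun y : ℝ × ℝ^1 × K => (φ.symm y.2.1 : ℂ)) y :=
      (contMDiff_circle_coe.contMDiffAt.comp y ((contMDiffAt_symm_of_mem_maximalAtlas
        (IsManifold.chart_mem_maximalAtlas _) hy.2).comp y
          (ContDiff.contMDiff (by fun_prop)).contMDiffAt)).contDiffAt
    have k2 : ContDiffAt ℝ ∞ (fun y : ℝ × ℝ^1 × K =>
        (expNegInvGlue (omega y.1) : ℂ)) y :=
      Complex.ofRealCLM.contDiff.contDiffAt.comp y
        (expNegInvGlue.contDiff.contDiffAt.comp y ((contDiff_omega.contDiffAt).comp y contDiffAt_fst))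
    exact (k2.mul k1).prodMk (by fun_prop)
  set T := T₀ ∩ S ⁻¹' e.target
  have hTo : IsOpen T := ContinuousOn.isOpen_inter_preimage (fun y hy =>
    (hSs y hy).continuousAt.continuousWithinAt) hT₀o e.open_target
  set U : Set P.Space := {b | (P.proj b ∈ c.dom ∧ c.chart (P.proj b) ∈ e.source) ∧ b ∉ P.bd ∧
    P.theta b ∈ φ.source} with hU
  have hUo : IsOpen U := by
    refine isOpen_iff_mem_nhds.2 fun b hb => ?_
    have k1 : ContinuousAt (fun b => c.chart (P.proj b)) b :=
      ContinuousAt.comp (g := c.chart) (c.chart.continuousAt hb.1.1) (continuous_proj P).continuousAt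
    exact ((eventually_proj hb.1.1).and (k1.eventually (e.open_source.eventually_mem hb.1.2))).and
      ((isOpen_bd_compl.eventually_mem hb.2.1).and
        (continuous_theta.continuousAt.eventually (φ.open_source.eventually_mem hb.2.2)))
  set G : ℝ × ℝ^1 × K → P.Space := fun y =>
    P.projInv (c.chart.symm (e.symm (S y))) with hG
  have hSc : ∀ b ∈ U, S (P.coordMap θ₀ R b) = e (c.chart (P.proj b)) := by
    intro b hb
    refine Prod.ext ?_ (by rw [h3]; rfl)
    rw [h3, c.chart.left_inv hb.1.1]
    change (expNegInvGlue (omega (P.g b)) : ℂ) * (φ.symm (φ (P.theta b)) : ℂ) = D.f (P.proj b)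
    refine Eq.trans ?_ (norm_mul_angle _)
    rw [← theta_of_ne hb.2.1, D.norm_f_eq]
    exact congrArg (fun θ : Circle => (expNegInvGlue (omega (P.g b)) : ℂ) * (θ : ℂ))
      (φ.left_inv hb.2.2)
  have hGT : ∀ y ∈ T, (e.symm (S y) ∈ c.chart.target ∧
      D.f (c.chart.symm (e.symm (S y))) = (S y).1 ∧ q (e.symm (S y)) = y.2.2) ∧ (S y).1 ≠ 0 := by
    intro y hy
    have k1 := e.right_inv hy.2
    rw [h3] at k1
    refine ⟨⟨h2 (e.map_target hy.2), congrArg Prod.fst k1, congrArg Prod.snd k1⟩, mul_ne_zero ?_ (Circle.coe_ne_zero _)⟩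
    exact_mod_cast (expNegInvGlue.pos_of_pos (omega_pos hy.1.1)).ne'
  refine exists_isAdaptedAt hK hUo hTo (G := G) (R := R) (c := c) (θ₀ := θ₀)
    (fun b hb => ⟨hb.1.1, hb.2.2, ⟨⟨D.g_pos hb.2.1, φ.map_source hb.2.2⟩, ?_⟩, ?_, ?_⟩)
    (fun y hy h0 => ?_) ⟨⟨hc, h1⟩, ha, mem_chart_source _ _⟩
  · change S _ ∈ e.target
    rw [hSc b hb]
    exact e.map_source hb.1.2
  · change P.projInv (c.chart.symm (e.symm (S (P.coordMap θ₀ R b)))) = b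
    rw [hSc b hb, e.left_inv hb.1.2, c.chart.left_inv hb.1.1]
    exact invOn_projInv.1 hb.2.1
  · obtain ⟨χ, k1, k2⟩ := exists_circle_extension (contMDiffAt_of_mem_maximalAtlas (n := ∞)
      (I := 𝓡 1) (IsManifold.chart_mem_maximalAtlas _) hb.2.2)
    refine ⟨fun p => (χ (angle (D.f p.1)), q (c.chart p.1)), ?_, ?_⟩
    · have k3 : ContMDiffAt 𝓘^n 𝓘(ℝ, ℝ^1) ∞ (fun x => χ (angle (D.f x))) (P.proj b) :=
        ContMDiffAt.comp (I' := 𝓘(ℝ, ℂ)) _ ((theta_of_ne hb.2.1) ▸ k1)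
          ((contDiffAt_angle hb.2.1).contMDiffAt.comp _ D.contMDiff_f.contMDiffAt)
      exact (contMDiffAt_comp_fst (q := P.can c b) k3).prodMk_space
        (contMDiffAt_comp_fst (q := P.can c b) (φ := fun x => q (c.chart x))
          (q.contDiff.contMDiff.contMDiffAt.comp _ (contMDiffAt_chart hb.1.1)))
    · filter_upwards [isOpen_bd_compl.eventually_mem hb.2.1] with b' hb'
      refine Prod.ext ?_ rfl
      exact ((congrArg χ (theta_of_ne hb')).symm.trans (k2 _)).symm
  · obtain ⟨⟨k1, k2, k3⟩, k4⟩ := hGT y hy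
    have hx : D.f (c.chart.symm (e.symm (S y))) ≠ 0 := by rwa [k2]
    have hd : c.chart.symm (e.symm (S y)) ∈ c.dom := c.chart.map_target k1
    have hp : P.proj (G y) = c.chart.symm (e.symm (S y)) := proj_projInv hx
    have hb : G y ∉ P.bd := projInv_mem hx
    have hE : 0 < expNegInvGlue (omega y.1) := expNegInvGlue.pos_of_pos (omega_pos hy.1.1)
    have hth : P.theta (G y) = φ.symm y.2.1 := Circle.ext (by
      rw [theta_of_ne hb, hp, k2]
      change angle (_ * _) = _
      rw [map_mul, angle_ofReal hE, one_mul, angle_circle])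
    have hch : c.chart (P.proj (G y)) = e.symm (S y) := by rw [hp, c.chart.right_inv k1]
    have hsm : ContMDiffAt 𝓘(ℝ, ℝ × ℝ^1 × K) 𝓘^n ∞ (fun y => c.chart.symm (e.symm (S y))) y :=
      (contMDiffAt_chart_symm k1).comp y (ContDiffAt.contMDiffAt
        (ContDiffAt.comp y (g := e.symm) (h4 _ hy.2) (hSs y hy.1)))
    refine ⟨⟨⟨hp ▸ hd, ?_⟩, hb, ?_⟩, Prod.ext ?_ (Prod.ext ?_ ?_), ?_, ?_⟩
    · rw [hch]; exact e.map_target hy.2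
    · rw [hth]; exact φ.map_target hy.1.2
    · refine omega_injective (D.g_nonneg _) h0 ?_
      refine (D.norm_f_eq _).symm.trans ?_
      rw [hp, k2]
      change ‖_ * _‖ = _
      rw [norm_mul, Circle.norm_coe, mul_one, Complex.norm_real, Real.norm_of_nonneg hE.le]
    · exact (congrArg φ hth).trans (φ.right_inv hy.1.2)
    · exact (congrArg q hch).trans k3
    · exact (ContinuousAt.comp (g := P.projInv) (f := fun y => c.chart.symm (e.symm (S y)))
        (continuousAt_projInv hx) hsm.continuousAt).continuousWithinAt
    · exact (ContMDiffAt.comp (I' := 𝓘^n) y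
        (g := fun x => P.can c (P.projInv x)) (contMDiffAt_can_projInv hx hd) hsm).contMDiffWithinAt

theorem exists_isAdaptedAt_self [T2Space X] (a : P.Space) : ∃ e, IsAdaptedAt P a e := by
  by_cases ha : a ∈ P.bd
  · exact exists_isAdaptedAt_bd ha
  · exact exists_isAdaptedAt_of_notMem ha

end AdaptedPair

namespace AdaptedPair

variable {e e' : OpenPartialHomeomorph P.Space (EuclideanHalfSpace (2 * n))}
  {E' H' M : Type*} [NormedAddCommGroup E'] [NormedSpace ℝ E']
  [TopologicalSpace H'] {J : ModelWithCorners ℝ E' H'} [TopologicalSpace M] [ChartedSpace H' M]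
  {H : M → P.Space} {s : Set M} {x : M} {r : WithTop ℕ∞}

theorem nonempty_space (P : AdaptedPair D ι) [h : Nonempty X] : Nonempty P.Space := by
  obtain ⟨c, hc⟩ := P.exists_chart h.some
  have := neBot_nhdsWithin hc
  obtain ⟨y, hy⟩ := Filter.nonempty_of_mem (self_mem_nhdsWithin (a := h.some) (s := {y | D.f y ≠ 0}))
  exact ⟨(exists_proj_eq (P := P) hy).choose⟩

theorem IsSmoothChart.contMDiffWithinAt_comp (he : IsSmoothChart P e) (hr : r ≤ ∞)
    (hH : ContinuousWithinAt H s x) (hx : x ∈ s) (hm : H x ∈ e.source) (hc : P.proj (H x) ∈ c.dom)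
    (h : ContMDiffWithinAt J (canModel D) r (fun y => P.can c (H y)) s x) :
    ContMDiffWithinAt J 𝓘(ℝ, ModelSpace n) r (fun y => (𝓡∂ (2 * n)) (e (H y))) s x := by
  obtain ⟨Ψ, h1, h2⟩ := he.exists_eq _ hm c hc
  exact (ContMDiffAt.comp_contMDiffWithinAt (I' := canModel D) x (g := Ψ) (h1.of_le hr)
    h).congr_of_eventuallyEq_of_mem (hH.tendsto.eventually h2) hx

theorem IsSmoothChart.contDiffOn_trans (he : IsSmoothChart P e) (he' : IsSmoothChart P e') :
    ContDiffOn ℝ ∞ ((𝓡∂ (2 * n)) ∘ (e.symm ≫ₕ e') ∘ (𝓡∂ (2 * n)).symm)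
      ((𝓡∂ (2 * n)).symm ⁻¹' (e.symm ≫ₕ e').source ∩ range (𝓡∂ (2 * n))) := by
  rintro y ⟨hy, hz⟩
  obtain ⟨z, rfl⟩ := hz
  rw [mem_preimage, ModelWithCorners.left_inv] at hy
  obtain ⟨h1, h2⟩ : z ∈ e.target ∧ e.symm z ∈ e'.source := by simpa using hy
  obtain ⟨c, hc⟩ := P.exists_chart (P.proj (e.symm z))
  have h3 := he.symm _ (e.map_target h1) c hc
  rw [e.right_inv h1] at h3
  refine (contMDiffWithinAt_iff_contDiffWithinAt.1 (he'.contMDiffWithinAt_comp (c := c) le_rfl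
    (H := fun y => e.symm ((𝓡∂ (2 * n)).symm y)) ?_ (mem_range_self z) ?_ ?_ h3)).mono inter_subset_right
  · refine ContinuousAt.continuousWithinAt (ContinuousAt.comp (g := e.symm) ?_
      (𝓡∂ (2 * n)).continuous_symm.continuousAt)
    rw [ModelWithCorners.left_inv]
    exact e.continuousAt_symm h1
  · rw [ModelWithCorners.left_inv]; exact h2
  · rw [ModelWithCorners.left_inv]; exact hc

/-- The smooth structure of the A'Campo space. -/
abbrev chartedSpace [T2Space X] (P : AdaptedPair D ι) :
    ChartedSpace (EuclideanHalfSpace (2 * n)) P.Space where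
  atlas := {e | IsSmoothChart P e}
  chartAt a := (exists_isAdaptedAt_self a).choose
  mem_chart_source a := (exists_isAdaptedAt_self a).choose_spec.2.1
  chart_mem_atlas a := (exists_isAdaptedAt_self a).choose_spec.1

variable [ChartedSpace (EuclideanHalfSpace (2 * n)) P.Space]

variable (P) in
/-- The given atlas consists of the charts of the smooth structure of the A'Campo space. -/
structure HasSmoothAtlas : Prop where
  isSmoothChart : ∀ e ∈ atlas (EuclideanHalfSpace (2 * n)) P.Space, IsSmoothChart P e
  isAdaptedAt : ∀ a, IsAdaptedAt P a (chartAt (EuclideanHalfSpace (2 * n)) a)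

namespace HasSmoothAtlas

theorem isManifold (hP : P.HasSmoothAtlas) : IsManifold (𝓡∂ (2 * n)) ∞ P.Space :=
  isManifold_of_contDiffOn _ _ _ fun _ _ he he' =>
    (hP.isSmoothChart _ he).contDiffOn_trans (hP.isSmoothChart _ he')

theorem boundary_eq (hP : P.HasSmoothAtlas) : (𝓡∂ (2 * n)).boundary P.Space = P.bd := by
  ext a
  obtain ⟨-, h1, θ₀, R, h2⟩ := hP.isAdaptedAt a
  rw [← g_eq_zero_iff]
  have h3 : (𝓡∂ (2 * n)).IsBoundaryPoint a ↔ extChartAt (𝓡∂ (2 * n)) a a ∈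
    frontier (range (𝓡∂ (2 * n))) := (𝓡∂ (2 * n)).isBoundaryPoint_iff
  refine h3.trans ?_
  rw [frontier_range_modelWithCornersEuclideanHalfSpace]
  change 0 = (𝓡∂ (2 * n)) (chartAt _ a a) 0 ↔ _
  rw [(h2 a h1).2, modelEquiv_zero]
  exact eq_comm

theorem contMDiffWithinAt_of_can (hP : P.HasSmoothAtlas) (hr : r ≤ ∞)
    (hH : ContinuousWithinAt H s x) (hx : x ∈ s) (hc : P.proj (H x) ∈ c.dom)
    (h : ContMDiffWithinAt J (canModel D) r (fun y => P.can c (H y)) s x) :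
    ContMDiffWithinAt J (𝓡∂ (2 * n)) r H s x :=
  contMDiffWithinAt_iff_target.2 ⟨hH, (hP.isAdaptedAt (H x)).1.contMDiffWithinAt_comp hr hH hx
    (hP.isAdaptedAt (H x)).2.1 hc h⟩

theorem contMDiffAt_can (hP : P.HasSmoothAtlas) (hc : P.proj a ∈ c.dom) :
    ContMDiffAt (𝓡∂ (2 * n)) (canModel D) ∞ (P.can c) a :=
  contMDiffAt_iff_source.2 ((hP.isAdaptedAt a).1.symm _ (hP.isAdaptedAt a).2.1 c hc)

theorem contMDiffAt_comp_can (hP : P.HasSmoothAtlas) (hc : P.proj a ∈ c.dom) (hr : r ≤ ∞)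
    {φ : P.Space → M} {Ψ} (hΨ : ContMDiffAt (canModel D) J r Ψ (P.can c a))
    (h : ∀ᶠ b in 𝓝 a, φ b = Ψ (P.can c b)) : ContMDiffAt (𝓡∂ (2 * n)) J r φ a :=
  (ContMDiffAt.comp (I' := canModel D) a hΨ ((hP.contMDiffAt_can hc).of_le hr)).congr_of_eventuallyEq
    h

theorem contMDiff_proj (hP : P.HasSmoothAtlas) :
    ContMDiff (𝓡∂ (2 * n)) 𝓘^n ∞ P.proj := fun a => by
  obtain ⟨c, hc⟩ := P.exists_chart (P.proj a)
  exact hP.contMDiffAt_comp_can hc le_rfl contMDiffAt_fst (Eventually.of_forall fun _ => rfl)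

theorem contMDiff_comp_snd (hP : P.HasSmoothAtlas) {F : Type*} [NormedAddCommGroup F]
    [NormedSpace ℝ F] {φ : ℝ × (Fin D.N → ℝ) → F} (hφ : ContDiff ℝ ∞ φ) :
    ContMDiff (𝓡∂ (2 * n)) 𝓘(ℝ, F) ∞ fun a => φ (P.g a, fun j => P.vBar j a) := fun a => by
  obtain ⟨c, hc⟩ := P.exists_chart (P.proj a)
  exact hP.contMDiffAt_comp_can hc le_rfl (contMDiffAt_comp_snd (φ := fun q => φ (q.1, q.2.1))
    (hφ.comp (by fun_prop)) _) (Eventually.of_forall fun _ => rfl)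

theorem contMDiffAt_arg (hP : P.HasSmoothAtlas) (hc : P.proj a ∈ c.dom) {j : Fin D.N}
    (hj : j ∈ c.S) : ContMDiffAt (𝓡∂ (2 * n)) 𝓘(ℝ, ℂ) ∞ (fun b => (b.1.1.arg (c.z j) : ℂ)) a :=
  hP.contMDiffAt_comp_can hc le_rfl (contMDiffAt_comp_snd (φ := fun q => q.2.2 j) (by fun_prop) _)
    (Eventually.of_forall fun _ => (can_snd_of_mem hj).symm)

theorem isSubmersion (hP : P.HasSmoothAtlas) [IsManifold (𝓡∂ (2 * n)) ∞ P.Space] :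
    Manifold.IsSubmersion (𝓡∂ (2 * n)) (𝓘(ℝ).prod (𝓡 1)) ∞
      (fun a : P.Space => (P.g a, P.theta a)) := by
  refine ⟨RestSpace n, inferInstance, inferInstance, fun a => ?_⟩
  obtain ⟨-, h1, θ₀, R, h2⟩ := hP.isAdaptedAt a
  refine Manifold.IsSubmersionAtOfComplement.mk_of_continuousAt
    (continuous_g_space.prodMk continuous_theta).continuousAt ((modelEquiv n).symm.trans
      (ContinuousLinearEquiv.prodAssoc ℝ ℝ ℝ^1 (RestSpace n)).symm)
    (chartAt _ a) ((OpenPartialHomeomorph.refl ℝ).prod (chartAt ℝ^1 θ₀)) h1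
    ⟨mem_univ _, (h2 a h1).1⟩ (IsManifold.chart_mem_maximalAtlas a)
    (IsManifold.mem_maximalAtlas_prod (IsManifold.subset_maximalAtlas rfl)
      (IsManifold.chart_mem_maximalAtlas _)) ?_
  intro y hy'
  obtain ⟨⟨z, rfl⟩, hy⟩ := (by simpa using hy' : (∃ z, (𝓡∂ (2 * n)) z = y) ∧
    (𝓡∂ (2 * n)).symm y ∈ (chartAt (EuclideanHalfSpace (2 * n)) a).target)
  have hz : z ∈ (chartAt (EuclideanHalfSpace (2 * n)) a).target := by
    rwa [ModelWithCorners.left_inv] at hy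
  have h3 := (h2 _ ((chartAt (EuclideanHalfSpace (2 * n)) a).map_target hz)).2
  rw [(chartAt (EuclideanHalfSpace (2 * n)) a).right_inv hz] at h3
  refine (congrArg (fun w => (P.g ((chartAt (EuclideanHalfSpace (2 * n)) a).symm w),
    chartAt ℝ^1 θ₀ (P.theta ((chartAt (EuclideanHalfSpace (2 * n)) a).symm w))))
    ((𝓡∂ (2 * n)).left_inv z)).trans ?_
  change _ = ((modelEquiv n).symm.trans (ContinuousLinearEquiv.prodAssoc ℝ ℝ ℝ^1 (RestSpace n)).symm
        ((𝓡∂ (2 * n)) z)).1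
  rw [h3]
  simp [coordMap]

theorem contMDiff_fA (hP : P.HasSmoothAtlas) [IsManifold (𝓡∂ (2 * n)) ∞ P.Space] :
    ContMDiff (𝓡∂ (2 * n)) (𝓘(ℝ).prod (𝓡 1)) ∞ P.fA := by
  have h1 := hP.isSubmersion.contMDiff
  have h2 : ContMDiff (𝓡∂ (2 * n)) 𝓘(ℝ) ∞ fun a => ‖D.f (P.proj a)‖ := by
    simp only [D.norm_f_eq]
    exact hP.contMDiff_comp_snd (φ := fun q => expNegInvGlue (omega q.1))
      (expNegInvGlue.contDiff.comp (contDiff_omega.comp contDiff_fst))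
  exact h2.prodMk (contMDiff_snd.comp h1)

theorem isDiffeoOn_proj (hP : P.HasSmoothAtlas) : IsDiffeoOn (𝓡∂ (2 * n))
    𝓘^n ∞ P.proj P.bdᶜ {x | D.f x ≠ 0} := by
  refine ⟨P.bijOn_proj, hP.contMDiff_proj.contMDiffOn, ?_⟩
  rcases isEmpty_or_nonempty X with h | h
  · exact ⟨h.elim, ⟨fun a => h.elim (P.proj a), fun x => h.elim x⟩, fun x => h.elim x⟩
  · have := nonempty_space P
    refine ⟨P.projInv, invOn_projInv, fun x hx => ?_⟩
    obtain ⟨c, hc⟩ := P.exists_chart x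
    have h1 : P.proj (P.projInv x) ∈ c.dom := by rwa [proj_projInv hx]
    exact (hP.contMDiffWithinAt_of_can le_rfl (continuousAt_projInv hx).continuousWithinAt
      (mem_univ x) h1 (contMDiffAt_can_projInv hx hc).contMDiffWithinAt).mono (subset_univ _)

end HasSmoothAtlas

end AdaptedPair

theorem contDiffOn_of_inverse {E F : Type*} [NormedAddCommGroup E] [NormedSpace ℝ E]
    [NormedAddCommGroup F] [NormedSpace ℝ F] [CompleteSpace E] {f : E → F} {k : F → E}
    {s : Set E} {t : Set F} (hs : UniqueDiffOn ℝ s) (ht : UniqueDiffOn ℝ t) (hst : MapsTo f s t)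
    (hts : MapsTo k t s) (hkf : LeftInvOn k f s) (hfk : LeftInvOn f k t)
    (hf : ContDiffOn ℝ ∞ f s) (hk : ContDiffOn ℝ 1 k t) : ContDiffOn ℝ ∞ k t := by
  have hkd := hk.differentiableOn one_ne_zero
  have hfd := hf.differentiableOn (by simp)
  have hinv : ∀ y ∈ t, ∃ Λ : E ≃L[ℝ] F, (Λ : E →L[ℝ] F) = fderivWithin ℝ f s (k y) ∧
      fderivWithin ℝ k t y = ContinuousLinearMap.inverse (fderivWithin ℝ f s (k y)) := by
    intro y hy
    have h1 := (hfd _ (hts hy)).hasFDerivWithinAt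
    have h2 := (hkd _ hy).hasFDerivWithinAt
    have h3 := (h1.comp y h2 hts).congr' (fun z hz => (hfk hz).symm) hy
    have h4 : HasFDerivWithinAt (k ∘ f) ((fderivWithin ℝ k t y).comp (fderivWithin ℝ f s (k y)))
        s (k y) := by
      refine HasFDerivWithinAt.comp (k y) ?_ h1 hst
      rwa [hfk hy]
    have h5 := h4.congr' (fun z hz => (hkf hz).symm) (hts hy)
    have h6 := (ht y hy).eq h3 (hasFDerivWithinAt_id y t)
    have h7 := (hs _ (hts hy)).eq h5 (hasFDerivWithinAt_id _ s)
    set Λ := ContinuousLinearEquiv.equivOfInverse (fderivWithin ℝ f s (k y))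
      (fderivWithin ℝ k t y) (fun v => DFunLike.congr_fun h7 v) (fun v => DFunLike.congr_fun h6 v)
    have h8 : (Λ : E →L[ℝ] F) = fderivWithin ℝ f s (k y) := rfl
    refine ⟨Λ, h8, ?_⟩
    rw [← h8, ContinuousLinearMap.inverse_equiv]
    rfl
  refine contDiffOn_infty.2 fun m => ?_
  induction m with
  | zero => exact hk.of_le (by simp)
  | succ m ih =>
    rw [Nat.cast_add, Nat.cast_one, contDiffOn_succ_iff_fderivWithin ht]
    refine ⟨hkd, fun h => absurd h (by exact_mod_cast WithTop.coe_ne_top), fun y hy => ?_⟩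
    obtain ⟨Λ, h1, h2⟩ := hinv y hy
    refine ContDiffWithinAt.congr (f := fun y => ContinuousLinearMap.inverse
      (fderivWithin ℝ f s (k y))) ?_ (fun z hz => (hinv z hz).choose_spec.2) h2
    refine ContDiffAt.comp_contDiffWithinAt (g := ContinuousLinearMap.inverse) y ?_
      ((((hf.fderivWithin hs (m := ∞) (by simp)) _ (hts hy)).of_le
        (by exact_mod_cast le_top)).comp y (ih y hy) hts)
    rw [← h1]
    exact contDiffAt_map_inverse Λ

namespace AdaptedPair

section Param

variable (y0 : CoordSpace c i)

open Classical in
/-- The parametrization of `Q_{k,n}` by angles, near the point `y0`. -/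
def angleParam (v : ℝ × (↥(c.S.erase i) → ℝ) × (↥c.S → ℝ) × (c.RestIdx → ℂ)) : CoordSpace c i :=
  (v.1, v.2.1, fun j => Complex.exp (v.2.2.1 j * Complex.I) * y0.2.2.1 j, v.2.2.2)

open Classical in
/-- The angle coordinates on `Q_{k,n}` near the point `y0`. -/
def angleCoord (y : CoordSpace c i) : ℝ × (↥(c.S.erase i) → ℝ) × (↥c.S → ℝ) × (c.RestIdx → ℂ) :=
  (y.1, y.2.1, fun j => (Complex.log (y.2.2.1 j / y0.2.2.1 j)).im, y.2.2.2)

/-- A neighbourhood of `y0` on which the angle coordinates are smooth. -/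
def angleSet : Set (CoordSpace c i) := {y | ∀ j, y.2.2.1 j / y0.2.2.1 j ∈ Complex.slitPlane}

theorem contDiff_angleParam : ContDiff ℝ ∞ (angleParam y0) := by
  unfold angleParam
  refine ContDiff.prodMk (by fun_prop) (ContDiff.prodMk (by fun_prop)
    (ContDiff.prodMk (contDiff_pi.2 fun j => ContDiff.mul ?_ contDiff_const) (by fun_prop)))
  exact Complex.contDiff_exp.comp ((Complex.ofRealCLM.contDiff.comp
    (by fun_prop)).mul contDiff_const)

variable {y0}

theorem contDiffAt_angleCoord {y : CoordSpace c i} (hy : y ∈ angleSet y0) :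
    ContDiffAt ℝ ∞ (angleCoord y0) y := by
  unfold angleCoord
  refine ContDiffAt.prodMk (by fun_prop) (ContDiffAt.prodMk (by fun_prop)
    (ContDiffAt.prodMk (contDiffAt_pi.2 fun j => ?_) (by fun_prop)))
  refine Complex.imCLM.contDiff.contDiffAt.comp y (ContDiffAt.comp y (g := Complex.log)
      (f := fun y : CoordSpace c i => y.2.2.1 j / y0.2.2.1 j)
      ((Complex.contDiffAt_log (hy j)).restrict_scalars ℝ) ?_)
  exact ContDiffAt.div_const (by fun_prop) _

theorem isOpen_angleSet : IsOpen (angleSet y0) := by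
  simp only [angleSet, ofPred_forall]
  exact isOpen_iInter_of_finite fun j => Complex.isOpen_slitPlane.preimage
    (Continuous.div_const (by fun_prop) _)

variable (hy0 : y0 ∈ Q c i)
include hy0

theorem mem_angleSet : y0 ∈ angleSet y0 := fun j => by
  rw [div_self (norm_ne_zero_iff.1 (by rw [hy0.2 j]; exact one_ne_zero))]
  exact Complex.one_mem_slitPlane

theorem angleParam_mem {v} (h : 0 ≤ v.1) : angleParam y0 v ∈ Q c i := ⟨h, fun j => by
  change ‖_ * _‖ = 1
  rw [norm_mul, Complex.norm_exp_ofReal_mul_I, hy0.2 j, one_mul]⟩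

theorem angleParam_angleCoord {y : CoordSpace c i} (hy : y ∈ Q c i) :
    angleParam y0 (angleCoord y0 y) = y := by
  refine Prod.ext rfl (Prod.ext rfl (Prod.ext (funext fun j => ?_) rfl))
  have h0 : y0.2.2.1 j ≠ 0 := norm_ne_zero_iff.1 (by rw [hy0.2 j]; exact one_ne_zero)
  have h1 := Complex.norm_mul_exp_arg_mul_I (y.2.2.1 j / y0.2.2.1 j)
  rw [norm_div, hy.2 j, hy0.2 j, div_one, Complex.ofReal_one, one_mul] at h1
  change Complex.exp (((Complex.log (y.2.2.1 j / y0.2.2.1 j)).im : ℝ) * Complex.I) * _ = _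
  rw [Complex.log_im, h1, div_mul_cancel₀ _ h0]

theorem angleCoord_angleParam {v} (h : ∀ j, v.2.2.1 j ∈ Ioo (-Real.pi) Real.pi) :
    angleCoord y0 (angleParam y0 v) = v := by
  refine Prod.ext rfl (Prod.ext rfl (Prod.ext (funext fun j => ?_) rfl))
  have h0 : y0.2.2.1 j ≠ 0 := norm_ne_zero_iff.1 (by rw [hy0.2 j]; exact one_ne_zero)
  change (Complex.log (Complex.exp (v.2.2.1 j * Complex.I) * y0.2.2.1 j / y0.2.2.1 j)).im = _
  rw [mul_div_cancel_right₀ _ h0, Complex.log_exp] <;> simp [(h j).1, (h j).2.le]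

end Param

theorem contMDiffOn_of_inverse {E H M : Type*} [NormedAddCommGroup E] [NormedSpace ℝ E]
    [CompleteSpace E] [TopologicalSpace H] {I : ModelWithCorners ℝ E H} [TopologicalSpace M]
    [ChartedSpace H M] [IsManifold I ∞ M] {c : AdaptedChart D} {i : Fin D.N}
    {F : M → CoordSpace c i} {G : CoordSpace c i → M} {Ω : Set M} {O : Set (CoordSpace c i)}
    (hΩ : IsOpen Ω) (hO : IsOpen O) (hF : ContMDiffOn I 𝓘(ℝ, CoordSpace c i) ∞ F Ω)
    (hb : BijOn F Ω (O ∩ Q c i)) (hi : InvOn G F Ω (O ∩ Q c i))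
    (hG : ContMDiffOn 𝓘(ℝ, CoordSpace c i) I 1 G (O ∩ Q c i)) :
    ContMDiffOn 𝓘(ℝ, CoordSpace c i) I ∞ G (O ∩ Q c i) := by
  intro y0 hy0
  set a := G y0
  have hQ := hy0.2
  set B := angleSet y0
  set α := angleParam y0 with hα
  set β := angleCoord y0 with hβ
  have hαc : Continuous α := (contDiff_angleParam y0).continuous
  have hGΩ : MapsTo G (O ∩ Q c i) Ω := fun y hy => by
    obtain ⟨b, hb1, rfl⟩ := hb.surjOn hy
    rw [hi.1 hb1]; exact hb1
  set Ω' := Ω ∩ F ⁻¹' B with hΩ'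
  have hΩ'o : IsOpen Ω' := hF.continuousOn.isOpen_inter_preimage hΩ isOpen_angleSet
  set s := (extChartAt I a).target ∩ (extChartAt I a).symm ⁻¹' Ω'
  set t : Set (ℝ × (↥(c.S.erase i) → ℝ) × (↥c.S → ℝ) × (c.RestIdx → ℂ)) :=
    {v | 0 ≤ v.1 ∧ (α v ∈ O ∧ α v ∈ B ∧ ∀ j, v.2.2.1 j ∈ Ioo (-Real.pi) Real.pi) ∧
      G (α v) ∈ (chartAt H a).source} with ht
  have htQ : MapsTo α t (O ∩ Q c i) := fun v hv => ⟨hv.2.1.1, angleParam_mem hQ hv.1⟩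
  have hGsrc : ∀ y ∈ O ∩ Q c i, G y ∈ (chartAt H a).source →
      ∀ᶠ z in 𝓝[O ∩ Q c i] y, G z ∈ (chartAt H a).source := fun y hy h =>
    (hG.continuousOn y hy).tendsto.eventually ((chartAt H a).open_source.eventually_mem h)
  have htu : UniqueDiffOn ℝ t := by
    intro v hv
    have h1 : UniqueDiffOn ℝ {v : ℝ × (↥(c.S.erase i) → ℝ) × (↥c.S → ℝ) × (c.RestIdx → ℂ) |
        0 ≤ v.1} := by
      refine uniqueDiffOn_convex (convex_halfSpace_ge
        (⟨fun _ _ => rfl, fun _ _ => rfl⟩ : IsLinearMap ℝ Prod.fst) 0) ⟨(1, 0), mem_interior.2 ⟨{v | 0 < v.1}, fun v (hv : 0 < v.1) =>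
          (hv.le : 0 ≤ v.1),
          isOpen_lt continuous_const continuous_fst, (one_pos : (0 : ℝ) < 1)⟩⟩
    refine (h1 v hv.1).mono_nhds (nhdsWithin_le_iff.2 ?_)
    have h2 : Tendsto α (𝓝[{v | 0 ≤ v.1}] v) (𝓝[O ∩ Q c i] (α v)) := by
      refine tendsto_nhdsWithin_iff.2 ⟨hαc.continuousAt.continuousWithinAt, ?_⟩
      filter_upwards [self_mem_nhdsWithin, nhdsWithin_le_nhds
        (hαc.continuousAt.eventually (hO.eventually_mem hv.2.1.1))] with w h3 h4
      exact ⟨h4, angleParam_mem hQ h3⟩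
    have h5 : ∀ᶠ w in 𝓝 v, ∀ j, w.2.2.1 j ∈ Ioo (-Real.pi) Real.pi := eventually_all.2 fun j =>
      (isOpen_Ioo.preimage (by fun_prop : Continuous fun w : ℝ × (↥(c.S.erase i) → ℝ) ×
        (↥c.S → ℝ) × (c.RestIdx → ℂ) => w.2.2.1 j)).eventually_mem (hv.2.1.2.2 j)
    filter_upwards [self_mem_nhdsWithin, nhdsWithin_le_nhds
      (hαc.continuousAt.eventually (hO.eventually_mem hv.2.1.1)), nhdsWithin_le_nhds
      (hαc.continuousAt.eventually (isOpen_angleSet.eventually_mem hv.2.1.2.1)),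
      nhdsWithin_le_nhds h5, h2.eventually (hGsrc _ (htQ hv) hv.2.2)] with w k1 k2 k3 k4 k5
    exact ⟨k1, ⟨k2, k3, k4⟩, k5⟩
  have hsym : ∀ z ∈ s, ContMDiffWithinAt 𝓘(ℝ, E) I ∞ (extChartAt I a).symm s z := fun z hz =>
    ((contMDiffOn_extChartAt_symm a).mono inter_subset_left) z hz
  have hext : ∀ b ∈ (chartAt H a).source, ContMDiffAt I 𝓘(ℝ, E) ∞ (extChartAt I a) b :=
    fun b hb => contMDiffAt_extChartAt' hb
  have key : ContDiffOn ℝ ∞ (fun v => extChartAt I a (G (α v))) t := by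
    refine contDiffOn_of_inverse (s := s) (f := fun z => β (F ((extChartAt I a).symm z)))
      (hΩ'o.uniqueMDiffOn.uniqueDiffOn_target_inter a) htu ?_ ?_ ?_ ?_ ?_ ?_
    · intro z hz
      have h1 := hb.mapsTo hz.2.1
      have h2 : α (β (F ((extChartAt I a).symm z))) = F ((extChartAt I a).symm z) :=
        angleParam_angleCoord hQ h1.2
      refine ⟨h1.2.1, ⟨?_, ?_, fun j => ?_⟩, ?_⟩
      · rw [h2]; exact h1.1
      · rw [h2]; exact hz.2.2
      · have h3 := Complex.mem_slitPlane_iff_arg.1 (hz.2.2 j)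
        change (Complex.log _).im ∈ _
        rw [Complex.log_im]
        exact ⟨Complex.neg_pi_lt_arg _, lt_of_le_of_ne (Complex.arg_le_pi _) h3.1⟩
      · rw [h2, hi.1 hz.2.1, ← extChartAt_source I]
        exact (extChartAt I a).map_target hz.1
    · intro v hv
      have h1 : G (α v) ∈ (extChartAt I a).source := by rw [extChartAt_source]; exact hv.2.2
      refine ⟨(extChartAt I a).map_source h1, ?_⟩
      rw [mem_preimage, (extChartAt I a).left_inv h1]
      refine ⟨hGΩ (htQ hv), ?_⟩
      rw [mem_preimage, hi.2 (htQ hv)]; exact hv.2.1.2.1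
    · intro z hz
      change extChartAt I a (G (α (β (F ((extChartAt I a).symm z))))) = z
      rw [hα, hβ, angleParam_angleCoord hQ (hb.mapsTo hz.2.1).2, hi.1 hz.2.1,
        (extChartAt I a).right_inv hz.1]
    · intro v hv
      change β (F ((extChartAt I a).symm (extChartAt I a (G (α v))))) = v
      rw [(extChartAt I a).left_inv (by rw [extChartAt_source]; exact hv.2.2), hi.2 (htQ hv)]
      exact angleCoord_angleParam hQ hv.2.1.2.2
    · intro z hz
      have h1 := ContMDiffWithinAt.comp (I' := I) z (hF _ hz.2.1) (hsym z hz) fun w hw => hw.2.1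
      exact (contDiffAt_angleCoord hz.2.2).comp_contDiffWithinAt z h1.contDiffWithinAt
    · intro v hv
      have h1 := ContMDiffWithinAt.comp (I' := 𝓘(ℝ, CoordSpace c i)) v (hG _ (htQ hv))
        (((contDiff_angleParam y0).of_le (by simp)).contMDiff.contMDiffAt.contMDiffWithinAt) htQ
      exact (ContMDiffAt.comp_contMDiffWithinAt (I' := I) v (g := extChartAt I a)
        ((hext _ hv.2.2).of_le (by simp)) h1).contDiffWithinAt
  refine contMDiffWithinAt_iff_target.2 ⟨hG.continuousOn y0 hy0, ?_⟩
  have hB0 : y0 ∈ B := mem_angleSet hQ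
  have hev : ∀ᶠ y in 𝓝[O ∩ Q c i] y0, β y ∈ t ∧ α (β y) = y := by
    filter_upwards [self_mem_nhdsWithin, nhdsWithin_le_nhds (isOpen_angleSet.eventually_mem hB0),
      hGsrc y0 hy0 (mem_chart_source H a)] with y h1 h2 h3
    have h4 : α (β y) = y := angleParam_angleCoord hQ h1.2
    refine ⟨⟨h1.2.1, ⟨?_, ?_, fun j => ?_⟩, ?_⟩, h4⟩
    · rw [h4]; exact h1.1
    · rw [h4]; exact h2
    · have h3 := Complex.mem_slitPlane_iff_arg.1 (h2 j)
      change (Complex.log _).im ∈ _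
      rw [Complex.log_im]
      exact ⟨Complex.neg_pi_lt_arg _, lt_of_le_of_ne (Complex.arg_le_pi _) h3.1⟩
    · rw [h4]; exact h3
  have h0 := hev.self_of_nhdsWithin hy0
  refine (((key _ h0.1).comp_of_preimage_mem_nhdsWithin (f := β) y0
    (contDiffAt_angleCoord hB0).contDiffWithinAt
    (hev.mono fun y hy => hy.1)).contMDiffWithinAt).congr_of_eventuallyEq_of_mem ?_ hy0
  filter_upwards [hev] with y hy
  exact (congrArg (fun z => extChartAt I a (G z)) hy.2).symm

end AdaptedPair

namespace AdaptedPair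

theorem vBarX_mem_Icc (P : AdaptedPair D ι) {x : X} (hx : D.f x ≠ 0) (j : Fin D.N) :
    P.vBarX j x ∈ Icc (-1 : ℝ) 1 := by
  classical
  refine P.τ.finsum_smul_mem_convex (g := fun p x =>
    if (D.D j ∩ (P.chart p).dom).Nonempty then (P.chart p).v j x else 0) (mem_univ x)
    (fun p hp => ?_) (convex_Icc (-1 : ℝ) 1)
  split_ifs with h
  · have hd : x ∈ (P.chart p).dom := P.subordinate p (subset_closure hp)
    obtain ⟨y, h1, h2⟩ := h
    have hj := mem_S_of_mem h2 h1
    have h3 := t_lt_one hd hj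
    have h4 := t_nonneg hd hj
    have h5 := u_pos hd hj hx
    have h6 := u_le_one hd hj hx
    rw [AdaptedChart.v]
    constructor <;> linarith
  · exact ⟨by norm_num, by norm_num⟩

theorem vBar_of_notMem (ha : a ∉ P.bd) (j : Fin D.N) : P.vBar j a = P.vBarX j (P.proj a) := by
  obtain ⟨R, hR, hev⟩ := P.exists_vBarX_eq (j := j) (notMem_D ha j)
  exact (lift_eq (G := fun b => R (P.proj b, P.g b)) (eventually_continuousAt_comp hR).self_of_nhds
    (P.continuous_proj.continuousAt.eventually hev)).trans (hev.self_of_nhds ha).symm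

theorem vBar_mem_Icc (a : P.Space) (j : Fin D.N) : P.vBar j a ∈ Icc (-1 : ℝ) 1 :=
  (isClosed_Icc.preimage (continuous_vBar j)).closure_subset_iff.2
    (fun b hb => by rw [mem_preimage, vBar_of_notMem hb]; exact vBarX_mem_Icc P hb j)
    (dense_bd_compl P a)

variable [ChartedSpace (EuclideanHalfSpace (2 * n)) P.Space]

namespace HasSmoothAtlas

theorem contMDiffAt_chartMap (hP : P.HasSmoothAtlas) {r : WithTop ℕ∞} (hr : r ≤ ∞)
    (ha : P.proj a ∈ c.dom) {V : Fin D.N → P.Space → ℝ}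
    (hV : ∀ j ∈ c.S, ContMDiffAt (𝓡∂ (2 * n)) 𝓘(ℝ) r (V j) a) :
    ContMDiffAt (𝓡∂ (2 * n)) 𝓘(ℝ, CoordSpace c i) r (P.chartMap c i V) a := by
  have h1 : ContDiff ℝ ∞ fun ξ : ℂ^n => fun k : c.RestIdx => ξ k := by fun_prop
  exact ((hP.contMDiff_comp_snd contDiff_fst).contMDiffAt.of_le hr).prodMk_space
    (ContMDiffAt.prodMk_space (contMDiffAt_pi_space.2 fun j => hV j (mem_of_mem_erase j.2))
    (ContMDiffAt.prodMk_space (contMDiffAt_pi_space.2 fun j => (hP.contMDiffAt_arg ha j.2).of_le hr)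
    ((h1.contMDiff.contMDiffAt.comp a ((contMDiffAt_chart ha).comp a
      hP.contMDiff_proj.contMDiffAt)).of_le hr)))

theorem contMDiffAt_psiBar (hP : P.HasSmoothAtlas) (ha : P.proj a ∈ c.dom) :
    ContMDiffAt (𝓡∂ (2 * n)) 𝓘(ℝ, CoordSpace c i) ∞ (P.psiBar c i) a :=
  hP.contMDiffAt_chartMap le_rfl ha fun j _ =>
    (hP.contMDiff_comp_snd (φ := fun q => q.2 j) (by fun_prop)).contMDiffAt

theorem isDiffeoToQ_psi (hP : P.HasSmoothAtlas) [Nonempty P.Space] (hi : i ∈ c.S) :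
    P.IsDiffeoToQ 1 c i (P.psi c i) := by
  have heq : EqOn (P.psi c i) (P.chartMap c i (P.vA c)) (P.pieceA c i) := fun b hb =>
    psi_eqOn hb.1
  refine ⟨src c i, isOpen_src, ?_⟩
  rw [piece_eq hi]
  refine ⟨(bijOn_psiA hi).congr heq.symm, ContMDiffOn.congr (fun b hb => ?_) heq, P.psiInv c i,
    ⟨fun b hb => ?_, fun y hy => ?_⟩, fun y hy => ?_⟩
  · refine (hP.contMDiffAt_chartMap (by simp) hb.1 fun j hj => ?_).contMDiffWithinAt
    obtain ⟨Ψ, h1, h2⟩ := exists_vA_eq hb.1 hj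
    exact hP.contMDiffAt_comp_can hb.1 (by simp) h1 h2
  · rw [heq hb]; exact (invOn_psiInv hi).1 hb
  · rw [heq (psiInv_mem hi hy)]; exact (invOn_psiInv hi).2 hy
  · exact hP.contMDiffWithinAt_of_can (by simp) (continuousOn_psiInv hi y hy) hy
      (psiInv_mem hi hy).1 (contMDiffWithinAt_can_psiInv hi hy)

theorem exists_isDiffeoToQ_psiBar [T2Space X] (hP : P.HasSmoothAtlas) [Nonempty P.Space] {x : X}
    (hx : D.f x = 0) : ∃ c : AdaptedChart D, x ∈ c.dom ∧ c.S.Nonempty ∧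
      ∀ i ∈ c.S, P.IsDiffeoToQ ∞ c i (P.psiBar c i) := by
  obtain ⟨c, ε, κ, L, K, W, hc, h⟩ := exists_isFlatChart P hx
  refine ⟨c, hc, S_nonempty hc hx, fun i hi => ?_⟩
  obtain ⟨O, G, hO, hb, hinv, hGc, hG⟩ := h.exists_psiBarInv hi
  refine ⟨O, hO, ?_⟩
  rw [piece_eq hi]
  refine ⟨hb, fun b hb => (hP.contMDiffAt_psiBar hb.1).contMDiffWithinAt, G, hinv, fun y hy => ?_⟩
  obtain ⟨b, hb1, hb2⟩ := hb.surjOn hy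
  exact hP.contMDiffWithinAt_of_can le_rfl (hGc y hy) hy
    (by rw [← hb2, hinv.1 hb1]; exact hb1.1) (hG y hy)

theorem isACampoStructure [T2Space X] (hP : P.HasSmoothAtlas) : P.IsACampoStructure where
  interior := hP.isDiffeoOn_proj
  c1_charts c i hi := by
    obtain ⟨x, -⟩ := (c.mem_S.1 hi)
    have : Nonempty X := ⟨x⟩
    have := nonempty_space P
    exact hP.isDiffeoToQ_psi hi
  exists_good x hx := by
    have : Nonempty X := ⟨x⟩
    have := nonempty_space P
    obtain ⟨c, hc, hS, h⟩ := hP.exists_isDiffeoToQ_psiBar hx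
    refine ⟨c, hc, hS, fun i hi => ?_⟩
    obtain ⟨O, hO, h1, h2, G, h3, h4⟩ := h i hi
    exact ⟨O, hO, h1, h2.of_le (by simp), G, h3, h4.of_le (by simp)⟩
  smooth_charts c hc i hi := by
    have := hP.isManifold
    obtain ⟨O, hO, h1, -, G, h3, h4⟩ := hc.2 i hi
    have h5 : ContMDiffOn (𝓡∂ (2 * n)) 𝓘(ℝ, CoordSpace c i) ∞ (P.psiBar c i) (P.piece c i) :=
      fun b hb => (hP.contMDiffAt_psiBar hb.1).contMDiffWithinAt
    exact ⟨O, hO, h1, h5, G, h3, contMDiffOn_of_inverse (by rw [piece_eq hi]; exact isOpen_pieceA)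
      hO h5 h1 h3 h4⟩

end HasSmoothAtlas

end AdaptedPair

theorem Degeneration.openFace_spec {I : Finset (Fin D.N)} {u : Fin D.N → ℝ}
    (hu : u ∈ D.openFace I) : (∀ j, 0 ≤ u j) ∧ ∑ j, omega (u j) = 1 := by
  obtain ⟨⟨s, h1, h2, rfl⟩, -⟩ := hu
  have h3 : ∀ j, s j ≤ 1 := fun j => h2 ▸ single_le_sum (fun k _ => h1 k) (Finset.mem_univ j)
  refine ⟨fun j => ?_, ?_⟩
  · rcases (h1 j).eq_or_lt with h | h
    · exact (eta_zero.symm.trans (congrArg eta h)).le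
    · exact (eta_pos h (h3 j)).le
  · simp only [omega_eta (h1 _) (h3 _), h2]

namespace AdaptedPair

variable {I : Finset (Fin D.N)}

theorem uA_of_bd (ha : a ∈ P.bd) : P.uA c j a = P.mu a j := by
  rw [uA, uG, delta_of_eq ha, sub_zero]

theorem mu_nonneg (ha : a ∈ P.bd) (j : Fin D.N) : 0 ≤ P.mu a j := by
  obtain ⟨c, hc⟩ := P.exists_chart (P.proj a)
  rw [← uA_of_bd (c := c) ha]
  by_cases hj : j ∈ c.S
  · exact uG_nonneg (mem_gam a) hc hj
  · exact (uG_of_notMem (mem_gam a) hc hj).ge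

theorem mu_eq_zero (ha : a ∈ P.bd) (hj : P.proj a ∉ D.D j) : P.mu a j = 0 := by
  obtain ⟨c, hc⟩ := P.exists_chart (P.proj a)
  by_cases hS : j ∈ c.S
  · have h1 := t_mul_omega_uG (mem_gam a) hc hS
    rw [D.t_eq_zero ha, mul_eq_zero] at h1
    by_contra h3
    refine (omega_pos ((mu_nonneg ha j).lt_of_ne' h3)).ne' ?_
    rw [← uA_of_bd (c := c) ha]
    exact h1.resolve_left (t_pos hc hS hj).ne'
  · exact (uA_of_bd (c := c) ha).symm.trans (uG_of_notMem (mem_gam a) hc hS)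

theorem sum_omega_mu (ha : a ∈ P.bd) : ∑ j, omega (P.mu a j) = 1 := by
  obtain ⟨c, hc⟩ := P.exists_chart (P.proj a)
  refine Eq.trans ?_ (sum_omega_uG (mem_gam a) hc (S_nonempty hc ha))
  refine Eq.trans (Finset.sum_subset (Finset.subset_univ c.S) fun j _ hj => ?_).symm
    (sum_congr rfl fun j _ => by rw [← uA_of_bd (c := c) ha, uA])
  rw [mu_eq_zero ha fun h => hj (mem_S_of_mem hc h), omega_of_nonpos le_rfl]

theorem bd_of_mem (h : P.proj a ∈ D.D j) : a ∈ P.bd := by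
  by_contra h1
  exact notMem_D h1 j h

theorem vBar_of_mem (h : P.proj a ∈ D.D j) : P.vBar j a = -P.mu a j := by
  obtain ⟨c, hc⟩ := P.exists_chart (P.proj a)
  have hjS := mem_S_of_mem hc h
  obtain ⟨K, W, hK, hW, -, hev⟩ := exists_vBar_eventuallyEq_flat hc h
  have h1 := modelMap_ptA (P := P) hc hjS
  rw [t_eq_zero hc h] at h1
  have h2 : (K ∘ modelMap) (ptA c j a) = 0 := by
    rw [comp_apply, h1]
    exact hK.zero _ _ (h1 ▸ hW)
  rw [hev.self_of_nhds, h2, vA, t_eq_zero hc h, uA_of_bd (bd_of_mem h)]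
  ring

theorem arg_of_notMem (ha : P.proj a ∈ c.dom) (hj : j ∈ c.S) (h : P.proj a ∉ D.D j) :
    (a.1.1.arg (c.z j) : ℂ) = angle (c.z j (P.proj a)) :=
  a.1.1.arg_unit (holAt_z ha j) fun h0 => h ((z_eq_zero_iff ha hj).1 h0)

theorem exists_mem_bd (P : AdaptedPair D ι) {x : X} (hf : D.f x = 0) (hx : x ∈ c.dom)
    {u : Fin D.N → ℝ} (hu : ∀ j, 0 ≤ u j) (hs : ∑ j, omega (u j) = 1)
    (h0 : ∀ j, x ∉ D.D j → u j = 0) (ζ : Fin D.N → Circle) :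
    ∃ a : P.Space, P.proj a = x ∧ P.mu a = u ∧ ∀ j, x ∈ D.D j → a.1.1.arg (c.z j) = ζ j := by
  obtain ⟨p, rfl, hp⟩ := Degeneration.KatoNakayama.exists_arg_eq hx ζ
  suffices (p.pt, u) ∈ P.Gam from ⟨⟨(p, u), this⟩, rfl, rfl, hp⟩
  have hS : ∑ j ∈ c.S, omega (u j) = 1 := by
    rw [← hs]
    refine Finset.sum_subset (Finset.subset_univ c.S) fun j _ hj => ?_
    rw [h0 j fun h => hj (mem_S_of_mem hx h), omega_of_nonpos le_rfl]
  obtain ⟨i, hi, hui⟩ : ∃ i ∈ c.S, 1 / ((n : ℝ) + 1) < omega (u i) := by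
    by_contra! h
    have h2 := sum_le_sum h
    rw [hS, sum_const, nsmul_eq_mul, mul_one_div, le_div_iff₀ (by positivity)] at h2
    have h4 : (c.S.card : ℝ) ≤ n := by exact_mod_cast card_S_le c
    linarith
  have hUU : ∀ j ∈ c.S, TT (0, c.t j p.pt - u j) = c.t j p.pt ∧ UU (0, c.t j p.pt - u j) = u j := by
    intro j hj
    have h1 : TT (0, c.t j p.pt - u j) = c.t j p.pt := by
      rw [TT_zero_fst]
      by_cases h : p.pt ∈ D.D j
      · rw [t_eq_zero hx h, max_eq_right (by linarith [hu j])]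
      · rw [h0 j h, sub_zero, max_eq_left (t_nonneg hx hj)]
    refine ⟨h1, ?_⟩
    rw [UU, h1]; ring
  have hit : c.t i p.pt = 0 := by
    by_contra h
    rw [h0 i fun h' => h (t_eq_zero hx h'), omega_of_nonpos le_rfl] at hui
    exact absurd hui (not_lt.2 (by positivity))
  set y : CoordSpace c i := (0, fun j => c.t j p.pt - u j, fun j => (p.arg (c.z j) : ℂ),
    fun k => c.chart p.pt k) with hy
  have hw : wCo y = omega (u i) := by
    rw [wCo, sub_eq_iff_eq_add, ← hS, ← Finset.add_sum_erase _ _ hi]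
    congr 1
    rw [← Finset.sum_coe_sort (c.S.erase i)]
    exact sum_congr rfl fun j _ => by rw [← (hUU j (mem_of_mem_erase j.2)).2]
  have hsC : ∀ j : c.S, sCo y j = c.t j p.pt - u j := by
    intro j
    by_cases h : (j : Fin D.N) = i
    · obtain ⟨j, hj⟩ := j
      obtain rfl : j = i := h
      rw [sCo_self, hw, eta_omega (hu j), hit]
      change omega 0 / _ - _ = _
      rw [omega_of_nonpos le_rfl, zero_div]
    · exact dif_neg h
  have hz : zCo y = c.chart p.pt := by
    rw [eq_comm, eq_assemble (c := c) (c.chart p.pt), zCo]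
    congr 1
    funext j
    change c.z j p.pt = _
    rw [hsC j, radius, (hUU j j.2).1, p.z_eq_norm_mul_arg hx j, norm_z_eq hx j.2]
  have hsrc : y ∈ src c i := ⟨hw.symm ▸ hui, by rw [hz]; exact c.chart.map_source hx⟩
  have hxC : xCo y = p.pt := by rw [xCo, hz, c.chart.left_inv hx]
  rw [← hxC]
  refine mem_gam_coord hi hsrc ⟨le_rfl, fun j => Circle.norm_coe _⟩ fun j => ?_
  rw [hxC, delta_of_eq hf, add_zero]
  split_ifs with hj
  · rw [hsC ⟨j, hj⟩]
    exact (hUU j hj).2.symm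
  · exact h0 j fun h => hj (mem_S_of_mem hx h)

theorem mem_openStratum_iff (hI : I.Nonempty) : a ∈ P.openStratum I ↔
    P.proj a ∈ D.stratum I ∧ ∀ j ∈ I, 0 < P.mu a j := by
  constructor
  · rintro ⟨ha, h⟩
    have hst := mem_of_mem_nhdsWithin ha h
    refine ⟨hst, fun j hj => (mu_nonneg ha j).lt_of_ne' fun h0 => ?_⟩
    have : Nonempty P.Space := ⟨a⟩
    obtain ⟨c, hc⟩ := P.exists_chart (P.proj a)
    obtain ⟨i, hi, hap⟩ := exists_pieceA hc (S_nonempty hc ha)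
    have hjD := (hst j).2 hj
    have hjS := mem_S_of_mem hc hjD
    have hji : j ≠ i := by
      rintro rfl
      have h1 := hap.2
      rw [uA_of_bd ha, h0, omega_of_nonpos le_rfl] at h1
      exact absurd h1 (not_lt.2 (by positivity))
    set j' : ↥(c.S.erase i) := ⟨j, mem_erase.2 ⟨hji, hjS⟩⟩
    classical
    set y := P.chartMap c i (P.vA c) a
    have hy0 : y ∈ src c i ∩ Q c i := (psiA_spec hi hap).1
    let γ : ℝ → CoordSpace c i := fun τ => (y.1, update y.2.1 j' τ, y.2.2)
    have hγc : Continuous γ := by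
      refine continuous_const.prodMk (Continuous.prodMk ?_ continuous_const)
      exact continuous_const.update j' continuous_id
    have hγ0 : γ 0 = y := by
      have h1 : y.2.1 j' = 0 := by
        change c.t j _ - P.uA c j a = 0
        rw [t_eq_zero hc hjD, uA_of_bd ha, h0, sub_zero]
      exact Prod.ext rfl (Prod.ext (h1 ▸ update_eq_self j' y.2.1) rfl)
    have hev : ∀ᶠ τ in 𝓝 0, γ τ ∈ src c i ∩ Q c i := ((hγc.tendsto 0).eventually
      (isOpen_src.eventually_mem (hγ0.symm ▸ hy0.1))).mono fun τ hτ => ⟨hτ, hy0.2⟩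
    have hbd : ∀ τ, γ τ ∈ src c i ∩ Q c i → P.psiInv c i (γ τ) ∈ P.bd := fun τ hτ => by
      rw [← g_eq_zero_iff]
      exact (congrArg (·.1) (psiA_psiInv (P := P) hi hτ)).trans (g_eq_zero_iff.2 ha)
    have hlim : Tendsto (fun τ => P.psiInv c i (γ τ)) (𝓝 0) (𝓝[P.bd] a) := by
      refine tendsto_nhdsWithin_iff.2 ⟨?_, hev.mono hbd⟩
      have h2 := continuousOn_psiInv (P := P) hi y hy0
      rw [ContinuousWithinAt, (invOn_psiInv hi).1 hap] at h2
      exact h2.comp (tendsto_nhdsWithin_iff.2 ⟨hγ0 ▸ hγc.tendsto 0, hev⟩)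
    have h3 := (hlim.eventually h).filter_mono (nhdsWithin_le_nhds (s := Ioi (0 : ℝ)))
    obtain ⟨τ, ⟨h4, h5⟩, h6⟩ := ((h3.and (hev.filter_mono nhdsWithin_le_nhds)).and
      self_mem_nhdsWithin).exists
    have h7 : P.proj (P.psiInv c i (γ τ)) ∈ D.D j := (h4 j).2 hj
    have h8 := t_eq_zero (psiInv_mem (P := P) hi h5).1 h7
    rw [proj_psiInv hi h5, t_xCo h5.1 h5.2 ⟨j, hjS⟩, sCo_of_ne _ j'] at h8
    have h9 : y.1 = 0 := g_eq_zero_iff.2 ha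
    change TT (y.1, update y.2.1 j' τ j') = 0 at h8
    rw [h9, TT_zero_fst, update_self, max_eq_left (le_of_lt h6)] at h8
    exact (ne_of_gt h6) h8
  · rintro ⟨hst, hmu⟩
    obtain ⟨j₀, hj₀⟩ := hI
    have ha := bd_of_mem ((hst j₀).2 hj₀)
    have h1 : ∀ᶠ b in 𝓝 a, ∀ j, j ∉ I → P.proj b ∉ D.D j := eventually_all.2 fun j => by
      by_cases hj : j ∈ I
      · exact Eventually.of_forall fun b h => absurd hj h
      · exact (P.continuous_proj.continuousAt.eventually
          ((D.isClosed_D j).isOpen_compl.eventually_mem fun h => hj ((hst j).1 h))).mono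
            fun b hb _ => hb
    have h2 : ∀ᶠ b in 𝓝 a, ∀ j ∈ I, 0 < P.mu b j := (Finset.eventually_all I).2 fun j hj =>
      ((continuous_apply j).comp continuous_mu).continuousAt.eventually (lt_mem_nhds (hmu j hj))
    refine ⟨ha, ?_⟩
    filter_upwards [nhdsWithin_le_nhds h1, nhdsWithin_le_nhds h2, self_mem_nhdsWithin]
      with b h3 h4 hb j
    refine ⟨fun h => by_contra fun h5 => h3 j h5 h, fun h => by_contra fun h5 => ?_⟩
    exact (h4 j h).ne' (mu_eq_zero hb h5)

theorem mapsTo_openStratum (hI : I.Nonempty) : MapsTo (fun a => (P.proj a, P.mu a))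
    (P.openStratum I) (D.stratum I ×ˢ D.openFace I) := by
  intro a ha
  obtain ⟨hst, hmu⟩ := (mem_openStratum_iff hI).1 ha
  refine ⟨hst, ⟨fun j => omega (P.mu a j), fun j => omega_nonneg _, sum_omega_mu ha.1,
    funext fun j => (eta_omega (mu_nonneg ha.1 j)).symm⟩, fun j hj => (hmu j hj).ne',
    fun j hj => mu_eq_zero ha.1 fun h => hj ((hst j).1 h)⟩

theorem HasSmoothAtlas.isSmoothTorusBundle [ChartedSpace (EuclideanHalfSpace (2 * n)) P.Space]
    (hP : P.HasSmoothAtlas) (hI : I.Nonempty) : P.IsSmoothTorusBundle I := by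
  refine ⟨mapsTo_openStratum hI, fun b hb => ?_⟩
  have : Nonempty X := ⟨b.1⟩
  have := nonempty_space P
  obtain ⟨c, hc⟩ := P.exists_chart b.1
  set O : Set (X × (Fin D.N → ℝ)) := {q | q.1 ∈ c.dom}
  set Θ : P.Space → (I → ℂ) := fun a j => (a.1.1.arg (c.z j) : ℂ)
  set A := P.openStratum I ∩ {a | (P.proj a, P.mu a) ∈ O}
  set T := ((D.stratum I ×ˢ D.openFace I) ∩ O) ×ˢ {ζ : I → ℂ | ∀ i, ‖ζ i‖ = 1}
  have hFT : MapsTo (fun a => ((P.proj a, P.mu a), Θ a)) A T := fun a ha =>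
    ⟨⟨mapsTo_openStratum hI ha.1, ha.2⟩, fun i => Circle.norm_coe _⟩
  have hinj : InjOn (fun a => ((P.proj a, P.mu a), Θ a)) A := by
    intro a ha a' ha' h
    have h1 : P.proj a = P.proj a' := congrArg (·.1.1) h
    refine ext_space (Degeneration.KatoNakayama.ext_of_arg h1 ha.2 fun j hj => Circle.ext ?_)
      (congrArg (·.1.2) h)
    by_cases hjI : j ∈ I
    · exact congrFun (congrArg (·.2) h) ⟨j, hjI⟩
    · have h2 := fun h => hjI (((mem_openStratum_iff hI).1 ha.1).1 j |>.1 h)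
      rw [arg_of_notMem ha.2 hj h2, arg_of_notMem ha'.2 hj (h1 ▸ h2), h1]
  have hex : ∀ τ ∈ T, ∃ a ∈ A, ((P.proj a, P.mu a), Θ a) = τ := by
    rintro ⟨⟨x, u⟩, ζ⟩ ⟨⟨⟨hx, hu⟩, hd⟩, hζ⟩
    obtain ⟨h1, h2⟩ := Degeneration.openFace_spec hu
    choose ξ hξ using fun j => exists_circle (hζ j)
    obtain ⟨a, rfl, rfl, h3⟩ := exists_mem_bd P
      (D.f_eq_zero_iff.2 (hI.imp fun j hj => (hx j).2 hj)) hd h1 h2 (fun j hj => hu.2.2 j fun h => hj ((hx j).2 h)) (fun j => if h : j ∈ I then ξ ⟨j, h⟩ else 1)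
    refine ⟨a, ⟨(mem_openStratum_iff hI).2 ⟨hx, fun j hj =>
      (h1 j).lt_of_ne' (hu.2.1 j hj)⟩, hd⟩, Prod.ext rfl (funext fun j => ?_)⟩
    refine (congrArg (fun θ : Circle => (θ : ℂ)) ((h3 j ((hx j).2 j.2)).trans (dif_pos j.2))).trans
      (hξ j)
  choose! G hGA hG using hex
  let J := ((𝓘^n).prod 𝓘(ℝ, Fin D.N → ℝ)).prod 𝓘(ℝ, I → ℂ)
  refine ⟨O, c.isOpen_dom.preimage continuous_fst, hc, Θ, ⟨hFT, hinj, fun τ hτ =>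
    ⟨G τ, hGA τ hτ, hG τ hτ⟩⟩, fun a ha => ?_, G, ⟨fun a ha => hinj (hGA _ (hFT ha)) ha
      (hG _ (hFT ha)), hG⟩, fun τ hτ => ?_⟩
  · have h1 : ContMDiffWithinAt (𝓡∂ (2 * n)) 𝓘(ℝ, Fin D.N → ℝ) ∞ P.mu A a := by
      refine contMDiffWithinAt_pi_space.2 fun j => ?_
      by_cases hj : j ∈ I
      · have h2 : ∀ a ∈ A, P.mu a j = -P.vBar j a := fun a ha => by
          rw [vBar_of_mem (((mem_openStratum_iff hI).1 ha.1).1 j |>.2 hj), neg_neg]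
        exact (hP.contMDiff_comp_snd (φ := fun q => -q.2 j)
          (by fun_prop)).contMDiffAt.contMDiffWithinAt.congr h2 (h2 a ha)
      · have h2 : ∀ a ∈ A, P.mu a j = 0 := fun a ha => (mapsTo_openStratum hI ha.1).2.2.2 j hj
        exact contMDiffWithinAt_const.congr h2 (h2 a ha)
    refine (hP.contMDiff_proj.contMDiffAt.contMDiffWithinAt.prodMk h1).prodMk
      (contMDiffWithinAt_pi_space.2 fun j => ?_)
    exact (hP.contMDiffAt_arg ha.2
      (mem_S_of_mem ha.2 (((mapsTo_openStratum hI ha.1).1 j).2 j.2))).contMDiffWithinAt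
  · have hp : ∀ τ ∈ T, P.proj (G τ) = τ.1.1 := fun τ hτ => congrArg (·.1.1) (hG τ hτ)
    have hm : ∀ τ ∈ T, ∀ j, P.mu (G τ) j = τ.1.2 j := fun τ hτ j =>
      congrFun (congrArg (·.1.2) (hG τ hτ)) j
    have hdom : ∀ τ ∈ T, P.proj (G τ) ∈ c.dom := fun τ hτ => (hGA τ hτ).2
    have hbd : ∀ τ ∈ T, G τ ∈ P.bd := fun τ hτ => (hGA τ hτ).1.1
    have hD : ∀ τ ∈ T, ∀ j, P.proj (G τ) ∈ D.D j ↔ j ∈ I := fun τ hτ =>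
      ((mem_openStratum_iff hI).1 (hGA τ hτ).1).1
    have h1 : ContMDiffWithinAt J 𝓘^n ∞ (fun τ => P.proj (G τ)) T τ :=
      (contMDiffWithinAt_fst.comp (t := univ) τ contMDiffWithinAt_fst (subset_univ _)).congr hp
        (hp τ hτ)
    have hch : ∀ {F : Type} [NormedAddCommGroup F] [NormedSpace ℝ F]
        {f : (Fin D.N → ℝ) × (I → ℂ) → F}, ContDiff ℝ ∞ f →
        ContMDiffWithinAt J 𝓘(ℝ, F) ∞ (fun τ => f (τ.1.2, τ.2)) T τ := fun hf =>
      (hf.contMDiff.contMDiffAt.comp τ ((contMDiffAt_snd.comp τ contMDiffAt_fst).prodMk_space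
        contMDiffAt_snd)).contMDiffWithinAt
    have h4 : ∀ j ∈ c.S, ContMDiffWithinAt J 𝓘(ℝ, ℂ) ∞
        (fun τ => ((G τ).1.1.arg (c.z j) : ℂ)) T τ := by
      intro j hj
      by_cases hjI : j ∈ I
      · have h5 : ∀ τ ∈ T, ((G τ).1.1.arg (c.z j) : ℂ) = τ.2 ⟨j, hjI⟩ := fun τ hτ =>
          congrFun (congrArg (·.2) (hG τ hτ)) ⟨j, hjI⟩
        exact (hch (f := fun q => q.2 ⟨j, hjI⟩) (by fun_prop)).congr h5 (h5 τ hτ)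
      · have h5 : ∀ τ ∈ T, ((G τ).1.1.arg (c.z j) : ℂ) = angle (c.z j (P.proj (G τ))) :=
          fun τ hτ => arg_of_notMem (hdom τ hτ) hj fun h => hjI ((hD τ hτ j).1 h)
        refine ContMDiffWithinAt.congr (ContMDiffAt.comp_contMDiffWithinAt
          (I' := 𝓘^n) τ (g := fun x => angle (c.z j x)) ?_ h1) h5 (h5 τ hτ)
        exact (contDiffAt_angle fun h => hjI ((hD τ hτ j).1
          ((z_eq_zero_iff (hdom τ hτ) hj).1 h))).contMDiffAt.comp _ (contMDiffAt_z (hdom τ hτ) j)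
    have hGc : ContinuousWithinAt G T τ := by
      refine tendsto_space (hdom τ hτ) h1.continuousWithinAt
        (fun j hj => (h4 j hj).continuousWithinAt) fun j hj => ?_
      have h5 : ∀ τ ∈ T, P.vA c j (G τ) = c.t j (P.proj (G τ)) - τ.1.2 j := fun τ hτ => by
        rw [vA, uA_of_bd (hbd τ hτ), hm τ hτ]
      have h6 : ContinuousWithinAt (fun τ => c.t j (P.proj (G τ)) - τ.1.2 j) T τ :=
        (ContinuousAt.comp_continuousWithinAt (g := c.t j) (f := fun τ => P.proj (G τ))
          (continuousAt_t (hdom τ hτ) hj) h1.continuousWithinAt).sub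
          (((continuous_apply j).comp (continuous_snd.comp continuous_fst)).continuousWithinAt)
      exact h6.congr h5 (h5 τ hτ)
    have h2 : ContMDiffWithinAt J 𝓘(ℝ) ∞ (fun τ => P.g (G τ)) T τ :=
      contMDiffWithinAt_const.congr (fun τ hτ => g_eq_zero_iff.2 (hbd τ hτ))
        (g_eq_zero_iff.2 (hbd τ hτ))
    refine hP.contMDiffWithinAt_of_can le_rfl hGc hτ (hdom τ hτ)
      (contMDiffWithinAt_can h1 h2 (fun j => ?_) h4)
    by_cases hj : j ∈ I
    · have h5 : ∀ τ ∈ T, P.vBar j (G τ) = -τ.1.2 j := fun τ hτ => by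
        rw [vBar_of_mem ((hD τ hτ j).2 hj), hm τ hτ]
      exact (hch (f := fun q => -q.1 j) (by fun_prop)).congr h5 (h5 τ hτ)
    · exact contMDiffWithinAt_vBar_of_notMem le_rfl hGc hτ (fun h => hj ((hD τ hτ j).1 h)) h1 h2

end AdaptedPair

namespace AdaptedPair

variable (P) {ι' : Type*} (P' : AdaptedPair D ι')

open Classical in
/-- The difference of the functions `ū` of two adapted pairs, extended by `0` to the divisor. -/
def shift (x : X) : Fin D.N → ℝ := fun j => if D.f x = 0 then 0 else P'.uBar j x - P.uBar j x

theorem shift_eq (c : AdaptedChart D) (x : X) (j : Fin D.N) :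
    shift P P' x j = P'.delta c j x - P.delta c j x := by
  by_cases h : D.f x = 0
  · rw [shift, if_pos h, delta_of_eq h, delta_of_eq h, sub_zero]
  · rw [shift, if_neg h, delta_of_ne h, delta_of_ne h]; ring

theorem continuous_shift : Continuous (shift P P') := by
  refine continuous_pi fun j => continuous_iff_continuousAt.2 fun x => ?_
  obtain ⟨c, hc⟩ := P.exists_chart x
  simp only [shift_eq P P' c]
  exact (continuousAt_delta hc).sub (continuousAt_delta hc)

theorem shift_swap (x : X) : shift P' P x = -shift P P' x := by
  ext j
  simp only [shift, Pi.neg_apply]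
  split_ifs <;> simp

theorem shift_mem_gam {q : X × (Fin D.N → ℝ)} (hq : q ∈ P.Gam) :
    (q.1, q.2 + shift P P' q.1) ∈ P'.Gam := by
  refine map_mem_closure (f := fun q => (q.1, q.2 + shift P P' q.1)) ?_ hq fun r hr => ?_
  · exact continuous_fst.prodMk (continuous_snd.add ((continuous_shift P P').comp continuous_fst))
  · refine ⟨hr.1, funext fun j => ?_⟩
    have h1 : r.2 j = P.uBar j r.1 := congrFun hr.2 j
    change r.2 j + shift P P' r.1 j = P'.uBar j r.1
    rw [h1, shift, if_neg hr.1, add_sub_cancel]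

/-- The map between the A'Campo spaces of two adapted pairs. -/
def comparison (a : P.Space) : P'.Space :=
  ⟨(a.1.1, a.1.2 + shift P P' a.1.1.pt), shift_mem_gam P P' a.2⟩

theorem continuous_comparison : Continuous (comparison P P') :=
  Continuous.subtype_mk ((continuous_fst.comp continuous_subtype_val).prodMk
    (continuous_mu.add ((continuous_shift P P').comp P.continuous_proj))) _

theorem comparison_comparison (a : P.Space) : comparison P' P (comparison P P' a) = a :=
  Subtype.ext (Prod.ext rfl (by
    change a.1.2 + shift P P' a.1.1.pt + shift P' P a.1.1.pt = a.1.2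
    rw [shift_swap P P', add_neg_cancel_right]))

/-- The homeomorphism between the A'Campo spaces of two adapted pairs. -/
def comparisonHomeo : P.Space ≃ₜ P'.Space where
  toFun := comparison P P'
  invFun := comparison P' P
  left_inv := comparison_comparison P P'
  right_inv := comparison_comparison P' P
  continuous_toFun := continuous_comparison P P'
  continuous_invFun := continuous_comparison P' P

variable {P P'}

theorem comparison_of_bd (ha : a ∈ P.bd) : (comparison P P' a).1 = a.1 := by
  refine Prod.ext rfl (funext fun j => ?_)
  change a.1.2 j + shift P P' (P.proj a) j = _
  have h1 : D.f (P.proj a) = 0 := ha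
  rw [shift, if_pos h1, add_zero]

theorem uA_comparison : P'.uA c j (comparison P P' a) = P.uA c j a := by
  change P.mu a j + shift P P' (P.proj a) j - P'.delta c j (P.proj a) =
    P.mu a j - P.delta c j (P.proj a)
  rw [shift_eq P P' c]
  ring

theorem comparison_mem_pieceA (ha : a ∈ P.pieceA c i) : comparison P P' a ∈ P'.pieceA c i :=
  ⟨ha.1, by rw [uA_comparison]; exact ha.2⟩

theorem psi_comparison (ha : P.proj a ∈ c.dom) : P'.psi c i (comparison P P' a) = P.psi c i a := by
  rw [psi_eqOn ha, psi_eqOn (x := comparison P P' a) ha]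
  refine Prod.ext rfl (Prod.ext (funext fun j => ?_) rfl)
  change _ - P'.uA c j _ = _ - P.uA c j a
  rw [uA_comparison]
  rfl

variable [ChartedSpace (EuclideanHalfSpace (2 * n)) P.Space]
  [ChartedSpace (EuclideanHalfSpace (2 * n)) P'.Space]

theorem contMDiff_comparison (h : P.IsACampoStructure) (h' : P'.IsACampoStructure) :
    ContMDiff (𝓡∂ (2 * n)) (𝓡∂ (2 * n)) 1 (comparison P P') := by
  intro a
  by_cases ha : a ∈ P.bd
  · obtain ⟨c, i, hi, hap⟩ := exists_pieceA_of_bd ha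
    obtain ⟨O, hO, -, h1, -⟩ := h.c1_charts c i hi
    obtain ⟨O', hO', h2, -, G, h3, h4⟩ := h'.c1_charts c i hi
    rw [piece_eq hi] at h1 h2 h3
    have hm : MapsTo (P.psi c i) (P.pieceA c i) (O' ∩ Q c i) := fun b hb => by
      rw [← psi_comparison (P' := P') hb.1]
      exact h2.mapsTo (comparison_mem_pieceA hb)
    refine ((h4.comp h1 hm).congr fun b hb => ?_).contMDiffAt (isOpen_pieceA.mem_nhds hap)
    rw [comp_apply, ← psi_comparison (P' := P') hb.1, h3.1 (comparison_mem_pieceA hb)]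
  · obtain ⟨-, h1, -⟩ := h.interior
    obtain ⟨-, -, G, h3, h4⟩ := h'.interior
    exact (((h4.comp h1 fun b hb => hb).congr fun b hb =>
      (h3.1 (show comparison P P' b ∈ P'.bdᶜ from hb)).symm).contMDiffAt
        (isOpen_bd_compl.mem_nhds ha)).of_le (by simp)

end AdaptedPair

end ACampo

end

theorem mainTheorem7 {n : ℕ} [NeZero n] {X : Type*} [TopologicalSpace X] [T2Space X]
    [SecondCountableTopology X] [ChartedSpace (EuclideanSpace ℂ (Fin n)) X]
    [IsManifold 𝓘(ℂ, EuclideanSpace ℂ (Fin n)) ω X]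
    (𝒟 : ACampo.Degeneration n X) {ι : Type*} (P : ACampo.AdaptedPair 𝒟 ι) :
    (T2Space P.Space ∧ SecondCountableTopology P.Space ∧
      ∃ (_ : ChartedSpace (EuclideanHalfSpace (2 * n)) P.Space)
        (_ : IsManifold (𝓡∂ (2 * n)) ∞ P.Space),
        P.IsACampoStructure ∧
        (𝓡∂ (2 * n)).boundary P.Space = P.bd ∧
        -- the projection to `X`
        ContMDiff (𝓡∂ (2 * n)) 𝓘(ℝ, EuclideanSpace ℂ (Fin n)) ∞ P.proj ∧
        ACampo.IsDiffeoOn (𝓡∂ (2 * n)) 𝓘(ℝ, EuclideanSpace ℂ (Fin n)) ∞ P.proj P.bdᶜ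
          {x | 𝒟.f x ≠ 0} ∧
        -- the submersion `(g, θ)` and the map `f_A`
        (∀ a, P.g a ∈ Set.Ico (0 : ℝ) 1) ∧
        Manifold.IsSubmersion (𝓡∂ (2 * n)) (𝓘(ℝ, ℝ).prod (𝓡 1)) ∞
          (fun a : P.Space => (P.g a, P.theta a)) ∧
        ContMDiff (𝓡∂ (2 * n)) (𝓘(ℝ, ℝ).prod (𝓡 1)) ∞ P.fA ∧
        -- the functions `v̄_i`
        (∀ i, (∀ a, P.vBar i a ∈ Set.Icc (-1 : ℝ) 1) ∧
          (∀ a ∉ P.bd, P.vBar i a = P.vBarX i (P.proj a)) ∧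
          ContMDiff (𝓡∂ (2 * n)) 𝓘(ℝ, ℝ) ∞ (P.vBar i)) ∧
        -- the strata
        ∀ I : Finset (Fin 𝒟.N), I.Nonempty → P.IsSmoothTorusBundle I) ∧
    -- the underlying `C^1`-structure does not depend on the adapted pair
    ∀ {ι' : Type*} (P' : ACampo.AdaptedPair 𝒟 ι')
      [ChartedSpace (EuclideanHalfSpace (2 * n)) P.Space] [IsManifold (𝓡∂ (2 * n)) ∞ P.Space]
      [ChartedSpace (EuclideanHalfSpace (2 * n)) P'.Space] [IsManifold (𝓡∂ (2 * n)) ∞ P'.Space],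
      P.IsACampoStructure → P'.IsACampoStructure →
      ∃ Φ : P.Space ≃ₜ P'.Space, (∀ a ∈ P.bd, (Φ a).1 = a.1) ∧ (∀ a, P'.proj (Φ a) = P.proj a) ∧
        ContMDiff (𝓡∂ (2 * n)) (𝓡∂ (2 * n)) 1 Φ ∧
        ContMDiff (𝓡∂ (2 * n)) (𝓡∂ (2 * n)) 1 Φ.symm := by
  refine ⟨⟨P.t2Space_space, P.secondCountableTopology_space, P.chartedSpace, ?_⟩, ?_⟩
  · let := P.chartedSpace
    have hP : P.HasSmoothAtlas :=
      ⟨fun e he => he, fun a => (ACampo.AdaptedPair.exists_isAdaptedAt_self a).choose_spec⟩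
    have := hP.isManifold
    exact ⟨this, hP.isACampoStructure, hP.boundary_eq, hP.contMDiff_proj, hP.isDiffeoOn_proj,
      fun a => ⟨𝒟.g_nonneg _, 𝒟.g_lt_one _⟩, hP.isSubmersion, hP.contMDiff_fA,
      fun i => ⟨fun a => ACampo.AdaptedPair.vBar_mem_Icc a i,
        fun a ha => ACampo.AdaptedPair.vBar_of_notMem ha i,
        hP.contMDiff_comp_snd (φ := fun q => q.2 i) (by fun_prop)⟩,
      fun I hI => hP.isSmoothTorusBundle hI⟩
  · intro ι' P' _ _ _ _ h h'
    exact ⟨P.comparisonHomeo P', fun a ha => ACampo.AdaptedPair.comparison_of_bd ha, fun a => rfl,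
      ACampo.AdaptedPair.contMDiff_comparison h h', ACampo.AdaptedPair.contMDiff_comparison h' h⟩
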